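/- A link is a finite disjoint union of simple closed curves in $\mathbb{R}^3$. Its thickness $\tau(L)$ is the infimum of the radii $r(x,y,z)$ of the circles through three distinct points $x,y,z$ of $L$ ($r=\infty$ for collinear points), its ropelength is $\mathrm{Len}(L)/\tau(L)$, and $L$ is tight if it has minimal ropelength among all links ambient isotopic to it. A set $J$ is topologically linked to $K$ if $K$ and $J$ cannot be separated by a sphere, i.e. no homeomorphism of $\mathbb{R}^3$ carries $K$ into the open unit ball and $J$ into the complement of the closed unit ball. A curve is $C^2$ if its constant-speed parametrization on the circle is $C^2$. Let $P_n$ be the infimum of the lengths of closed plane curves that enclose $n$ pairwise disjoint open unit disks, i.e. such that the disks lie in the union of the bounded components of the complement of the curve (so $P_0=0$). (a) The infimum $P_n$ is attained, for every $n$. (b) Let $K$ be a component of a link of thickness at least $1$ whose other components can be partitioned into $n$ sublinks, each of which is topologically linked to $K$. Then $$\mathrm{Len}(K)\ \ge\ 2\pi+P_n .$$ (c) Consequently the bound gives tight links: let $L$ be a link of thickness at least $1$ such that, for each component $K$, there is an $n$ such that the other components can be partitioned into $n$ sublinks, each topologically linked to $K$, and $\mathrm{Len}(K)=2\pi+P_n$.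 Then $L$ is tight. (d) The bound is sharp for $n\le 5$, and tight links need not be $C^2$: for every $n\le5$ there is a tight link of thickness $1$ with $n+1$ components, one of which, $K$, is topologically linked to each of the $n$ others and has $\mathrm{Len}(K)=2\pi+P_n$; if $n\ge2$, this link can be chosen such that $K$ is not $C^2$. (e) Tight links need not be unique: there is a family $(L_t)_{t\in[0,1]}$ of tight five-component links of thickness $1$, depending continuously on $t$ and all ambient isotopic to one another, with a component $K_t$ of $L_t$ that depends continuously on $t$, is topologically linked to each of the four other components of $L_t$ and has length $2\pi+P_4$, such that for $s\ne t$ no similarity of $\mathbb{R}^3$ carries $L_s$ to $L_t$, and none carries $K_s$ to $K_t$. -/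

import Mathlib

open Set Metric MeasureTheory
open scoped ENNReal NNReal unitInterval

noncomputable section

namespace Ropelength

/-- The Euclidean plane. -/
abbrev Plane : Type := EuclideanSpace ℝ (Fin 2)

/-- Euclidean three-space. -/
abbrev Space : Type := EuclideanSpace ℝ (Fin 3)

/-- The length of a closed curve: the supremum of the lengths of inscribed polygons. -/
def curveLength {E : Type*} [PseudoEMetricSpace E] (γ : C(UnitAddCircle, E)) : ℝ≥0∞ :=
  eVariationOn (fun t : ℝ => γ (t : UnitAddCircle)) (Icc 0 1)

/-! ### The perimeter problem in the plane -/

/-- The set of points enclosed by a closed plane curve: the union of the bounded connected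
components of the complement of the curve. -/
def enclosedRegion (γ : C(UnitAddCircle, Plane)) : Set Plane :=
  {x | x ∉ range γ ∧ Bornology.IsBounded (connectedComponentIn (range γ)ᶜ x)}

/-- The curve `γ` encloses `n` pairwise disjoint (open) unit disks. -/
def EnclosesUnitDisks (n : ℕ) (γ : C(UnitAddCircle, Plane)) : Prop :=
  ∃ c : Fin n → Plane,
    Pairwise (fun i j => Disjoint (ball (c i) 1) (ball (c j) 1)) ∧
      ∀ i, ball (c i) 1 ⊆ enclosedRegion γ

/-- The set of lengths of closed plane curves that enclose `n` disjoint unit disks. -/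
def enclosingLengths (n : ℕ) : Set ℝ≥0∞ :=
  {ℓ | ∃ γ : C(UnitAddCircle, Plane), EnclosesUnitDisks n γ ∧ curveLength γ = ℓ}

/-- `P_n`, the minimal length of a closed plane curve that encloses `n` disjoint unit disks. -/
def peri (n : ℕ) : ℝ≥0∞ := sInf (enclosingLengths n)

/-! ### Thickness -/

open Classical in
/-- The radius of the circle through three distinct points, `∞` if they are collinear. -/
def circleRadius (x y z : Space) : ℝ≥0∞ :=
  if h : AffineIndependent ℝ ![x, y, z] then
    ENNReal.ofReal (Affine.Simplex.circumradius (⟨![x, y, z], h⟩ : Affine.Simplex ℝ Space 2))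
  else ∞

/-- The local thickness at `x` of a subset `X` of space. -/
def localThickness (X : Set Space) (x : Space) : ℝ≥0∞ :=
  ⨅ (y ∈ X) (z ∈ X) (_ : x ≠ y ∧ y ≠ z ∧ z ≠ x), circleRadius x y z

/-- The thickness of a subset `X` of space: the infimal radius of circles through three
distinct points of `X`. -/
def thickness (X : Set Space) : ℝ≥0∞ := ⨅ x ∈ X, localThickness X x

/-! ### Links -/

/-- A link with `m` components: pairwise disjoint simple closed curves in space. -/
structure Link (m : ℕ) where
  /-- A parametrization of each component. -/
  curve : Fin m → C(UnitAddCircle, Space)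
  simple : ∀ i, Function.Injective (curve i)
  disjoint : Pairwise fun i j => Disjoint (range (curve i)) (range (curve j))

/-- `K` and `J` form a split pair: some homeomorphism of space moves `K` into the open unit
ball and `J` off the closed unit ball, i.e. a (locally flat) sphere separates `K` from `J`. -/
def IsSplit (K J : Set Space) : Prop :=
  ∃ h : Space ≃ₜ Space, h '' K ⊆ ball 0 1 ∧ Disjoint (h '' J) (closedBall 0 1)

/-- `J` is topologically linked to `K`: the two cannot be separated by a sphere. -/
def TopologicallyLinked (K J : Set Space) : Prop := ¬ IsSplit K J

/-- Ambient isotopy of subsets of space. -/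
def AmbientIsotopic (A B : Set Space) : Prop :=
  ∃ H : I → (Space ≃ₜ Space),
    Continuous (fun p : I × Space => H p.1 p.2) ∧ (∀ x, H 0 x = x) ∧ H 1 '' A = B

/-- `A` and `B` have the same shape: some similarity of space carries `A` onto `B`. -/
def SameShape (A B : Set Space) : Prop := ∃ f : Space ≃ᵈ Space, f '' A = B

/-- The simple closed curve `K` is of class `C²`, with respect to its constant-speed
parametrization on the circle `ℝ / ℤ`. -/
def IsC2Curve (K : Set Space) : Prop :=
  ∃ (γ : ℝ → Space) (v : ℝ≥0), Function.Periodic γ 1 ∧ InjOn γ (Ico 0 1) ∧ range γ = K ∧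
    HasConstantSpeedOnWith γ univ v ∧ ContDiff ℝ 2 γ

namespace Link

variable {m : ℕ}

/-- The `i`-th component, as a set. -/
def component (L : Link m) (i : Fin m) : Set Space := range (L.curve i)

/-- The union of all components. -/
def carrier (L : Link m) : Set Space := ⋃ i, L.component i

/-- The length of the `i`-th component. -/
def length (L : Link m) (i : Fin m) : ℝ≥0∞ := curveLength (L.curve i)

/-- The thickness `τ(L)`. -/
def thickness (L : Link m) : ℝ≥0∞ := Ropelength.thickness L.carrier

/-- The ropelength `Len(L) / τ(L)`. -/
def ropelength (L : Link m) : ℝ≥0∞ := (∑ i, L.length i) / L.thickness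

/-- `L` is tight: it minimizes ropelength among all links of its (unoriented) link type. -/
def IsTight (L : Link m) : Prop :=
  ∀ L' : Link m, AmbientIsotopic L.carrier L'.carrier → L.ropelength ≤ L'.ropelength

/-- The components of `L` other than the `k`-th one can be partitioned into `n` sublinks,
each of which is topologically linked to the `k`-th component. The `j`-th sublink consists of
the components `i` with `part i = j`. -/
def LinkedToSublinks (L : Link m) (k : Fin m) (n : ℕ) : Prop :=
  ∃ part : {i : Fin m // i ≠ k} → Fin n, ∀ j : Fin n,
    TopologicallyLinked (L.component k) (⋃ (i : {i : Fin m // i ≠ k}) (_ : part i = j),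
      L.component i)

end Link

end Ropelength

end

noncomputable section

namespace Ropelength

open Filter Topology Real InnerProductGeometry
open scoped RealInnerProductSpace

set_option linter.unusedSectionVars false
set_option linter.unusedSimpArgs false

/-! ### Closed chains and lengths -/

/-! All plane perimeters come from support functions. By Cauchy's formula the hull of points `c i`
has perimeter `hullPerim c`, the integral of its support function, and thickening by unit disks adds
`2π`. Circumscribed polygons with many sides enclose the disks and have lengths tending to `2π +
hullPerim c` (`peri_le`). Conversely a closed curve enclosing the disks reaches beyond them in every
direction, so it is at least as long (`exists_hullPerim_le_curveLength`). Hence `P_n` is `2π` plus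
the least hull perimeter of `n` points at mutual distances at least `2`. It is attained by
Arzelà–Ascoli (`peri_mem_enclosingLengths`).

The length bound is a cone argument. Thickness at least `1` keeps different components at distance
at least `2` (`Thick.two_mul_le_dist`), and a sublink linked to `K` meets every cone over `K`, since
a cone is star-shaped and could otherwise be separated from it
(`TopologicallyLinked.exists_mem_cone`). The apex is chosen so that an inscribed polygon of `K` is
seen under total angle exactly `2π` (`exists_angle_sum_eq_two_pi`). The cone then unrolls onto the
plane without shortening any distance (`exists_hullPerim_le_of_angle_sum`). The result is a plane
polygon, no longer than `K` up to a small error, at distance `2` around `n` points that are `2`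
apart, so its length is at least `4π + hullPerim c ≥ 2π + P_n`. For `n = 0` the bound `2π` is
Fenchel's theorem: the radii of circles bound the curvature by `1`, and the total curvature is at
least `2π` (`Thick.two_pi_le_curveLength`). Tightness follows by rescaling a competitor to thickness
`1` and adding up the bounds of its components.

For sharpness, a `Rim` is the plane curve at distance `2` from a convex polygon, linked by a
vertical circle of radius `2` through each vertex. The rings have length `4π = 2π + P_1`. If the
polygon has `n` sides of length `2`, the rim has length `4π + 2n`. This is optimal because `P_n ≥ 2π
+ 2n` for `2 ≤ n ≤ 5` (`two_mul_le_hullPerim`). Points in convex position give this by adding `n`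
sides of length at least `2`; a point inside a triangle of others forces a large perimeter by angle
estimates. Linking is detected by winding numbers (`topologicallyLinked_of_exp_eq`). The rim is not
`C²` where an arc of radius `2` passes into a segment, because the curvature jumps there. For `n =
4` the rhombi with sides of length `2` form a one-parameter family. Their links are isotopic by a
radial deformation of the plane, and ratios of extremal distances to the center distinguish their
shapes. -/

/-- A closed chain of points is at least twice as long as the distance of two of its points. -/
lemma two_mul_dist_le_sum {X : Type*} [PseudoMetricSpace X] (x : ℕ → X) (N : ℕ) (h : x N = x 0)
    {j k : ℕ} (hj : j ≤ N) (hk : k ≤ N) :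
    2 * dist (x j) (x k) ≤ ∑ i ∈ Finset.range N, dist (x i) (x (i + 1)) := by
  wlog hjk : j ≤ k generalizing j k
  · rw [dist_comm]; exact this hk hj (le_of_not_ge hjk)
  have h1 := dist_le_Ico_sum_dist x (Nat.zero_le j)
  have h2 := dist_le_Ico_sum_dist x hjk
  have h3 := dist_le_Ico_sum_dist x hk
  have h4 : dist (x j) (x k) ≤ dist (x 0) (x j) + dist (x k) (x N) := by
    rw [h, add_comm, dist_comm (x 0)]
    calc dist (x j) (x k) ≤ dist (x j) (x 0) + dist (x 0) (x k) := dist_triangle _ _ _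
      _ = _ := by rw [dist_comm (x 0) (x k)]; ring
  rw [Finset.range_eq_Ico, ← Finset.sum_Ico_consecutive _ (Nat.zero_le j) hj,
    ← Finset.sum_Ico_consecutive _ hjk hk]
  linarith

/-- The function `g` serves as a clock that runs at least as fast as arc length; the sums of
distances telescope against it. -/
lemma eVariationOn_le_of_dist_le {E : Type*} [PseudoMetricSpace E] {f : ℝ → E} {g : ℝ → ℝ}
    {a b : ℝ} (hab : a ≤ b)
    (h : ∀ s ∈ Icc a b, ∀ t ∈ Icc a b, s ≤ t → dist (f s) (f t) ≤ g t - g s) :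
    eVariationOn f (Icc a b) ≤ ENNReal.ofReal (g b - g a) := by
  have hmono : ∀ s ∈ Icc a b, ∀ t ∈ Icc a b, s ≤ t → g s ≤ g t := fun s hs t ht hst => by
    have := h s hs t ht hst
    have := dist_nonneg (x := f s) (y := f t)
    linarith
  refine iSup_le ?_
  rintro ⟨n, u, hu, us⟩
  have h1 : ∀ i ∈ Finset.range n, edist (f (u (i + 1))) (f (u i)) ≤
      ENNReal.ofReal (g (u (i + 1)) - g (u i)) := fun i _ => by
    rw [edist_dist, dist_comm]
    exact ENNReal.ofReal_le_ofReal (h _ (us _) _ (us _) (hu (Nat.le_succ i)))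
  refine (Finset.sum_le_sum h1).trans ?_
  rw [← ENNReal.ofReal_sum_of_nonneg fun i _ =>
    sub_nonneg.2 (hmono _ (us _) _ (us _) (hu (Nat.le_succ i))),
    Finset.sum_range_sub (fun i => g (u i))]
  refine ENNReal.ofReal_le_ofReal ?_
  have h2 := hmono _ (us n) b ⟨hab, le_rfl⟩ (us n).2
  have h3 := hmono a ⟨le_rfl, hab⟩ _ (us 0) (us 0).1
  linarith

/-- The closed curve given by a path on `[0, 1]` with equal end points. -/
def closedCurve {E : Type*} [TopologicalSpace E] (f : ℝ → E) (hf : ContinuousOn f (Icc 0 1))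
    (h : f 0 = f 1) : C(UnitAddCircle, E) where
  toFun := Function.Periodic.lift (f := fun x : ℝ => f (Int.fract x)) (c := 1)
    (fun x => by simp [Int.fract_add_one])
  continuous_toFun := Continuous.quotient_lift (ContinuousOn.comp_fract'' hf h) _

section
variable {E : Type*} [TopologicalSpace E] {f : ℝ → E} {hf : ContinuousOn f (Icc 0 1)}
    {h : f 0 = f 1}

lemma closedCurve_coe (x : ℝ) : closedCurve f hf h (x : UnitAddCircle) = f (Int.fract x) := rfl

lemma closedCurve_coe_of_mem {x : ℝ} (hx : x ∈ Icc (0 : ℝ) 1) :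
    closedCurve f hf h (x : UnitAddCircle) = f x := by
  rw [closedCurve_coe]
  rcases hx.2.lt_or_eq with h1 | rfl
  · rw [Int.fract_eq_self.2 ⟨hx.1, h1⟩]
  · simp [h]

lemma exists_mem_Ico_coe_eq (x : UnitAddCircle) : ∃ s ∈ Ico (0 : ℝ) 1, (s : UnitAddCircle) = x := by
  have := AddCircle.coe_image_Ico_eq (1 : ℝ) 0
  have h : x ∈ (QuotientAddGroup.mk '' Ico (0 : ℝ) (0 + 1) : Set UnitAddCircle) := by
    rw [this]; trivial
  simpa using h

lemma range_closedCurve : range (closedCurve f hf h) = f '' Icc 0 1 := by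
  ext y
  constructor
  · rintro ⟨x, rfl⟩
    obtain ⟨s, hs, rfl⟩ := exists_mem_Ico_coe_eq x
    exact ⟨s, Ico_subset_Icc_self hs, (closedCurve_coe_of_mem (Ico_subset_Icc_self hs)).symm⟩
  · rintro ⟨s, hs, rfl⟩
    exact ⟨(s : UnitAddCircle), closedCurve_coe_of_mem hs⟩

lemma closedCurve_injective (hi : InjOn f (Ico 0 1)) : Function.Injective (closedCurve f hf h) := by
  intro x y hxy
  obtain ⟨s, hs, rfl⟩ := exists_mem_Ico_coe_eq x
  obtain ⟨t, ht, rfl⟩ := exists_mem_Ico_coe_eq y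
  rw [closedCurve_coe_of_mem (Ico_subset_Icc_self hs),
    closedCurve_coe_of_mem (Ico_subset_Icc_self ht)] at hxy
  rw [hi hs ht hxy]

end

lemma curveLength_closedCurve {E : Type*} [PseudoEMetricSpace E] {f : ℝ → E}
    {hf : ContinuousOn f (Icc 0 1)} {h : f 0 = f 1} :
    curveLength (closedCurve f hf h) = eVariationOn f (Icc 0 1) :=
  eVariationOn.congr fun _ hx => closedCurve_coe_of_mem hx

/-- The piecewise linear function that grows from `0` to `1` on `[0, 1]`. -/
def ramp (t : ℝ) : ℝ := max 0 (min 1 t)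

@[fun_prop] lemma continuous_ramp : Continuous ramp := by unfold ramp; fun_prop
lemma ramp_mono : Monotone ramp := fun a b h => by unfold ramp; gcongr
lemma ramp_nonneg (t : ℝ) : 0 ≤ ramp t := le_max_left _ _
lemma ramp_le_one (t : ℝ) : ramp t ≤ 1 := max_le zero_le_one (min_le_left _ _)
lemma ramp_of_nonpos {t : ℝ} (h : t ≤ 0) : ramp t = 0 := max_eq_left ((min_le_right _ _).trans h)
lemma ramp_of_one_le {t : ℝ} (h : 1 ≤ t) : ramp t = 1 := by simp [ramp, min_eq_left h]
lemma ramp_of_mem {t : ℝ} (h : t ∈ Icc (0 : ℝ) 1) : ramp t = t := by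
  simp [ramp, min_eq_right h.2, max_eq_right h.1]

section Polygon
variable {E : Type*} [NormedAddCommGroup E] [NormedSpace ℝ E]

/-- The path on `[0, N]` along the polygon with vertices `v 0, …, v N`. -/
def polyPath (v : ℕ → E) (N : ℕ) (x : ℝ) : E :=
  v 0 + ∑ k ∈ Finset.range N, ramp (x - k) • (v (k + 1) - v k)

lemma continuous_polyPath (v : ℕ → E) (N : ℕ) : Continuous (polyPath v N) := by
  unfold polyPath; fun_prop

lemma sum_ramp_smul (v : ℕ → E) {N k : ℕ} (hk : k < N) {x : ℝ} (hx : x ∈ Icc (k : ℝ) (k + 1)) :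
    ∑ i ∈ Finset.range N, ramp (x - i) • v i =
      ∑ i ∈ Finset.range k, v i + (x - k) • v k := by
  obtain ⟨d, rfl⟩ : ∃ d, N = k + 1 + d := ⟨N - (k + 1), by omega⟩
  rw [Finset.sum_range_add, Finset.sum_range_succ, ramp_of_mem ⟨by linarith [hx.1], by linarith [hx.2]⟩]
  have h1 : ∑ i ∈ Finset.range d, ramp (x - (k + 1 + i : ℕ)) • v (k + 1 + i) = 0 :=
    Finset.sum_eq_zero fun i _ => by
      rw [ramp_of_nonpos, zero_smul]
      push_cast
      linarith [hx.2, (Nat.cast_nonneg i : (0 : ℝ) ≤ i)]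
  rw [h1, add_zero]
  congr 1
  refine Finset.sum_congr rfl fun i hi => ?_
  rw [ramp_of_one_le, one_smul]
  have : (i : ℝ) + 1 ≤ k := by exact_mod_cast Finset.mem_range.1 hi
  linarith [hx.1]

lemma polyPath_eq (v : ℕ → E) {N k : ℕ} (hk : k < N) {x : ℝ} (hx : x ∈ Icc (k : ℝ) (k + 1)) :
    polyPath v N x = v k + (x - k) • (v (k + 1) - v k) := by
  rw [polyPath, sum_ramp_smul (fun i => v (i + 1) - v i) hk hx, Finset.sum_range_sub, ← add_assoc,
    add_sub_cancel]

lemma exists_nat_mem_Icc {N : ℕ} (hN : 0 < N) {x : ℝ} (hx : x ∈ Icc (0 : ℝ) N) :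
    ∃ k < N, x ∈ Icc (k : ℝ) (k + 1) := by
  rcases hx.2.lt_or_eq with h | h
  · refine ⟨⌊x⌋₊, (Nat.floor_lt hx.1).2 h, Nat.floor_le hx.1, (Nat.lt_floor_add_one x).le⟩
  · refine ⟨N - 1, by omega, ?_⟩
    have : ((N - 1 : ℕ) : ℝ) = N - 1 := by push_cast [Nat.succ_le_of_lt hN]; ring
    rw [this, h]
    constructor <;> linarith

/-- The closed polygon with vertices `v 0, …, v N = v 0`, as a closed curve. -/
def polyCurve (v : ℕ → E) (N : ℕ) (h : v N = v 0) : C(UnitAddCircle, E) :=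
  closedCurve (fun s => polyPath v N (N * s))
    ((continuous_polyPath v N).comp (continuous_const.mul continuous_id)).continuousOn (by
      rcases N.eq_zero_or_pos with rfl | hN
      · simp
      have h1 := polyPath_eq v hN (x := 0) (by simp)
      have h2 := polyPath_eq v (k := N - 1) (N := N) (by omega) (x := N) (by
        have : ((N - 1 : ℕ) : ℝ) = N - 1 := by push_cast [Nat.succ_le_of_lt hN]; ring
        rw [this]; constructor <;> linarith)
      have : ((N - 1 : ℕ) : ℝ) = N - 1 := by push_cast [Nat.succ_le_of_lt hN]; ring
      rw [this, Nat.sub_add_cancel hN] at h2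
      simp only [mul_zero, mul_one, h1, h2]
      simp [h])

lemma range_polyCurve {v : ℕ → E} {N : ℕ} (hN : 0 < N) (h : v N = v 0) :
    range (polyCurve v N h) = ⋃ k < N, segment ℝ (v k) (v (k + 1)) := by
  have hN' : (0 : ℝ) < N := by exact_mod_cast hN
  rw [polyCurve, range_closedCurve]
  ext y
  simp only [mem_image, mem_iUnion, exists_prop, segment_eq_image', mem_image]
  constructor
  · rintro ⟨s, hs, rfl⟩
    obtain ⟨k, hk, hx⟩ := exists_nat_mem_Icc hN (x := N * s)
      ⟨mul_nonneg hN'.le hs.1, by nlinarith [hs.2]⟩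
    exact ⟨k, hk, N * s - k, ⟨by linarith [hx.1], by linarith [hx.2]⟩, (polyPath_eq v hk hx).symm⟩
  · rintro ⟨k, hk, t, ht, rfl⟩
    have hk' : (k : ℝ) + 1 ≤ N := by exact_mod_cast hk
    refine ⟨(k + t) / N, ⟨by have := ht.1; positivity, ?_⟩, ?_⟩
    · rw [div_le_one hN']; linarith [ht.2]
    · rw [mul_div_cancel₀ _ hN'.ne', polyPath_eq v hk ⟨by linarith [ht.1], by linarith [ht.2]⟩]
      simp

lemma curveLength_polyCurve_le (v : ℕ → E) (N : ℕ) (h : v N = v 0) :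
    curveLength (polyCurve v N h) ≤
      ENNReal.ofReal (∑ k ∈ Finset.range N, dist (v k) (v (k + 1))) := by
  rw [polyCurve, curveLength_closedCurve]
  refine (eVariationOn_le_of_dist_le (g := fun s => ∑ k ∈ Finset.range N,
    ramp (N * s - k) * dist (v k) (v (k + 1))) zero_le_one ?_).trans ?_
  · intro s _ t _ hst
    rw [polyPath, polyPath, dist_add_left, dist_eq_norm, ← Finset.sum_sub_distrib,
      ← Finset.sum_sub_distrib]
    refine (norm_sum_le _ _).trans (Finset.sum_le_sum fun k _ => ?_)
    have hm : ramp (N * s - k) ≤ ramp (N * t - k) := ramp_mono (by gcongr)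
    rw [← sub_smul, ← sub_mul, norm_smul, Real.norm_eq_abs, abs_sub_comm, abs_of_nonneg (by linarith),
      dist_comm, dist_eq_norm]
  · refine ENNReal.ofReal_le_ofReal ?_
    have h1 : ∀ k ∈ Finset.range N, 0 ≤ ramp (N * 0 - k) * dist (v k) (v (k + 1)) :=
      fun k _ => mul_nonneg (ramp_nonneg _) dist_nonneg
    have h2 : ∀ k ∈ Finset.range N, ramp (N * 1 - k) * dist (v k) (v (k + 1)) ≤
        dist (v k) (v (k + 1)) :=
      fun k _ => mul_le_of_le_one_left dist_nonneg (ramp_le_one _)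
    have := Finset.sum_nonneg h1
    have := Finset.sum_le_sum h2
    linarith

end Polygon

/-! ### Directions in the plane -/

/-- The unit vector of direction `θ`. -/
def uvec (θ : ℝ) : Plane := !₂[cos θ, sin θ]

/-- The unit vector of direction `θ + π / 2`. -/
def uperp (θ : ℝ) : Plane := !₂[-sin θ, cos θ]

lemma plane_inner (v w : Plane) : ⟪v, w⟫ = v 0 * w 0 + v 1 * w 1 := by
  simp [PiLp.inner_apply, Fin.sum_univ_two, mul_comm]

lemma plane_norm_sq (v : Plane) : ‖v‖ ^ 2 = v 0 ^ 2 + v 1 ^ 2 := by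
  rw [EuclideanSpace.norm_sq_eq]; simp [Fin.sum_univ_two]

lemma plane_ext {v w : Plane} (h0 : v 0 = w 0) (h1 : v 1 = w 1) : v = w := by
  ext i; fin_cases i <;> assumption

@[simp] lemma uvec_zero' (θ : ℝ) : uvec θ 0 = cos θ := rfl
@[simp] lemma uvec_one' (θ : ℝ) : uvec θ 1 = sin θ := rfl
@[simp] lemma uperp_zero' (θ : ℝ) : uperp θ 0 = -sin θ := rfl
@[simp] lemma uperp_one' (θ : ℝ) : uperp θ 1 = cos θ := rfl

@[simp] lemma norm_uvec (θ : ℝ) : ‖uvec θ‖ = 1 := by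
  rw [← sq_eq_sq₀ (norm_nonneg _) zero_le_one, plane_norm_sq]; simp

@[simp] lemma norm_uperp (θ : ℝ) : ‖uperp θ‖ = 1 := by
  rw [← sq_eq_sq₀ (norm_nonneg _) zero_le_one, plane_norm_sq]; simp

lemma inner_uvec_uvec (α β : ℝ) : ⟪uvec α, uvec β⟫ = cos (α - β) := by
  rw [plane_inner, cos_sub]; simp

lemma inner_uperp_uvec (α β : ℝ) : ⟪uperp α, uvec β⟫ = sin (β - α) := by
  rw [plane_inner, sin_sub]; simp; ring

lemma inner_uvec (w : Plane) (θ : ℝ) : ⟪w, uvec θ⟫ = w 0 * cos θ + w 1 * sin θ := plane_inner _ _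

@[fun_prop] lemma continuous_uvec : Continuous uvec := by
  unfold uvec
  refine (PiLp.continuous_toLp 2 _).comp (continuous_pi fun i => ?_)
  fin_cases i
  · exact continuous_cos
  · exact continuous_sin

@[fun_prop] lemma continuous_uperp : Continuous uperp := by
  unfold uperp
  refine (PiLp.continuous_toLp 2 _).comp (continuous_pi fun i => ?_)
  fin_cases i
  · exact continuous_sin.neg
  · exact continuous_cos

lemma uvec_add_two_pi (θ : ℝ) : uvec (θ + 2 * π) = uvec θ := by
  apply plane_ext <;> simp

lemma uvec_add_pi (θ : ℝ) : uvec (θ + π) = -uvec θ := by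
  apply plane_ext <;> simp

lemma exists_eq_smul_uvec (w : Plane) : ∃ α, w = ‖w‖ • uvec α := by
  set z : ℂ := ⟨w 0, w 1⟩
  have hz : ‖z‖ = ‖w‖ := by
    rw [← sq_eq_sq₀ (norm_nonneg _) (norm_nonneg _), plane_norm_sq, Complex.sq_norm,
      Complex.normSq_apply]
    ring
  refine ⟨Complex.arg z, ?_⟩
  rw [← hz]
  apply plane_ext
  · exact (Complex.norm_mul_cos_arg z).symm
  · exact (Complex.norm_mul_sin_arg z).symm

lemma exists_uvec_eq {w : Plane} (h : ‖w‖ = 1) : ∃ α, uvec α = w := by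
  obtain ⟨α, hα⟩ := exists_eq_smul_uvec w
  exact ⟨α, by rw [hα, h, one_smul]⟩

lemma dist_uvec_le (α β : ℝ) : dist (uvec α) (uvec β) ≤ |α - β| := by
  rw [dist_eq_norm, ← sq_le_sq₀ (norm_nonneg _) (abs_nonneg _), sq_abs, norm_sub_sq_real,
    inner_uvec_uvec, norm_uvec, norm_uvec]
  have := Real.one_sub_sq_div_two_le_cos (x := α - β)
  linarith

lemma integral_abs_cos : ∫ θ in (0 : ℝ)..(2 * π), |cos θ| = 4 := by
  have hp : Function.Periodic (fun θ => |cos θ|) (2 * π) := fun θ => by simp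
  have h1 := hp.intervalIntegral_add_eq 0 (-(π / 2))
  rw [zero_add] at h1
  rw [h1, show -(π / 2) + 2 * π = π / 2 + π by ring,
    ← intervalIntegral.integral_add_adjacent_intervals (b := π / 2)
      ((by fun_prop : Continuous fun θ => |cos θ|).intervalIntegrable _ _)
      ((by fun_prop : Continuous fun θ => |cos θ|).intervalIntegrable _ _)]
  have h2 : ∫ θ in (-(π / 2))..(π / 2), |cos θ| = ∫ θ in (-(π / 2))..(π / 2), cos θ := by
    refine intervalIntegral.integral_congr fun θ hθ => ?_
    rw [uIcc_of_le (by linarith [pi_pos])] at hθ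
    exact abs_of_nonneg (cos_nonneg_of_mem_Icc hθ)
  have h3 : ∫ θ in (π / 2)..(π / 2 + π), |cos θ| = ∫ θ in (π / 2)..(π / 2 + π), -cos θ := by
    refine intervalIntegral.integral_congr fun θ hθ => ?_
    rw [uIcc_of_le (by linarith [pi_pos])] at hθ
    exact abs_of_nonpos (cos_nonpos_of_pi_div_two_le_of_le hθ.1 (by linarith [hθ.2]))
  rw [h2, h3, intervalIntegral.integral_neg, integral_cos, integral_cos, sin_add_pi, sin_neg,
    sin_pi_div_two]
  norm_num

/-- A vector projects to four times its length, on integrating over all directions. -/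
lemma integral_abs_inner_uvec (w : Plane) : ∫ θ in (0 : ℝ)..(2 * π), |⟪w, uvec θ⟫| = 4 * ‖w‖ := by
  obtain ⟨α, hα⟩ := exists_eq_smul_uvec w
  have h1 : ∀ θ, |⟪w, uvec θ⟫| = ‖w‖ * |cos (θ - α)| := fun θ => by
    conv_lhs => rw [hα]
    rw [inner_smul_left, inner_uvec_uvec, abs_mul, ← neg_sub, cos_neg]; simp
  have hp : Function.Periodic (fun θ => |cos θ|) (2 * π) := fun θ => by simp
  have h2 := hp.intervalIntegral_add_eq 0 (-α)
  simp_rw [h1]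
  rw [intervalIntegral.integral_const_mul,
    intervalIntegral.integral_comp_sub_right (fun θ => |cos θ|), zero_sub,
    show 2 * π - α = -α + 2 * π by ring, ← h2, zero_add, integral_abs_cos, mul_comm]

/-- The length of a closed polygon is at least the integral of its support function. -/
lemma integral_le_sum_dist (v : ℕ → Plane) (N : ℕ) (hv : v N = v 0) {h : ℝ → ℝ} (hc : Continuous h)
    (hp : Function.Periodic h (2 * π)) (hle : ∀ θ, ∃ j ≤ N, h θ ≤ ⟪v j, uvec θ⟫) :
    ∫ θ in (0 : ℝ)..(2 * π), h θ ≤ ∑ k ∈ Finset.range N, dist (v k) (v (k + 1)) := by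
  have hcont : ∀ k, Continuous fun θ => |⟪v k - v (k + 1), uvec θ⟫| := fun k => by fun_prop
  -- Projected to the direction `θ`, the polygon is a closed chain that reaches `h θ` on one side
  -- and `-h (θ + π)` on the other, so its variation is at least twice this width. Integration over
  -- `θ` gives four times the integral of `h` on the left and four times the length on the right.
  have key : ∀ θ, 2 * (h θ + h (θ + π)) ≤
      ∑ k ∈ Finset.range N, |⟪v k - v (k + 1), uvec θ⟫| := by
    intro θ
    obtain ⟨j, hj, hj'⟩ := hle θ
    obtain ⟨k, hk, hk'⟩ := hle (θ + π)
    have := two_mul_dist_le_sum (fun i => ⟪v i, uvec θ⟫) N (by simp [hv]) hj hk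
    simp only [Real.dist_eq, ← inner_sub_left] at this
    refine le_trans ?_ this
    rw [uvec_add_pi, inner_neg_right] at hk'
    have h3 := le_abs_self ⟪v j - v k, uvec θ⟫
    rw [inner_sub_left] at h3 ⊢
    linarith
  have h1 : ∫ θ in (0 : ℝ)..(2 * π), h (θ + π) = ∫ θ in (0 : ℝ)..(2 * π), h θ := by
    rw [intervalIntegral.integral_comp_add_right, zero_add, add_comm (2 * π)]
    have := hp.intervalIntegral_add_eq π 0
    rw [this, zero_add]
  have h2 := intervalIntegral.integral_mono_on (μ := volume) (a := 0) (b := 2 * π) (by positivity)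
    ((by fun_prop : Continuous fun θ => 2 * (h θ + h (θ + π))).intervalIntegrable _ _)
    ((continuous_finsetSum (Finset.range N) fun k _ => hcont k).intervalIntegrable _ _)
    (fun θ _ => key θ)
  rw [intervalIntegral.integral_const_mul, intervalIntegral.integral_add
    (hc.intervalIntegrable _ _) ((by fun_prop : Continuous fun θ => h (θ + π)).intervalIntegrable _ _),
    h1, intervalIntegral.integral_finsetSum fun k _ => (hcont k).intervalIntegrable _ _] at h2
  simp_rw [integral_abs_inner_uvec, ← dist_eq_norm, ← Finset.mul_sum] at h2
  linarith

/-- The Riemann sums of a Lipschitz function. -/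
lemma abs_integral_sub_sum_le {f : ℝ → ℝ} {K : ℝ} (hf : ∀ x y, |f x - f y| ≤ K * |x - y|)
    {N : ℕ} (hN : 0 < N) :
    |(∫ θ in (0 : ℝ)..(2 * π), f θ) - 2 * π / N * ∑ k ∈ Finset.range N, f (k * (2 * π / N))| ≤
      (2 * π) ^ 2 * K / N := by
  have hN' : (0 : ℝ) < N := by exact_mod_cast hN
  have hK : 0 ≤ K := by simpa using (abs_nonneg _).trans (hf 1 0)
  have hcont : Continuous f := (LipschitzWith.of_dist_le_mul (K := ⟨K, hK⟩) fun x y => hf x y).continuous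
  set δ := 2 * π / N with hδ
  have hδ0 : 0 < δ := by positivity
  have hs := intervalIntegral.sum_integral_adjacent_intervals (μ := volume) (f := f)
    (a := fun k : ℕ => k * δ) (n := N) fun k _ => hcont.intervalIntegrable _ _
  have hNδ : N * δ = 2 * π := by rw [hδ]; field_simp
  simp only [Nat.cast_zero, zero_mul, hNδ] at hs
  rw [← hs, Finset.mul_sum, ← Finset.sum_sub_distrib]
  have hk : ∀ k ∈ Finset.range N, |(∫ θ in (k * δ : ℝ)..((k + 1 : ℕ) * δ), f θ) - δ * f (k * δ)| ≤
      K * δ * δ := by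
    intro k _
    have e : ((k + 1 : ℕ) : ℝ) * δ - k * δ = δ := by push_cast; ring
    have h1 : δ * f (k * δ) = ∫ _ in (k * δ : ℝ)..((k + 1 : ℕ) * δ), f (k * δ) := by
      rw [intervalIntegral.integral_const, e, smul_eq_mul]
    rw [h1, ← intervalIntegral.integral_sub (hcont.intervalIntegrable _ _)
      (continuous_const.intervalIntegrable _ _)]
    have h2 := intervalIntegral.norm_integral_le_of_norm_le_const (a := k * δ)
      (b := (k + 1 : ℕ) * δ) (f := fun θ => f θ - f (k * δ)) (C := K * δ) (by
        intro x hx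
        rw [uIoc_of_le (by linarith)] at hx
        refine (hf _ _).trans ?_
        rw [abs_of_pos (by linarith [hx.1])]
        exact mul_le_mul_of_nonneg_left (by linarith [hx.2]) hK)
    rwa [e, abs_of_pos hδ0] at h2
  refine (Finset.abs_sum_le_sum_abs _ _).trans ((Finset.sum_le_sum hk).trans (le_of_eq ?_))
  rw [Finset.sum_const, Finset.card_range, nsmul_eq_mul, hδ]
  field_simp

/-! ### The support function of finitely many points and the perimeter of their hull -/

section HullSupp
variable {ι : Type*} [Finite ι] [Nonempty ι]

/-- The support function of the points `c i`. -/
def hullSupp (c : ι → Plane) (θ : ℝ) : ℝ := ⨆ i, ⟪c i, uvec θ⟫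

lemma inner_le_hullSupp (c : ι → Plane) (θ : ℝ) (i : ι) : ⟪c i, uvec θ⟫ ≤ hullSupp c θ :=
  le_ciSup (f := fun i => ⟪c i, uvec θ⟫) (finite_range _).bddAbove i

lemma exists_hullSupp_eq (c : ι → Plane) (θ : ℝ) : ∃ i, ⟪c i, uvec θ⟫ = hullSupp c θ :=
  exists_eq_ciSup_of_finite

lemma hullSupp_le {c : ι → Plane} {θ r : ℝ} (h : ∀ i, ⟪c i, uvec θ⟫ ≤ r) : hullSupp c θ ≤ r :=
  ciSup_le h

lemma hullSupp_periodic (c : ι → Plane) : Function.Periodic (hullSupp c) (2 * π) := fun θ => by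
  simp [hullSupp, uvec_add_two_pi]

lemma exists_lipschitz_hullSupp (c : ι → Plane) :
    ∃ K : ℝ, ∀ x y, |hullSupp c x - hullSupp c y| ≤ K * |x - y| := by
  obtain ⟨K, hK⟩ := (finite_range fun i => ‖c i‖).bddAbove
  have hK' : ∀ i, ‖c i‖ ≤ K := fun i => hK ⟨i, rfl⟩
  have key : ∀ x y, hullSupp c x - hullSupp c y ≤ K * |x - y| := by
    intro x y
    obtain ⟨i, hi⟩ := exists_hullSupp_eq c x
    have h1 := inner_le_hullSupp c y i
    have h2 := real_inner_le_norm (c i) (uvec x - uvec y)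
    rw [inner_sub_right, ← dist_eq_norm] at h2
    have h3 : ‖c i‖ * dist (uvec x) (uvec y) ≤ K * |x - y| :=
      mul_le_mul (hK' i) (dist_uvec_le x y) dist_nonneg ((norm_nonneg _).trans (hK' i))
    linarith
  refine ⟨K, fun x y => abs_sub_le_iff.2 ⟨key x y, ?_⟩⟩
  rw [abs_sub_comm]; exact key y x

@[fun_prop] lemma continuous_hullSupp (c : ι → Plane) : Continuous (hullSupp c) := by
  obtain ⟨K, hK⟩ := exists_lipschitz_hullSupp c
  have hK0 : 0 ≤ K := by simpa using (abs_nonneg _).trans (hK 1 0)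
  exact (LipschitzWith.of_dist_le_mul (K := ⟨K, hK0⟩) fun x y => hK x y).continuous

/-- The perimeter of the convex hull of the points `c i`. -/
def hullPerim (c : ι → Plane) : ℝ := ∫ θ in (0 : ℝ)..(2 * π), hullSupp c θ

/-- For a single point the support function is a sinusoid and equality holds; a point that is
extreme in the direction `θ` gives the inequality. This discrete form of `h + h'' ≥ 0` makes the
edges of circumscribed polygons have nonnegative signed length. -/
lemma two_cos_mul_hullSupp_le (c : ι → Plane) (θ δ : ℝ) :
    2 * cos δ * hullSupp c θ ≤ hullSupp c (θ + δ) + hullSupp c (θ - δ) := by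
  obtain ⟨i, hi⟩ := exists_hullSupp_eq c θ
  have h1 := inner_le_hullSupp c (θ + δ) i
  have h2 := inner_le_hullSupp c (θ - δ) i
  rw [← hi]
  rw [inner_uvec] at *
  rw [cos_add, sin_add] at h1
  rw [cos_sub, sin_sub] at h2
  linarith

end HullSupp

/-! ### Circumscribed polygons -/

section Circumscribed
variable (H : ℝ → ℝ) (δ : ℝ)

/-- The `k`-th vertex of the polygon with equally spaced outer normals and support function `H`. -/
def circVertex (k : ℕ) : Plane :=
  H (k * δ) • uvec (k * δ) - ((H (k * δ - δ) - H (k * δ) * cos δ) / sin δ) • uperp (k * δ)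

variable {H δ}

/-- The vertex with index `k + 1` is where the support lines with normals `k * δ` and `(k + 1) * δ`
meet. The definition locates it on the second line, this formula on the first. -/
lemma circVertex_succ (hδ : 0 < sin δ) (k : ℕ) : circVertex H δ (k + 1) =
    H (k * δ) • uvec (k * δ) + ((H (k * δ + δ) - H (k * δ) * cos δ) / sin δ) • uperp (k * δ) := by
  have e : ((k + 1 : ℕ) : ℝ) * δ = k * δ + δ := by push_cast; ring
  rw [circVertex, e, add_sub_cancel_right]
  generalize H (k * δ + δ) = A
  generalize H (k * δ) = B
  generalize (k : ℝ) * δ = θ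
  have h1 := sin_sq_add_cos_sq δ
  apply plane_ext
  · simp only [PiLp.sub_apply, PiLp.add_apply, PiLp.smul_apply, uvec_zero', uperp_zero', cos_add,
      sin_add, smul_eq_mul]
    field_simp
    linear_combination (-A * sin θ) * h1
  · simp only [PiLp.sub_apply, PiLp.add_apply, PiLp.smul_apply, uvec_one', uperp_one', cos_add,
      sin_add, smul_eq_mul]
    field_simp
    linear_combination (A * cos θ) * h1

lemma circVertex_succ_sub (hδ : 0 < sin δ) (k : ℕ) :
    circVertex H δ (k + 1) - circVertex H δ k =
      ((H (k * δ + δ) + H (k * δ - δ) - 2 * cos δ * H (k * δ)) / sin δ) • uperp (k * δ) := by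
  rw [circVertex_succ hδ, circVertex, show ∀ a b c : Plane, a + b - (a - c) = b + c by
    intros; abel, ← add_smul]
  congr 1
  ring

variable {N : ℕ}

lemma dist_circVertex (hδ : 0 < sin δ)
    (hsub : ∀ θ, 2 * cos δ * H θ ≤ H (θ + δ) + H (θ - δ)) (k : ℕ) :
    dist (circVertex H δ k) (circVertex H δ (k + 1)) =
      (H (k * δ + δ) + H (k * δ - δ) - 2 * cos δ * H (k * δ)) / sin δ := by
  rw [dist_comm, dist_eq_norm, circVertex_succ_sub hδ, norm_smul, norm_uperp, mul_one,
    Real.norm_eq_abs, abs_of_nonneg]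
  exact div_nonneg (by linarith [hsub (k * δ)]) hδ.le

lemma circVertex_period (hN : N * δ = 2 * π) (hp : Function.Periodic H (2 * π)) :
    circVertex H δ N = circVertex H δ 0 := by
  have h1 := hp 0
  have h2 := hp (0 - δ)
  rw [zero_add] at h1
  rw [circVertex, circVertex, hN, Nat.cast_zero, zero_mul, show 2 * π - δ = 0 - δ + 2 * π by ring,
    h1, h2]
  congr 2
  · simpa using uvec_add_two_pi 0
  · apply plane_ext <;> simp

/-- By periodicity the two shifted sums of `H` equal the unshifted one. The factor is `2 tan (δ /
2)`, asymptotically `δ`, so the perimeter is nearly a Riemann sum of `H`. -/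
lemma sum_dist_circVertex (hδ : 0 < sin δ) (hN : N * δ = 2 * π) (hp : Function.Periodic H (2 * π))
    (hsub : ∀ θ, 2 * cos δ * H θ ≤ H (θ + δ) + H (θ - δ)) :
    ∑ k ∈ Finset.range N, dist (circVertex H δ k) (circVertex H δ (k + 1)) =
      (2 - 2 * cos δ) / sin δ * ∑ k ∈ Finset.range N, H (k * δ) := by
  have h1 : ∑ k ∈ Finset.range N, H (k * δ + δ) = ∑ k ∈ Finset.range N, H (k * δ) := by
    have := Finset.sum_range_succ' (fun k : ℕ => H (k * δ)) N
    rw [Finset.sum_range_succ] at this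
    have e := hp 0
    simp only [hN, Nat.cast_zero, zero_mul, zero_add, Nat.cast_add, Nat.cast_one, add_mul,
      one_mul] at this e
    linarith
  have h2 : ∑ k ∈ Finset.range N, H (k * δ - δ) = ∑ k ∈ Finset.range N, H (k * δ) := by
    have := Finset.sum_range_succ' (fun k : ℕ => H (k * δ - δ)) N
    rw [Finset.sum_range_succ] at this
    have e := hp (0 - δ)
    rw [show 0 - δ + 2 * π = 2 * π - δ by ring] at e
    simp only [hN, Nat.cast_zero, zero_mul, Nat.cast_add, Nat.cast_one, add_mul,
      one_mul, add_sub_cancel_right] at this e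
    linarith
  simp_rw [dist_circVertex hδ hsub]
  rw [← Finset.sum_div, Finset.sum_sub_distrib, Finset.sum_add_distrib, h1, h2, ← Finset.mul_sum]
  ring

lemma inner_circVertex (k : ℕ) : ⟪circVertex H δ k, uvec (k * δ)⟫ = H (k * δ) := by
  rw [circVertex, inner_sub_left, inner_smul_left, inner_smul_left, inner_uvec_uvec,
    inner_uperp_uvec]
  simp

lemma inner_circVertex_succ (hδ : 0 < sin δ) (k : ℕ) :
    ⟪circVertex H δ (k + 1), uvec (k * δ)⟫ = H (k * δ) := by
  rw [circVertex_succ hδ, inner_add_left, inner_smul_left, inner_smul_left, inner_uvec_uvec,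
    inner_uperp_uvec]
  simp

lemma inner_of_mem_segment_circVertex (hδ : 0 < sin δ) {k : ℕ} {y : Plane}
    (hy : y ∈ segment ℝ (circVertex H δ k) (circVertex H δ (k + 1))) :
    ⟪y, uvec (k * δ)⟫ = H (k * δ) := by
  obtain ⟨a, b, _, _, hab, rfl⟩ := hy
  rw [inner_add_left, inner_smul_left, inner_smul_left, inner_circVertex, inner_circVertex_succ hδ]
  simp only [conj_trivial]
  rw [← add_mul, hab, one_mul]

lemma eq_smul_add_smul (y : Plane) (θ : ℝ) : y = ⟪y, uvec θ⟫ • uvec θ + ⟪y, uperp θ⟫ • uperp θ := by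
  have := sin_sq_add_cos_sq θ
  apply plane_ext
  · simp only [PiLp.add_apply, PiLp.smul_apply, uvec_zero', uperp_zero', smul_eq_mul, plane_inner,
      uvec_one', uperp_one']
    linear_combination (-y 0) * this
  · simp only [PiLp.add_apply, PiLp.smul_apply, uvec_zero', uperp_zero', smul_eq_mul, plane_inner,
      uvec_one', uperp_one']
    linear_combination (-y 1) * this

lemma mem_segment_circVertex (hδ : 0 < sin δ) {k : ℕ} {y : Plane}
    (h0 : ⟪y, uvec (k * δ)⟫ = H (k * δ)) (h1 : ⟪y, uvec (k * δ + δ)⟫ ≤ H (k * δ + δ))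
    (h2 : ⟪y, uvec (k * δ - δ)⟫ ≤ H (k * δ - δ)) :
    y ∈ segment ℝ (circVertex H δ k) (circVertex H δ (k + 1)) := by
  set θ := (k : ℝ) * δ
  set t := ⟪y, uperp θ⟫ with ht
  have e1 : ⟪y, uvec (θ + δ)⟫ = H θ * cos δ + t * sin δ := by
    rw [← h0, ht, plane_inner, plane_inner, plane_inner]
    simp [cos_add, sin_add]; ring
  have e2 : ⟪y, uvec (θ - δ)⟫ = H θ * cos δ - t * sin δ := by
    rw [← h0, ht, plane_inner, plane_inner, plane_inner]
    simp [cos_sub, sin_sub]; ring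
  rw [e1] at h1
  rw [e2] at h2
  have hy := eq_smul_add_smul y θ
  rw [h0, ← ht] at hy
  set a := (H (θ - δ) - H θ * cos δ) / sin δ with ha
  set b := (H (θ + δ) - H θ * cos δ) / sin δ with hb
  have hb' : t ≤ b := by rw [hb, le_div_iff₀ hδ]; linarith
  have ha' : -t ≤ a := by rw [ha, le_div_iff₀ hδ]; linarith
  rw [circVertex_succ hδ, circVertex, ← ha, ← hb, hy]
  rw [show H θ • uvec θ - a • uperp θ = H θ • uvec θ + (-a) • uperp θ by rw [neg_smul]; abel]
  have hmem : t ∈ segment ℝ (-a) b := by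
    rw [segment_eq_Icc (by linarith)]; exact ⟨by linarith, hb'⟩
  obtain ⟨p, q, hp, hq, hpq, hpqt⟩ := hmem
  refine ⟨p, q, hp, hq, hpq, ?_⟩
  rw [← hpqt, smul_add, smul_add, smul_smul, smul_smul, smul_smul, smul_smul, smul_eq_mul,
    smul_eq_mul]
  have : H θ = p * H θ + q * H θ := by rw [← add_mul, hpq, one_mul]
  conv_rhs => rw [this]
  module

/-- A circumscribed polygon encloses the points inside it. -/
lemma subset_enclosedRegion_circVertex {m : ℕ} (hm : 0 < m) (hδ : 0 < sin δ)
    (hN : (4 * m : ℕ) * δ = 2 * π) (hp : Function.Periodic H (2 * π)) {x : Plane}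
    (hx : ∀ θ, ⟪x, uvec θ⟫ < H θ) :
    x ∈ enclosedRegion (polyCurve (circVertex H δ) (4 * m) (circVertex_period hN hp)) := by
  have hr := range_polyCurve (v := circVertex H δ) (by omega) (circVertex_period hN hp)
  set γ := polyCurve (circVertex H δ) (4 * m) (circVertex_period hN hp)
  have hxγ : x ∉ range γ := by
    rw [hr]
    simp only [mem_iUnion, not_exists]
    intro k _ hk
    have := inner_of_mem_segment_circVertex hδ hk
    linarith [hx (k * δ)]
  refine ⟨hxγ, ?_⟩
  -- The interior `U` of the polygon and its exterior `V` are disjoint open sets. A point in neither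
  -- satisfies all the weak inequalities and lies on one of the lines, hence on an edge. So the
  -- component of `x` in the complement of the curve stays in `U`.
  set U : Set Plane := ⋂ k ∈ Finset.range (4 * m), {y | ⟪y, uvec (k * δ)⟫ < H (k * δ)}
  set V : Set Plane := ⋃ k ∈ Finset.range (4 * m), {y | H (k * δ) < ⟪y, uvec (k * δ)⟫}
  have hU : IsOpen U := isOpen_biInter_finset fun k _ => isOpen_lt (by fun_prop) (by fun_prop)
  have hV : IsOpen V := isOpen_biUnion fun k _ => isOpen_lt (by fun_prop) (by fun_prop)
  have hall : ∀ y : Plane, (∀ k < 4 * m, ⟪y, uvec (k * δ)⟫ ≤ H (k * δ)) →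
      ∀ k : ℕ, ⟪y, uvec (k * δ)⟫ ≤ H (k * δ) := by
    intro y hy k
    have e : (k : ℝ) * δ = ((k % (4 * m) : ℕ) : ℝ) * δ + (k / (4 * m) : ℕ) * (2 * π) := by
      conv_lhs => rw [← Nat.mod_add_div k (4 * m)]
      rw [← hN]; push_cast; ring
    have h1 : Function.Periodic (fun θ => H θ - ⟪y, uvec θ⟫) (2 * π) := fun θ => by
      simp only [uvec_add_two_pi, hp θ]
    have h2 := h1.nat_mul (k / (4 * m)) (((k % (4 * m) : ℕ) : ℝ) * δ)
    rw [← e] at h2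
    have := hy (k % (4 * m)) (Nat.mod_lt _ (by omega))
    linarith
  have hcov : (range γ)ᶜ ⊆ U ∪ V := by
    intro y hy
    by_contra hUV
    simp only [U, V, mem_union, mem_iInter, mem_iUnion, Finset.mem_range, mem_ofPred_eq, not_or,
      not_forall, not_exists, not_lt, exists_prop] at hUV
    obtain ⟨⟨k, hk, hk1⟩, h2'⟩ := hUV
    have h2 : ∀ k < 4 * m, ⟪y, uvec (k * δ)⟫ ≤ H (k * δ) := fun k hk =>
      not_lt.1 fun h => h2' k ⟨hk, h⟩
    have h3 := hall y h2
    apply hy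
    rw [hr]
    -- The preceding index `k - 1` is replaced by `k + (4 * m - 1)`, which has the same direction
    -- and is never negative.
    have hprev : ⟪y, uvec (k * δ - δ)⟫ ≤ H (k * δ - δ) := by
      have := h3 (k + (4 * m - 1))
      have e : ((k + (4 * m - 1) : ℕ) : ℝ) * δ = k * δ - δ + 2 * π := by
        rw [← hN]; push_cast [Nat.cast_sub (show 1 ≤ 4 * m by omega)]; ring
      rw [e, uvec_add_two_pi, hp] at this
      exact this
    have hnext : ⟪y, uvec (k * δ + δ)⟫ ≤ H (k * δ + δ) := by
      have := h3 (k + 1)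
      rwa [show ((k + 1 : ℕ) : ℝ) * δ = k * δ + δ by push_cast; ring] at this
    exact mem_iUnion₂.2 ⟨k, hk, mem_segment_circVertex hδ (le_antisymm (h2 k hk) hk1) hnext hprev⟩
  have hdisj : Disjoint U V := by
    rw [Set.disjoint_left]
    intro y hy hy'
    simp only [U, V, mem_iInter, mem_iUnion, Finset.mem_range, mem_ofPred_eq, exists_prop] at hy hy'
    obtain ⟨k, hk, hk'⟩ := hy'
    linarith [hy k hk]
  have hsub : connectedComponentIn (range γ)ᶜ x ⊆ U :=
    isPreconnected_connectedComponentIn.subset_left_of_subset_union hU hV hdisj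
      ((connectedComponentIn_subset _ _).trans hcov)
      ⟨x, mem_connectedComponentIn hxγ, by
        simp only [U, mem_iInter, mem_ofPred_eq]; exact fun k _ => hx _⟩
  refine Bornology.IsBounded.subset ?_ hsub
  -- Since the number of sides is a multiple of four, the four coordinate directions are among the
  -- normals, and `U` lies in a box.
  have hδm : (m : ℝ) * δ = π / 2 := by push_cast at hN; linarith
  refine isBounded_iff_forall_norm_le.2 ⟨|H 0| + |H (π / 2)| + |H π| + |H (π + π / 2)|, fun y hy => ?_⟩
  simp only [U, mem_iInter, Finset.mem_range, mem_ofPred_eq] at hy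
  have q0 := hy 0 (by omega)
  have q1 := hy m (by omega)
  have q2 := hy (2 * m) (by omega)
  have q3 := hy (3 * m) (by omega)
  rw [show ((2 * m : ℕ) : ℝ) * δ = π by push_cast; linarith] at q2
  rw [show ((3 * m : ℕ) : ℝ) * δ = π + π / 2 by push_cast; linarith] at q3
  rw [hδm] at q1
  simp only [inner_uvec, Nat.cast_zero, zero_mul, cos_zero, sin_zero, cos_pi_div_two,
    sin_pi_div_two, cos_pi, sin_pi, cos_add, sin_add] at q0 q1 q2 q3
  have b0 : |y 0| ≤ |H 0| + |H π| := abs_le.2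
    ⟨by linarith [le_abs_self (H π), abs_nonneg (H 0)], by linarith [le_abs_self (H 0), abs_nonneg (H π)]⟩
  have b1 : |y 1| ≤ |H (π / 2)| + |H (π + π / 2)| := abs_le.2
    ⟨by linarith [le_abs_self (H (π + π / 2)), abs_nonneg (H (π / 2))],
      by linarith [le_abs_self (H (π / 2)), abs_nonneg (H (π + π / 2))]⟩
  have : ‖y‖ ≤ |y 0| + |y 1| := by
    rw [← sq_le_sq₀ (norm_nonneg _) (by positivity), plane_norm_sq]
    nlinarith [sq_abs (y 0), sq_abs (y 1), mul_nonneg (abs_nonneg (y 0)) (abs_nonneg (y 1))]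
  linarith

end Circumscribed

lemma enclosesUnitDisks_zero (γ : C(UnitAddCircle, Plane)) : EnclosesUnitDisks 0 γ :=
  ⟨Fin.elim0, fun i => i.elim0, fun i => i.elim0⟩

lemma peri_zero : peri 0 = 0 := by
  refine le_antisymm (sInf_le ⟨ContinuousMap.const _ 0, enclosesUnitDisks_zero _, ?_⟩) zero_le
  exact eVariationOn.constant_on (by rintro _ ⟨_, _, rfl⟩ _ ⟨_, _, rfl⟩; rfl)

/-- `P_n` is at most the perimeter of the hull of `n` disjoint unit disks. -/
lemma peri_le {n : ℕ} [NeZero n] (c : Fin n → Plane) (hc : Pairwise fun i j => 2 ≤ dist (c i) (c j)) :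
    peri n ≤ ENNReal.ofReal (2 * π + hullPerim c) := by
  -- The support function of the union of the unit disks around the points.
  set H : ℝ → ℝ := fun θ => hullSupp c θ + 1 with hH
  obtain ⟨K, hK⟩ := exists_lipschitz_hullSupp c
  have hp : Function.Periodic H (2 * π) := fun θ => by simp [hH, hullSupp_periodic c θ]
  have hlip : ∀ x y, |H x - H y| ≤ K * |x - y| := fun x y => by simpa [hH] using hK x y
  have hint : ∫ θ in (0 : ℝ)..(2 * π), H θ = 2 * π + hullPerim c := by
    rw [hH, intervalIntegral.integral_add ((continuous_hullSupp c).intervalIntegrable _ _)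
      (continuous_const.intervalIntegrable _ _), hullPerim]
    simp; ring
  set δ : ℕ → ℝ := fun m => 2 * π / (4 * m : ℕ) with hδdef
  have key : ∀ m : ℕ, 2 ≤ m → peri n ≤ ENNReal.ofReal
      ((2 - 2 * cos (δ m)) / sin (δ m) * ∑ k ∈ Finset.range (4 * m), H (k * δ m)) := by
    intro m hm
    have hm' : (2 : ℝ) ≤ m := by exact_mod_cast hm
    have hN : (4 * m : ℕ) * δ m = 2 * π := by simp only [hδdef]; push_cast; field_simp
    have hδ0 : 0 < δ m := by simp only [hδdef]; push_cast; positivity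
    have hδπ : δ m < π := by
      simp only [hδdef]; push_cast
      rw [div_lt_iff₀ (by positivity)]; nlinarith [pi_pos]
    have hs : 0 < sin (δ m) := sin_pos_of_pos_of_lt_pi hδ0 hδπ
    have hsub : ∀ θ, 2 * cos (δ m) * H θ ≤ H (θ + δ m) + H (θ - δ m) := fun θ => by
      have := two_cos_mul_hullSupp_le c θ (δ m)
      have := cos_le_one (δ m)
      simp only [hH]; linarith
    rw [← sum_dist_circVertex hs hN hp hsub]
    refine le_trans (sInf_le ⟨polyCurve (circVertex H (δ m)) (4 * m) (circVertex_period hN hp),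
      ⟨c, fun i j hij => ball_disjoint_ball (by linarith [hc hij]), fun i x hx => ?_⟩, rfl⟩)
      (curveLength_polyCurve_le _ _ _)
    refine subset_enclosedRegion_circVertex (by omega) hs hN hp fun θ => ?_
    have h1 := inner_le_hullSupp c θ i
    have h2 := real_inner_le_norm (x - c i) (uvec θ)
    rw [inner_sub_left, norm_uvec, mul_one] at h2
    have h3 : ‖x - c i‖ < 1 := by rwa [← dist_eq_norm]
    simp only [hH]; linarith
  have hδ0 : Tendsto δ atTop (𝓝 0) := by
    have h1 : Tendsto (fun m : ℕ => (π / 2) / (m : ℝ)) atTop (𝓝 0) :=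
      tendsto_const_div_atTop_nhds_zero_nat _
    refine h1.congr fun m => ?_
    simp only [hδdef]; push_cast
    rcases eq_or_ne (m : ℝ) 0 with h | h
    · simp [h]
    · field_simp; ring
  have hδne : ∀ᶠ m in atTop, δ m ≠ 0 := by
    filter_upwards [eventually_ge_atTop 1] with m hm
    have : (0 : ℝ) < m := by exact_mod_cast hm
    simp only [hδdef]; push_cast; positivity
  -- The quotient is `tan (δ / 2) / (δ / 2)`, a difference quotient of the tangent at `0`.
  have hratio : Tendsto (fun m => (2 - 2 * cos (δ m)) / sin (δ m) / δ m) atTop (𝓝 1) := by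
    have h1 : HasDerivAt tan 1 0 := by simpa using hasDerivAt_tan (x := 0) (by simp)
    have h2 := h1.tendsto_slope
    have h3 : Tendsto (fun m => δ m / 2) atTop (𝓝[≠] 0) :=
      tendsto_nhdsWithin_iff.2 ⟨by simpa using hδ0.div_const 2, by
        filter_upwards [hδne] with m hm; simpa using hm⟩
    have h4 := h2.comp h3
    refine h4.congr' ?_
    have h5 : ∀ᶠ m in atTop, δ m ∈ Ioo (-1 : ℝ) 1 := hδ0 (Ioo_mem_nhds (by norm_num) (by norm_num))
    filter_upwards [hδne, h5] with m hm hm1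
    have hc0 : 0 < cos (δ m / 2) := cos_pos_of_mem_Ioo
      ⟨by linarith [hm1.1, pi_gt_three], by linarith [hm1.2, pi_gt_three]⟩
    have hs0 : sin (δ m / 2) ≠ 0 := fun h => by
      rw [sin_eq_zero_iff_of_lt_of_lt (by linarith [hm1.1, pi_gt_three])
        (by linarith [hm1.2, pi_gt_three])] at h
      exact hm (by linarith)
    simp only [Function.comp, slope_def_field, sub_zero, tan_eq_sin_div_cos, sin_zero, zero_div]
    have e1 : cos (δ m) = 1 - 2 * sin (δ m / 2) ^ 2 := by
      rw [show δ m = 2 * (δ m / 2) by ring, cos_two_mul, cos_sq']; ring_nf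
    have e2 : sin (δ m) = 2 * sin (δ m / 2) * cos (δ m / 2) := by
      conv_lhs => rw [show δ m = 2 * (δ m / 2) by ring, sin_two_mul]
    rw [e1, e2]
    field_simp
    ring
  have hsum : Tendsto (fun m => δ m * ∑ k ∈ Finset.range (4 * m), H (k * δ m)) atTop
      (𝓝 (2 * π + hullPerim c)) := by
    rw [← hint, tendsto_iff_dist_tendsto_zero]
    refine squeeze_zero' (Eventually.of_forall fun _ => dist_nonneg) ?_
      (tendsto_const_div_atTop_nhds_zero_nat ((2 * π) ^ 2 * K / 4))
    filter_upwards [eventually_ge_atTop 1] with m hm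
    have := abs_integral_sub_sum_le hlip (N := 4 * m) (by omega)
    rw [Real.dist_eq, abs_sub_comm]
    refine this.trans (le_of_eq ?_)
    push_cast; rw [div_div]
  have hlim := hratio.mul hsum
  rw [one_mul] at hlim
  refine ge_of_tendsto (ENNReal.tendsto_ofReal hlim) ?_
  filter_upwards [hδne, eventually_ge_atTop 2] with m hm hm2
  rw [← mul_assoc, div_mul_cancel₀ _ hm]
  exact key m hm2

/-! ### Inscribed polygons of closed curves -/

section Inscribed
variable {E : Type*} [PseudoMetricSpace E] (γ : C(UnitAddCircle, E))

lemma sum_dist_le_curveLength {N : ℕ} {u : ℕ → ℝ} (hu : Monotone u) (hu' : ∀ i, u i ∈ Icc (0 : ℝ) 1) :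
    ENNReal.ofReal (∑ i ∈ Finset.range N, dist (γ (u i)) (γ (u (i + 1)))) ≤ curveLength γ := by
  rw [ENNReal.ofReal_sum_of_nonneg fun _ _ => dist_nonneg]
  refine le_trans (le_of_eq ?_) (eVariationOn.sum_le (n := N) hu hu')
  exact Finset.sum_congr rfl fun i _ => by rw [← edist_dist, edist_comm]

lemma coe_one_eq_coe_zero : ((1 : ℝ) : UnitAddCircle) = ((0 : ℝ) : UnitAddCircle) :=
  AddCircle.coe_period (1 : ℝ)

/-- The points of the uniform partition of the circle into `N` arcs. -/
def gridPt (N i : ℕ) : UnitAddCircle := ((i / N : ℝ) : UnitAddCircle)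

lemma gridPt_self {N : ℕ} (hN : 0 < N) : gridPt N N = gridPt N 0 := by
  have : (N : ℝ) ≠ 0 := by exact_mod_cast hN.ne'
  simp only [gridPt, div_self this, Nat.cast_zero, zero_div]
  exact coe_one_eq_coe_zero

lemma sum_dist_gridPt_le_curveLength (N : ℕ) :
    ENNReal.ofReal (∑ i ∈ Finset.range N, dist (γ (gridPt N i)) (γ (gridPt N (i + 1)))) ≤
      curveLength γ := by
  rcases N.eq_zero_or_pos with rfl | hN
  · simp
  have hN' : (0 : ℝ) < N := by exact_mod_cast hN
  -- The minimum with `1` keeps the sequence in `[0, 1]` for all indices; it changes nothing up to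
  -- index `N`.
  have := sum_dist_le_curveLength γ (N := N) (u := fun i => min 1 ((i : ℝ) / N))
    (fun i j hij => by dsimp only; gcongr) (fun i => ⟨by positivity, min_le_left _ _⟩)
  refine le_trans (le_of_eq ?_) this
  congr 1
  refine Finset.sum_congr rfl fun i hi => ?_
  have h1 : (i : ℝ) + 1 ≤ N := by exact_mod_cast Finset.mem_range.1 hi
  have h2 : (i : ℝ) / N ≤ 1 := by rw [div_le_one hN']; linarith
  have h3 : ((i + 1 : ℕ) : ℝ) / N ≤ 1 := by rw [div_le_one hN']; push_cast; linarith
  rw [min_eq_right h2, min_eq_right h3]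
  rfl

lemma exists_uniform_modulus {ε : ℝ} (hε : 0 < ε) :
    ∃ δ > 0, ∀ s t : ℝ, |s - t| < δ → dist (γ (s : UnitAddCircle)) (γ (t : UnitAddCircle)) < ε := by
  obtain ⟨δ, hδ, h⟩ := Metric.uniformContinuous_iff.1
    (CompactSpace.uniformContinuous_of_continuous γ.continuous) ε hε
  refine ⟨δ, hδ, fun s t hst => h ?_⟩
  rw [dist_eq_norm, ← AddCircle.coe_sub]
  exact (QuotientAddGroup.norm_mk_le_norm).trans_lt hst

/-- A fine grid comes close to every point of a closed curve. -/
lemma exists_gridPt_dist_lt {ε : ℝ} (hε : 0 < ε) : ∃ N₀ : ℕ, 0 < N₀ ∧ ∀ N ≥ N₀,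
    (∀ x : UnitAddCircle, ∃ i < N, ∃ s ∈ Icc ((i : ℝ) / N) ((i + 1) / N), (s : UnitAddCircle) = x) ∧
    ∀ i : ℕ, ∀ s ∈ Icc ((i : ℝ) / N) ((i + 1) / N), dist (γ (s : UnitAddCircle)) (γ (gridPt N i)) < ε ∧
      dist (γ (s : UnitAddCircle)) (γ (gridPt N (i + 1))) < ε := by
  obtain ⟨δ, hδ, h⟩ := exists_uniform_modulus γ hε
  obtain ⟨N₀, hN₀⟩ := exists_nat_gt (1 / δ)
  have hN₀' : (0 : ℝ) < N₀ := lt_trans (by positivity) hN₀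
  refine ⟨N₀, by exact_mod_cast hN₀', fun N hN => ?_⟩
  have hNN : (N₀ : ℝ) ≤ N := by exact_mod_cast hN
  have hN' : (0 : ℝ) < N := by linarith
  have h1 : 1 / (N : ℝ) < δ := by
    rw [div_lt_iff₀ hN']; rw [div_lt_iff₀ hδ] at hN₀; nlinarith
  constructor
  · intro x
    obtain ⟨s, hs, rfl⟩ := exists_mem_Ico_coe_eq x
    obtain ⟨k, hk, hx⟩ := exists_nat_mem_Icc (N := N) (by exact_mod_cast hN') (x := N * s)
      ⟨mul_nonneg hN'.le hs.1, by nlinarith [hs.2]⟩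
    refine ⟨k, hk, s, ⟨?_, ?_⟩, rfl⟩
    · rw [div_le_iff₀ hN']; linarith [hx.1]
    · rw [le_div_iff₀ hN']; linarith [hx.2]
  · intro i s hs
    have e : ((i + 1 : ℕ) : ℝ) / N = i / N + 1 / N := by push_cast; ring
    have e' : ((i : ℝ) + 1) / N = i / N + 1 / N := by ring
    rw [e'] at hs
    constructor
    · exact h _ _ (by rw [abs_lt]; constructor <;> linarith [hs.1, hs.2])
    · refine h _ _ ?_
      rw [e, abs_lt]; constructor <;> linarith [hs.1, hs.2]

end Inscribed

/-- The length of a closed curve is at least the integral of its support function. -/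
lemma integral_le_curveLength (γ : C(UnitAddCircle, Plane)) {h : ℝ → ℝ} (hc : Continuous h)
    (hp : Function.Periodic h (2 * π)) (hle : ∀ θ, ∃ s, h θ ≤ ⟪γ s, uvec θ⟫) :
    ENNReal.ofReal (∫ θ in (0 : ℝ)..(2 * π), h θ) ≤ curveLength γ := by
  have key : ∀ ε > 0, ENNReal.ofReal ((∫ θ in (0 : ℝ)..(2 * π), h θ) - 2 * π * ε) ≤ curveLength γ := by
    intro ε hε
    obtain ⟨N, hN, hN'⟩ := exists_gridPt_dist_lt γ hε
    obtain ⟨h1, h2⟩ := hN' N le_rfl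
    refine le_trans (ENNReal.ofReal_le_ofReal ?_) (sum_dist_gridPt_le_curveLength γ N)
    have := integral_le_sum_dist (fun i => γ (gridPt N i)) N (by simp [gridPt_self hN])
      (h := fun θ => h θ - ε) (by fun_prop) (fun θ => by simp [hp θ]) (fun θ => by
        obtain ⟨s, hs⟩ := hle θ
        obtain ⟨i, hi, t, ht, rfl⟩ := h1 s
        refine ⟨i, hi.le, ?_⟩
        have h3 := (h2 i t ht).1
        have h4 := real_inner_le_norm (γ t - γ (gridPt N i)) (uvec θ)
        rw [inner_sub_left, norm_uvec, mul_one, ← dist_eq_norm] at h4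
        linarith)
    rw [intervalIntegral.integral_sub (hc.intervalIntegrable _ _)
      (continuous_const.intervalIntegrable _ _)] at this
    simpa using this
  have h1 : Tendsto (fun ε : ℝ => ENNReal.ofReal ((∫ θ in (0 : ℝ)..(2 * π), h θ) - 2 * π * ε))
      (𝓝[>] 0) (𝓝 (ENNReal.ofReal (∫ θ in (0 : ℝ)..(2 * π), h θ))) := by
    refine ENNReal.tendsto_ofReal (tendsto_nhdsWithin_of_tendsto_nhds ?_)
    have : Continuous fun ε : ℝ => (∫ θ in (0 : ℝ)..(2 * π), h θ) - 2 * π * ε := by fun_prop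
    simpa using this.tendsto 0
  exact le_of_tendsto h1 (by filter_upwards [self_mem_nhdsWithin] with ε hε using key ε hε)

/-- A closed curve reaches beyond the points that it encloses, in every direction. -/
lemma exists_lt_inner_of_mem_enclosedRegion {γ : C(UnitAddCircle, Plane)} {x : Plane}
    (hx : x ∈ enclosedRegion γ) (θ : ℝ) : ∃ s, ⟪x, uvec θ⟫ ≤ ⟪γ s, uvec θ⟫ := by
  by_contra! hcon
  obtain ⟨hxγ, hb⟩ := hx
  -- If the curve stayed strictly below `x` in this direction, the closed half-plane `A` beyond `x`
  -- would be a connected unbounded set off the curve, contained in the bounded component of `x`.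
  set A : Set Plane := {y | ⟪x, uvec θ⟫ ≤ ⟪y, uvec θ⟫}
  have hA : Convex ℝ A := by
    have : A = {y | ⟪x, uvec θ⟫ ≤ innerSL ℝ (uvec θ) y} := by
      ext y; simp [A, real_inner_comm]
    rw [this]
    exact convex_halfSpace_ge (innerSL ℝ (uvec θ)).isLinear _
  have hsub : A ⊆ connectedComponentIn (range γ)ᶜ x := by
    refine hA.isPreconnected.subset_connectedComponentIn (by simp [A]) ?_
    rintro y hy ⟨s, rfl⟩
    exact absurd (hcon s) (not_lt.2 hy)
  obtain ⟨R, hR⟩ := isBounded_iff_forall_norm_le.1 (hb.subset hsub)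
  have h1 := hR (x + (|R| + ‖x‖ + 1) • uvec θ) (by
    simp only [A, mem_ofPred_eq, inner_add_left, inner_smul_left, inner_uvec_uvec, sub_self, cos_zero,
      mul_one, conj_trivial]
    have := norm_nonneg x
    have := abs_nonneg R
    linarith)
  have h2 : ‖(|R| + ‖x‖ + 1) • uvec θ‖ = |R| + ‖x‖ + 1 := by
    rw [norm_smul, norm_uvec, mul_one, Real.norm_eq_abs, abs_of_pos (by positivity)]
  have h3 := norm_sub_le (x + (|R| + ‖x‖ + 1) • uvec θ) x
  rw [add_sub_cancel_left, h2] at h3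
  linarith [le_abs_self R]

/-- The points `c + r • uvec θ` with `r < 1` are enclosed, so the curve reaches at least as far as
each of them. Its maximum in this direction is attained, so the bound persists for `r = 1`. -/
lemma exists_inner_add_one_le {γ : C(UnitAddCircle, Plane)} {c : Plane}
    (hc : ball c 1 ⊆ enclosedRegion γ) (θ : ℝ) : ∃ s, ⟪c, uvec θ⟫ + 1 ≤ ⟪γ s, uvec θ⟫ := by
  obtain ⟨s, -, hs⟩ := isCompact_univ.exists_isMaxOn univ_nonempty
    (by fun_prop : Continuous fun s => ⟪γ s, uvec θ⟫).continuousOn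
  refine ⟨s, ?_⟩
  by_contra! hlt
  set μ := ⟪γ s, uvec θ⟫
  obtain ⟨r, hr1, hr2⟩ := exists_between (max_lt (zero_lt_one) (by linarith : μ - ⟪c, uvec θ⟫ < 1))
  have hr0 : 0 < r := (le_max_left _ _).trans_lt hr1
  have hr3 := (le_max_right (0 : ℝ) _).trans_lt hr1
  obtain ⟨t, ht⟩ := exists_lt_inner_of_mem_enclosedRegion (hc (show c + r • uvec θ ∈ ball c 1 by
    rw [mem_ball, dist_eq_norm, add_sub_cancel_left, norm_smul, norm_uvec, mul_one, Real.norm_eq_abs,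
      abs_of_pos hr0]; exact hr2)) θ
  have h1 : ⟪γ t, uvec θ⟫ ≤ μ := hs (mem_univ t)
  rw [inner_add_left, inner_smul_left, inner_uvec_uvec] at ht
  simp at ht
  linarith

lemma two_le_dist_of_disjoint_ball {x y : Plane} (h : Disjoint (ball x 1) (ball y 1)) :
    2 ≤ dist x y := by
  by_contra! hlt
  have hm : dist x (midpoint ℝ x y) < 1 := by
    rw [dist_left_midpoint, Real.norm_ofNat]; linarith
  have hm' : dist y (midpoint ℝ x y) < 1 := by
    rw [dist_right_midpoint, Real.norm_ofNat]; linarith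
  exact Set.disjoint_left.1 h (mem_ball'.2 hm) (mem_ball'.2 hm')

/-- A closed curve enclosing `n` disjoint unit disks is at least as long as the hull of these. -/
lemma exists_hullPerim_le_curveLength {n : ℕ} [NeZero n] {γ : C(UnitAddCircle, Plane)}
    (h : EnclosesUnitDisks n γ) : ∃ c : Fin n → Plane, (Pairwise fun i j => 2 ≤ dist (c i) (c j)) ∧
      ENNReal.ofReal (2 * π + hullPerim c) ≤ curveLength γ := by
  obtain ⟨c, hc, hc'⟩ := h
  refine ⟨c, fun i j hij => two_le_dist_of_disjoint_ball (hc hij), ?_⟩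
  have h1 := integral_le_curveLength γ (h := fun θ => hullSupp c θ + 1) (by fun_prop)
    (fun θ => by simp [hullSupp_periodic c θ]) (fun θ => by
      obtain ⟨i, hi⟩ := exists_hullSupp_eq c θ
      rw [← hi]
      exact exists_inner_add_one_le (hc' i) θ)
  rw [intervalIntegral.integral_add ((continuous_hullSupp c).intervalIntegrable _ _)
      (continuous_const.intervalIntegrable _ _)] at h1
  refine le_trans (le_of_eq ?_) h1
  simp [hullPerim]; ring_nf

lemma le_peri {n : ℕ} [NeZero n] {r : ℝ}
    (h : ∀ c : Fin n → Plane, (Pairwise fun i j => 2 ≤ dist (c i) (c j)) → r ≤ hullPerim c) :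
    ENNReal.ofReal (2 * π + r) ≤ peri n := by
  refine le_sInf ?_
  rintro _ ⟨γ, hγ, rfl⟩
  obtain ⟨c, hc, hc'⟩ := exists_hullPerim_le_curveLength hγ
  exact (ENNReal.ofReal_le_ofReal (by linarith [h c hc])).trans hc'

lemma peri_lt_top (n : ℕ) : peri n < ∞ := by
  rcases n.eq_zero_or_pos with rfl | hn
  · simp [peri_zero]
  have : NeZero n := ⟨hn.ne'⟩
  refine (peri_le (fun i : Fin n => (!₂[2 * (i : ℝ), 0] : Plane)) fun i j hij => ?_).trans_lt
    ENNReal.ofReal_lt_top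
  have h1 : (1 : ℝ) ≤ |((i : ℕ) : ℝ) - ((j : ℕ) : ℝ)| := by
    have : (1 : ℤ) ≤ |((i : ℕ) : ℤ) - ((j : ℕ) : ℤ)| :=
      Int.one_le_abs (by rw [sub_ne_zero]; exact_mod_cast fun h => hij (Fin.ext h))
    exact_mod_cast this
  have h2 := PiLp.norm_apply_le ((!₂[2 * (i : ℝ), 0] : Plane) - !₂[2 * (j : ℝ), 0]) 0
  show 2 ≤ dist (!₂[2 * (i : ℝ), 0] : Plane) !₂[2 * (j : ℝ), 0]
  rw [dist_eq_norm]
  refine le_trans ?_ h2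
  simp only [PiLp.sub_apply, Matrix.cons_val_zero]
  rw [show (2 * ((i : ℕ) : ℝ) - 2 * ((j : ℕ) : ℝ)) = 2 * ((i : ℕ) - (j : ℕ)) by ring, norm_mul]
  simp; linarith

/-! ### Existence of minimizers -/

/-- A closed curve of finite length has a Lipschitz parametrization. -/
lemma exists_lipschitz_param {E : Type*} [MetricSpace E] (γ : C(UnitAddCircle, E)) (hγ : curveLength γ ≠ ∞) :
    ∃ f : ℝ → E, (∀ s ∈ Icc (0 : ℝ) 1, ∀ t ∈ Icc (0 : ℝ) 1,
      dist (f s) (f t) ≤ (curveLength γ).toReal * |s - t|) ∧ f 0 = f 1 ∧ f '' Icc 0 1 = range γ := by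
  set F : ℝ → E := fun t => γ (t : UnitAddCircle) with hF
  have hFc : Continuous F := γ.continuous.comp continuous_quotient_mk'
  have hbv : BoundedVariationOn F (Icc 0 1) := hγ
  have hloc := hbv.locallyBoundedVariationOn
  set L := (curveLength γ).toReal with hL
  set V : ℝ → ℝ := variationOnFromTo F (Icc 0 1) 0 with hV
  have h0 : (0 : ℝ) ∈ Icc (0 : ℝ) 1 := ⟨le_rfl, zero_le_one⟩
  have h1 : (1 : ℝ) ∈ Icc (0 : ℝ) 1 := ⟨zero_le_one, le_rfl⟩
  have hV0 : V 0 = 0 := variationOnFromTo.self _ _ _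
  have hV1 : V 1 = L := by
    rw [hV, variationOnFromTo.eq_of_le _ _ zero_le_one, inter_self]; rfl
  have hVmono : MonotoneOn V (Icc 0 1) := variationOnFromTo.monotoneOn hloc h0
  have hdist : ∀ s ∈ Icc (0 : ℝ) 1, ∀ t ∈ Icc (0 : ℝ) 1, dist (F s) (F t) ≤ |V s - V t| := by
    have key : ∀ s ∈ Icc (0 : ℝ) 1, ∀ t ∈ Icc (0 : ℝ) 1, s ≤ t → dist (F s) (F t) ≤ V t - V s := by
      intro s hs t ht hst
      have h2 := variationOnFromTo.add hloc h0 hs ht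
      have h3 := variationOnFromTo.edist_zero_of_eq_zero (f := F) hloc (a := s) (b := t) hs ht
      have h4 : V t - V s = variationOnFromTo F (Icc 0 1) s t := by
        have : V t = V s + variationOnFromTo F (Icc 0 1) s t := h2.symm
        linarith
      rw [h4, variationOnFromTo.eq_of_le _ _ hst, dist_edist]
      exact ENNReal.toReal_mono (hloc s t hs ht)
        (eVariationOn.edist_le _ ⟨hs, le_rfl, hst⟩ ⟨ht, hst, le_rfl⟩)
    intro s hs t ht
    rcases le_total s t with h | h
    · rw [abs_sub_comm]; exact (key s hs t ht h).trans (le_abs_self _)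
    · rw [dist_comm]; exact (key t ht s hs h).trans (le_abs_self _)
  have hVc : ContinuousOn V (Icc 0 1) := by
    intro x hx
    have hl := hbv.tendsto_eVariationOn_Icc_zero_left (x := x) hFc.continuousWithinAt
    have hr := hbv.tendsto_eVariationOn_Icc_zero_right x hFc.continuousWithinAt
    have h2 := (ENNReal.tendsto_toReal ENNReal.zero_ne_top).comp hl
    have h3 := (ENNReal.tendsto_toReal ENNReal.zero_ne_top).comp hr
    have h4 := h2.add h3
    simp only [ENNReal.toReal_zero, add_zero] at h4
    refine tendsto_iff_dist_tendsto_zero.2 (squeeze_zero' (Eventually.of_forall fun _ => dist_nonneg)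
      ?_ h4)
    filter_upwards [self_mem_nhdsWithin] with y hy
    have h5 := variationOnFromTo.add hloc h0 hx hy
    have h6 : V y - V x = variationOnFromTo F (Icc 0 1) x y := by
      have : V y = V x + variationOnFromTo F (Icc 0 1) x y := h5.symm
      linarith
    rw [Real.dist_eq, h6]
    rcases le_total x y with h | h
    · rw [variationOnFromTo.eq_of_le _ _ h, abs_of_nonneg ENNReal.toReal_nonneg]
      exact le_add_of_nonneg_left ENNReal.toReal_nonneg
    · rw [variationOnFromTo.eq_of_ge _ _ h, abs_neg, abs_of_nonneg ENNReal.toReal_nonneg]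
      exact le_add_of_nonneg_right ENNReal.toReal_nonneg
  have hL0 : 0 ≤ L := ENNReal.toReal_nonneg
  have hsurj : ∀ u ∈ Icc (0 : ℝ) 1, ∃ s ∈ Icc (0 : ℝ) 1, V s = L * u := by
    intro u hu
    have := intermediate_value_Icc zero_le_one hVc
    rw [hV0, hV1] at this
    exact this ⟨mul_nonneg hL0 hu.1, mul_le_of_le_one_right hL0 hu.2⟩
  -- `ρ` is an arbitrary right inverse of the arc length function. It may jump where the curve
  -- rests, but `F ∘ ρ` is Lipschitz because `F` only depends on the value of `V`.
  choose! ρ hρ hρV using hsurj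
  have hd : ∀ s ∈ Icc (0 : ℝ) 1, ∀ t ∈ Icc (0 : ℝ) 1, V s = V t → F s = F t := fun s hs t ht h => by
    have := hdist s hs t ht
    rw [h, sub_self, abs_zero] at this
    exact dist_le_zero.1 this
  refine ⟨fun u => F (ρ u), fun s hs t ht => ?_, ?_, ?_⟩
  · refine (hdist _ (hρ s hs) _ (hρ t ht)).trans (le_of_eq ?_)
    rw [hρV s hs, hρV t ht, ← mul_sub, abs_mul, abs_of_nonneg hL0]
  · have e0 : F (ρ 0) = F 0 := hd _ (hρ 0 h0) _ h0 (by rw [hρV 0 h0, hV0, mul_zero])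
    have e1 : F (ρ 1) = F 1 := hd _ (hρ 1 h1) _ h1 (by rw [hρV 1 h1, hV1, mul_one])
    exact (e0.trans (by simp only [hF, coe_one_eq_coe_zero])).trans e1.symm
  · ext y
    constructor
    · rintro ⟨u, _, rfl⟩; exact ⟨_, rfl⟩
    · rintro ⟨x, rfl⟩
      obtain ⟨s, hs, rfl⟩ := exists_mem_Ico_coe_eq x
      have hs' := Ico_subset_Icc_self hs
      have hVs0 : 0 ≤ V s := by rw [← hV0]; exact hVmono h0 hs' hs'.1
      have hVs1 : V s ≤ L := by rw [← hV1]; exact hVmono hs' h1 hs'.2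
      rcases hL0.eq_or_lt with h | h
      · refine ⟨0, h0, hd _ (hρ 0 h0) _ hs' ?_⟩
        rw [hρV 0 h0]; linarith
      · have hu : V s / L ∈ Icc (0 : ℝ) 1 := ⟨by positivity, (div_le_one h).2 hVs1⟩
        refine ⟨V s / L, hu, hd _ (hρ _ hu) _ hs' ?_⟩
        rw [hρV _ hu, mul_div_cancel₀ _ h.ne']

/-- The points enclosed by the translate of a curve. -/
lemma add_mem_enclosedRegion {γ γ' : C(UnitAddCircle, Plane)} {a x : Plane}
    (h : range γ' = (fun y => y + a) '' range γ) (hx : x ∈ enclosedRegion γ) :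
    x + a ∈ enclosedRegion γ' := by
  obtain ⟨h1, h2⟩ := hx
  have e : (range γ')ᶜ = (Homeomorph.addRight a) '' (range γ)ᶜ := by
    rw [h, image_compl_eq (Homeomorph.addRight a).bijective]; rfl
  refine ⟨?_, ?_⟩
  · rw [h]; rintro ⟨y, hy, hya⟩
    exact h1 (add_right_cancel hya ▸ hy)
  · have := (Homeomorph.addRight a).image_connectedComponentIn (s := (range γ)ᶜ) h1
    rw [e]
    simp only [Homeomorph.coe_addRight] at this ⊢
    rw [← this]
    obtain ⟨R, hR⟩ := isBounded_iff_forall_norm_le.1 h2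
    refine isBounded_iff_forall_norm_le.2 ⟨R + ‖a‖, ?_⟩
    rintro _ ⟨y, hy, rfl⟩
    exact (norm_add_le _ _).trans (by linarith [hR y hy])

/-- `P_n` is attained. -/
lemma peri_mem_enclosingLengths (n : ℕ) : peri n ∈ enclosingLengths n := by
  rcases n.eq_zero_or_pos with rfl | hn
  · refine ⟨ContinuousMap.const _ 0, enclosesUnitDisks_zero _, ?_⟩
    rw [peri_zero]
    exact eVariationOn.constant_on (by rintro _ ⟨_, _, rfl⟩ _ ⟨_, _, rfl⟩; rfl)
  set P := (peri n).toReal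
  have hP : ENNReal.ofReal P = peri n := ENNReal.ofReal_toReal (peri_lt_top n).ne
  have hP0 : 0 ≤ P := ENNReal.toReal_nonneg
  -- A minimizing sequence of curves, parametrized proportionally to arc length and translated to
  -- start at the origin.
  have hseq : ∀ k : ℕ, ∃ (f : ℝ → Plane) (c : Fin n → Plane), f 0 = 0 ∧ f 1 = 0 ∧
      (∀ s ∈ Icc (0 : ℝ) 1, ∀ t ∈ Icc (0 : ℝ) 1, dist (f s) (f t) ≤ (P + 1 / (k + 1)) * |s - t|) ∧
      (Pairwise fun i j => 2 ≤ dist (c i) (c j)) ∧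
      ∃ γ : C(UnitAddCircle, Plane), range γ = f '' Icc 0 1 ∧ ∀ i, ball (c i) 1 ⊆ enclosedRegion γ := by
    intro k
    have hlt : peri n < ENNReal.ofReal (P + 1 / (k + 1)) := by
      rw [← hP]
      have : (0 : ℝ) < 1 / (k + 1) := by positivity
      exact (ENNReal.ofReal_lt_ofReal_iff (by positivity)).2 (by linarith)
    obtain ⟨ℓ, ⟨γ, ⟨c, hc, hc'⟩, rfl⟩, hγ⟩ := sInf_lt_iff.1 hlt
    obtain ⟨f, hf, hf01, hfr⟩ := exists_lipschitz_param γ (hγ.trans ENNReal.ofReal_lt_top).ne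
    have hlen : (curveLength γ).toReal ≤ P + 1 / (k + 1) :=
      ENNReal.toReal_le_of_le_ofReal (by positivity) hγ.le
    set a := -f 0
    refine ⟨fun s => f s + a, fun i => c i + a, by simp [a], by simp [a, hf01], ?_, ?_,
      ⟨fun x => γ x + a, by fun_prop⟩, ?_, ?_⟩
    · intro s hs t ht
      rw [dist_add_right]
      exact (hf s hs t ht).trans (by gcongr)
    · intro i j hij
      simpa using two_le_dist_of_disjoint_ball (hc hij)
    · ext y
      constructor
      · rintro ⟨x, rfl⟩
        have : γ x ∈ f '' Icc 0 1 := hfr ▸ ⟨x, rfl⟩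
        obtain ⟨s, hs, h⟩ := this
        exact ⟨s, hs, by simp [h]⟩
      · rintro ⟨s, hs, rfl⟩
        have : f s ∈ range γ := hfr ▸ ⟨s, hs, rfl⟩
        obtain ⟨x, hx⟩ := this
        exact ⟨x, by simp [hx]⟩
    · intro i x hx
      have : x - a ∈ ball (c i) 1 := by
        rw [mem_ball, dist_eq_norm] at hx ⊢
        rwa [show x - a - c i = x - (c i + a) by abel]
      have := add_mem_enclosedRegion (γ' := ⟨fun x => γ x + a, by fun_prop⟩) (a := a) (by
        rw [← range_comp]; rfl) (hc' i this)
      rwa [sub_add_cancel] at this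
  choose f c hf0 hf1 hfL hcd γ hγr hγe using hseq
  have hone : ∀ k : ℕ, 1 / ((k : ℝ) + 1) ≤ 1 := fun k => by
    rw [div_le_one (by positivity)]; linarith [(Nat.cast_nonneg k : (0 : ℝ) ≤ k)]
  set Λ : ℝ≥0 := ⟨P + 1, by positivity⟩
  have hLip : ∀ k, LipschitzWith Λ fun s : I => f k s := fun k =>
    LipschitzWith.of_dist_le_mul fun s t => (hfL k s s.2 t t.2).trans (by
      show _ ≤ (P + 1) * |(s : ℝ) - t|
      gcongr
      exact hone k)
  set G : ℕ → BoundedContinuousFunction I Plane := fun k =>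
    BoundedContinuousFunction.mkOfCompact ⟨fun s : I => f k s, (hLip k).continuous⟩
  have hfb : ∀ k, ∀ s ∈ Icc (0 : ℝ) 1, ‖f k s‖ ≤ P + 1 := by
    intro k s hs
    have := (hLip k).dist_le_mul ⟨s, hs⟩ 0
    simp only [Icc.coe_zero, hf0, dist_zero_right] at this
    refine this.trans ?_
    have h2 : dist (⟨s, hs⟩ : I) 0 ≤ 1 := by
      rw [Subtype.dist_eq, Real.dist_eq]; simp [abs_of_nonneg hs.1, hs.2]
    calc (Λ : ℝ) * dist (⟨s, hs⟩ : I) 0 ≤ Λ * 1 := by gcongr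
      _ = P + 1 := mul_one _
  set A : Set (BoundedContinuousFunction I Plane) := range G
  have hAc : IsCompact (closure A) := by
    refine BoundedContinuousFunction.arzela_ascoli (closedBall (0 : Plane) (P + 1))
      (isCompact_closedBall _ _) A ?_ ?_
    · rintro _ x ⟨k, rfl⟩
      exact mem_closedBall_zero_iff.2 (hfb k x x.2)
    · refine LipschitzWith.uniformEquicontinuous _ Λ ?_ |>.equicontinuous
      rintro ⟨_, ⟨k, rfl⟩⟩
      exact hLip k
  -- The curve reaches beyond the center in the direction of the center itself, and the curve stays
  -- in the ball of radius `P + 1`.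
  have hcb : ∀ k i, ‖c k i‖ ≤ P + 1 := by
    intro k i
    obtain ⟨α, hα⟩ := exists_eq_smul_uvec (c k i)
    obtain ⟨s, hs⟩ := exists_inner_add_one_le (hγe k i) α
    have h1 : γ k s ∈ f k '' Icc 0 1 := hγr k ▸ ⟨s, rfl⟩
    obtain ⟨t, ht, hts⟩ := h1
    have h2 := real_inner_le_norm (γ k s) (uvec α)
    rw [norm_uvec, mul_one, ← hts] at h2
    have h3 := hfb k t ht
    have h4 : ⟪c k i, uvec α⟫ = ‖c k i‖ := by
      conv_lhs => rw [hα]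
      rw [inner_smul_left, inner_uvec_uvec]; simp
    rw [← hts] at hs
    linarith
  have hprod := hAc.prod (isCompact_closedBall (0 : Fin n → Plane) (P + 1))
  obtain ⟨⟨g, d⟩, -, φ, hφ, hlim⟩ := hprod.tendsto_subseq (x := fun k => (G k, c k)) (fun k =>
    ⟨subset_closure ⟨k, rfl⟩, mem_closedBall_zero_iff.2
      ((pi_norm_le_iff_of_nonneg (by positivity)).2 fun i => hcb k i)⟩)
  rw [Prod.tendsto_iff] at hlim
  obtain ⟨hG, hc⟩ := hlim
  simp only [Function.comp_def] at hG hc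
  have hGs : ∀ s : I, Tendsto (fun k => f (φ k) s) atTop (𝓝 (g s)) := fun s =>
    ((continuous_eval_const s).tendsto g).comp hG
  have hci : ∀ i, Tendsto (fun k => c (φ k) i) atTop (𝓝 (d i)) := fun i =>
    ((continuous_apply i).tendsto d).comp hc
  have hdist : ∀ ε > 0, ∀ᶠ k in atTop, ∀ s : I, dist (f (φ k) s) (g s) < ε := by
    intro ε hε
    filter_upwards [Metric.tendsto_nhds.1 hG ε hε] with k hk s
    exact (BoundedContinuousFunction.dist_coe_le_dist (f := G (φ k)) (g := g) s).trans_lt hk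
  set F : ℝ → Plane := fun s => g (projIcc 0 1 zero_le_one s)
  have hF01 : F 0 = F 1 := by
    have e0 : F 0 = 0 := by
      have : F 0 = g 0 := by simp [F, projIcc_left]
      rw [this]
      exact tendsto_nhds_unique (hGs 0) (by simp [hf0])
    have e1 : F 1 = 0 := by
      have : F 1 = g 1 := by simp [F, projIcc_right]
      rw [this]
      exact tendsto_nhds_unique (hGs 1) (by simp [hf1])
    rw [e0, e1]
  have hFc : Continuous F := g.continuous.comp continuous_projIcc
  set Γ := closedCurve F hFc.continuousOn hF01
  have hFI : ∀ s (hs : s ∈ Icc (0 : ℝ) 1), F s = g ⟨s, hs⟩ := fun s hs => by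
    simp [F, projIcc_of_mem zero_le_one hs]
  have hΓr : ∀ y, y ∈ range Γ ↔ ∃ s : I, g s = y := by
    intro y
    rw [range_closedCurve]
    constructor
    · rintro ⟨s, hs, rfl⟩; exact ⟨⟨s, hs⟩, (hFI s hs).symm⟩
    · rintro ⟨s, rfl⟩; exact ⟨s, s.2, hFI s s.2⟩
  have hlen : curveLength Γ ≤ peri n := by
    rw [curveLength_closedCurve, ← hP]
    refine (eVariationOn_le_of_dist_le (g := fun s => P * s) zero_le_one ?_).trans (by simp)
    intro s hs t ht hst
    rw [hFI s hs, hFI t ht]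
    have h1 : Tendsto (fun k => dist (f (φ k) s) (f (φ k) t)) atTop
        (𝓝 (dist (g ⟨s, hs⟩) (g ⟨t, ht⟩))) := (hGs ⟨s, hs⟩).dist (hGs ⟨t, ht⟩)
    have h2 : Tendsto (fun k => (P + 1 / ((φ k : ℝ) + 1)) * |s - t|) atTop (𝓝 ((P + 0) * |s - t|)) :=
      (tendsto_const_nhds.add (tendsto_one_div_add_atTop_nhds_zero_nat.comp hφ.tendsto_atTop)).mul_const _
    have h3 := le_of_tendsto_of_tendsto' h1 h2 fun k => hfL (φ k) s hs t ht
    rw [abs_sub_comm, abs_of_nonneg (by linarith)] at h3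
    linarith
  have hdd : Pairwise fun i j => 2 ≤ dist (d i) (d j) := fun i j hij =>
    ge_of_tendsto' ((hci i).dist (hci j)) fun k => hcd (φ k) hij
  have henc : EnclosesUnitDisks n Γ := by
    refine ⟨d, fun i j hij => ball_disjoint_ball (by linarith [hdd hij]), fun i x hx => ?_⟩
    have hxk : ∀ᶠ k in atTop, x ∈ enclosedRegion (γ (φ k)) := by
      have h1 : Tendsto (fun k => dist x (c (φ k) i)) atTop (𝓝 (dist x (d i))) :=
        tendsto_const_nhds.dist (hci i)
      filter_upwards [h1.eventually_lt_const hx] with k hk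
      exact hγe _ i hk
    have hxΓ : x ∉ range Γ := by
      rw [hΓr]
      rintro ⟨s, rfl⟩
      have h1 : Tendsto (fun k => dist (f (φ k) s) (c (φ k) i)) atTop (𝓝 (dist (g s) (d i))) :=
        (hGs s).dist (hci i)
      obtain ⟨k, hk⟩ := (h1.eventually_lt_const hx).exists
      refine (hγe (φ k) i hk).1 ?_
      rw [hγr]; exact ⟨s, s.2, rfl⟩
    refine ⟨hxΓ, ?_⟩
    -- If the component of `x` for the limit curve were unbounded, a path off this curve would lead
    -- from `x` to a point `y` outside the ball of radius `P + 1`. By compactness the path also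
    -- misses the approximating curves sufficiently far in the sequence. Then such a curve encloses
    -- `y`, although it lies in that ball.
    by_contra hunb
    obtain ⟨y, hy, hyn⟩ : ∃ y ∈ connectedComponentIn (range Γ)ᶜ x, P + 1 < ‖y‖ := by
      by_contra! hcon
      exact hunb (isBounded_iff_forall_norm_le.2 ⟨P + 1, hcon⟩)
    have hopen : IsOpen (range Γ)ᶜ := (isCompact_range Γ.continuous).isClosed.isOpen_compl
    have hpc : IsPathConnected (connectedComponentIn (range Γ)ᶜ x) :=
      (hopen.connectedComponentIn.isConnected_iff_isPathConnected).1
        (isConnected_connectedComponentIn_iff.2 hxΓ)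
    obtain ⟨p, hp⟩ := hpc.joinedIn x (mem_connectedComponentIn hxΓ) y hy
    have hdis : Disjoint (range p) (range Γ) := by
      rw [Set.disjoint_left]
      rintro _ ⟨s, rfl⟩ hs
      exact connectedComponentIn_subset _ _ (hp s) hs
    obtain ⟨r, hr, hrd⟩ := exists_pos_forall_lt_edist (isCompact_range p.continuous)
      (isCompact_range Γ.continuous).isClosed hdis
    obtain ⟨k, hk1, hk2⟩ := (hxk.and (hdist r (by exact_mod_cast hr))).exists
    have hpk : range p ⊆ (range (γ (φ k)))ᶜ := by
      rintro _ ⟨s, rfl⟩ hs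
      rw [hγr] at hs
      obtain ⟨t, ht, hts⟩ := hs
      have h1 := hk2 ⟨t, ht⟩
      have h2 := hrd (p s) ⟨s, rfl⟩ (g ⟨t, ht⟩) ((hΓr _).2 ⟨_, rfl⟩)
      rw [← hts, edist_dist] at h2
      have h3 : ENNReal.ofReal (dist (f (φ k) t) (g ⟨t, ht⟩)) ≤ r := by
        rw [← ENNReal.ofReal_coe_nnreal]; exact ENNReal.ofReal_le_ofReal h1.le
      exact absurd h2 (not_lt.2 h3)
    have hyx : y ∈ connectedComponentIn (range (γ (φ k)))ᶜ x :=
      (isPreconnected_range p.continuous).subset_connectedComponentIn ⟨0, p.source⟩ hpk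
        ⟨1, p.target⟩
    have hye : y ∈ enclosedRegion (γ (φ k)) :=
      ⟨connectedComponentIn_subset _ _ hyx, connectedComponentIn_eq hyx ▸ hk1.2⟩
    obtain ⟨α, hα⟩ := exists_eq_smul_uvec y
    obtain ⟨s, hs⟩ := exists_lt_inner_of_mem_enclosedRegion hye α
    have h1 : γ (φ k) s ∈ f (φ k) '' Icc 0 1 := hγr (φ k) ▸ ⟨s, rfl⟩
    obtain ⟨t, ht, hts⟩ := h1
    have h2 := real_inner_le_norm (γ (φ k) s) (uvec α)
    rw [norm_uvec, mul_one] at h2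
    have h3 := hfb (φ k) t ht
    have h4 : ⟪y, uvec α⟫ = ‖y‖ := by
      conv_lhs => rw [hα]
      rw [inner_smul_left, inner_uvec_uvec]; simp
    rw [← hts] at h2 hs
    linarith
  exact ⟨Γ, henc, le_antisymm hlen (sInf_le ⟨Γ, henc, rfl⟩)⟩

/-! ### Thickness -/

/-- All circles through three distinct points of `X` have radius at least `r`. -/
def Thick (r : ℝ) (X : Set Space) : Prop :=
  ∀ x ∈ X, ∀ y ∈ X, ∀ z ∈ X, x ≠ y → y ≠ z → z ≠ x →
    4 * r ^ 2 * (‖y - x‖ ^ 2 * ‖z - x‖ ^ 2 - ⟪y - x, z - x⟫ ^ 2) ≤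
      ‖y - x‖ ^ 2 * ‖z - x‖ ^ 2 * ‖y - z‖ ^ 2

/-- The circumradius `R` of a triangle with sides `a, b, c` satisfies `a b c = 4 R · area`, and the
Gram determinant on the left is four times the squared area. Squaring avoids square roots. For
collinear points the determinant vanishes, in agreement with the radius `∞`. -/
lemma ofReal_le_circleRadius_iff {r : ℝ} (hr : 0 ≤ r) (x y z : Space) :
    ENNReal.ofReal r ≤ circleRadius x y z ↔
      4 * r ^ 2 * (‖y - x‖ ^ 2 * ‖z - x‖ ^ 2 - ⟪y - x, z - x⟫ ^ 2) ≤
        ‖y - x‖ ^ 2 * ‖z - x‖ ^ 2 * ‖y - z‖ ^ 2 := by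
  unfold circleRadius
  split_ifs with h
  · set t : Affine.Simplex ℝ Space 2 := ⟨![x, y, z], h⟩
    set R := t.circumradius
    have hR : 0 ≤ R := t.circumradius_nonneg
    have d0 : dist x t.circumcenter = R := t.dist_circumcenter_eq_circumradius 0
    have d1 : dist y t.circumcenter = R := t.dist_circumcenter_eq_circumradius 1
    have d2 : dist z t.circumcenter = R := t.dist_circumcenter_eq_circumradius 2
    have hmem := t.circumcenter_mem_affineSpan
    have hrange : range t.points = {x, y, z} := by
      show range ![x, y, z] = _
      simp [Matrix.range_cons, Matrix.range_empty]
      ext p; simp; tauto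
    rw [hrange] at hmem
    have hw : t.circumcenter - x ∈ Submodule.span ℝ {y - x, z - x} := by
      have h1 := AffineSubspace.vsub_mem_direction hmem
        (mem_affineSpan ℝ (show x ∈ ({x, y, z} : Set Space) by simp))
      rw [direction_affineSpan, vectorSpan_eq_span_vsub_set_right ℝ
        (show x ∈ ({x, y, z} : Set Space) by simp)] at h1
      refine Submodule.span_le.2 ?_ h1
      rintro _ ⟨p, hp, rfl⟩
      simp only [mem_insert_iff, mem_singleton_iff] at hp
      rcases hp with rfl | rfl | rfl
      · simp
      · exact Submodule.subset_span (by simp)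
      · exact Submodule.subset_span (by simp)
    obtain ⟨α, β, hαβ⟩ := Submodule.mem_span_pair.1 hw
    set w := t.circumcenter - x
    set a := y - x
    set b := z - x
    have e0 : ‖w‖ ^ 2 = R ^ 2 := by rw [← d0, dist_comm, dist_eq_norm]
    have e1 : ‖a - w‖ ^ 2 = R ^ 2 := by rw [← d1, dist_eq_norm]; congr 2; simp [a, w]
    have e2 : ‖b - w‖ ^ 2 = R ^ 2 := by rw [← d2, dist_eq_norm]; congr 2; simp [b, w]
    rw [norm_sub_sq_real] at e1 e2
    have i1 : ⟪a, w⟫ = α * ‖a‖ ^ 2 + β * ⟪a, b⟫ := by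
      rw [← hαβ, inner_add_right, inner_smul_right, inner_smul_right, real_inner_self_eq_norm_sq]
    have i2 : ⟪b, w⟫ = α * ⟪a, b⟫ + β * ‖b‖ ^ 2 := by
      rw [← hαβ, inner_add_right, inner_smul_right, inner_smul_right, real_inner_self_eq_norm_sq,
        real_inner_comm a b]
    have i0 : ‖w‖ ^ 2 = α * ⟪a, w⟫ + β * ⟪b, w⟫ := by
      rw [← real_inner_self_eq_norm_sq]
      conv_lhs => rw [← hαβ, inner_add_left, inner_smul_left, inner_smul_left, hαβ]
      simp
    have hyz : ‖y - z‖ ^ 2 = ‖a‖ ^ 2 - 2 * ⟪a, b⟫ + ‖b‖ ^ 2 := by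
      rw [← norm_sub_sq_real]; congr 2; simp [a, b]
    have hD : 0 < ‖a‖ ^ 2 * ‖b‖ ^ 2 - ⟪a, b⟫ ^ 2 := by
      have hcs : 0 ≤ ‖a‖ ^ 2 * ‖b‖ ^ 2 - ⟪a, b⟫ ^ 2 := by
        have := abs_real_inner_le_norm a b
        nlinarith [abs_nonneg ⟪a, b⟫, sq_abs ⟪a, b⟫, norm_nonneg a, norm_nonneg b]
      refine lt_of_le_of_ne hcs fun h0 => ?_
      rw [affineIndependent_iff_not_collinear_set] at h
      apply h
      rw [collinear_iff_of_mem (p₀ := x) (by simp)]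
      rcases eq_or_ne b 0 with hb | hb
      · have hzx : z = x := sub_eq_zero.1 hb
        refine ⟨a, fun p hp => ?_⟩
        simp only [mem_insert_iff, mem_singleton_iff] at hp
        rcases hp with rfl | rfl | rfl
        · exact ⟨0, by simp⟩
        · exact ⟨1, by simp [a]⟩
        · exact ⟨0, by simp [hzx]⟩
      · have hb' : ‖b‖ ^ 2 ≠ 0 := by simpa using hb
        have hv : ‖‖b‖ ^ 2 • a - ⟪a, b⟫ • b‖ ^ 2 = 0 := by
          rw [norm_sub_sq_real, norm_smul, norm_smul, inner_smul_left, inner_smul_right]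
          simp only [norm_pow, norm_norm, mul_pow, Real.norm_eq_abs, sq_abs, conj_trivial]
          linear_combination (-‖b‖ ^ 2) * h0
        have hv' : ‖b‖ ^ 2 • a = ⟪a, b⟫ • b := by
          rw [← sub_eq_zero, ← norm_eq_zero]; exact pow_eq_zero_iff (two_ne_zero) |>.1 hv
        refine ⟨b, fun p hp => ?_⟩
        simp only [mem_insert_iff, mem_singleton_iff] at hp
        rcases hp with rfl | rfl | rfl
        · exact ⟨0, by simp⟩
        · refine ⟨⟪a, b⟫ / ‖b‖ ^ 2, ?_⟩
          have : a = (⟪a, b⟫ / ‖b‖ ^ 2) • b := by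
            rw [div_eq_inv_mul, mul_smul, ← hv', smul_smul, inv_mul_cancel₀ hb', one_smul]
          rw [← this]; simp [a]
        · exact ⟨1, by simp [b]⟩
    -- Equal distances of the circumcenter from the vertices mean `⟪a, w⟫ = ‖a‖² / 2` and `⟪b, w⟫ =
    -- ‖b‖² / 2`, which determine the coefficients of `w` and its norm `R`.
    have hkey : 4 * R ^ 2 * (‖a‖ ^ 2 * ‖b‖ ^ 2 - ⟪a, b⟫ ^ 2) = ‖a‖ ^ 2 * ‖b‖ ^ 2 * ‖y - z‖ ^ 2 := by
      have j1 : ⟪a, w⟫ = ‖a‖ ^ 2 / 2 := by linarith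
      have j2 : ⟪b, w⟫ = ‖b‖ ^ 2 / 2 := by linarith
      rw [j1] at i1
      rw [j2] at i2
      rw [hyz, ← e0, i0, j1, j2]
      linear_combination (-2 * (‖a‖ ^ 2 * ‖b‖ ^ 2 - ‖a‖ ^ 2 * ⟪a, b⟫) +
        2 * 0) * i2 * 1 + (-2 * (‖a‖ ^ 2 * ‖b‖ ^ 2 - ‖b‖ ^ 2 * ⟪a, b⟫)) * i1
    rw [← hkey, ENNReal.ofReal_le_ofReal_iff hR, mul_le_mul_iff_left₀ hD]
    constructor
    · intro h; gcongr
    · intro h; exact (pow_le_pow_iff_left₀ hr hR two_ne_zero).1 (by linarith)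
  · refine iff_of_true le_top ?_
    rw [affineIndependent_iff_not_collinear_set, not_not, collinear_iff_of_mem (p₀ := x) (by simp)] at h
    obtain ⟨v, hv⟩ := h
    obtain ⟨s, hs⟩ := hv y (by simp)
    obtain ⟨t, ht⟩ := hv z (by simp)
    have ha : y - x = s • v := by rw [hs]; simp
    have hb : z - x = t • v := by rw [ht]; simp
    have : ‖y - x‖ ^ 2 * ‖z - x‖ ^ 2 - ⟪y - x, z - x⟫ ^ 2 = 0 := by
      rw [ha, hb, norm_smul, norm_smul, inner_smul_left, inner_smul_right, real_inner_self_eq_norm_sq]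
      simp only [mul_pow, Real.norm_eq_abs, sq_abs, conj_trivial]
      ring
    rw [this, mul_zero]
    positivity

lemma ofReal_le_thickness_iff {r : ℝ} (hr : 0 ≤ r) (X : Set Space) :
    ENNReal.ofReal r ≤ thickness X ↔ Thick r X := by
  simp only [thickness, localThickness, le_iInf_iff, ofReal_le_circleRadius_iff hr, Thick]
  constructor
  · intro h x hx y hy z hz h1 h2 h3
    exact h x hx y hy z hz ⟨h1, h2, h3⟩
  · intro h x hx y hy z hz ⟨h1, h2, h3⟩
    exact h x hx y hy z hz h1 h2 h3

/-! ### Distances in thick links -/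

/-- On both sides of a point of a simple closed curve there are points at any small distance. -/
lemma exists_dist_eq_both_sides {γ : C(UnitAddCircle, Space)} (hγ : Function.Injective γ)
    (s₀ : UnitAddCircle) : ∃ δ₀ > 0, ∀ δ ∈ Ioo 0 δ₀, ∃ z₁ ∈ range γ, ∃ z₂ ∈ range γ,
      z₁ ≠ z₂ ∧ dist z₁ (γ s₀) = δ ∧ dist z₂ (γ s₀) = δ := by
  obtain ⟨s, -, rfl⟩ := exists_mem_Ico_coe_eq s₀
  have hinj : ∀ a b : ℝ, a ∈ Ico (s - 1 / 2) (s + 1 / 2) → b ∈ Ico (s - 1 / 2) (s + 1 / 2) →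
      γ (a : UnitAddCircle) = γ (b : UnitAddCircle) → a = b := by
    intro a b ha hb hab
    have e : s + 1 / 2 = s - 1 / 2 + 1 := by ring
    rw [e] at ha hb
    exact (AddCircle.coe_eq_coe_iff_of_mem_Ico ha hb).1 (hγ hab)
  have hper : ((s + 1 / 2 : ℝ) : UnitAddCircle) = ((s - 1 / 2 : ℝ) : UnitAddCircle) := by
    rw [show s + 1 / 2 = s - 1 / 2 + 1 by ring]; exact AddCircle.coe_add_period 1 _
  set F : ℝ → ℝ := fun t => dist (γ (t : UnitAddCircle)) (γ (s : UnitAddCircle)) with hF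
  have hFc : Continuous F := (γ.continuous.comp continuous_quotient_mk').dist continuous_const
  have hF0 : F s = 0 := dist_self _
  -- Both half circles from `s` end at the same antipodal point, so the distance takes all small
  -- values on each of them.
  have hFe : F (s + 1 / 2) = F (s - 1 / 2) := by simp only [hF, hper]
  have hpos : 0 < F (s - 1 / 2) := by
    refine dist_pos.2 fun h => ?_
    have := hinj (s - 1 / 2) s ⟨le_rfl, by linarith⟩ ⟨by linarith, by linarith⟩ h
    linarith
  refine ⟨F (s - 1 / 2), hpos, fun δ hδ => ?_⟩
  obtain ⟨t₁, ht₁, h1⟩ := intermediate_value_Icc' (show s - 1 / 2 ≤ s by linarith) hFc.continuousOn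
    (show δ ∈ Icc (F s) (F (s - 1 / 2)) from ⟨hF0.symm ▸ hδ.1.le, hδ.2.le⟩)
  obtain ⟨t₂, ht₂, h2⟩ := intermediate_value_Icc (show s ≤ s + 1 / 2 by linarith) hFc.continuousOn
    (show δ ∈ Icc (F s) (F (s + 1 / 2)) from ⟨hF0.symm ▸ hδ.1.le, hFe.symm ▸ hδ.2.le⟩)
  refine ⟨_, ⟨t₁, rfl⟩, _, ⟨t₂, rfl⟩, fun h => ?_, h1, h2⟩
  have h3 : t₂ ≠ s + 1 / 2 := fun h => by rw [h, hFe] at h2; linarith [hδ.2]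
  have h4 : t₁ = t₂ := hinj t₁ t₂ ⟨ht₁.1, by linarith [ht₁.2]⟩
    ⟨by linarith [ht₂.1], lt_of_le_of_ne ht₂.2 h3⟩ h
  have h5 : t₁ = s := le_antisymm ht₁.2 (h4 ▸ ht₂.1)
  rw [h5, hF0] at h1
  linarith [hδ.1]

/-- Points at equal distance from a point of a thick set are nearly opposite. -/
lemma Thick.norm_add_sq_le {r : ℝ} {X : Set Space} (h : Thick r X) {x z₁ z₂ : Space} (hx : x ∈ X)
    (h₁ : z₁ ∈ X) (h₂ : z₂ ∈ X) (hne : z₁ ≠ z₂) {δ : ℝ} (hδ : 0 < δ) (d₁ : dist z₁ x = δ)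
    (d₂ : dist z₂ x = δ) : r ^ 2 * ‖(z₁ - x) + (z₂ - x)‖ ^ 2 ≤ δ ^ 4 := by
  have hx1 : x ≠ z₁ := fun h => by rw [h, dist_self] at d₁; linarith
  have hx2 : z₂ ≠ x := fun h => by rw [h, dist_self] at d₂; linarith
  have := h x hx z₁ h₁ z₂ h₂ hx1 hne hx2
  rw [dist_eq_norm] at d₁ d₂
  have e : ‖z₁ - z₂‖ ^ 2 = 2 * δ ^ 2 - 2 * ⟪z₁ - x, z₂ - x⟫ := by
    rw [show z₁ - z₂ = (z₁ - x) - (z₂ - x) by abel, norm_sub_sq_real, d₁, d₂]; ring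
  have hpos : 0 < ‖z₁ - z₂‖ ^ 2 := by
    have := norm_pos_iff.2 (sub_ne_zero.2 hne); positivity
  rw [norm_add_sq_real, d₁, d₂]
  rw [d₁, d₂, e] at this
  rw [e] at hpos
  generalize ⟪z₁ - x, z₂ - x⟫ = s at *
  -- With two sides equal to `δ` and inner product `s`, the Gram determinant is `(δ² - s)(δ² + s)`
  -- and the third side squared is `2(δ² - s)`. The common factor is positive and cancels.
  have h2 : (δ ^ 2 - s) * (r ^ 2 * (δ ^ 2 + 2 * s + δ ^ 2)) ≤ (δ ^ 2 - s) * δ ^ 4 := by nlinarith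
  exact le_of_mul_le_mul_left h2 (by linarith)

/-- Let `x` be the point of the curve nearest to `y`, and let `z₁`, `z₂` be points of the curve at
distance `δ` from `x` on either side. They are nearly opposite as seen from `x`, and neither is
nearer to `y` than `x` is, so both directions are nearly perpendicular to `y - x`. As `δ` tends to
`0`, the thickness inequality for `x, z₁, y` becomes `2 r ≤ dist x y`. -/
lemma Thick.two_mul_le_dist {r : ℝ} (hr : 0 ≤ r) {X : Set Space} (h : Thick r X)
    {γ : C(UnitAddCircle, Space)} (hγ : Function.Injective γ) (hX : range γ ⊆ X) {y : Space}
    (hy : y ∈ X) (hy' : y ∉ range γ) (s : UnitAddCircle) : 2 * r ≤ dist (γ s) y := by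
  rcases hr.eq_or_lt with rfl | hr
  · simp
  obtain ⟨s₀, -, hs₀⟩ := isCompact_univ.exists_isMinOn univ_nonempty
    (by fun_prop : Continuous fun s => dist (γ s) y).continuousOn
  refine le_trans ?_ (hs₀ (mem_univ s))
  set x := γ s₀ with hx
  have hmin : ∀ z ∈ range γ, dist x y ≤ dist z y := by rintro _ ⟨t, rfl⟩; exact hs₀ (mem_univ t)
  set d := dist x y with hd
  have hd0 : 0 < d := dist_pos.2 fun h => hy' ⟨s₀, h⟩
  obtain ⟨δ₀, hδ₀, hδ⟩ := exists_dist_eq_both_sides hγ s₀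
  -- `C * δ ^ 2` bounds the inner products of `z₁ - x` and `z₂ - x` with `y - x`. Each is at most
  -- `δ² / 2` by minimality, and their sum is at least `-(d / r) δ²`.
  set C := d / r + 1 / 2 with hC
  have key : ∀ δ ∈ Ioo 0 δ₀, 4 * r ^ 2 * (d ^ 2 - C ^ 2 * δ ^ 2) ≤
      d ^ 2 * (δ ^ 2 + d ^ 2 + 2 * C * δ ^ 2) := by
    intro δ hδ'
    obtain ⟨z₁, h₁, z₂, h₂, hne, d₁, d₂⟩ := hδ δ hδ'
    have hδ0 := hδ'.1
    have hadd := h.norm_add_sq_le (hX ⟨s₀, rfl⟩) (hX h₁) (hX h₂) hne hδ0 d₁ d₂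
    rw [← hx] at hadd d₁ d₂
    have hadd' : ‖(z₁ - x) + (z₂ - x)‖ ≤ δ ^ 2 / r := by
      rw [le_div_iff₀ hr]
      refine (pow_le_pow_iff_left₀ (by positivity) (by positivity) two_ne_zero).1 ?_
      nlinarith
    have hxy : x ≠ y := fun h => by rw [hd, h, dist_self] at hd0; exact lt_irrefl _ hd0
    have hx1 : x ≠ z₁ := fun h => by rw [h, dist_self] at d₁; linarith
    have hz1y : z₁ ≠ y := fun h => hy' (h ▸ h₁)
    have ht := h x (hX ⟨s₀, rfl⟩) z₁ (hX h₁) y hy hx1 hz1y hxy.symm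
    have m₁ := hmin z₁ h₁
    have m₂ := hmin z₂ h₂
    rw [dist_eq_norm] at d₁ d₂ m₁ m₂
    have hde : ‖y - x‖ = d := by rw [hd, dist_comm, dist_eq_norm]
    have e₁ : ‖z₁ - y‖ ^ 2 = δ ^ 2 - 2 * ⟪z₁ - x, y - x⟫ + d ^ 2 := by
      rw [← hde, ← d₁, ← norm_sub_sq_real]; congr 2; abel
    have e₂ : ‖z₂ - y‖ ^ 2 = δ ^ 2 - 2 * ⟪z₂ - x, y - x⟫ + d ^ 2 := by
      rw [← hde, ← d₂, ← norm_sub_sq_real]; congr 2; abel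
    have hs : -(δ ^ 2 / r * d) ≤ ⟪z₁ - x, y - x⟫ + ⟪z₂ - x, y - x⟫ := by
      rw [← inner_add_left]
      have h3 := abs_le.1 (abs_real_inner_le_norm ((z₁ - x) + (z₂ - x)) (y - x))
      have h4 : ‖(z₁ - x) + (z₂ - x)‖ * ‖y - x‖ ≤ δ ^ 2 / r * d := by rw [hde]; gcongr
      linarith [h3.1]
    have m₁' : d ^ 2 ≤ ‖z₁ - y‖ ^ 2 := by gcongr
    have m₂' : d ^ 2 ≤ ‖z₂ - y‖ ^ 2 := by gcongr
    rw [e₁] at m₁' ht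
    rw [e₂] at m₂'
    rw [d₁, hde] at ht
    generalize ⟪z₁ - x, y - x⟫ = p at *
    generalize ⟪z₂ - x, y - x⟫ = q at *
    have hCδ : C * δ ^ 2 = δ ^ 2 / r * d + δ ^ 2 / 2 := by rw [hC]; ring
    have hC0 : 0 ≤ C := by positivity
    have hp1 : -(C * δ ^ 2) ≤ p := by linarith
    have hp2 : p ≤ C * δ ^ 2 := by
      have : 0 ≤ δ ^ 2 / r * d := by positivity
      linarith
    have hp3 : p ^ 2 ≤ (C * δ ^ 2) ^ 2 := sq_le_sq' hp1 hp2
    have h5 : δ ^ 2 * (4 * r ^ 2 * (d ^ 2 - C ^ 2 * δ ^ 2)) ≤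
        δ ^ 2 * (d ^ 2 * (δ ^ 2 + d ^ 2 + 2 * C * δ ^ 2)) := by
      have h6 : 4 * r ^ 2 * p ^ 2 ≤ 4 * r ^ 2 * (C * δ ^ 2) ^ 2 := by gcongr
      have h7 : δ ^ 2 * d ^ 2 * (δ ^ 2 - 2 * p + d ^ 2) ≤
          δ ^ 2 * d ^ 2 * (δ ^ 2 + 2 * (C * δ ^ 2) + d ^ 2) := by gcongr; linarith
      linarith
    exact le_of_mul_le_mul_left h5 (by positivity)
  have hlim : 4 * r ^ 2 * (d ^ 2 - C ^ 2 * 0 ^ 2) ≤ d ^ 2 * (0 ^ 2 + d ^ 2 + 2 * C * 0 ^ 2) := by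
    have c1 : Continuous fun δ : ℝ => 4 * r ^ 2 * (d ^ 2 - C ^ 2 * δ ^ 2) := by fun_prop
    have c2 : Continuous fun δ : ℝ => d ^ 2 * (δ ^ 2 + d ^ 2 + 2 * C * δ ^ 2) := by fun_prop
    refine le_of_tendsto_of_tendsto (b := 𝓝[>] 0) (c1.tendsto 0 |>.mono_left nhdsWithin_le_nhds)
      (c2.tendsto 0 |>.mono_left nhdsWithin_le_nhds) ?_
    filter_upwards [Ioo_mem_nhdsGT hδ₀] with δ hδ using key δ hδ
  refine (pow_le_pow_iff_left₀ (by positivity) hd0.le two_ne_zero).1 ?_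
  have : d ^ 2 * (2 * r) ^ 2 ≤ d ^ 2 * d ^ 2 := by nlinarith
  exact le_of_mul_le_mul_left this (by positivity)

/-- A simple closed curve has finite thickness. -/
lemma exists_not_thick {γ : C(UnitAddCircle, Space)} (hγ : Function.Injective γ) {X : Set Space}
    (hX : range γ ⊆ X) : ∃ r > 0, ¬ Thick r X := by
  by_contra! hcon
  -- At the point farthest from the origin, infinite thickness makes two neighbors at equal distance
  -- exactly opposite. By the parallelogram law one of them is still farther from the origin.
  obtain ⟨s₀, -, hs₀⟩ := isCompact_univ.exists_isMaxOn univ_nonempty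
    (by fun_prop : Continuous fun s => ‖γ s‖).continuousOn
  obtain ⟨δ₀, hδ₀, hδ⟩ := exists_dist_eq_both_sides hγ s₀
  obtain ⟨z₁, ⟨t₁, rfl⟩, z₂, ⟨t₂, rfl⟩, hne, d₁, d₂⟩ := hδ (δ₀ / 2) ⟨by linarith, by linarith⟩
  set δ := δ₀ / 2
  have hδ0 : 0 < δ := by positivity
  set w := (γ t₁ - γ s₀) + (γ t₂ - γ s₀)
  have hw : ‖w‖ ^ 2 = 0 := by
    by_contra hne0
    have hpos : 0 < ‖w‖ ^ 2 := lt_of_le_of_ne (by positivity) (Ne.symm hne0)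
    have := (hcon ((δ ^ 4 + 1) / ‖w‖ ^ 2 + 1) (by positivity)).norm_add_sq_le (hX ⟨s₀, rfl⟩)
      (hX ⟨t₁, rfl⟩) (hX ⟨t₂, rfl⟩) hne hδ0 d₁ d₂
    have h1 : (δ ^ 4 + 1) / ‖w‖ ^ 2 * ‖w‖ ^ 2 = δ ^ 4 + 1 := div_mul_cancel₀ _ hne0
    have h2 : 0 ≤ (δ ^ 4 + 1) / ‖w‖ ^ 2 := by positivity
    have h3 : (δ ^ 4 + 1) / ‖w‖ ^ 2 * ‖w‖ ^ 2 ≤ ((δ ^ 4 + 1) / ‖w‖ ^ 2 + 1) ^ 2 * ‖w‖ ^ 2 := by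
      gcongr; nlinarith
    linarith
  have hw0 : w = 0 := by simpa using hw
  have m₁ : ‖γ t₁‖ ≤ ‖γ s₀‖ := hs₀ (mem_univ t₁)
  have m₂ : ‖γ t₂‖ ≤ ‖γ s₀‖ := hs₀ (mem_univ t₂)
  have e1 : γ t₁ = γ s₀ + (γ t₁ - γ s₀) := by abel
  have e2 : γ t₂ = γ s₀ - (γ t₁ - γ s₀) := by
    have : γ t₂ = w + γ s₀ - (γ t₁ - γ s₀) := by simp only [w]; abel
    rw [this, hw0]; abel
  have p := parallelogram_law_with_norm ℝ (γ s₀) (γ t₁ - γ s₀)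
  rw [← e1, ← e2, ← dist_eq_norm (γ t₁), d₁] at p
  nlinarith [norm_nonneg (γ t₁), norm_nonneg (γ t₂), norm_nonneg (γ s₀)]

/-! ### Radial homeomorphisms and cones -/

section Radial
variable {E : Type*} [NormedAddCommGroup E] [NormedSpace ℝ E] [ProperSpace E]

/-- The map that rescales every vector so that it gets the norm `N x`. -/
def radialMap (N : E → ℝ) (x : E) : E := (N x / ‖x‖) • x

lemma norm_radialMap {N : E → ℝ} (h0 : N 0 = 0) (hN : ∀ x, 0 ≤ N x) (x : E) :
    ‖radialMap N x‖ = N x := by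
  rcases eq_or_ne x 0 with rfl | hx
  · simp [radialMap, h0]
  · rw [radialMap, norm_smul, Real.norm_eq_abs, abs_div, abs_norm, abs_of_nonneg (hN x),
      div_mul_cancel₀ _ (norm_ne_zero_iff.2 hx)]

lemma continuous_radialMap {N : E → ℝ} (hc : Continuous N) (h0 : N 0 = 0) (hN : ∀ x, 0 ≤ N x) :
    Continuous (radialMap N) := by
  refine continuous_iff_continuousAt.2 fun x => ?_
  rcases eq_or_ne x 0 with rfl | hx
  · have h1 : radialMap N 0 = 0 := by simp [radialMap]
    rw [ContinuousAt, h1, tendsto_zero_iff_norm_tendsto_zero]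
    simp_rw [norm_radialMap h0 hN]
    simpa [h0] using hc.tendsto 0
  · unfold radialMap
    exact (hc.continuousAt.div continuous_norm.continuousAt (norm_ne_zero_iff.2 hx)).smul
      continuousAt_id

/-- Strict growth of `N` along each ray gives injectivity, and continuity with linear growth gives
surjectivity on the ray. The lower bound `δ * ‖x‖` also makes the map proper, hence closed, so that
its inverse is continuous. -/
lemma exists_homeomorph_radialMap {N : E → ℝ} (hc : Continuous N) {δ : ℝ} (hδ : 0 < δ) (h0 : N 0 = 0)
    (hN : ∀ x, δ * ‖x‖ ≤ N x) (hmono : ∀ x, x ≠ 0 → ∀ t ∈ Ico (0 : ℝ) 1, N (t • x) < N x) :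
    ∃ h : E ≃ₜ E, ⇑h = radialMap N := by
  have hN0 : ∀ x, 0 ≤ N x := fun x => le_trans (by positivity) (hN x)
  have hcont := continuous_radialMap hc h0 hN0
  have hpos : ∀ x, x ≠ 0 → 0 < N x := fun x hx =>
    lt_of_lt_of_le (mul_pos hδ (norm_pos_iff.2 hx)) (hN x)
  have hinj : Function.Injective (radialMap N) := by
    intro x y hxy
    have hn : N x = N y := by rw [← norm_radialMap h0 hN0 x, hxy, norm_radialMap h0 hN0]
    rcases eq_or_ne x 0 with rfl | hx
    · by_contra hy
      have := hpos y (Ne.symm hy)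
      linarith
    rcases eq_or_ne y 0 with rfl | hy
    · have := hpos x hx
      linarith
    have hx' := norm_pos_iff.2 hx
    have hy' := norm_pos_iff.2 hy
    have e : y = (‖y‖ / ‖x‖) • x := by
      unfold radialMap at hxy
      rw [hn] at hxy
      have h1 : (‖y‖ / N y) • ((N y / ‖x‖) • x) = (‖y‖ / N y) • ((N y / ‖y‖) • y) := by rw [hxy]
      have h2 := (hpos y hy).ne'
      rw [smul_smul, smul_smul] at h1
      rw [show ‖y‖ / N y * (N y / ‖y‖) = 1 by field_simp, one_smul] at h1
      exact h1.symm.trans (by congr 1; field_simp)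
    rcases lt_trichotomy ‖y‖ ‖x‖ with h | h | h
    · have := hmono x hx (‖y‖ / ‖x‖) ⟨by positivity, (div_lt_one hx').2 h⟩
      rw [← e] at this; linarith
    · rw [e, h, div_self hx'.ne', one_smul]
    · have e' : x = (‖x‖ / ‖y‖) • y := by
        nth_rewrite 2 [e]
        rw [smul_smul, div_mul_div_cancel₀ hy'.ne', div_self hx'.ne', one_smul]
      have := hmono y hy (‖x‖ / ‖y‖) ⟨by positivity, (div_lt_one hy').2 h⟩
      rw [← e'] at this; linarith
  have hsurj : Function.Surjective (radialMap N) := by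
    intro y
    rcases eq_or_ne y 0 with rfl | hy
    · exact ⟨0, by simp [radialMap]⟩
    have hy' := norm_pos_iff.2 hy
    have h1 : ContinuousOn (fun t : ℝ => N (t • y)) (Icc 0 (1 / δ)) := by fun_prop
    have h2 : ‖y‖ ∈ Icc (N ((0 : ℝ) • y)) (N ((1 / δ) • y)) := by
      constructor
      · rw [zero_smul, h0]; exact hy'.le
      · refine le_trans (le_of_eq ?_) (hN _)
        rw [norm_smul, Real.norm_eq_abs, abs_of_pos (by positivity)]; field_simp
    obtain ⟨t, ht, htN⟩ := intermediate_value_Icc (by positivity) h1 h2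
    have ht0 : t ≠ 0 := fun h => by
      simp only [h, zero_smul, h0] at htN; linarith
    have htp : 0 < t := lt_of_le_of_ne ht.1 (Ne.symm ht0)
    refine ⟨t • y, ?_⟩
    simp only at htN
    rw [radialMap, htN, norm_smul, Real.norm_eq_abs, abs_of_pos htp, smul_smul]
    rw [show ‖y‖ / (t * ‖y‖) * t = 1 by field_simp, one_smul]
  have hproper : IsProperMap (radialMap N) := by
    rw [isProperMap_iff_tendsto_cocompact]
    refine ⟨hcont, ?_⟩
    rw [← Metric.cobounded_eq_cocompact, ← tendsto_norm_atTop_iff_cobounded]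
    refine tendsto_atTop_mono (f := fun x => δ * ‖x‖) (fun x => ?_)
      (tendsto_norm_cobounded_atTop.const_mul_atTop hδ)
    rw [norm_radialMap h0 hN0]; exact hN x
  exact ⟨(Equiv.ofBijective _ ⟨hinj, hsurj⟩).toHomeomorphOfContinuousClosed hcont
    hproper.isClosedMap, rfl⟩

end Radial

/-- A compact set that is star-shaped about a point splits from every closed set disjoint from
it. -/
lemma isSplit_of_star {K J C : Set Space} {p : Space} (hC : IsCompact C) (hp : p ∈ C)
    (hstar : ∀ x ∈ C, ∀ t ∈ Icc (0 : ℝ) 1, p + t • (x - p) ∈ C) (hKC : K ⊆ C) (hJ : IsClosed J)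
    (hCJ : Disjoint C J) : IsSplit K J := by
  obtain ⟨R, hR⟩ := isBounded_iff_forall_norm_le.1 hC.isBounded
  obtain ⟨η, hη, hηd⟩ := exists_pos_forall_lt_edist hC hJ hCJ
  have hη' : (0 : ℝ) < η := by exact_mod_cast hη
  set S := |R| + ‖p‖ + 1
  have hS : 0 < S := by positivity
  set d : Space → ℝ := fun x => infDist (x + p) C with hd
  have hdc : Continuous d := (continuous_infDist_pt C).comp (by fun_prop)
  have hne : C.Nonempty := ⟨p, hp⟩
  -- On `C`, centered at `p`, only the term with the norm is present and it is below `1`; on `J` the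
  -- distance term alone is at least `2`. Star-shapedness gives `d (t • x) ≤ t * d x`, so `N` grows
  -- strictly along rays.
  set N : Space → ℝ := fun x => 1 / (2 * S) * ‖x‖ + 2 / η * d x with hNdef
  have hd0 : d 0 = 0 := by simp only [hd, zero_add]; exact infDist_zero_of_mem hp
  have hdt : ∀ x, ∀ t ∈ Icc (0 : ℝ) 1, d (t • x) ≤ t * d x := by
    intro x t ht
    obtain ⟨y, hy, hyd⟩ := hC.exists_infDist_eq_dist hne (x + p)
    simp only [hd]
    rw [hyd]
    refine (infDist_le_dist_of_mem (hstar y hy t ht)).trans (le_of_eq ?_)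
    rw [dist_eq_norm, dist_eq_norm, show t • x + p - (p + t • (y - p)) = t • (x + p - y) by
      simp only [smul_sub, smul_add]; abel, norm_smul, Real.norm_eq_abs, abs_of_nonneg ht.1]
  have hdn : ∀ x, 0 ≤ d x := fun x => infDist_nonneg
  obtain ⟨h, hh⟩ := exists_homeomorph_radialMap (N := N) (by fun_prop) (δ := 1 / (2 * S))
    (by positivity) (by simp [hNdef, hd0]) (fun x => by
      have := hdn x
      simp only [hNdef]; linarith [show 0 ≤ 2 / (η : ℝ) * d x by positivity]) (fun x hx t ht => by
      have h1 := hdt x t ⟨ht.1, ht.2.le⟩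
      have h2 := norm_pos_iff.2 hx
      have h3 := hdn x
      simp only [hNdef, norm_smul, Real.norm_eq_abs, abs_of_nonneg ht.1]
      have h4 : 2 / (η : ℝ) * d (t • x) ≤ 2 / η * d x := by
        gcongr; nlinarith [ht.2]
      have h5 : 1 / (2 * S) * (t * ‖x‖) < 1 / (2 * S) * ‖x‖ := by
        gcongr; nlinarith [ht.2]
      linarith)
  have hnorm : ∀ x, ‖h x‖ = N x := fun x => by
    rw [hh]
    refine norm_radialMap (by simp [hNdef, hd0]) (fun x => ?_) x
    have := hdn x
    simp only [hNdef]; positivity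
  refine ⟨(Homeomorph.addRight (-p)).trans h, ?_, ?_⟩
  · rintro _ ⟨x, hx, rfl⟩
    rw [mem_ball_zero_iff, Homeomorph.trans_apply, hnorm]
    simp only [hNdef, hd, Homeomorph.coe_addRight, neg_add_cancel_right]
    rw [infDist_zero_of_mem (hKC hx), mul_zero, add_zero, one_div, inv_mul_lt_iff₀ (by positivity)]
    have h1 := hR x (hKC hx)
    have h2 := norm_add_le x (-p)
    rw [norm_neg] at h2
    have := le_abs_self R
    simp only [S]
    have := abs_nonneg R
    have := norm_nonneg p
    linarith
  · rw [Set.disjoint_left]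
    rintro _ ⟨x, hx, rfl⟩ hmem
    rw [mem_closedBall_zero_iff, Homeomorph.trans_apply, hnorm] at hmem
    simp only [hNdef, hd, Homeomorph.coe_addRight, neg_add_cancel_right] at hmem
    obtain ⟨y, hy, hyd⟩ := hC.exists_infDist_eq_dist hne x
    have h1 := hηd y hy x hx
    rw [edist_dist, dist_comm, ← ENNReal.ofReal_coe_nnreal, ENNReal.ofReal_lt_ofReal_iff_of_nonneg hη'.le] at h1
    rw [hyd] at hmem
    have h2 : 2 / (η : ℝ) * η ≤ 2 / η * dist x y := by gcongr
    rw [div_mul_cancel₀ _ hη'.ne'] at h2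
    have : 0 ≤ 1 / (2 * S) * ‖x + -p‖ := by positivity
    linarith

/-- A set linked to a closed curve meets every cone over this curve. -/
lemma TopologicallyLinked.exists_mem_cone {γ : C(UnitAddCircle, Space)} {J : Set Space}
    (h : TopologicallyLinked (range γ) J) (hJ : IsClosed J) (p : Space) :
    ∃ s, ∃ t ∈ Icc (0 : ℝ) 1, p + t • (γ s - p) ∈ J := by
  by_contra! hcon
  refine h (isSplit_of_star (p := p)
    (C := (fun q : UnitAddCircle × ℝ => p + q.2 • (γ q.1 - p)) '' (univ ×ˢ Icc 0 1)) ?_ ?_ ?_ ?_ hJ ?_)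
  · exact (isCompact_univ.prod isCompact_Icc).image (by fun_prop)
  · exact ⟨(0, 0), by simp, by simp⟩
  · rintro _ ⟨⟨s, t⟩, ⟨-, ht⟩, rfl⟩ u hu
    refine ⟨(s, u * t), ⟨trivial, mul_nonneg hu.1 ht.1, mul_le_one₀ hu.2 ht.1 ht.2⟩, ?_⟩
    simp [mul_smul]
  · rintro _ ⟨s, rfl⟩
    exact ⟨(s, 1), by simp, by simp⟩
  · rw [Set.disjoint_left]
    rintro _ ⟨⟨s, t⟩, ⟨-, ht⟩, rfl⟩ hmem
    exact hcon s t ht hmem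

/-! ### Developing a polygonal cone into the plane -/

section Sector

lemma sin_smul_uvec (a b θ : ℝ) :
    sin (b - a) • uvec θ = sin (b - θ) • uvec a + sin (θ - a) • uvec b := by
  have h1 := sin_sq_add_cos_sq a
  have h2 := sin_sq_add_cos_sq b
  apply plane_ext <;> simp [sin_sub] <;> ring

/-- The angle of a nonnegative combination of two directions lies between theirs. -/
lemma exists_angle_of_combination {a b ρ θ s t : ℝ} (hab : a < b) (hab' : b < a + π) (hρ : 0 < ρ)
    (hs : 0 ≤ s) (ht : 0 ≤ t) (h : ρ • uvec θ = s • uvec a + t • uvec b) :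
    ∃ k : ℤ, θ + k * (2 * π) ∈ Icc a b := by
  have hc : ∀ c, ρ * sin (c - θ) = s * sin (c - a) + t * sin (c - b) := fun c => by
    have := congrArg (fun w => ⟪w, uperp (c + π)⟫) h
    simp only [inner_add_left, inner_smul_left, conj_trivial, plane_inner, uvec_zero', uvec_one',
      uperp_zero', uperp_one', sin_add_pi, cos_add_pi] at this
    rw [sin_sub, sin_sub, sin_sub]
    linarith
  obtain ⟨k, hk, -⟩ := existsUnique_add_zsmul_mem_Ico (show (0 : ℝ) < 2 * π by positivity) θ a
  have hsin : sin (θ + k * (2 * π) - a) = sin (θ - a) := by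
    rw [show θ + k * (2 * π) - a = θ - a + k * (2 * π) by ring, sin_add_int_mul_two_pi]
  have hsin' : sin (b - (θ + k * (2 * π))) = sin (b - θ) := by
    rw [show b - (θ + k * (2 * π)) = b - θ - k * (2 * π) by ring, sin_sub_int_mul_two_pi]
  rw [zsmul_eq_mul] at hk
  set θ' := θ + k * (2 * π)
  have hba : 0 < sin (b - a) := sin_pos_of_pos_of_lt_pi (by linarith) (by linarith)
  have h1 : 0 ≤ sin (θ' - a) := by
    have := hc a
    rw [sub_self, sin_zero, mul_zero, zero_add, ← neg_sub θ a, ← neg_sub b a, sin_neg, sin_neg] at this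
    rw [hsin]
    have : 0 ≤ ρ * sin (θ - a) := by
      have := mul_nonneg ht hba.le
      linarith
    exact nonneg_of_mul_nonneg_right this hρ
  have h2 : 0 ≤ sin (b - θ') := by
    have := hc b
    rw [sub_self, sin_zero, mul_zero, add_zero] at this
    rw [hsin']
    have : 0 ≤ ρ * sin (b - θ) := by
      have := mul_nonneg hs hba.le
      linarith
    exact nonneg_of_mul_nonneg_right this hρ
  have h3 : θ' - a ≤ π := by
    by_contra! hlt
    have := sin_neg_of_neg_of_neg_pi_lt (x := θ' - a - 2 * π) (by linarith [hk.2]) (by linarith)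
    rw [sin_sub_two_pi] at this
    linarith
  refine ⟨k, hk.1, ?_⟩
  by_contra! hlt
  have := sin_neg_of_neg_of_neg_pi_lt (x := b - θ') (by linarith) (by linarith)
  linarith

end Sector

section Develop
variable {N : ℕ} {φ r : ℕ → ℝ}

/-- A ray that starts inside a star-shaped polygon around the origin meets the polygon. -/
lemma exists_mem_ray_mem_edge (hN : 0 < N) (hφ : ∀ j < N, φ j < φ (j + 1))
    (hφ' : ∀ j < N, φ (j + 1) < φ j + π) (h0 : φ 0 = 0) (hφN : φ N = 2 * π) (hr : ∀ j ≤ N, 0 < r j)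
    (hrN : r N = r 0) {Y : Plane}
    (hY : ∃ j < N, ∃ α β : ℝ, 0 ≤ α ∧ 0 ≤ β ∧ α + β ≤ 1 ∧
      Y = α • r j • uvec (φ j) + β • r (j + 1) • uvec (φ (j + 1))) (u : Plane) (hu : ‖u‖ = 1) :
    ∃ τ : ℝ, 0 ≤ τ ∧ ∃ l < N, ∃ α β : ℝ, 0 ≤ α ∧ 0 ≤ β ∧ α + β = 1 ∧
      Y + τ • u = α • r l • uvec (φ l) + β • r (l + 1) • uvec (φ (l + 1)) := by
  set w : ℕ → Plane := fun j => r j • uvec (φ j) with hw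
  -- `A` consists of the triangles from the origin to the edges, `B` of the parts of the same
  -- sectors beyond the edges. Both are closed and together they cover the plane. The ray is
  -- connected, starts in `A` and leaves `A`, so it meets `A ∩ B`; such points lie on the polygon.
  set A : Set Plane := ⋃ j ∈ Finset.range N, (fun q : ℝ × ℝ => q.1 • w j + q.2 • w (j + 1)) ''
    {q | 0 ≤ q.1 ∧ 0 ≤ q.2 ∧ q.1 + q.2 ≤ 1}
  set B : Set Plane := ⋃ j ∈ Finset.range N, {z | ∃ α β : ℝ, 0 ≤ α ∧ 0 ≤ β ∧ 1 ≤ α + β ∧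
    z = α • w j + β • w (j + 1)}
  have hmono : ∀ i j, i ≤ j → j ≤ N → φ i ≤ φ j := by
    intro i j hij
    induction j, hij using Nat.le_induction with
    | base => intro; exact le_rfl
    | succ j hj ih => intro h; exact (ih (by omega)).trans (hφ j (by omega)).le
  have hsmono : ∀ i j, i < j → j ≤ N → φ i < φ j := fun i j hij hj =>
    (hφ i (by omega)).trans_le (hmono _ _ hij hj)
  have hcoef : ∀ j < N, ∀ z : Plane, ∃ α β : ℝ, z = α • w j + β • w (j + 1) := by
    intro j hj z
    obtain ⟨θ, hθ⟩ := exists_eq_smul_uvec z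
    have hs : sin (φ (j + 1) - φ j) ≠ 0 :=
      (sin_pos_of_pos_of_lt_pi (by linarith [hφ j hj]) (by linarith [hφ' j hj])).ne'
    have h1 := (hr j (by omega)).ne'
    have h2 := (hr (j + 1) (by omega)).ne'
    refine ⟨‖z‖ * sin (φ (j + 1) - θ) / (sin (φ (j + 1) - φ j) * r j),
      ‖z‖ * sin (θ - φ j) / (sin (φ (j + 1) - φ j) * r (j + 1)), ?_⟩
    have h3 := sin_smul_uvec (φ j) (φ (j + 1)) θ
    have h4 : uvec θ = (sin (φ (j + 1) - φ j))⁻¹ •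
        (sin (φ (j + 1) - θ) • uvec (φ j) + sin (θ - φ j) • uvec (φ (j + 1))) := by
      rw [← h3, smul_smul, inv_mul_cancel₀ hs, one_smul]
    conv_lhs => rw [hθ, h4]
    simp only [hw, smul_add, smul_smul]
    congr 2 <;> field_simp
  have hAc : IsClosed A := by
    refine (Finset.range N).finite_toSet.isClosed_biUnion fun j _ => IsCompact.isClosed ?_
    refine IsCompact.image ?_ (show Continuous fun q : ℝ × ℝ =>
      q.1 • w j + q.2 • w (j + 1) by fun_prop)
    refine Metric.isCompact_of_isClosed_isBounded ?_ ?_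
    · exact (isClosed_le continuous_const continuous_fst).inter
        ((isClosed_le continuous_const continuous_snd).inter
          (isClosed_le (continuous_fst.add continuous_snd) continuous_const))
    · refine (isCompact_Icc (a := ((0 : ℝ), (0 : ℝ))) (b := (1, 1))).isBounded.subset ?_
      rintro ⟨a, b⟩ ⟨h1, h2, h3⟩
      simp only at h1 h2 h3
      exact ⟨⟨h1, h2⟩, ⟨by linarith, by linarith⟩⟩
  have hAb : Bornology.IsBounded A := by
    refine (Bornology.isBounded_biUnion_finset _).2 fun j _ => ?_
    refine isBounded_iff_forall_norm_le.2 ⟨‖w j‖ + ‖w (j + 1)‖, ?_⟩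
    rintro _ ⟨⟨a, b⟩, ⟨h1, h2, h3⟩, rfl⟩
    simp only at h1 h2 h3 ⊢
    refine (norm_add_le _ _).trans ?_
    rw [norm_smul a (w j), norm_smul b (w (j + 1)), Real.norm_eq_abs, Real.norm_eq_abs,
      abs_of_nonneg h1, abs_of_nonneg h2]
    exact add_le_add (mul_le_of_le_one_left (norm_nonneg _) (by linarith))
      (mul_le_of_le_one_left (norm_nonneg _) (by linarith))
  have hBc : IsClosed B := by
    refine (Finset.range N).finite_toSet.isClosed_biUnion fun j hj => ?_
    have hj' : j < N := Finset.mem_range.1 (by simpa using hj)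
    have hs : 0 < sin (φ (j + 1) - φ j) :=
      sin_pos_of_pos_of_lt_pi (by linarith [hφ j hj']) (by linarith [hφ' j hj'])
    have h1 := hr j (by omega)
    have h2 := hr (j + 1) (by omega)
    set D := sin (φ (j + 1) - φ j)
    set fa : Plane → ℝ := fun z => -⟪z, uperp (φ (j + 1))⟫ / (D * r j)
    set fb : Plane → ℝ := fun z => ⟪z, uperp (φ j)⟫ / (D * r (j + 1))
    have hz : ∀ α β : ℝ, fa (α • w j + β • w (j + 1)) = α ∧ fb (α • w j + β • w (j + 1)) = β := by
      intro α β
      have e1 : ⟪uvec (φ j), uperp (φ (j + 1))⟫ = -D := by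
        rw [real_inner_comm, inner_uperp_uvec, ← sin_neg, neg_sub]
      have e2 : ⟪uvec (φ (j + 1)), uperp (φ j)⟫ = D := by rw [real_inner_comm, inner_uperp_uvec]
      have e3 : ∀ x, ⟪uvec x, uperp x⟫ = 0 := fun x => by
        rw [real_inner_comm, inner_uperp_uvec, sub_self, sin_zero]
      simp only [fa, fb, hw, inner_add_left, inner_smul_left, conj_trivial, e1, e2, e3]
      constructor <;> field_simp <;> ring
    have : {z | ∃ α β : ℝ, 0 ≤ α ∧ 0 ≤ β ∧ 1 ≤ α + β ∧ z = α • w j + β • w (j + 1)} =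
        {z | 0 ≤ fa z} ∩ ({z | 0 ≤ fb z} ∩ {z | 1 ≤ fa z + fb z}) := by
      ext z
      constructor
      · rintro ⟨α, β, hα, hβ, hab, rfl⟩
        simp only [mem_inter_iff, mem_ofPred_eq, (hz α β).1, (hz α β).2]
        exact ⟨hα, hβ, hab⟩
      · rintro ⟨h1, h2, h3⟩
        obtain ⟨α, β, rfl⟩ := hcoef j hj' z
        simp only [mem_ofPred_eq, (hz α β).1, (hz α β).2] at h1 h2 h3
        exact ⟨α, β, h1, h2, h3, rfl⟩
    rw [this]
    have c1 : Continuous fa := by fun_prop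
    have c2 : Continuous fb := by fun_prop
    exact (isClosed_le continuous_const c1).inter ((isClosed_le continuous_const c2).inter
      (isClosed_le continuous_const (c1.add c2)))
  have hcov : ∀ z, z ∈ A ∪ B := by
    intro z
    obtain ⟨θ₀, hθ₀⟩ := exists_eq_smul_uvec z
    obtain ⟨θ, hθ, hθz⟩ : ∃ θ ∈ Ico 0 (2 * π), z = ‖z‖ • uvec θ := by
      obtain ⟨k, hk, -⟩ := existsUnique_add_zsmul_mem_Ico (show (0 : ℝ) < 2 * π by positivity) θ₀ 0
      rw [zero_add] at hk
      refine ⟨_, hk, ?_⟩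
      conv_lhs => rw [hθ₀]
      congr 1
      apply plane_ext
      · simp only [uvec_zero', zsmul_eq_mul, cos_add_int_mul_two_pi]
      · simp only [uvec_one', zsmul_eq_mul, sin_add_int_mul_two_pi]
    obtain ⟨j, hj, hj1, hj2⟩ : ∃ j < N, φ j ≤ θ ∧ θ < φ (j + 1) := by
      have hex : ∃ j, θ < φ (j + 1) ∨ N ≤ j := ⟨N, Or.inr le_rfl⟩
      classical
      set j := Nat.find hex
      have hjs := Nat.find_spec hex
      have hmin : ∀ i < j, φ (i + 1) ≤ θ ∧ i < N := fun i hi => by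
        have := Nat.find_min hex hi
        push Not at this; exact this
      have hjN : j < N := by
        by_contra! hge
        have := (hmin (N - 1) (by omega)).1
        rw [Nat.sub_add_cancel hN, hφN] at this
        linarith [hθ.2]
      refine ⟨j, hjN, ?_, hjs.resolve_right (by omega)⟩
      rcases j.eq_zero_or_pos with h | h
      · rw [h, h0]; exact hθ.1
      · have := (hmin (j - 1) (by omega)).1
        rwa [Nat.sub_add_cancel h] at this
    have hs : 0 < sin (φ (j + 1) - φ j) :=
      sin_pos_of_pos_of_lt_pi (by linarith [hφ j hj]) (by linarith [hφ' j hj])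
    have h1 := hr j (by omega)
    have h2 := hr (j + 1) (by omega)
    have h4 : uvec θ = (sin (φ (j + 1) - φ j))⁻¹ •
        (sin (φ (j + 1) - θ) • uvec (φ j) + sin (θ - φ j) • uvec (φ (j + 1))) := by
      rw [← sin_smul_uvec, smul_smul, inv_mul_cancel₀ hs.ne', one_smul]
    have s1 : 0 ≤ sin (φ (j + 1) - θ) := sin_nonneg_of_nonneg_of_le_pi (by linarith)
      (by linarith [hφ' j hj])
    have s2 : 0 ≤ sin (θ - φ j) := sin_nonneg_of_nonneg_of_le_pi (by linarith)
      (by linarith [hφ' j hj])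
    set α := ‖z‖ * sin (φ (j + 1) - θ) / (sin (φ (j + 1) - φ j) * r j)
    set β := ‖z‖ * sin (θ - φ j) / (sin (φ (j + 1) - φ j) * r (j + 1))
    have hα : 0 ≤ α := by positivity
    have hβ : 0 ≤ β := by positivity
    have hz : z = α • w j + β • w (j + 1) := by
      conv_lhs => rw [hθz, h4]
      simp only [hw, smul_add, smul_smul, α, β]
      congr 2 <;> field_simp
    rcases le_total (α + β) 1 with h | h
    · exact Or.inl (mem_biUnion (Finset.mem_coe.2 (Finset.mem_range.2 hj))
        ⟨(α, β), ⟨hα, hβ, h⟩, hz.symm⟩)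
    · exact Or.inr (mem_biUnion (Finset.mem_coe.2 (Finset.mem_range.2 hj)) ⟨α, β, hα, hβ, h, hz⟩)
  have hray : IsPreconnected ((fun τ : ℝ => Y + τ • u) '' Ici 0) :=
    isPreconnected_Ici.image _ (by fun_prop)
  have hYA : Y ∈ A := by
    obtain ⟨j, hj, α, β, hα, hβ, hab, rfl⟩ := hY
    exact mem_biUnion (Finset.mem_coe.2 (Finset.mem_range.2 hj)) ⟨(α, β), ⟨hα, hβ, hab⟩, rfl⟩
  obtain ⟨R, hR⟩ := isBounded_iff_forall_norm_le.1 hAb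
  have hfar : Y + (|R| + ‖Y‖ + 1) • u ∉ A := fun h => by
    have h1 := hR _ h
    have h2 := norm_sub_le (Y + (|R| + ‖Y‖ + 1) • u) Y
    rw [add_sub_cancel_left, norm_smul, hu, mul_one, Real.norm_eq_abs,
      abs_of_pos (by positivity)] at h2
    linarith [le_abs_self R]
  obtain ⟨_, ⟨τ, hτ, rfl⟩, hzA, hzB⟩ := isPreconnected_closed_iff.1 hray A B hAc hBc
    (fun z _ => hcov z) ⟨Y, ⟨0, by simp, by simp⟩, hYA⟩
    ⟨_, ⟨|R| + ‖Y‖ + 1, by simp only [mem_Ici]; positivity, rfl⟩, (hcov _).resolve_left hfar⟩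
  refine ⟨τ, hτ, ?_⟩
  simp only at hzA hzB
  set z := Y + τ • u
  obtain ⟨j, hj, ⟨α, β⟩, ⟨hα, hβ, hαβ⟩, hzj⟩ := mem_iUnion₂.1 hzA
  obtain ⟨l, hl, α', β', hα', hβ', hαβ', hzl⟩ := mem_iUnion₂.1 hzB
  simp only at hα hβ hαβ hzj
  have hj' : j < N := Finset.mem_range.1 hj
  have hl' : l < N := Finset.mem_range.1 hl
  have cross : ∀ i < N, ∀ a b : ℝ, ⟪a • w i + b • w (i + 1), uperp (φ i)⟫ =
        b * r (i + 1) * sin (φ (i + 1) - φ i) ∧ ⟪a • w i + b • w (i + 1), uperp (φ (i + 1))⟫ =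
        -(a * r i * sin (φ (i + 1) - φ i)) := by
    intro i _ a b
    have hi : ∀ x y, ⟪uvec x, uperp y⟫ = sin (x - y) := fun x y => by
      rw [real_inner_comm, inner_uperp_uvec]
    simp only [hw, inner_add_left, inner_smul_left, conj_trivial, hi, sub_self, sin_zero]
    rw [show φ i - φ (i + 1) = -(φ (i + 1) - φ i) by ring, sin_neg]
    constructor <;> ring
  have hspos : ∀ i < N, 0 < sin (φ (i + 1) - φ i) := fun i hi =>
    sin_pos_of_pos_of_lt_pi (by linarith [hφ i hi]) (by linarith [hφ' i hi])
  have hz0 : z ≠ 0 := by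
    intro h
    have h1 := (cross l hl' α' β').1
    have h2 := (cross l hl' α' β').2
    rw [← hzl, h, inner_zero_left] at h1 h2
    have p1 := hspos l hl'
    have p2 := hr l (by omega)
    have p3 := hr (l + 1) (by omega)
    have b0 : β' = 0 := by
      by_contra hne
      have : β' * r (l + 1) * sin (φ (l + 1) - φ l) ≠ 0 := by positivity
      exact this h1.symm
    have a0 : α' = 0 := by
      by_contra hne
      have : α' * r l * sin (φ (l + 1) - φ l) ≠ 0 := by positivity
      exact this (neg_eq_zero.1 h2.symm)
    linarith
  obtain ⟨θ, hθ⟩ := exists_eq_smul_uvec z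
  have hzn := norm_pos_iff.2 hz0
  have a1 := hr j (by omega)
  have a2 := hr (j + 1) (by omega)
  have a3 := hr l (by omega)
  have a4 := hr (l + 1) (by omega)
  obtain ⟨k₁, hk₁⟩ := exists_angle_of_combination (hφ j hj') (hφ' j hj') hzn (θ := θ)
    (mul_nonneg hα a1.le) (mul_nonneg hβ a2.le) (by rw [← hθ, ← hzj, mul_smul, mul_smul])
  obtain ⟨k₂, hk₂⟩ := exists_angle_of_combination (hφ l hl') (hφ' l hl') hzn (θ := θ)
    (mul_nonneg hα' a3.le) (mul_nonneg hβ' a4.le) (by rw [← hθ, hzl, mul_smul, mul_smul])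
  have hcoefeq : ∀ i < N, ∀ a b a' b' : ℝ, a • w i + b • w (i + 1) = a' • w i + b' • w (i + 1) →
      a = a' ∧ b = b' := by
    intro i hi a b a' b' h
    have p1 := hspos i hi
    have p2 := hr i (by omega)
    have p3 := hr (i + 1) (by omega)
    have h1 := (cross i hi a b).1.symm.trans ((congrArg (fun v => ⟪v, uperp (φ i)⟫) h).trans
      (cross i hi a' b').1)
    have h2 := (cross i hi a b).2.symm.trans ((congrArg (fun v => ⟪v, uperp (φ (i + 1))⟫) h).trans
      (cross i hi a' b').2)
    constructor
    · have : (a - a') * (r i * sin (φ (i + 1) - φ i)) = 0 := by linear_combination -h2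
      rcases mul_eq_zero.1 this with h | h
      · linarith
      · exact absurd h (by positivity)
    · have : (b - b') * (r (i + 1) * sin (φ (i + 1) - φ i)) = 0 := by linear_combination h1
      rcases mul_eq_zero.1 this with h | h
      · linarith
      · exact absurd h (by positivity)
  rcases eq_or_ne j l with rfl | hjl
  · obtain ⟨rfl, rfl⟩ := hcoefeq j hj' α β α' β' (hzj.trans hzl)
    exact ⟨j, hj', α, β, hα, hβ, le_antisymm hαβ hαβ', hzj.symm⟩
  -- The point may be in `A` by one sector and in `B` by another. Two different sectors share a
  -- direction only if they are adjacent, or if they are the first and the last one. In both cases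
  -- it is the direction of a common vertex, with a single radius.
  have key : ∀ i l, i < l → l < N → ∀ θ₁ ∈ Icc (φ i) (φ (i + 1)), ∀ θ₂ ∈ Icc (φ l) (φ (l + 1)),
      ∀ k : ℤ, θ₂ = θ₁ + k * (2 * π) → ∃ m m', (m = i ∨ m = i + 1) ∧ θ₁ = φ m ∧
        (m' = l ∨ m' = l + 1) ∧ θ₂ = φ m' ∧ r m = r m' := by
    intro i l hil hlN θ₁ h1 θ₂ h2 k hk
    have e1 := hmono (i + 1) l (by omega) (by omega)
    have e2 := hmono 0 i (by omega) (by omega)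
    have e3 := hmono (l + 1) N (by omega) (by omega)
    have hπ := pi_pos
    have hk0 : 0 ≤ k := by
      by_contra! hlt
      have : (k : ℝ) ≤ -1 := by exact_mod_cast Int.le_sub_one_of_lt hlt
      nlinarith [h1.2, h2.1]
    rcases hk0.eq_or_lt with rfl | hk1
    · simp only [Int.cast_zero, zero_mul, add_zero] at hk
      have : l = i + 1 := by
        by_contra hne
        have := hsmono (i + 1) l (by omega) (by omega)
        linarith [h1.2, h2.1]
      subst this
      have := le_antisymm h1.2 (hk ▸ h2.1)
      exact ⟨i + 1, i + 1, Or.inr rfl, this, Or.inl rfl, hk.trans this, rfl⟩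
    · have hk1' : (1 : ℝ) ≤ k := by exact_mod_cast hk1
      have : 2 * π ≤ k * (2 * π) := le_mul_of_one_le_left (by positivity) hk1'
      have i0 : i = 0 := by
        by_contra hne
        have := hsmono 0 i (by omega) (by omega)
        linarith [h1.1, h2.2]
      have l0 : l + 1 = N := by
        by_contra hne
        have := hsmono (l + 1) N (by omega) le_rfl
        linarith [h1.1, h2.2]
      refine ⟨i, l + 1, Or.inl rfl, ?_, Or.inr rfl, ?_, by rw [i0, l0, hrN]⟩
      · rw [i0] at h1 ⊢; linarith [h1.1, h2.2]
      · rw [l0] at h2 ⊢; linarith [h1.1, h2.2]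
  obtain ⟨m, m', hm, hθ₁, hm', hθ₂, hrm⟩ : ∃ m m', (m = j ∨ m = j + 1) ∧ θ + k₁ * (2 * π) = φ m ∧
      (m' = l ∨ m' = l + 1) ∧ θ + k₂ * (2 * π) = φ m' ∧ r m = r m' := by
    rcases hjl.lt_or_gt with h | h
    · exact key j l h hl' _ hk₁ _ hk₂ (k₂ - k₁) (by push_cast; ring)
    · obtain ⟨m, m', h1, h2, h3, h4, h5⟩ := key l j h hj' _ hk₂ _ hk₁ (k₁ - k₂)
        (by push_cast; ring)
      exact ⟨m', m, h3, h4, h1, h2, h5.symm⟩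
  have hrot : ∀ k : ℤ, uvec (θ + k * (2 * π)) = uvec θ := fun k => by
    apply plane_ext
    · simp only [uvec_zero', cos_add_int_mul_two_pi]
    · simp only [uvec_one', sin_add_int_mul_two_pi]
  have hvert : ∀ i < N, ∀ m, (m = i ∨ m = i + 1) → ∀ a b : ℝ, z = a • w i + b • w (i + 1) →
      (uvec (φ m) = uvec θ) → (a + b) * r m = ‖z‖ := by
    intro i hi m hm a b hz hu
    have p2 := (hr i (by omega)).ne'
    have p3 := (hr (i + 1) (by omega)).ne'
    rcases hm with rfl | rfl
    · obtain ⟨rfl, rfl⟩ := hcoefeq m hi a b (‖z‖ / r m) 0 (by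
        rw [← hz, zero_smul, add_zero, hw, smul_smul, div_mul_cancel₀ _ p2, hu, ← hθ])
      rw [add_zero, div_mul_cancel₀ _ p2]
    · obtain ⟨rfl, rfl⟩ := hcoefeq i hi a b 0 (‖z‖ / r (i + 1)) (by
        rw [← hz, zero_smul, zero_add, hw, smul_smul, div_mul_cancel₀ _ p3, hu, ← hθ])
      rw [zero_add, div_mul_cancel₀ _ p3]
  have hum : uvec (φ m) = uvec θ := by rw [← hθ₁, hrot]
  -- In the shared vertex direction, `A` gives `‖z‖ ≤ r m` and `B` gives `‖z‖ ≥ r m`, so the point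
  -- is the vertex.
  have v1 := hvert j hj' m hm α β hzj.symm hum
  have v2 := hvert l hl' m' hm' α' β' hzl (by rw [← hθ₂, hrot])
  have hmN : m ≤ N := by omega
  have hm0 := hr m hmN
  rw [← hrm] at v2
  have hzr : ‖z‖ = r m := by
    apply le_antisymm <;> nlinarith
  have hzm : z = w m := by rw [hθ, hzr, ← hum]
  rcases hmN.lt_or_eq with h | h
  · exact ⟨m, h, 1, 0, zero_le_one, le_rfl, by ring, by rw [hzm, one_smul, zero_smul, add_zero]⟩
  · refine ⟨N - 1, by omega, 0, 1, le_rfl, zero_le_one, by ring, ?_⟩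
    rw [Nat.sub_add_cancel hN, hzm, one_smul, zero_smul, zero_add, h]

lemma inner_combination_le {E F : Type*} [NormedAddCommGroup E] [InnerProductSpace ℝ E]
    [NormedAddCommGroup F] [InnerProductSpace ℝ F] {a b c d : E} {a' b' c' d' : F}
    (h1 : ⟪a, c⟫ ≤ ⟪a', c'⟫) (h2 : ⟪a, d⟫ ≤ ⟪a', d'⟫) (h3 : ⟪b, c⟫ ≤ ⟪b', c'⟫)
    (h4 : ⟪b, d⟫ ≤ ⟪b', d'⟫) {s t x y : ℝ} (hs : 0 ≤ s) (ht : 0 ≤ t) (hx : 0 ≤ x) (hy : 0 ≤ y) :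
    ⟪s • a + t • b, x • c + y • d⟫ ≤ ⟪s • a' + t • b', x • c' + y • d'⟫ := by
  simp only [inner_add_left, inner_add_right, inner_smul_left, inner_smul_right, conj_trivial]
  gcongr

lemma norm_combination_eq {E F : Type*} [NormedAddCommGroup E] [InnerProductSpace ℝ E]
    [NormedAddCommGroup F] [InnerProductSpace ℝ F] {a b : E} {a' b' : F} (ha : ‖a‖ = ‖a'‖)
    (hb : ‖b‖ = ‖b'‖) (hab : ⟪a, b⟫ = ⟪a', b'⟫) (s t : ℝ) :
    ‖s • a + t • b‖ = ‖s • a' + t • b'‖ := by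
  rw [← sq_eq_sq₀ (norm_nonneg _) (norm_nonneg _), norm_add_sq_real, norm_add_sq_real]
  simp only [norm_smul, inner_smul_left, inner_smul_right, ha, hb, hab]

lemma dist_le_dist_of_inner_le {E F : Type*} [NormedAddCommGroup E] [InnerProductSpace ℝ E]
    [NormedAddCommGroup F] [InnerProductSpace ℝ F] {x y : E} {x' y' : F} (hx : ‖x‖ = ‖x'‖)
    (hy : ‖y‖ = ‖y'‖) (h : ⟪x, y⟫ ≤ ⟪x', y'⟫) : dist x' y' ≤ dist x y := by
  rw [dist_eq_norm, dist_eq_norm, ← sq_le_sq₀ (norm_nonneg _) (norm_nonneg _), norm_sub_sq_real,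
    norm_sub_sq_real, hx, hy]
  linarith

/-- A polygon of total angle `2π` around the origin is developed into the plane, without
shortening any distance in the cone over it. -/
lemma exists_hullPerim_le_of_angle_sum {q : ℕ → Space} (hN : 0 < N) (hq : q N = q 0)
    (hq0 : ∀ j ≤ N, q j ≠ 0) (hpos : ∀ j < N, 0 < angle (q j) (q (j + 1)))
    (hlt : ∀ j < N, angle (q j) (q (j + 1)) < π)
    (hsum : ∑ j ∈ Finset.range N, angle (q j) (q (j + 1)) = 2 * π) {ι : Type*} [Finite ι]
    [Nonempty ι] {ρ : ℝ} (y : ι → Space)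
    (hy : ∀ i, ∃ j < N, ∃ α β : ℝ, 0 ≤ α ∧ 0 ≤ β ∧ α + β ≤ 1 ∧ y i = α • q j + β • q (j + 1))
    (hfar : ∀ i, ∀ l < N, ∀ α β : ℝ, 0 ≤ α → 0 ≤ β → α + β = 1 →
      ρ ≤ dist (y i) (α • q l + β • q (l + 1)))
    (hsep : Pairwise fun i k => ρ ≤ dist (y i) (y k)) :
    ∃ c : ι → Plane, (Pairwise fun i k => ρ ≤ dist (c i) (c k)) ∧
      2 * π * ρ + hullPerim c ≤ ∑ j ∈ Finset.range N, dist (q j) (q (j + 1)) := by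
  set φ : ℕ → ℝ := fun j => ∑ i ∈ Finset.range j, angle (q i) (q (i + 1)) with hφ
  have hφs : ∀ j, φ (j + 1) = φ j + angle (q j) (q (j + 1)) := fun j => Finset.sum_range_succ _ _
  have hφ0 : φ 0 = 0 := Finset.sum_range_zero _
  -- The developed polygon has the same radii and the same successive angles, so every single
  -- triangle of the cone is carried over isometrically.
  set w : ℕ → Plane := fun j => ‖q j‖ • uvec (φ j) with hw
  have hwn : ∀ j, ‖w j‖ = ‖q j‖ := fun j => by simp [hw, norm_smul]
  have hwi : ∀ a b, ⟪w a, w b⟫ = ‖q a‖ * ‖q b‖ * cos (φ b - φ a) := fun a b => by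
    simp only [hw, inner_smul_left, inner_smul_right, conj_trivial, inner_uvec_uvec]
    rw [← cos_neg, neg_sub]; ring
  have hqi : ∀ a b, ⟪q a, q b⟫ = ‖q a‖ * ‖q b‖ * cos (angle (q a) (q b)) := fun a b => by
    rw [← cos_angle_mul_norm_mul_norm]; ring
  have hang : ∀ a b, a ≤ b → b ≤ N → angle (q a) (q b) ≤ φ b - φ a := by
    intro a b hab
    induction b, hab using Nat.le_induction with
    | base => intro ha; rw [angle_self (hq0 a ha), sub_self]
    | succ b _ ih =>
      intro hb
      rw [hφs]
      linarith [angle_le_angle_add_angle (q a) (q b) (q (b + 1)), ih (by omega)]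
  have hvv : ∀ a b, a ≤ b → b ≤ N → ⟪w a, w b⟫ ≤ ⟪q a, q b⟫ := by
    intro a b hab hb
    rw [hwi, hqi]
    refine mul_le_mul_of_nonneg_left ?_ (by positivity)
    have h1 := hang a b hab hb
    -- The angle in space is bounded by the developed angle on either way around, in particular by
    -- the smaller one. Hence inner products do not increase under development. Points of the cone
    -- are nonnegative combinations of vertices, so their distances do not decrease.
    have h2 : angle (q a) (q b) ≤ 2 * π - (φ b - φ a) := by
      have e1 := hang 0 a (Nat.zero_le _) (by omega)
      have e2 := hang b N hb le_rfl
      rw [hq] at e2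
      rw [show φ N = 2 * π from hsum] at e2
      rw [hφ0] at e1
      have := angle_le_angle_add_angle (q a) (q 0) (q b)
      rw [angle_comm (q a) (q 0), angle_comm (q 0) (q b)] at this
      linarith
    have h0 := angle_nonneg (q a) (q b)
    rcases le_total (φ b - φ a) π with h | h
    · exact cos_le_cos_of_nonneg_of_le_pi h0 h h1
    · rw [← cos_two_pi_sub (φ b - φ a)]
      exact cos_le_cos_of_nonneg_of_le_pi h0 (by linarith) h2
  have hvv' : ∀ a b, a ≤ N → b ≤ N → ⟪w a, w b⟫ ≤ ⟪q a, q b⟫ := by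
    intro a b ha hb
    rcases le_total a b with h | h
    · exact hvv a b h hb
    · rw [real_inner_comm, real_inner_comm (q b)]; exact hvv b a h ha
  have hnorm : ∀ j, ∀ α β : ℝ, ‖α • w j + β • w (j + 1)‖ = ‖α • q j + β • q (j + 1)‖ := fun j =>
    norm_combination_eq (hwn j) (hwn _) (by rw [hwi, hqi, hφs, add_sub_cancel_left])
  have hdist : ∀ j < N, ∀ l < N, ∀ α β α' β' : ℝ, 0 ≤ α → 0 ≤ β → 0 ≤ α' → 0 ≤ β' →
      dist (α • q j + β • q (j + 1)) (α' • q l + β' • q (l + 1)) ≤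
        dist (α • w j + β • w (j + 1)) (α' • w l + β' • w (l + 1)) := by
    intro j hj l hl α β α' β' h1 h2 h3 h4
    exact dist_le_dist_of_inner_le (hnorm _ _ _) (hnorm _ _ _)
      (inner_combination_le (hvv' _ _ (by omega) (by omega)) (hvv' _ _ (by omega) (by omega))
        (hvv' _ _ (by omega) (by omega)) (hvv' _ _ (by omega) (by omega)) h1 h2 h3 h4)
  choose j hj α β hα hβ hαβ hyi using hy
  refine ⟨fun i => α i • w (j i) + β i • w (j i + 1), fun i k hik => ?_, ?_⟩
  · refine (hsep hik).trans ?_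
    rw [hyi i, hyi k]
    exact hdist _ (hj i) _ (hj k) _ _ _ _ (hα i) (hβ i) (hα k) (hβ k)
  set c : ι → Plane := fun i => α i • w (j i) + β i • w (j i + 1) with hc
  have hwd : ∀ l, dist (w l) (w (l + 1)) = dist (q l) (q (l + 1)) := fun l => by
    have := hnorm l 1 (-1)
    simpa [dist_eq_norm, ← sub_eq_add_neg] using this
  have hwN : w N = w 0 := by
    simp only [hw, hq, hφ0, show φ N = 2 * π from hsum]
    congr 1
    simpa using uvec_add_two_pi 0
  have := integral_le_sum_dist w N hwN (h := fun θ => hullSupp c θ + ρ) (by fun_prop)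
    (fun θ => by simp [hullSupp_periodic c θ]) ?_
  · rw [intervalIntegral.integral_add ((continuous_hullSupp c).intervalIntegrable _ _)
      (continuous_const.intervalIntegrable _ _)] at this
    simp only [hwd] at this
    rw [hullPerim]
    simp only [intervalIntegral.integral_const, sub_zero, smul_eq_mul] at this
    linarith
  · intro θ
    obtain ⟨i, hi⟩ := exists_hullSupp_eq c θ
    -- The ray from the extreme point `c i` in the direction `θ` meets the developed polygon, at
    -- distance at least `ρ`. So the support function of the polygon exceeds that of the points by
    -- at least `ρ`, and integration adds `2πρ`.
    obtain ⟨τ, hτ, l, hl, a, b, ha, hb, hab, hX⟩ := exists_mem_ray_mem_edge (φ := φ)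
      (r := fun j => ‖q j‖) hN (fun j hj => by rw [hφs]; linarith [hpos j hj])
      (fun j hj => by rw [hφs]; linarith [hlt j hj]) hφ0 hsum (fun j hj => norm_pos_iff.2 (hq0 j hj))
      (by rw [hq]) (Y := c i) ⟨j i, hj i, α i, β i, hα i, hβ i, hαβ i, rfl⟩ (uvec θ) (norm_uvec θ)
    change c i + τ • uvec θ = a • w l + b • w (l + 1) at hX
    have hρ : ρ ≤ τ := by
      have h1 := hfar i l hl a b ha hb hab
      rw [hyi i] at h1
      have h2 := h1.trans (hdist _ (hj i) _ hl _ _ _ _ (hα i) (hβ i) ha hb)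
      rw [← hX] at h2
      change ρ ≤ dist (c i) _ at h2
      rwa [dist_self_add_right, norm_smul, norm_uvec, mul_one, Real.norm_of_nonneg hτ] at h2
    have h3 := congrArg (fun z => ⟪z, uvec θ⟫) hX
    simp only [inner_add_left, inner_smul_left, conj_trivial, real_inner_self_eq_norm_sq, norm_uvec,
      hi] at h3
    rcases le_total ⟪w l, uvec θ⟫ ⟪w (l + 1), uvec θ⟫ with h | h
    · have e1 := mul_le_mul_of_nonneg_left h ha
      have e2 : (a + b) * ⟪w (l + 1), uvec θ⟫ = ⟪w (l + 1), uvec θ⟫ := by rw [hab, one_mul]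
      exact ⟨l + 1, hl, by linarith⟩
    · have e1 := mul_le_mul_of_nonneg_left h hb
      have e2 : (a + b) * ⟪w l, uvec θ⟫ = ⟪w l, uvec θ⟫ := by rw [hab, one_mul]
      exact ⟨l, hl.le, by linarith⟩

end Develop

/-- As `v` is outside the span of `a` and `b`, the point `τ • v` is on no line through these two
distinct points. So it is collinear with neither direction, and the angle at it is neither `0` nor
`π`. -/
lemma angle_mem_Ioo_of_notMem_span {a b v : Space} (hab : a ≠ b)
    (hv : v ∉ Submodule.span ℝ {a, b}) {τ : ℝ} (hτ : τ ≠ 0) :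
    a - τ • v ≠ 0 ∧ b - τ • v ≠ 0 ∧ angle (a - τ • v) (b - τ • v) ∈ Ioo 0 π := by
  have key : ∀ x y z : ℝ, x * τ ≠ 0 → x • τ • v = y • a + z • b → False := fun x y z hx h => by
    refine hv (Submodule.mem_span_pair.2 ⟨(x * τ)⁻¹ * y, (x * τ)⁻¹ * z, ?_⟩)
    rw [mul_smul, mul_smul, ← smul_add, ← h, smul_smul x, smul_smul, inv_mul_cancel₀ hx, one_smul]
  have ha : a - τ • v ≠ 0 := fun h => key 1 1 0 (by simpa) (by
    rw [one_smul, one_smul, zero_smul, add_zero, sub_eq_zero.1 h])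
  have hb : b - τ • v ≠ 0 := fun h => key 1 0 1 (by simpa) (by
    rw [one_smul, one_smul, zero_smul, zero_add, sub_eq_zero.1 h])
  have hr : ∀ r : ℝ, b - τ • v ≠ r • (a - τ • v) := fun r h => by
    have h' : (1 - r) • τ • v = (-r) • a + (1 : ℝ) • b := by
      rw [sub_smul, one_smul, neg_smul, one_smul]
      rw [smul_sub, sub_eq_sub_iff_add_eq_add] at h
      rw [sub_eq_iff_eq_add, add_assoc, h]
      abel
    by_cases hr1 : r = 1
    · rw [hr1, one_smul, sub_left_inj] at h
      exact hab h.symm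
    · exact key _ _ _ (mul_ne_zero (sub_ne_zero.2 (Ne.symm hr1)) hτ) h'
  refine ⟨ha, hb, (angle_nonneg _ _).lt_of_ne fun h => ?_, (angle_le_pi _ _).lt_of_ne fun h => ?_⟩
  · obtain ⟨-, r, -, h⟩ := angle_eq_zero_iff.1 h.symm
    exact hr r h
  · obtain ⟨-, r, -, h⟩ := angle_eq_pi_iff.1 h
    exact hr r h

/-- A closed polygon that starts by running three times along one edge is seen under the total
angle `2π` from some point that is on no line through an edge. -/
lemma exists_angle_sum_eq_two_pi {Q : ℕ → Space} {M : ℕ} (hM : 3 ≤ M)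
    (hQ : ∀ j < M, Q j ≠ Q (j + 1)) (h2 : Q 2 = Q 0) (h3 : Q 3 = Q 1) :
    ∃ p, (∀ j ≤ M, Q j - p ≠ 0) ∧ (∀ j < M, angle (Q j - p) (Q (j + 1) - p) ∈ Ioo 0 π) ∧
      ∑ j ∈ Finset.range M, angle (Q j - p) (Q (j + 1) - p) = 2 * π := by
  -- The apex moves from this midpoint along a line that avoids the planes through `m` and the
  -- edges; such a direction exists because finitely many proper subspaces do not cover space. The
  -- total angle is continuous. Near `m` it is almost `3π` or more, from the tripled edge alone; far
  -- away it tends to `0`; so it takes the value `2π`.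
  set m := midpoint ℝ (Q 0) (Q 1)
  obtain ⟨v, hv⟩ : ∃ v, ∀ j < M, v ∉ Submodule.span ℝ {Q j - m, Q (j + 1) - m} := by
    by_contra! hcon
    obtain ⟨i, hi⟩ := Subspace.exists_eq_top_of_iUnion_eq_univ (k := ℝ) (E := Space)
      (p := fun j : Fin M => Submodule.span ℝ {Q j - m, Q (j + 1) - m}) (by
        refine eq_univ_of_forall fun v => ?_
        obtain ⟨j, hj, h⟩ := hcon v
        exact mem_iUnion.2 ⟨⟨j, hj⟩, h⟩)
    have h1 := finrank_span_le_card (R := ℝ) ({Q i - m, Q (i + 1) - m} : Set Space)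
    rw [hi, finrank_top, finrank_euclideanSpace_fin] at h1
    have h2 := Finset.card_le_two (a := Q i - m) (b := Q (i + 1) - m)
    simp only [toFinset_insert, toFinset_singleton] at h1
    omega
  have hQm : ∀ j < M, Q j - m ≠ Q (j + 1) - m := fun j hj h => hQ j hj (sub_left_injective h)
  have hang := fun j hj τ hτ => angle_mem_Ioo_of_notMem_span (hQm j hj) (hv j hj) (τ := τ) hτ
  set f : ℝ → ℝ := fun τ => ∑ j ∈ Finset.range M,
    angle (Q j - m - τ • v) (Q (j + 1) - m - τ • v) with hf
  have hcont : ContinuousOn f (Ioi 0) := by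
    refine continuousOn_finsetSum _ fun j hj τ hτ => ContinuousAt.continuousWithinAt ?_
    have := hang j (Finset.mem_range.1 hj) τ (ne_of_gt hτ)
    exact ContinuousAt.comp (f := fun τ : ℝ => (Q j - m - τ • v, Q (j + 1) - m - τ • v))
      (InnerProductGeometry.continuousAt_angle this.1 this.2.1)
      (Continuous.continuousAt (by fun_prop))
  have hv0 : v ≠ 0 := fun h => hv 0 (by omega) (h ▸ Submodule.zero_mem _)
  obtain ⟨τ₁, hτ₁, hf₁⟩ : ∃ τ > 0, 2 * π ≤ f τ := by
    set a := Q 0 - m with ha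
    have hb : Q 1 - m = -a := by
      simp only [ha, m, midpoint_eq_smul_add, invOf_eq_inv]
      module
    have ha0 : a ≠ 0 := fun h => hQm 0 (by omega) (by rw [← ha, zero_add, hb, h, neg_zero])
    have ht : Tendsto (fun τ : ℝ => angle (a - τ • v) (-a - τ • v)) (𝓝[>] 0) (𝓝 π) := by
      have : ContinuousAt (fun τ : ℝ => angle (a - τ • v) (-a - τ • v)) 0 :=
        ContinuousAt.comp (f := fun τ : ℝ => (a - τ • v, -a - τ • v))
          (InnerProductGeometry.continuousAt_angle (by simpa using ha0) (by simpa using ha0))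
          (Continuous.continuousAt (by fun_prop))
      have h := this.tendsto
      simp only [zero_smul, sub_zero, angle_self_neg_of_nonzero ha0] at h
      exact h.mono_left nhdsWithin_le_nhds
    obtain ⟨τ, hτ, hτ0⟩ := ((ht.eventually_const_lt (show 2 * π / 3 < π by linarith [pi_pos])).and
      self_mem_nhdsWithin).exists
    refine ⟨τ, hτ0, ?_⟩
    have : ∑ j ∈ Finset.range 3, angle (Q j - m - τ • v) (Q (j + 1) - m - τ • v) ≤ f τ :=
      Finset.sum_le_sum_of_subset_of_nonneg (by simpa using hM) fun _ _ _ => angle_nonneg _ _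
    refine le_trans ?_ this
    simp only [Finset.sum_range_succ, Finset.sum_range_zero, zero_add, Nat.reduceAdd, h2, h3, hb,
      ← ha]
    rw [angle_comm (-a - τ • v)]
    linarith
  obtain ⟨τ₂, hτ₂, hf₂⟩ : ∃ τ > τ₁, f τ ≤ 2 * π := by
    have ht : Tendsto f atTop (𝓝 (∑ j ∈ Finset.range M, 0)) := by
      refine tendsto_finsetSum _ fun j _ => ?_
      -- Scaling by `s = τ⁻¹` does not change angles and replaces the limit at infinity by
      -- continuity at `s = 0`, where both directions become `-v`.
      have h1 : ContinuousAt (fun s : ℝ => angle (s • (Q j - m) - v) (s • (Q (j + 1) - m) - v)) 0 :=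
        ContinuousAt.comp (f := fun s : ℝ => (s • (Q j - m) - v, s • (Q (j + 1) - m) - v))
          (InnerProductGeometry.continuousAt_angle (by simpa using hv0) (by simpa using hv0))
          (Continuous.continuousAt (by fun_prop))
      have h := h1.tendsto
      simp only [zero_smul, zero_sub, angle_self (neg_ne_zero.2 hv0)] at h
      refine (h.comp tendsto_inv_atTop_zero).congr' ?_
      filter_upwards [eventually_gt_atTop 0] with τ hτ
      have h2 : ∀ x : Space, τ⁻¹ • x - v = τ⁻¹ • (x - τ • v) := fun x => by
        rw [smul_sub, smul_smul, inv_mul_cancel₀ hτ.ne', one_smul]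
      simp only [Function.comp, h2]
      rw [angle_smul_left_of_pos _ _ (inv_pos.2 hτ), angle_smul_right_of_pos _ _ (inv_pos.2 hτ)]
    rw [Finset.sum_const_zero] at ht
    obtain ⟨τ, hτ, hτ0⟩ := ((ht.eventually_lt_const (show (0 : ℝ) < 2 * π by positivity)).and
      (eventually_gt_atTop τ₁)).exists
    exact ⟨τ, hτ0, hτ.le⟩
  obtain ⟨τ, hτ, hfτ⟩ := intermediate_value_Icc' (le_of_lt hτ₂)
    (hcont.mono fun x hx => lt_of_lt_of_le hτ₁ hx.1) ⟨hf₂, hf₁⟩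
  have hτ0 : τ ≠ 0 := (lt_of_lt_of_le hτ₁ hτ.1).ne'
  have hsub : ∀ j, Q j - (m + τ • v) = Q j - m - τ • v := fun j => by abel
  refine ⟨m + τ • v, fun j hj => ?_, fun j hj => ?_, ?_⟩
  · rw [hsub]
    rcases hj.lt_or_eq with h | rfl
    · exact (hang j h τ hτ0).1
    · obtain ⟨j, rfl⟩ := Nat.exists_eq_add_one.2 (show 0 < j by omega)
      exact (hang j (by omega) τ hτ0).2.1
  · rw [hsub, hsub]; exact (hang j hj τ hτ0).2.2
  · simp only [hsub]; exact hfτ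
lemma gridPt_ne_succ {N : ℕ} (hN : 2 ≤ N) (i : ℕ) : gridPt N i ≠ gridPt N (i + 1) := by
  intro h
  have hN' : (2 : ℝ) ≤ N := by exact_mod_cast hN
  have h1 : (((1 / N : ℝ)) : UnitAddCircle) = 0 := by
    have : (1 / N : ℝ) = ((i + 1 : ℕ) / N : ℝ) - i / N := by push_cast; ring
    rw [this, AddCircle.coe_sub]
    exact sub_eq_zero.2 h.symm
  obtain ⟨k, hk⟩ := AddCircle.coe_eq_zero_iff (p := (1 : ℝ)).1 h1
  rw [zsmul_eq_mul, mul_one, eq_div_iff (by positivity)] at hk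
  have hk' : k * (N : ℤ) = 1 := by exact_mod_cast hk
  have := Int.isUnit_iff.1 (IsUnit.of_mul_eq_one_right _ hk')
  omega

lemma hullPerim_nonneg {ι : Type*} [Finite ι] [Nonempty ι] (c : ι → Plane) : 0 ≤ hullPerim c := by
  obtain ⟨i⟩ := ‹Nonempty ι›
  have h : ∫ θ in (0 : ℝ)..(2 * π), ⟪c i, uvec θ⟫ = 0 := by
    simp only [inner_uvec]
    rw [intervalIntegral.integral_add (Continuous.intervalIntegrable (by fun_prop) _ _)
      (Continuous.intervalIntegrable (by fun_prop) _ _)]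
    simp
  rw [← h]
  exact intervalIntegral.integral_mono_on (by positivity)
    (Continuous.intervalIntegrable (by fun_prop) _ _)
    ((continuous_hullSupp c).intervalIntegrable _ _) fun θ _ => inner_le_hullSupp c θ i

lemma hullPerim_smul {ι : Type*} [Finite ι] [Nonempty ι] {r : ℝ} (hr : 0 ≤ r) (c : ι → Plane) :
    hullPerim (fun i => r • c i) = r * hullPerim c := by
  rw [hullPerim, hullPerim, ← intervalIntegral.integral_const_mul]
  congr 1
  ext θ
  simp only [hullSupp, inner_smul_left, conj_trivial]
  exact (Real.mul_iSup_of_nonneg hr _).symm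

/-- The cone over a fine inscribed polygon, from an apex with total angle `2π`, is developed into
the plane. Each `J i` has a point on the cone over `γ`, and a move of at most `ε` brings it to the
polygonal cone. Therefore the distances `2` become `2 - 2 * ε`. The two additional runs along one
edge lengthen the polygon by at most `2 * ε`. -/
lemma exists_hullPerim_add_le {n : ℕ} [NeZero n] {γ : C(UnitAddCircle, Space)}
    (hγ : Function.Injective γ) (hfin : curveLength γ ≠ ∞) {J : Fin n → Set Space}
    (hJ : ∀ i, IsClosed (J i)) (hlink : ∀ i, TopologicallyLinked (range γ) (J i))
    (hfar : ∀ s i, ∀ y ∈ J i, 2 ≤ dist (γ s) y)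
    (hsep : ∀ i k, i ≠ k → ∀ y ∈ J i, ∀ z ∈ J k, 2 ≤ dist y z) {ε : ℝ} (hε : 0 < ε) :
    ∃ c : Fin n → Plane, (Pairwise fun i k => 2 - 2 * ε ≤ dist (c i) (c k)) ∧
      2 * π * (2 - 2 * ε) + hullPerim c ≤ (curveLength γ).toReal + 2 * ε := by
  obtain ⟨N₀, hN₀, hgrid⟩ := exists_gridPt_dist_lt γ hε
  set N := N₀ + 2
  obtain ⟨hcell, hclose⟩ := hgrid N (by omega)
  have hN : (0 : ℝ) < N := by positivity
  set g : ℕ → Space := fun i => γ (gridPt N i) with hg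
  have hgd : ∀ i, dist (g i) (g (i + 1)) < ε := fun i =>
    (hclose i (i / N) ⟨le_rfl, by gcongr; linarith⟩).2
  have hgne : ∀ i < N, g i ≠ g (i + 1) := fun i _ h => gridPt_ne_succ (by omega) i (hγ h)
  -- The polygon `g 0, g 1, g 0, g 1, g 2, …`: the edges are those of `g` shifted by two, after a
  -- run forth and back along the edge `g 0 g 1`.
  set Q : ℕ → Space := fun j => if j = 0 then g 0 else if j = 1 then g 1 else g (j - 2) with hQ
  have hQs : ∀ j, Q (j + 2) = g j := fun j => by simp [hQ]
  have hQ0 : Q 0 = g 0 := rfl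
  have hQ1 : Q 1 = g 1 := rfl
  have hQγ : ∀ j, ∃ s, Q j = γ s := fun j => by
    simp only [hQ]
    split_ifs
    exacts [⟨_, rfl⟩, ⟨_, rfl⟩, ⟨_, rfl⟩]
  have hQd : ∀ j, dist (Q j) (Q (j + 1)) < ε := by
    rintro (_ | _ | j)
    · rw [hQ0, hQ1]; exact hgd 0
    · rw [hQs 0, dist_comm]; exact hgd 0
    · rw [hQs, show j + 2 + 1 = j + 1 + 2 by ring, hQs]; exact hgd j
  obtain ⟨p, hp0, hpang, hpsum⟩ := exists_angle_sum_eq_two_pi (Q := Q) (M := N + 2) (by omega)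
    (by
      rintro (_ | _ | j) hj
      · exact hgne 0 (by omega)
      · rw [hQs 0]; exact (hgne 0 (by omega)).symm
      · rw [hQs, show j + 2 + 1 = j + 1 + 2 by ring, hQs]; exact hgne j (by omega))
    (hQs 0) (hQs 1)
  choose s t ht hst using fun i => (hlink i).exists_mem_cone (hJ i) p
  choose j hj x hx hxs using fun i => hcell (s i)
  -- The point of `J i` on the segment from `p` to `γ (s i)` is moved to the segment from `p` to a
  -- neighboring vertex, so it lies on the edge of a triangle of the cone.
  set y : Fin n → Space := fun i => t i • (g (j i) - p) with hy
  have hyd : ∀ i, dist (p + y i) (p + t i • (γ (s i) - p)) ≤ ε := by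
    intro i
    rw [dist_add_left, hy, dist_eq_norm, ← smul_sub, sub_sub_sub_cancel_right, norm_smul,
      Real.norm_of_nonneg (ht i).1, ← dist_eq_norm, dist_comm, ← hxs i]
    exact (mul_le_of_le_one_left dist_nonneg (ht i).2).trans (hclose _ _ (hx i)).1.le
  obtain ⟨c, hc, hcl⟩ := exists_hullPerim_le_of_angle_sum (q := fun j => Q j - p) (N := N + 2)
    (by omega) (by rw [hQs, hQ0, hg]; simp only [gridPt_self (show 0 < N by omega)]) hp0
    (fun j hj => (hpang j hj).1) (fun j hj => (hpang j hj).2) hpsum (ρ := 2 - 2 * ε) y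
    (fun i => ⟨j i + 2, by have := hj i; omega, t i, 0, (ht i).1, le_rfl, by linarith [(ht i).2],
      by rw [hQs, zero_smul, add_zero]⟩)
    (fun i l hl α β hα hβ hαβ => by
      obtain ⟨s', hs'⟩ := hQγ l
      have h1 := hfar s' i _ (hst i)
      rw [← hs'] at h1
      have h2 : dist (Q l) (p + (α • (Q l - p) + β • (Q (l + 1) - p))) ≤ ε := by
        rw [show p + (α • (Q l - p) + β • (Q (l + 1) - p)) = Q l + β • (Q (l + 1) - Q l) by
          rw [show α = 1 - β by linarith]; module, dist_self_add_right, norm_smul,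
          Real.norm_of_nonneg hβ, ← dist_eq_norm, dist_comm]
        exact (mul_le_of_le_one_left dist_nonneg (by linarith)).trans (hQd l).le
      rw [← dist_add_left p]
      have h3 := dist_triangle4 (Q l) (p + (α • (Q l - p) + β • (Q (l + 1) - p))) (p + y i)
        (p + t i • (γ (s i) - p))
      rw [dist_comm _ (p + y i)] at h3
      linarith [hyd i])
    (fun i k hik => by
      have h1 := hsep i k hik _ (hst i) _ (hst k)
      have h3 := dist_triangle4 (p + t i • (γ (s i) - p)) (p + y i) (p + y k)
        (p + t k • (γ (s k) - p))
      rw [dist_comm _ (p + y i)] at h3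
      rw [dist_add_left p (y i) (y k)] at h3
      linarith [hyd i, hyd k])
  refine ⟨c, hc, hcl.trans ?_⟩
  simp only [dist_sub_right]
  rw [Finset.sum_range_succ', Finset.sum_range_succ']
  have h1 : ∑ j ∈ Finset.range N, dist (Q (j + 1 + 1)) (Q (j + 1 + 1 + 1)) ≤
      (curveLength γ).toReal := by
    rw [← ENNReal.ofReal_le_iff_le_toReal hfin]
    refine le_trans (le_of_eq ?_) (sum_dist_gridPt_le_curveLength γ N)
    congr 1
  have h2 := hQd 0
  have h3 := hQd 1
  simp only [zero_add] at h2 h3 ⊢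
  linarith

/-- A curve that keeps distance `2` from `n` closed sets linked to it, which keep distance `2` from
each other, has length at least `2π + P_n`. -/
lemma ofReal_add_peri_le_curveLength {n : ℕ} [NeZero n] {γ : C(UnitAddCircle, Space)}
    (hγ : Function.Injective γ) {J : Fin n → Set Space}
    (hJ : ∀ i, IsClosed (J i)) (hlink : ∀ i, TopologicallyLinked (range γ) (J i))
    (hfar : ∀ s i, ∀ y ∈ J i, 2 ≤ dist (γ s) y)
    (hsep : ∀ i k, i ≠ k → ∀ y ∈ J i, ∀ z ∈ J k, 2 ≤ dist y z) :
    ENNReal.ofReal (2 * π) + peri n ≤ curveLength γ := by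
  by_cases hfin : curveLength γ = ∞
  · rw [hfin]; exact le_top
  set ℓ := (curveLength γ).toReal
  -- Scaling by `(1 - ε)⁻¹` restores the mutual distance `2`, so that `peri_le` applies. In the
  -- limit `4π + hullPerim c` splits into `2π` and the perimeter `2π + hullPerim c` of the hull of
  -- disks.
  have key : ∀ ε ∈ Ioo (0 : ℝ) (1 / 2), ENNReal.ofReal (2 * π) + peri n ≤
      ENNReal.ofReal ((ℓ + 2 * ε) / (1 - ε)) := by
    intro ε hε
    obtain ⟨c, hc, hcl⟩ := exists_hullPerim_add_le hγ hfin hJ hlink hfar hsep hε.1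
    have h1 : 0 < 1 - ε := by linarith [hε.2]
    have h2 := peri_le (fun i => (1 - ε)⁻¹ • c i) (fun i k hik => by
      have := hc hik
      change 2 ≤ dist ((1 - ε)⁻¹ • c i) ((1 - ε)⁻¹ • c k)
      rw [dist_smul₀, Real.norm_of_nonneg (inv_pos.2 h1).le, ← div_eq_inv_mul, le_div_iff₀ h1]
      linarith)
    rw [hullPerim_smul (inv_pos.2 h1).le] at h2
    have hP : 0 ≤ 2 * π + (1 - ε)⁻¹ * hullPerim c := by
      have := hullPerim_nonneg c
      positivity
    refine (add_le_add_right h2 _).trans ?_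
    rw [← ENNReal.ofReal_add (by positivity) hP]
    refine ENNReal.ofReal_le_ofReal ?_
    rw [le_div_iff₀ h1]
    have : (1 - ε)⁻¹ * hullPerim c * (1 - ε) = hullPerim c := by field_simp
    linarith
  have ht : Tendsto (fun ε : ℝ => ENNReal.ofReal ((ℓ + 2 * ε) / (1 - ε))) (𝓝[>] 0)
      (𝓝 (ENNReal.ofReal ((ℓ + 2 * 0) / (1 - 0)))) := by
    refine ENNReal.tendsto_ofReal (Tendsto.mono_left ?_ nhdsWithin_le_nhds)
    have : ContinuousAt (fun ε : ℝ => (ℓ + 2 * ε) / (1 - ε)) 0 :=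
      ContinuousAt.div (by fun_prop) (by fun_prop) (by norm_num)
    exact this
  have := ge_of_tendsto ht (by
    filter_upwards [Ioo_mem_nhdsGT (show (0 : ℝ) < 1 / 2 by norm_num)] with ε hε using key ε hε)
  simpa [ℓ, ENNReal.ofReal_toReal hfin] using this

/-! ### Total curvature -/

section Fenchel
variable {E : Type*} [NormedAddCommGroup E] [InnerProductSpace ℝ E]

lemma angle_le_sum_angle {T : ℕ → E} {a b : ℕ} (hab : a ≤ b) (hT : T a ≠ 0) :
    angle (T a) (T b) ≤ ∑ j ∈ Finset.Ico a b, angle (T j) (T (j + 1)) := by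
  induction b, hab using Nat.le_induction with
  | base => simp [angle_self hT]
  | succ b hb ih =>
    rw [Finset.sum_Ico_succ_top hb]
    linarith [angle_le_angle_add_angle (T a) (T b) (T (b + 1))]

/-- The exterior angles of a closed polygon add up to at least `2π`. -/
lemma two_pi_le_sum_angle (n : ℕ) (T : ℕ → E) (hT : ∀ j ≤ n, T j ≠ 0)
    (hsum : ∑ j ∈ Finset.range (n + 1), T j = 0) :
    2 * π ≤ ∑ j ∈ Finset.range n, angle (T j) (T (j + 1)) + angle (T n) (T 0) := by
  induction n generalizing T with
  | zero => simp at hsum; exact absurd hsum (hT 0 le_rfl)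
  | succ n ih =>
    -- Replacing the two edges `T 0`, `T 1` by their sum does not increase the total exterior angle,
    -- which is the induction step. If the two edges cancel, the turn between them is already `π`,
    -- and by the triangle inequality the other turns from `T 1` back to `T 0` add up to at least
    -- another `π`.
    by_cases h : T 0 + T 1 = 0
    · have h0 : T 0 = -T 1 := eq_neg_of_add_eq_zero_left h
      have h1 := angle_le_sum_angle (T := T) (show 1 ≤ n + 1 by omega) (hT 1 (by omega))
      rw [Finset.range_eq_Ico, Finset.sum_eq_sum_Ico_succ_bot (by omega)]
      have h2 := angle_le_angle_add_angle (T 1) (T (n + 1)) (T 0)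
      have h3 : angle (T 1) (T 0) = π := by rw [h0, angle_self_neg_of_nonzero (hT 1 (by omega))]
      have h4 : angle (T 0) (T 1) = π := by rw [angle_comm, h3]
      simp only [zero_add] at h1 ⊢
      linarith
    · set T' : ℕ → E := fun j => if j = 0 then T 0 + T 1 else T (j + 1)
      have hT' : ∀ j, T' (j + 1) = T (j + 1 + 1) := fun j => rfl
      have hT0 : T' 0 = T 0 + T 1 := rfl
      have := ih T' (by
        rintro (_ | j) hj
        · exact h
        · exact hT _ (by omega)) (by
        rw [Finset.sum_range_succ', Finset.sum_range_succ'] at hsum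
        rw [Finset.sum_range_succ', hT0]
        simp only [hT']
        rw [← hsum]
        abel)
      refine this.trans ?_
      obtain ⟨n, rfl⟩ : ∃ k, n = k + 1 := Nat.exists_eq_add_one.2 (by
        by_contra! hn
        obtain rfl : n = 0 := by omega
        simp [Finset.sum_range_succ] at hsum
        exact h hsum)
      rw [Finset.sum_range_succ', Finset.sum_range_succ', Finset.sum_range_succ', hT0]
      simp only [hT', zero_add, hT0]
      have e1 := angle_eq_angle_add_add_angle_add (T 0) (hT 1 (by omega))
      have e2 := angle_le_angle_add_angle (T 0 + T 1) (T 1) (T (1 + 1))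
      have e3 := angle_le_angle_add_angle (T (n + 1 + 1)) (T 0) (T 0 + T 1)
      rw [angle_comm (T 1) (T 0 + T 1)] at e1
      linarith

end Fenchel

section Curvature
variable {X : Set Space} {γ : C(UnitAddCircle, Space)}

/-- A right angle at `x` makes the segment from `y` to `z` a diameter of the circle through the
three points. -/
lemma Thick.four_le_norm_sub_sq (h : Thick 1 X) {x y z : Space} (hx : x ∈ X) (hy : y ∈ X)
    (hz : z ∈ X) (hxy : x ≠ y) (hzx : z ≠ x) (h0 : ⟪y - x, z - x⟫ = 0) : 2 ≤ ‖y - z‖ := by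
  have hyz : y ≠ z := by
    rintro rfl
    exact hzx (sub_eq_zero.1 (inner_self_eq_zero.1 h0))
  have h1 := h x hx y hy z hz hxy hyz hzx
  rw [h0] at h1
  have p1 : 0 < ‖y - x‖ := norm_pos_iff.2 (sub_ne_zero.2 hxy.symm)
  have p2 : 0 < ‖z - x‖ := norm_pos_iff.2 (sub_ne_zero.2 hzx)
  have p3 : 0 < ‖y - x‖ ^ 2 * ‖z - x‖ ^ 2 := by positivity
  have h2 : 2 ^ 2 ≤ ‖y - z‖ ^ 2 := le_of_mul_le_mul_left (by linarith) p3
  exact (sq_le_sq₀ (by norm_num) (norm_nonneg _)).1 h2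

/-- Short pieces of a curve of thickness `1` before and after a point form an obtuse angle. -/
lemma Thick.inner_neg (h : Thick 1 X) (hγ : Function.Injective γ) (hX : range γ ⊆ X) {δ : ℝ}
    (hδ : δ ≤ 1 / 4)
    (hmod : ∀ s t : ℝ, |s - t| < 2 * δ → dist (γ (s : UnitAddCircle)) (γ (t : UnitAddCircle)) < 1)
    (s : ℝ) {a b : ℝ} (ha : a ∈ Ioo 0 δ) (hb : b ∈ Ioo 0 δ) :
    ⟪γ ((s + a : ℝ) : UnitAddCircle) - γ (s : UnitAddCircle),
      γ ((s - b : ℝ) : UnitAddCircle) - γ (s : UnitAddCircle)⟫ < 0 := by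
  set F : ℝ → Space := fun t => γ (t : UnitAddCircle) with hF
  change ⟪F (s + a) - F s, F (s - b) - F s⟫ < 0
  have hFc : Continuous F := γ.continuous.comp continuous_quotient_mk'
  have hne : ∀ t u, t ≠ u → |t - u| < 1 → F t ≠ F u := by
    intro t u htu h1 heq
    have h2 := hγ heq
    rw [abs_lt] at h1
    rcases lt_or_gt_of_ne htu with h | h
    · exact htu ((AddCircle.coe_eq_coe_iff_of_mem_Ico (p := (1 : ℝ)) (a := t) ⟨le_rfl, by linarith⟩
        ⟨h.le, by linarith⟩).1 h2)
    · exact htu ((AddCircle.coe_eq_coe_iff_of_mem_Ico (p := (1 : ℝ)) (a := u) ⟨h.le, by linarith⟩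
        ⟨le_rfl, by linarith⟩).1 h2)
  -- On the square of parameters `G` has no zero, because a right angle would force two points of
  -- this short arc to be `2` apart. It is negative somewhere, since points at equal small distance
  -- on the two sides are nearly opposite. The square is connected, so `G` is negative on all of it.
  set G : ℝ × ℝ → ℝ := fun q => ⟪F (s + q.1) - F s, F (s - q.2) - F s⟫ with hG
  have hGc : Continuous G := by fun_prop
  have hδ0 : 0 < δ := ha.1.trans ha.2
  have hG0 : ∀ q ∈ Ioo 0 δ ×ˢ Ioo 0 δ, G q ≠ 0 := by
    rintro ⟨x, y⟩ ⟨hx, hy⟩ h0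
    simp only at hx hy
    have h1 := h.four_le_norm_sub_sq (hX ⟨_, rfl⟩) (hX ⟨_, rfl⟩) (hX ⟨_, rfl⟩)
      (hne s (s + x) (by linarith [hx.1]) (by rw [abs_lt]; constructor <;> linarith [hx.1, hx.2]))
      (hne (s - y) s (by linarith [hy.1]) (by rw [abs_lt]; constructor <;> linarith [hy.1, hy.2])) h0
    have h2 := hmod (s + x) (s - y) (by
      rw [abs_lt]; constructor <;> linarith [hx.1, hx.2, hy.1, hy.2])
    rw [dist_eq_norm] at h2
    linarith
  obtain ⟨q, hq, hqneg⟩ : ∃ q ∈ Ioo 0 δ ×ˢ Ioo 0 δ, G q < 0 := by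
    have c1 : Continuous fun t => dist (F t) (F s) := by fun_prop
    set d := min (dist (F (s + δ / 2)) (F s)) (dist (F (s - δ / 2)) (F s))
    have hd0 : 0 < d := lt_min (dist_pos.2 (hne _ _ (by linarith) (by
      rw [abs_lt]; constructor <;> linarith))) (dist_pos.2 (hne _ _ (by linarith) (by
      rw [abs_lt]; constructor <;> linarith)))
    have hd1 : d < 1 := (min_le_left _ _).trans_lt (hmod _ _ (by
      rw [abs_lt]; constructor <;> linarith))
    obtain ⟨t₁, ht₁, h1⟩ := intermediate_value_Icc (show s ≤ s + δ / 2 by linarith) c1.continuousOn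
      (show d ∈ Icc _ _ from ⟨by simpa using hd0.le, min_le_left _ _⟩)
    obtain ⟨t₂, ht₂, h2⟩ := intermediate_value_Icc' (show s - δ / 2 ≤ s by linarith) c1.continuousOn
      (show d ∈ Icc _ _ from ⟨by simpa using hd0.le, min_le_right _ _⟩)
    simp only at h1 h2
    have hs1 : t₁ ≠ s := by rintro rfl; rw [dist_self] at h1; linarith
    have hs2 : t₂ ≠ s := by rintro rfl; rw [dist_self] at h2; linarith
    have hs1' := lt_of_le_of_ne ht₁.1 hs1.symm
    have hs2' := lt_of_le_of_ne ht₂.2 hs2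
    refine ⟨(t₁ - s, s - t₂), ⟨⟨by simpa using hs1', by linarith [ht₁.2]⟩,
      ⟨by simpa using hs2', by linarith [ht₂.1]⟩⟩, ?_⟩
    have h3 := h.norm_add_sq_le (x := F s) (hX ⟨_, rfl⟩) (hX ⟨_, rfl⟩) (hX ⟨_, rfl⟩)
      (hne t₁ t₂ (by linarith) (by
        rw [abs_lt]; constructor <;> linarith [ht₁.2, ht₂.1])) hd0 h1 h2
    change 1 ^ 2 * ‖F t₁ - F s + (F t₂ - F s)‖ ^ 2 ≤ d ^ 4 at h3
    rw [norm_add_sq_real, ← dist_eq_norm, ← dist_eq_norm, h1, h2] at h3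
    have e : G (t₁ - s, s - t₂) = ⟪F t₁ - F s, F t₂ - F s⟫ := by simp [hG]
    have h4 : d ^ 4 < d ^ 2 := pow_lt_pow_right_of_lt_one₀ hd0 hd1 (by norm_num)
    have h5 : 0 < d ^ 2 := by positivity
    rw [e]
    linarith
  by_contra! hge
  obtain ⟨q', hq', h0⟩ := (isPreconnected_Ioo.prod isPreconnected_Ioo).intermediate_value
    (f := G) hq (show (a, b) ∈ Ioo 0 δ ×ˢ Ioo 0 δ from ⟨ha, hb⟩) hGc.continuousOn ⟨hqneg.le, hge⟩
  exact hG0 q' hq' h0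

/-- For consecutive edges `q`, `p` of an inscribed polygon with exterior angle `α`, the law of sines
on a circle of radius at least `1` gives `sin α ≤ ‖p + q‖ / 2`. Then `cos α ≥ 1 - ε`, and `α cos α ≤
sin α` turns this into a bound for `α` itself. -/
lemma angle_mul_le_of_inner_pos {p q : Space} {ε : ℝ} (hε : 0 ≤ ε) (hε1 : ε ≤ 1) (h : 0 < ⟪q, p⟫)
    (hR : 4 * (‖p‖ ^ 2 * ‖q‖ ^ 2 - ⟪q, p⟫ ^ 2) ≤ ‖p‖ ^ 2 * ‖q‖ ^ 2 * ‖p + q‖ ^ 2)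
    (hpq : ‖p + q‖ ≤ 2 * ε) : angle q p * (1 - ε) ≤ (‖p‖ + ‖q‖) / 2 := by
  have hp : p ≠ 0 := by rintro rfl; simp at h
  have hq : q ≠ 0 := by rintro rfl; simp at h
  have hp' := norm_pos_iff.2 hp
  have hq' := norm_pos_iff.2 hq
  set α := angle q p
  have hα0 : 0 ≤ α := angle_nonneg _ _
  have hαπ : α ≤ π := angle_le_pi _ _
  have hcos : cos α * (‖q‖ * ‖p‖) = ⟪q, p⟫ := cos_angle_mul_norm_mul_norm _ _
  have hcpos : 0 < cos α := by
    by_contra! hle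
    have := mul_nonneg_of_nonpos_of_nonpos hle (neg_nonpos.2 (by positivity : 0 ≤ ‖q‖ * ‖p‖))
    linarith
  have hα2 : α < π / 2 := by
    by_contra! hle
    have := cos_nonpos_of_pi_div_two_le_of_le hle (by linarith [pi_pos])
    linarith
  have hsin0 : 0 ≤ sin α := sin_nonneg_of_nonneg_of_le_pi hα0 hαπ
  have hsin : sin α ≤ ‖p + q‖ / 2 := by
    rw [← sq_le_sq₀ hsin0 (by positivity)]
    have h1 := sin_sq_add_cos_sq α
    have h2 : 0 < ‖q‖ ^ 2 * ‖p‖ ^ 2 := by positivity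
    refine le_of_mul_le_mul_left ?_ h2
    rw [← hcos] at hR
    have : sin α ^ 2 = 1 - cos α ^ 2 := by linarith
    rw [this]
    nlinarith
  have htri := norm_add_le p q
  have hc : 1 - ε ≤ cos α := by
    rw [← sq_le_sq₀ (by linarith) hcpos.le]
    have h1 := sin_sq_add_cos_sq α
    nlinarith
  have htan := le_tan hα0 hα2
  rw [tan_eq_sin_div_cos, le_div_iff₀ hcpos] at htan
  nlinarith

/-- A simple closed curve of thickness at least `1` has length at least `2π`. -/
lemma Thick.two_pi_le_curveLength (h : Thick 1 X) (hγ : Function.Injective γ) (hX : range γ ⊆ X) :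
    ENNReal.ofReal (2 * π) ≤ curveLength γ := by
  have key : ∀ ε ∈ Ioo (0 : ℝ) 1, ENNReal.ofReal (2 * π * (1 - ε)) ≤ curveLength γ := by
    intro ε hε
    obtain ⟨δ₁, hδ₁, hmod⟩ := exists_uniform_modulus γ hε.1
    set δ := min (δ₁ / 2) (1 / 4)
    have hδ0 : 0 < δ := by positivity
    have hδ1 : 2 * δ ≤ δ₁ := by linarith [min_le_left (δ₁ / 2) (1 / 4 : ℝ)]
    obtain ⟨n, hn⟩ := exists_nat_gt (1 / δ)
    have hn0 : (0 : ℝ) < n := lt_trans (by positivity) hn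
    have hnδ : 1 / (n : ℝ) < δ := by rwa [div_lt_comm₀ hn0 hδ0]
    have hnN : 0 < n := by exact_mod_cast hn0
    set F : ℝ → Space := fun t => γ (t : UnitAddCircle) with hF
    have hFp : ∀ t, F (t + 1) = F t := fun t => by
      simp only [hF]; rw [AddCircle.coe_add_period]
    set T : ℕ → Space := fun j => F ((j + 1 : ℕ) / n) - F (j / n) with hT
    have hTn : ∀ j, T j = γ (gridPt n (j + 1)) - γ (gridPt n j) := fun j => rfl
    have hstep : ∀ j, ∃ s : ℝ, T j = F s - F (s - 1 / n) ∧ T (j + 1) = F (s + 1 / n) - F s := by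
      intro j
      refine ⟨((j + 1 : ℕ) : ℝ) / n, ?_, ?_⟩
      · simp only [hT]; congr 2; push_cast; ring
      · simp only [hT]; congr 2; push_cast; ring
    have hmem : 1 / (n : ℝ) ∈ Ioo 0 δ := ⟨by positivity, hnδ⟩
    have hpos : ∀ j, 0 < ⟪T j, T (j + 1)⟫ := by
      intro j
      obtain ⟨s, h1, h2⟩ := hstep j
      have := h.inner_neg hγ hX (min_le_right _ _) (fun s t hst =>
        (hmod s t (lt_of_lt_of_le hst hδ1)).trans hε.2) s hmem hmem
      change ⟪F (s + 1 / n) - F s, F (s - 1 / n) - F s⟫ < 0 at this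
      rw [h1, h2, real_inner_comm, ← neg_sub (F (s - 1 / n)), inner_neg_right]
      linarith
    have hT0 : ∀ j, T j ≠ 0 := fun j hj => by
      have := hpos j
      rw [hj, inner_zero_left] at this
      exact lt_irrefl _ this
    -- Each exterior angle is at most, up to the factor `1 - ε`, the mean of the two adjacent edge
    -- lengths. Summed over the closed polygon this compares its total curvature, at least `2π`,
    -- with its length.
    have hang : ∀ j, angle (T j) (T (j + 1)) * (1 - ε) ≤ (‖T (j + 1)‖ + ‖T j‖) / 2 := by
      intro j
      have hp := hpos j
      have h01 := hT0 j
      have h02 := hT0 (j + 1)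
      obtain ⟨s, h1, h2⟩ := hstep j
      have e : T (j + 1) + T j = F (s + 1 / n) - F (s - 1 / n) := by rw [h1, h2]; abel
      refine angle_mul_le_of_inner_pos hε.1.le hε.2.le hp ?_ ?_
      · have hne : F (s + 1 / n) ≠ F (s - 1 / n) := by
          intro heq
          rw [heq, sub_self, add_comm] at e
          have h3 : T j = -T (j + 1) := eq_neg_of_add_eq_zero_left e
          rw [h3, inner_neg_left, real_inner_self_eq_norm_sq] at hp
          have := sq_nonneg ‖T (j + 1)‖
          linarith
        have := h (F s) (hX ⟨_, rfl⟩) (F (s + 1 / n)) (hX ⟨_, rfl⟩) (F (s - 1 / n)) (hX ⟨_, rfl⟩)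
          (fun heq => h02 (by rw [h2, heq, sub_self])) hne
          (fun heq => h01 (by rw [h1, heq, sub_self]))
        rw [← e, ← h2, ← neg_sub (F s), ← h1, norm_neg, inner_neg_right,
          real_inner_comm (T j)] at this
        linarith
      · rw [e, ← dist_eq_norm]
        refine ((hmod _ _ ?_).le).trans (by linarith [hε.1])
        rw [show s + 1 / (n : ℝ) - (s - 1 / n) = 2 * (1 / n) by ring, abs_of_pos (by positivity)]
        linarith
    have hTper : T n = T 0 := by
      simp only [hT]
      have e1 : ((n + 1 : ℕ) : ℝ) / n = ((0 + 1 : ℕ) : ℝ) / n + 1 := by push_cast; field_simp; ring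
      have e2 : ((n : ℕ) : ℝ) / n = ((0 : ℕ) : ℝ) / n + 1 := by push_cast; field_simp; simp
      rw [e1, e2, hFp, hFp]
    have hfen := two_pi_le_sum_angle (n - 1) T (fun j _ => hT0 j) (by
      rw [Nat.sub_add_cancel hnN]
      simp only [hTn]
      rw [Finset.sum_range_sub fun j => γ (gridPt n j), gridPt_self hnN, sub_self])
    have e : angle (T (n - 1)) (T 0) = angle (T (n - 1)) (T (n - 1 + 1)) := by
      rw [Nat.sub_add_cancel hnN, hTper]
    rw [e, ← Finset.sum_range_succ (fun j => angle (T j) (T (j + 1))), Nat.sub_add_cancel hnN] at hfen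
    refine le_trans (ENNReal.ofReal_le_ofReal ?_) (sum_dist_gridPt_le_curveLength γ n)
    have h1 : ∑ j ∈ Finset.range n, dist (γ (gridPt n j)) (γ (gridPt n (j + 1))) =
        ∑ j ∈ Finset.range n, ‖T j‖ := Finset.sum_congr rfl fun j _ => by
      rw [hTn, dist_comm, dist_eq_norm]
    have h2 : ∑ j ∈ Finset.range n, ‖T (j + 1)‖ = ∑ j ∈ Finset.range n, ‖T j‖ := by
      have := (Finset.sum_range_succ' (fun j => ‖T j‖) n).symm.trans (Finset.sum_range_succ _ n)
      rw [hTper] at this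
      linarith
    have h3 := Finset.sum_le_sum fun j (_ : j ∈ Finset.range n) => hang j
    rw [← Finset.sum_mul, ← Finset.sum_div, Finset.sum_add_distrib, h2] at h3
    rw [h1]
    nlinarith [hε.2]
  have ht : Tendsto (fun ε : ℝ => ENNReal.ofReal (2 * π * (1 - ε))) (𝓝[>] 0)
      (𝓝 (ENNReal.ofReal (2 * π * (1 - 0)))) :=
    ENNReal.tendsto_ofReal (Tendsto.mono_left
      ((by fun_prop : Continuous fun ε : ℝ => 2 * π * (1 - ε)).tendsto 0) nhdsWithin_le_nhds)
  have := le_of_tendsto ht (by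
    filter_upwards [Ioo_mem_nhdsGT (show (0 : ℝ) < 1 by norm_num)] with ε hε using key ε hε)
  simpa using this

end Curvature

/-! ### The length bound for links, and tightness -/

lemma IsSplit.of_image {K J K' J' : Set Space} (h : IsSplit K' J') (Φ : Space ≃ₜ Space)
    (hK : Φ '' K ⊆ K') (hJ : Φ '' J ⊆ J') : IsSplit K J := by
  obtain ⟨g, h1, h2⟩ := h
  refine ⟨Φ.trans g, ?_, ?_⟩
  · rw [show ⇑(Φ.trans g) = g ∘ Φ from rfl, image_comp]
    exact (image_mono hK).trans h1
  · rw [show ⇑(Φ.trans g) = g ∘ Φ from rfl, image_comp]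
    exact h2.mono_left (image_mono hJ)

namespace Link
variable {m : ℕ}

lemma isCompact_component (L : Link m) (i : Fin m) : IsCompact (L.component i) :=
  isCompact_range (L.curve i).continuous

lemma isPreconnected_component (L : Link m) (i : Fin m) : IsPreconnected (L.component i) :=
  isPreconnected_range (L.curve i).continuous

lemma component_subset_carrier (L : Link m) (i : Fin m) : L.component i ⊆ L.carrier :=
  subset_iUnion L.component i

lemma component_nonempty (L : Link m) (i : Fin m) : (L.component i).Nonempty := range_nonempty _

lemma disjoint_component (L : Link m) {i j : Fin m} (h : i ≠ j) :
    Disjoint (L.component i) (L.component j) := L.disjoint h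

lemma eq_of_mem_component (L : Link m) {i j : Fin m} {x : Space} (hi : x ∈ L.component i)
    (hj : x ∈ L.component j) : i = j := by
  by_contra h
  exact disjoint_left.1 (L.disjoint_component h) hi hj

lemma exists_subset_component (L : Link m) {S : Set Space} (hS : IsPreconnected S)
    (hne : S.Nonempty) (hsub : S ⊆ L.carrier) : ∃ i, S ⊆ L.component i := by
  obtain ⟨x, hx⟩ := hne
  obtain ⟨i, hi⟩ := mem_iUnion.1 (hsub hx)
  refine ⟨i, (isPreconnected_iff_subset_of_disjoint_closed.1 hS (L.component i)
    (⋃ j, ⋃ (_ : j ≠ i), L.component j) (L.isCompact_component i).isClosed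
    (isClosed_iUnion_of_finite fun j => isClosed_iUnion_of_finite fun _ =>
      (L.isCompact_component j).isClosed) (fun y hy => ?_) ?_).resolve_right fun h => ?_⟩
  · obtain ⟨j, hj⟩ := mem_iUnion.1 (hsub hy)
    by_cases h : j = i
    · exact Or.inl (h ▸ hj)
    · exact Or.inr (mem_iUnion₂.2 ⟨j, h, hj⟩)
  · refine eq_empty_of_forall_notMem ?_
    rintro y ⟨-, h1, h2⟩
    obtain ⟨j, hj, h2⟩ := mem_iUnion₂.1 h2
    exact hj (L.eq_of_mem_component h2 h1)
  · obtain ⟨j, hj, h2⟩ := mem_iUnion₂.1 (h hx)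
    exact hj (L.eq_of_mem_component h2 hi)

/-- The image of a component is connected, so it lies in one component of the other link. The
inverse homeomorphism gives the reverse inclusions. -/
lemma exists_perm_component {L L' : Link m} (Φ : Space ≃ₜ Space) (h : Φ '' L.carrier = L'.carrier) :
    ∃ e : Equiv.Perm (Fin m), ∀ i, Φ '' L.component i = L'.component (e i) := by
  have h' : Φ.symm '' L'.carrier = L.carrier := by
    rw [← h, ← image_comp]; simp
  choose f hf using fun i => L'.exists_subset_component
    ((L.isPreconnected_component i).image Φ Φ.continuous.continuousOn)
    ((L.component_nonempty i).image Φ) ((image_mono (L.component_subset_carrier i)).trans h.le)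
  choose g hg using fun i => L.exists_subset_component
    ((L'.isPreconnected_component i).image Φ.symm Φ.symm.continuous.continuousOn)
    ((L'.component_nonempty i).image Φ.symm)
    ((image_mono (L'.component_subset_carrier i)).trans h'.le)
  have hfg : ∀ i, f (g i) = i := fun i => by
    obtain ⟨x, hx⟩ := L'.component_nonempty i
    have h1 := hf (g i) (mem_image_of_mem Φ (hg i (mem_image_of_mem Φ.symm hx)))
    rw [Φ.apply_symm_apply] at h1
    exact L'.eq_of_mem_component h1 hx
  have hgf : ∀ i, g (f i) = i := fun i => by
    obtain ⟨x, hx⟩ := L.component_nonempty i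
    have h1 := hg (f i) (mem_image_of_mem Φ.symm (hf i (mem_image_of_mem Φ hx)))
    rw [Φ.symm_apply_apply] at h1
    exact L.eq_of_mem_component h1 hx
  refine ⟨⟨f, g, hgf, hfg⟩, fun i => (hf i).antisymm fun x hx => ?_⟩
  have h1 := hg (f i) (mem_image_of_mem Φ.symm hx)
  rw [hgf] at h1
  exact ⟨_, h1, Φ.apply_symm_apply x⟩

lemma LinkedToSublinks.map {L L' : Link m} {k : Fin m} {n : ℕ} (h : L.LinkedToSublinks k n)
    (Φ : Space ≃ₜ Space) (e : Equiv.Perm (Fin m))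
    (he : ∀ i, Φ '' L.component i = L'.component (e i)) : L'.LinkedToSublinks (e k) n := by
  obtain ⟨part, hpart⟩ := h
  refine ⟨fun i => part ⟨e.symm i, fun h => i.2 ((e.symm_apply_eq).1 h)⟩, fun j hs => ?_⟩
  refine hpart j (hs.of_image Φ (he k).le ?_)
  rintro _ ⟨x, hx, rfl⟩
  obtain ⟨i, hi, hx⟩ := mem_iUnion₂.1 hx
  refine mem_iUnion₂.2 ⟨⟨e i, fun h => i.2 (e.injective h)⟩, ?_, ?_⟩
  · simpa using hi
  · exact (he i).le (mem_image_of_mem Φ hx)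

lemma thick_iff (L : Link m) {r : ℝ} (hr : 0 ≤ r) :
    ENNReal.ofReal r ≤ L.thickness ↔ Thick r L.carrier := ofReal_le_thickness_iff hr _

lemma two_le_dist_of_thick {L : Link m} (hL : Thick 1 L.carrier) {i j : Fin m} (hij : i ≠ j)
    {x y : Space} (hx : x ∈ L.component i) (hy : y ∈ L.component j) : 2 ≤ dist x y := by
  obtain ⟨s, rfl⟩ := hx
  have := hL.two_mul_le_dist zero_le_one (L.simple i) (L.component_subset_carrier i)
    (L.component_subset_carrier j hy)
    (fun h => hij (L.eq_of_mem_component h hy)) s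
  linarith

/-- The length bound. -/
lemma le_length {L : Link m} {k : Fin m} {n : ℕ} (hL : Thick 1 L.carrier)
    (h : L.LinkedToSublinks k n) : ENNReal.ofReal (2 * π) + peri n ≤ L.length k := by
  rcases n.eq_zero_or_pos with rfl | hn
  · rw [peri_zero, add_zero]
    exact hL.two_pi_le_curveLength (L.simple k) (L.component_subset_carrier k)
  have : NeZero n := ⟨hn.ne'⟩
  obtain ⟨part, hpart⟩ := h
  refine ofReal_add_peri_le_curveLength (L.simple k) (fun j => ?_) hpart ?_ ?_
  · exact isClosed_iUnion_of_finite fun i => isClosed_iUnion_of_finite fun _ =>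
      (L.isCompact_component i).isClosed
  · intro s j y hy
    obtain ⟨i, -, hy⟩ := mem_iUnion₂.1 hy
    exact two_le_dist_of_thick hL i.2.symm ⟨s, rfl⟩ hy
  · intro j j' hj y hy z hz
    obtain ⟨i, hi, hy⟩ := mem_iUnion₂.1 hy
    obtain ⟨i', hi', hz⟩ := mem_iUnion₂.1 hz
    refine two_le_dist_of_thick hL (fun h => hj ?_) hy hz
    rw [← hi, ← hi', Subtype.ext h]

end Link

lemma Thick.smul {t : ℝ} (ht : 0 < t) {X : Set Space} (h : Thick t X) :
    Thick 1 ((fun x => t⁻¹ • x) '' X) := by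
  rintro _ ⟨x, hx, rfl⟩ _ ⟨y, hy, rfl⟩ _ ⟨z, hz, rfl⟩ h1 h2 h3
  have := h x hx y hy z hz (fun e => h1 (by rw [e])) (fun e => h2 (by rw [e]))
    (fun e => h3 (by rw [e]))
  simp only [← smul_sub, norm_smul, inner_smul_left, inner_smul_right, conj_trivial,
    Real.norm_of_nonneg (inv_pos.2 ht).le]
  have h4 : 0 < t⁻¹ ^ 6 := by positivity
  have h5 := mul_le_mul_of_nonneg_left this h4.le
  have h6 : t⁻¹ * t = 1 := inv_mul_cancel₀ ht.ne'
  have h7 : t⁻¹ ^ 6 * t ^ 2 = t⁻¹ ^ 4 := by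
    rw [show t⁻¹ ^ 6 * t ^ 2 = t⁻¹ ^ 4 * (t⁻¹ * t) ^ 2 by ring, h6]; ring
  refine le_trans (le_of_eq ?_) (h5.trans (le_of_eq (by ring)))
  rw [show ∀ a, t⁻¹ ^ 6 * (4 * t ^ 2 * a) = 4 * (t⁻¹ ^ 6 * t ^ 2) * a by intro a; ring, h7]
  ring

lemma curveLength_comp_le {E F : Type*} [PseudoEMetricSpace E] [PseudoEMetricSpace F]
    {f : C(E, F)} {K : ℝ≥0} (hf : LipschitzWith K f) (γ : C(UnitAddCircle, E)) :
    curveLength (f.comp γ) ≤ K * curveLength γ :=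
  (hf.lipschitzOnWith (s := univ)).comp_eVariationOn_le (g := fun t : ℝ => γ (t : UnitAddCircle))
    (mapsTo_univ _ _)

lemma curveLength_pos {E : Type*} [MetricSpace E] {γ : C(UnitAddCircle, E)}
    (hγ : Function.Injective γ) : 0 < curveLength γ := by
  have h1 := eVariationOn.edist_le (fun t : ℝ => γ (t : UnitAddCircle)) (s := Icc 0 1)
    (show (0 : ℝ) ∈ Icc (0 : ℝ) 1 by simp) (show (1 / 2 : ℝ) ∈ Icc (0 : ℝ) 1 by norm_num)
  refine lt_of_lt_of_le (edist_pos.2 fun h => ?_) h1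
  have h2 := (AddCircle.coe_eq_coe_iff_of_mem_Ico (p := (1 : ℝ)) (a := 0) (by simp)
    (by norm_num)).1 (hγ h)
  norm_num at h2

namespace Link
variable {m : ℕ}

/-- The link scaled by `c`. -/
def scale (L : Link m) {c : ℝ} (hc : c ≠ 0) : Link m where
  curve i := (⟨fun x => c • x, by fun_prop⟩ : C(Space, Space)).comp (L.curve i)
  simple i := (smul_right_injective Space hc).comp (L.simple i)
  disjoint i j hij := by
    refine disjoint_left.2 ?_
    rintro _ ⟨s, rfl⟩ ⟨t, ht⟩
    have h1 : L.curve j t = L.curve i s := smul_right_injective Space hc ht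
    exact disjoint_left.1 (L.disjoint hij) ⟨s, rfl⟩ ⟨t, h1⟩

lemma scale_carrier (L : Link m) {c : ℝ} (hc : c ≠ 0) :
    (L.scale hc).carrier = (fun x => c • x) '' L.carrier := by
  simp only [carrier, image_iUnion, component]
  exact iUnion_congr fun i => range_comp (fun x => c • x) (L.curve i)

/-- A link all of whose components attain the length bound is tight. -/
lemma isTight_of_length_eq {L : Link m} (hL : 1 ≤ L.thickness)
    (h : ∀ k : Fin m, ∃ n : ℕ, L.LinkedToSublinks k n ∧
      L.length k = ENNReal.ofReal (2 * π) + peri n) : L.IsTight := by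
  intro L' hiso
  obtain ⟨H, -, -, hH⟩ := hiso
  have h1 : L.ropelength ≤ ∑ i, L.length i := ENNReal.div_le_of_le_mul (le_mul_of_one_le_right' hL)
  refine h1.trans ?_
  rcases m.eq_zero_or_pos with rfl | hm
  · simp
  have htop : L'.thickness ≠ ∞ := by
    intro htop
    obtain ⟨r, hr, hr'⟩ := exists_not_thick (L'.simple ⟨0, hm⟩) (L'.component_subset_carrier ⟨0, hm⟩)
    exact hr' ((L'.thick_iff hr.le).1 (htop ▸ le_top))
  -- Division by zero gives `∞` because the total length is positive, so such a competitor is no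
  -- better.
  by_cases h0 : L'.thickness = 0
  · rw [ropelength, h0, ENNReal.div_zero]
    · exact le_top
    · exact (lt_of_lt_of_le (curveLength_pos (L'.simple ⟨0, hm⟩))
        (Finset.single_le_sum (f := fun i => L'.length i) (fun _ _ => zero_le)
          (Finset.mem_univ (⟨0, hm⟩ : Fin m)))).ne'
  set t := L'.thickness.toReal with ht
  have ht0 : 0 < t := ENNReal.toReal_pos h0 htop
  have htE : L'.thickness = ENNReal.ofReal t := (ENNReal.ofReal_toReal htop).symm
  have hthick := ((L'.thick_iff ht0.le).1 htE.ge).smul ht0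
  have hc : t⁻¹ ≠ 0 := inv_ne_zero ht0.ne'
  -- The competitor scaled to thickness `1` is still the image of `L` under a homeomorphism. So its
  -- components inherit the linking of those of `L`, up to a permutation, and obey the same length
  -- bounds.
  rw [← L'.scale_carrier hc] at hthick
  set Φ : Space ≃ₜ Space := (H 1).trans (Homeomorph.smulOfNeZero t⁻¹ hc)
  obtain ⟨e, he⟩ := exists_perm_component (L := L) (L' := L'.scale hc) Φ (by
    rw [scale_carrier, ← hH, ← image_comp]; rfl)
  have key : ∀ k, L.length k ≤ L'.length (e k) / L'.thickness := by
    intro k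
    obtain ⟨n, hn, hk⟩ := h k
    rw [hk]
    refine (le_length hthick (hn.map Φ e he)).trans ?_
    have hlip : LipschitzWith ⟨t⁻¹, (inv_pos.2 ht0).le⟩
        (⟨fun x => t⁻¹ • x, by fun_prop⟩ : C(Space, Space)) := by
      refine LipschitzWith.of_dist_le_mul fun x y => ?_
      change dist (t⁻¹ • x) (t⁻¹ • y) ≤ t⁻¹ * dist x y
      rw [dist_smul₀, Real.norm_of_nonneg (inv_pos.2 ht0).le]
    refine (curveLength_comp_le hlip (L'.curve (e k))).trans (le_of_eq ?_)
    rw [htE, ENNReal.div_eq_inv_mul, ← ENNReal.ofReal_inv_of_pos ht0]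
    congr 1
    rw [ENNReal.ofReal, Real.toNNReal_of_nonneg (inv_pos.2 ht0).le]
    rfl
  calc ∑ k, L.length k ≤ ∑ k, L'.length (e k) / L'.thickness := Finset.sum_le_sum fun k _ => key k
    _ = L'.ropelength := by
      simp only [div_eq_mul_inv]
      rw [← Finset.sum_mul, Equiv.sum_comp e, ropelength, div_eq_mul_inv]

end Link

/-! ### Perimeters of hulls of at most five points -/

section Perimeter

lemma hullPerim_comp_le {ι κ : Type*} [Finite ι] [Nonempty ι] [Finite κ] [Nonempty κ] (c : ι → Plane)
    (f : κ → ι) : hullPerim (fun k => c (f k)) ≤ hullPerim c :=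
  intervalIntegral.integral_mono_on (by positivity) ((continuous_hullSupp _).intervalIntegrable _ _)
    ((continuous_hullSupp _).intervalIntegrable _ _) fun θ _ =>
      hullSupp_le fun k => inner_le_hullSupp c θ (f k)

/-- A closed polygon whose total variation in every direction is at most twice the width of the
hull is at most as long as the perimeter of the hull. -/
lemma sum_dist_le_hullPerim {ι : Type*} [Finite ι] [Nonempty ι] (c : ι → Plane) (v : ℕ → Plane)
    (N : ℕ) (h : ∀ θ m M : ℝ, (∀ i, ⟪c i, uvec θ⟫ ∈ Icc m M) →
      ∑ k ∈ Finset.range N, |⟪v k, uvec θ⟫ - ⟪v (k + 1), uvec θ⟫| ≤ 2 * (M - m)) :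
    ∑ k ∈ Finset.range N, dist (v k) (v (k + 1)) ≤ hullPerim c := by
  have hcont : ∀ k, Continuous fun θ => |⟪v k - v (k + 1), uvec θ⟫| := fun k => by fun_prop
  -- Cauchy's formula on both sides: the variations integrate to four times the length, and twice
  -- the widths integrate to four times the perimeter.
  have h1 : ∫ θ in (0 : ℝ)..(2 * π), ∑ k ∈ Finset.range N, |⟪v k - v (k + 1), uvec θ⟫| =
      4 * ∑ k ∈ Finset.range N, dist (v k) (v (k + 1)) := by
    rw [intervalIntegral.integral_finsetSum fun k _ => (hcont k).intervalIntegrable _ _,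
      Finset.mul_sum]
    refine Finset.sum_congr rfl fun k _ => ?_
    rw [integral_abs_inner_uvec, dist_eq_norm]
  have hper : ∫ θ in (0 : ℝ)..(2 * π), hullSupp c (θ + π) = hullPerim c := by
    rw [intervalIntegral.integral_comp_add_right, zero_add, add_comm (2 * π),
      (hullSupp_periodic c).intervalIntegral_add_eq π 0, zero_add, hullPerim]
  have h2 : ∫ θ in (0 : ℝ)..(2 * π), 2 * (hullSupp c θ + hullSupp c (θ + π)) = 4 * hullPerim c := by
    rw [intervalIntegral.integral_const_mul, intervalIntegral.integral_add
      ((continuous_hullSupp c).intervalIntegrable _ _)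
      (Continuous.intervalIntegrable (by fun_prop) _ _), hper, hullPerim]
    ring
  have h3 : ∫ θ in (0 : ℝ)..(2 * π), ∑ k ∈ Finset.range N, |⟪v k - v (k + 1), uvec θ⟫| ≤
      ∫ θ in (0 : ℝ)..(2 * π), 2 * (hullSupp c θ + hullSupp c (θ + π)) := by
    refine intervalIntegral.integral_mono_on (by positivity)
      (Continuous.intervalIntegrable (by fun_prop) _ _)
      (Continuous.intervalIntegrable (by fun_prop) _ _) fun θ _ => ?_
    have := h θ (-hullSupp c (θ + π)) (hullSupp c θ) fun i => ⟨?_, inner_le_hullSupp c θ i⟩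
    · simp only [inner_sub_left]; linarith
    · have := inner_le_hullSupp c (θ + π) i
      rw [uvec_add_pi, inner_neg_right] at this
      linarith
  linarith

variable {ι : Type*} [Finite ι] [Nonempty ι] (c : ι → Plane)

lemma two_mul_dist_le_hullPerim (i j : ι) : 2 * dist (c i) (c j) ≤ hullPerim c := by
  have := sum_dist_le_hullPerim c (fun k => if k = 1 then c j else c i) 2 fun θ m M h => by
    have hi := h i
    have hj := h j
    simp only [Finset.sum_range_succ, Finset.sum_range_zero]
    norm_num
    rw [abs_sub_comm ⟪c j, uvec θ⟫]
    have : |⟪c i, uvec θ⟫ - ⟪c j, uvec θ⟫| ≤ M - m :=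
      abs_le.2 ⟨by linarith [hi.1, hj.2], by linarith [hi.2, hj.1]⟩
    linarith
  simp only [Finset.sum_range_succ, Finset.sum_range_zero] at this
  norm_num at this
  rw [dist_comm (c j)] at this
  linarith

lemma triangle_le_hullPerim (i j k : ι) :
    dist (c i) (c j) + dist (c j) (c k) + dist (c k) (c i) ≤ hullPerim c := by
  have := sum_dist_le_hullPerim c (fun l => if l = 1 then c j else if l = 2 then c k else c i) 3
    fun θ m M h => by
      have hi := h i
      have hj := h j
      have hk := h k
      simp only [Finset.sum_range_succ, Finset.sum_range_zero]
      norm_num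
      obtain ⟨h1, h2⟩ := hi
      obtain ⟨h3, h4⟩ := hj
      obtain ⟨h5, h6⟩ := hk
      rcases abs_cases (⟪c i, uvec θ⟫ - ⟪c j, uvec θ⟫) with ⟨e1, _⟩ | ⟨e1, _⟩ <;>
      rcases abs_cases (⟪c j, uvec θ⟫ - ⟪c k, uvec θ⟫) with ⟨e2, _⟩ | ⟨e2, _⟩ <;>
      rcases abs_cases (⟪c k, uvec θ⟫ - ⟪c i, uvec θ⟫) with ⟨e3, _⟩ | ⟨e3, _⟩ <;>
      rw [e1, e2, e3] <;> linarith
  simpa [Finset.sum_range_succ] using this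

/-- Two pairs of numbers such that neither lies above the other. -/
def Interlocked (a c b d : ℝ) : Prop :=
  (a ≤ b ∨ a ≤ d ∨ c ≤ b ∨ c ≤ d) ∧ (b ≤ a ∨ d ≤ a ∨ b ≤ c ∨ d ≤ c)

/-- A common weighted mean of `a, c` and of `b, d` excludes that one pair lies strictly above the
other. Crossing segments provide such a mean in every projection. -/
lemma interlocked_of_eq {a b c d α β γ δ : ℝ} (hα : 0 ≤ α) (hβ : 0 ≤ β) (hγ : 0 ≤ γ) (hδ : 0 ≤ δ)
    (hs : α + γ = β + δ) (hpos : 0 < α + γ) (h : α * a + γ * c = β * b + δ * d) :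
    Interlocked a c b d := by
  constructor
  · by_contra! hcon
    obtain ⟨h1, h2, h3, h4⟩ := hcon
    have m1 : max b d < min a c := by simp [*]
    have e1 : α * min a c ≤ α * a := mul_le_mul_of_nonneg_left (min_le_left _ _) hα
    have e2 : γ * min a c ≤ γ * c := mul_le_mul_of_nonneg_left (min_le_right _ _) hγ
    have e3 : β * b ≤ β * max b d := mul_le_mul_of_nonneg_left (le_max_left _ _) hβ
    have e4 : δ * d ≤ δ * max b d := mul_le_mul_of_nonneg_left (le_max_right _ _) hδ
    have e5 : (α + γ) * max b d < (α + γ) * min a c := mul_lt_mul_of_pos_left m1 hpos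
    have e6 : (α + γ) * max b d = (β + δ) * max b d := by rw [hs]
    linarith
  · by_contra! hcon
    obtain ⟨h1, h2, h3, h4⟩ := hcon
    have m1 : max a c < min b d := by simp [*]
    have e1 : α * a ≤ α * max a c := mul_le_mul_of_nonneg_left (le_max_left _ _) hα
    have e2 : γ * c ≤ γ * max a c := mul_le_mul_of_nonneg_left (le_max_right _ _) hγ
    have e3 : β * min b d ≤ β * b := mul_le_mul_of_nonneg_left (min_le_left _ _) hβ
    have e4 : δ * min b d ≤ δ * d := mul_le_mul_of_nonneg_left (min_le_right _ _) hδ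
    have e5 : (α + γ) * max a c < (α + γ) * min b d := mul_lt_mul_of_pos_left m1 hpos
    have e6 : (α + γ) * min b d = (β + δ) * min b d := by rw [hs]
    linarith

/-- A closed chain that rises once and falls once has variation at most twice its range. A chain of
four numbers can rise twice only if `a, c` both lie above `b, d` or both below, which interlocking
forbids. -/
lemma sum_abs_four_le {a b c d m M : ℝ} (h : Interlocked a c b d) (ha : a ∈ Icc m M)
    (hb : b ∈ Icc m M) (hc : c ∈ Icc m M) (hd : d ∈ Icc m M) :
    |a - b| + |b - c| + |c - d| + |d - a| ≤ 2 * (M - m) := by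
  obtain ⟨a1, a2⟩ := ha
  obtain ⟨b1, b2⟩ := hb
  obtain ⟨c1, c2⟩ := hc
  obtain ⟨d1, d2⟩ := hd
  obtain ⟨h1, h2⟩ := h
  rcases abs_cases (a - b) with ⟨e1, _⟩ | ⟨e1, _⟩ <;>
  rcases abs_cases (b - c) with ⟨e2, _⟩ | ⟨e2, _⟩ <;>
  rcases abs_cases (c - d) with ⟨e3, _⟩ | ⟨e3, _⟩ <;>
  rcases abs_cases (d - a) with ⟨e4, _⟩ | ⟨e4, _⟩ <;>
  rw [e1, e2, e3, e4] <;> first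
    | linarith
    | (rcases h1 with h | h | h | h <;> linarith)
    | (rcases h2 with h | h | h | h <;> linarith)

/-- As for four numbers: the five interlockings, one for each choice of four of the points, rule out
that the cyclic sequence rises twice. -/
lemma sum_abs_five_le {a b c d e m M : ℝ} (h1 : Interlocked a c b d) (h2 : Interlocked a c b e)
    (h3 : Interlocked a d b e) (h4 : Interlocked a d c e) (h5 : Interlocked b d c e)
    (ha : a ∈ Icc m M) (hb : b ∈ Icc m M) (hc : c ∈ Icc m M) (hd : d ∈ Icc m M)
    (he : e ∈ Icc m M) :
    |a - b| + |b - c| + |c - d| + |d - e| + |e - a| ≤ 2 * (M - m) := by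
  obtain ⟨a1, a2⟩ := ha
  obtain ⟨b1, b2⟩ := hb
  obtain ⟨c1, c2⟩ := hc
  obtain ⟨d1, d2⟩ := hd
  obtain ⟨e1, e2⟩ := he
  obtain ⟨p1, q1⟩ := h1
  obtain ⟨p2, q2⟩ := h2
  obtain ⟨p3, q3⟩ := h3
  obtain ⟨p4, q4⟩ := h4
  obtain ⟨p5, q5⟩ := h5
  rcases abs_cases (a - b) with ⟨f1, _⟩ | ⟨f1, _⟩ <;>
  rcases abs_cases (b - c) with ⟨f2, _⟩ | ⟨f2, _⟩ <;>
  rcases abs_cases (c - d) with ⟨f3, _⟩ | ⟨f3, _⟩ <;>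
  rcases abs_cases (d - e) with ⟨f4, _⟩ | ⟨f4, _⟩ <;>
  rcases abs_cases (e - a) with ⟨f5, _⟩ | ⟨f5, _⟩ <;>
  rw [f1, f2, f3, f4, f5] <;> first
    | linarith
    | (rcases p1 with h | h | h | h <;> linarith)
    | (rcases q1 with h | h | h | h <;> linarith)
    | (rcases p2 with h | h | h | h <;> linarith)
    | (rcases q2 with h | h | h | h <;> linarith)
    | (rcases p3 with h | h | h | h <;> linarith)
    | (rcases q3 with h | h | h | h <;> linarith)
    | (rcases p4 with h | h | h | h <;> linarith)
    | (rcases q4 with h | h | h | h <;> linarith)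
    | (rcases p5 with h | h | h | h <;> linarith)
    | (rcases q5 with h | h | h | h <;> linarith)

lemma quadrilateral_le_hullPerim (i j k l : ι)
    (h : ∀ θ, Interlocked ⟪c i, uvec θ⟫ ⟪c k, uvec θ⟫ ⟪c j, uvec θ⟫ ⟪c l, uvec θ⟫) :
    dist (c i) (c j) + dist (c j) (c k) + dist (c k) (c l) + dist (c l) (c i) ≤ hullPerim c := by
  have := sum_dist_le_hullPerim c (fun n => if n = 1 then c j else if n = 2 then c k else
    if n = 3 then c l else c i) 4 fun θ m M hm => by
      have := sum_abs_four_le (h θ) (hm i) (hm j) (hm k) (hm l)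
      simpa [Finset.sum_range_succ] using this
  simpa [Finset.sum_range_succ] using this

/-- The signed area spanned by three points. -/
def orient (P Q R : Plane) : ℝ :=
  (Q 0 - P 0) * (R 1 - P 1) - (Q 1 - P 1) * (R 0 - P 0)

/-- The four signed areas are the coefficients of the affine relation between the points. Their
positivity says that the diagonals `P R` and `Q S` cross. -/
lemma interlocked_of_orient {P Q R S : Plane} (h1 : 0 < orient Q R S) (h2 : 0 < orient P Q S)
    (h3 : 0 < orient P R S) (h4 : 0 < orient P Q R) (θ : ℝ) :
    Interlocked ⟪P, uvec θ⟫ ⟪R, uvec θ⟫ ⟪Q, uvec θ⟫ ⟪S, uvec θ⟫ := by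
  refine interlocked_of_eq h1.le h3.le h2.le h4.le ?_ (by linarith) ?_
  · simp only [orient]; ring
  · simp only [orient, inner_uvec]; ring

lemma pentagon_le_hullPerim (c : Fin 5 → Plane)
    (h : ∀ i j k, i < j → j < k → 0 < orient (c i) (c j) (c k)) :
    dist (c 0) (c 1) + dist (c 1) (c 2) + dist (c 2) (c 3) + dist (c 3) (c 4) + dist (c 4) (c 0) ≤
      hullPerim c := by
  have := sum_dist_le_hullPerim c (fun n => if n = 1 then c 1 else if n = 2 then c 2 else
    if n = 3 then c 3 else if n = 4 then c 4 else c 0) 5 fun θ m M hm => by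
      have hi : ∀ i j k l : Fin 5, i < j → j < k → k < l →
          Interlocked ⟪c i, uvec θ⟫ ⟪c k, uvec θ⟫ ⟪c j, uvec θ⟫ ⟪c l, uvec θ⟫ :=
        fun i j k l h1 h2 h3 => interlocked_of_orient (h _ _ _ h2 h3) (h _ _ _ h1 (h2.trans h3))
          (h _ _ _ (h1.trans h2) h3) (h _ _ _ h1 h2) θ
      have := sum_abs_five_le (hi 0 1 2 3 (by decide) (by decide) (by decide))
        (hi 0 1 2 4 (by decide) (by decide) (by decide)) (hi 0 1 3 4 (by decide) (by decide) (by decide))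
        (hi 0 2 3 4 (by decide) (by decide) (by decide)) (hi 1 2 3 4 (by decide) (by decide) (by decide))
        (hm 0) (hm 1) (hm 2) (hm 3) (hm 4)
      simpa [Finset.sum_range_succ] using this
  simpa [Finset.sum_range_succ] using this

end Perimeter

/-! ### Points in triangles -/

section Triangle

/-- The point `D` lies in the triangle `A B C`. -/
def InTri (D A B C : Plane) : Prop :=
  ∃ α β γ : ℝ, 0 ≤ α ∧ 0 ≤ β ∧ 0 ≤ γ ∧ α + β + γ = 1 ∧ D = α • A + β • B + γ • C

lemma InTri.rotate {D A B C : Plane} (h : InTri D A B C) : InTri D B C A := by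
  obtain ⟨α, β, γ, h1, h2, h3, h4, rfl⟩ := h
  exact ⟨β, γ, α, h2, h3, h1, by linarith, by abel⟩

lemma InTri.swap {D A B C : Plane} (h : InTri D A B C) : InTri D B A C := by
  obtain ⟨α, β, γ, h1, h2, h3, h4, rfl⟩ := h
  exact ⟨β, α, γ, h2, h1, h3, by linarith, by abel⟩

lemma InTri.trans {D A B C E : Plane} (h : InTri D A B C) (hA : InTri A E B C) : InTri D E B C := by
  obtain ⟨α, β, γ, h1, h2, h3, h4, rfl⟩ := h
  obtain ⟨α', β', γ', h1', h2', h3', h4', rfl⟩ := hA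
  refine ⟨α * α', α * β' + β, α * γ' + γ, by positivity, by positivity, by positivity, ?_, ?_⟩
  · linear_combination α * h4' + h4
  · module

/-- The directions to the vertices of a triangle, seen from a point inside, differ by at least
`2π` in total. -/
lemma InTri.two_pi_le {O A B C : Plane} (h : InTri O A B C) (hA : O ≠ A) (hB : O ≠ B) (hC : O ≠ C) :
    2 * π ≤ angle (A - O) (B - O) + angle (B - O) (C - O) + angle (C - O) (A - O) := by
  -- The degenerate case of a point on a side: this side is seen under the angle `π`, and the other
  -- two angles add up to at least `π`.
  have two : ∀ {P Q R : Plane} {α β : ℝ}, 0 ≤ α → 0 ≤ β → α + β = 1 → O ≠ P → O ≠ Q →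
      O = α • P + β • Q →
      2 * π ≤ angle (P - O) (Q - O) + angle (Q - O) (R - O) + angle (R - O) (P - O) := by
    intro P Q R α β hα hβ hs hP hQ hO
    have hα0 : 0 < α := hα.lt_of_ne fun h => hQ (by
      rw [hO, ← h, show β = 1 by linarith]; simp)
    have hβ0 : 0 < β := hβ.lt_of_ne fun h => hP (by
      rw [hO, ← h, show α = 1 by linarith]; simp)
    have hπ : angle (P - O) (Q - O) = π := by
      have e : P - O = (-(β / α)) • (Q - O) := by
        have : α • (P - O) + β • (Q - O) = 0 := by
          rw [smul_sub, smul_sub, show α • P - α • O + (β • Q - β • O) =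
            α • P + β • Q - (α + β) • O by module, ← hO, hs, one_smul, sub_self]
        rw [neg_smul, div_eq_inv_mul, mul_smul, ← smul_neg, ← eq_neg_of_add_eq_zero_left this,
          smul_smul, inv_mul_cancel₀ hα0.ne', one_smul]
      rw [e, neg_smul, angle_neg_left, angle_smul_left_of_pos _ _ (by positivity),
        angle_self (sub_ne_zero.2 hQ.symm), sub_zero]
    have := angle_le_angle_add_angle (Q - O) (R - O) (P - O)
    rw [angle_comm (Q - O) (P - O), hπ] at this
    linarith
  obtain ⟨α, β, γ, hα, hβ, hγ, hs, hO⟩ := h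
  rcases hα.eq_or_lt with rfl | hα0
  · have := two (R := A) hβ hγ (by linarith) hB hC (by simpa using hO)
    linarith
  rcases hβ.eq_or_lt with rfl | hβ0
  · have := two (R := B) hγ hα (by linarith) hC hA (by rw [add_comm]; simpa using hO)
    linarith
  rcases hγ.eq_or_lt with rfl | hγ0
  · have := two (R := C) hα hβ (by linarith) hA hB (by simpa using hO)
    linarith
  have h3 : α • (A - O) + β • (B - O) + γ • (C - O) = 0 := by
    rw [show α • (A - O) + β • (B - O) + γ • (C - O) = α • A + β • B + γ • C - (α + β + γ) • O by
      module, ← hO, hs, one_smul, sub_self]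
  -- The barycentric weights make the three vectors the edges of a closed polygon, and the angles
  -- between them are its exterior angles.
  have := two_pi_le_sum_angle 2 (fun j => if j = 0 then α • (A - O) else if j = 1 then β • (B - O)
    else γ • (C - O)) (by
      intro j _
      rcases j with _ | _ | j
      · simpa [hα0.ne', sub_eq_zero] using hA.symm
      · simpa [hβ0.ne', sub_eq_zero] using hB.symm
      · simpa [hγ0.ne', sub_eq_zero] using hC.symm) (by
      simpa [Finset.sum_range_succ] using h3)
  simpa [Finset.sum_range_succ, angle_smul_left_of_pos, angle_smul_right_of_pos, hα0, hβ0, hγ0]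
    using this

/-- By the law of cosines the squared side is `(p - q)² + 4 p q sin² (θ / 2)`, with `p, q ≥ 2` the
distances to `O`. -/
lemma four_sin_le_dist {O A B : Plane} (hA : 2 ≤ dist A O) (hB : 2 ≤ dist B O) :
    4 * sin (angle (A - O) (B - O) / 2) ≤ dist A B := by
  set θ := angle (A - O) (B - O)
  have h0 : 0 ≤ θ := angle_nonneg _ _
  have hπ : θ ≤ π := angle_le_pi _ _
  have hs : 0 ≤ sin (θ / 2) := sin_nonneg_of_nonneg_of_le_pi (by linarith) (by linarith)
  rw [← sq_le_sq₀ (by positivity) dist_nonneg]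
  have e : dist A B ^ 2 = dist A O ^ 2 + dist B O ^ 2 - 2 * (dist A O * dist B O * cos θ) := by
    rw [dist_eq_norm, show A - B = (A - O) - (B - O) by abel, norm_sub_sq_real,
      ← cos_angle_mul_norm_mul_norm, dist_eq_norm, dist_eq_norm]
    ring
  have hc : cos θ = 1 - 2 * sin (θ / 2) ^ 2 := by
    rw [show θ = 2 * (θ / 2) by ring, cos_two_mul, cos_sq']; ring_nf
  rw [e, hc]
  have h2 : 4 ≤ dist A O * dist B O := by nlinarith
  nlinarith [sq_nonneg (dist A O - dist B O), sq_nonneg (sin (θ / 2)),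
    mul_le_mul_of_nonneg_right h2 (sq_nonneg (sin (θ / 2)))]

lemma sin_ge_chord {a b x : ℝ} (ha : 0 ≤ a) (hb : b ≤ π) (hab : a < b) (hx : x ∈ Icc a b) :
    sin a + (sin b - sin a) / (b - a) * (x - a) ≤ sin x := by
  have h := strictConcaveOn_sin_Icc.concaveOn.2 (show a ∈ Icc 0 π from ⟨ha, by linarith⟩)
    (show b ∈ Icc 0 π from ⟨by linarith, hb⟩)
    (show 0 ≤ (b - x) / (b - a) from div_nonneg (by linarith [hx.2]) (by linarith))
    (show 0 ≤ (x - a) / (b - a) from div_nonneg (by linarith [hx.1]) (by linarith))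
    (by rw [← add_div, show b - x + (x - a) = b - a by ring, div_self (by linarith)])
  have hne : b - a ≠ 0 := by linarith
  simp only [smul_eq_mul] at h
  rw [show (b - x) / (b - a) * a + (x - a) / (b - a) * b = x by field_simp; ring] at h
  refine le_trans (le_of_eq ?_) h
  field_simp
  ring

/-- A side of length at least `2`, seen from a point at distance at least `2` from its ends. -/
lemma one_add_angle_le_dist {O A B : Plane} (hA : 2 ≤ dist A O) (hB : 2 ≤ dist B O)
    (hAB : 2 ≤ dist A B) : 1 + 3 / π * angle (A - O) (B - O) ≤ dist A B := by
  set θ := angle (A - O) (B - O) with hθ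
  have hπ := pi_pos
  -- The bound is the chord of the concave function `4 sin (θ / 2)` from the value `2` at `π / 3` to
  -- the value `4` at `π`. For smaller angles the hypothesis on the side itself suffices. Being
  -- affine in the angle, the bound can be summed around `O`: `k` sides with total angle at least
  -- `2π` have total length at least `k + 6`.
  rcases le_total θ (π / 3) with h | h
  · have : 3 / π * θ ≤ 3 / π * (π / 3) := mul_le_mul_of_nonneg_left h (by positivity)
    rw [show 3 / π * (π / 3) = 1 by field_simp] at this
    linarith
  · have h1 := four_sin_le_dist hA hB
    have h2 := sin_ge_chord (a := π / 6) (b := π / 2) (x := θ / 2) (by positivity) (by linarith)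
      (by linarith) ⟨by linarith, by linarith [angle_le_pi (A - O) (B - O)]⟩
    rw [sin_pi_div_six, sin_pi_div_two] at h2
    have e : 1 + 3 / π * θ = 4 * (1 / 2 + (1 - 1 / 2) / (π / 2 - π / 6) * (θ / 2 - π / 6)) := by
      field_simp; ring
    rw [e]
    linarith

end Triangle

section Triangle

lemma plane_dist_sq (A B : Plane) : dist A B ^ 2 = (A 0 - B 0) ^ 2 + (A 1 - B 1) ^ 2 := by
  rw [dist_eq_norm, plane_norm_sq]; simp

/-- A point inside a triangle of perimeter less than `10`, at distance at least `2` from the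
vertices, sees some side at an angle greater than `3π / 4`. -/
lemma exists_angle_gt {O A B C : Plane} (h : InTri O A B C) (hA : 2 ≤ dist A O)
    (hB : 2 ≤ dist B O) (hC : 2 ≤ dist C O)
    (hp : dist A B + dist B C + dist C A < 10) :
    3 * π / 4 < angle (A - O) (B - O) ∨ 3 * π / 4 < angle (B - O) (C - O) ∨
      3 * π / 4 < angle (C - O) (A - O) := by
  by_contra! hcon
  obtain ⟨h1, h2, h3⟩ := hcon
  have hπ := pi_pos
  have hne : ∀ {P : Plane}, 2 ≤ dist P O → O ≠ P := by
    rintro P hP rfl; rw [dist_self] at hP; linarith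
  have hsum := h.two_pi_le (hne hA) (hne hB) (hne hC)
  set x := angle (A - O) (B - O)
  set y := angle (B - O) (C - O)
  set z := angle (C - O) (A - O)
  -- If no angle exceeds `3π / 4`, all three are at least `π / 2`. The chord of `4 sin (t / 2)` on
  -- this interval, rounded down, gives a perimeter of at least `3 · 2.8 + 2 · 0.84 = 10.08`.
  have key : ∀ t, π / 2 ≤ t → t ≤ 3 * π / 4 →
      2.8 + 0.84 / (π / 4) * (t - π / 2) ≤ 4 * sin (t / 2) := by
    intro t ht1 ht2
    have := sin_ge_chord (a := π / 4) (b := 3 * π / 8) (x := t / 2) (by positivity) (by linarith)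
      (by linarith) ⟨by linarith, by linarith⟩
    have e1 : (0.707 : ℝ) < sin (π / 4) := by
      rw [sin_pi_div_four]
      have : (1.414 : ℝ) < √2 := Real.lt_sqrt_of_sq_lt (by norm_num)
      linarith
    have e2 : (0.923 : ℝ) < sin (3 * π / 8) := by
      rw [show 3 * π / 8 = π / 2 - π / 8 by ring, sin_pi_div_two_sub, cos_pi_div_eight]
      have h1 : (1.414 : ℝ) < √2 := Real.lt_sqrt_of_sq_lt (by norm_num)
      have : (1.846 : ℝ) < √(2 + √2) := Real.lt_sqrt_of_sq_lt (by norm_num; linarith)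
      linarith
    have e3 : sin (π / 4) + (sin (3 * π / 8) - sin (π / 4)) / (3 * π / 8 - π / 4) * (t / 2 - π / 4) =
        sin (π / 4) * (1 - (t - π / 2) / (π / 4)) + sin (3 * π / 8) * ((t - π / 2) / (π / 4)) := by
      field_simp; ring
    rw [e3] at this
    have f1 : 0 ≤ (t - π / 2) / (π / 4) := div_nonneg (by linarith) (by linarith)
    have f2 : (t - π / 2) / (π / 4) ≤ 1 := (div_le_one (by linarith)).2 (by linarith)
    have f3 : 0.84 / (π / 4) * (t - π / 2) = 0.84 * ((t - π / 2) / (π / 4)) := by ring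
    rw [f3]
    nlinarith
  have k1 := (key x (by linarith) h1).trans (four_sin_le_dist hA hB)
  have k2 := (key y (by linarith) h2).trans (four_sin_le_dist hB hC)
  have k3 := (key z (by linarith) h3).trans (four_sin_le_dist hC hA)
  have e : 0.84 / (π / 4) * (x - π / 2) + 0.84 / (π / 4) * (y - π / 2) +
      0.84 / (π / 4) * (z - π / 2) = 0.84 / (π / 4) * (x + y + z - 3 * (π / 2)) := by ring
  have e2 : 0.84 / (π / 4) * (π / 2) ≤ 0.84 / (π / 4) * (x + y + z - 3 * (π / 2)) :=
    mul_le_mul_of_nonneg_left (by linarith) (by positivity)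
  have e3 : 0.84 / (π / 4) * (π / 2) = 1.68 := by field_simp; norm_num
  linarith

/-- The law of cosines for an angle greater than `3π / 4`. -/
lemma sq_add_le_of_angle_gt {O A B : Plane} (h : 3 * π / 4 < angle (A - O) (B - O)) :
    dist A O ^ 2 + dist B O ^ 2 + 1.414 * (dist A O * dist B O) ≤ dist A B ^ 2 := by
  have hc : cos (angle (A - O) (B - O)) ≤ -0.707 := by
    have h1 := cos_le_cos_of_nonneg_of_le_pi (by positivity) (angle_le_pi _ _) h.le
    have h2 : cos (3 * π / 4) = -(√2 / 2) := by
      rw [show 3 * π / 4 = π - π / 4 by ring, cos_pi_sub, cos_pi_div_four]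
    have h3 : (1.414 : ℝ) < √2 := Real.lt_sqrt_of_sq_lt (by norm_num)
    linarith
  have e : dist A B ^ 2 = dist A O ^ 2 + dist B O ^ 2 -
      2 * (dist A O * dist B O * cos (angle (A - O) (B - O))) := by
    rw [dist_eq_norm, show A - B = (A - O) - (B - O) by abel, norm_sub_sq_real,
      ← cos_angle_mul_norm_mul_norm, dist_eq_norm, dist_eq_norm]
    ring
  have h0 : 0 ≤ dist A O * dist B O := by positivity
  rw [e]
  nlinarith

lemma dist_lt_of_angle_gt {O A B : Plane} (h : 3 * π / 4 < angle (A - O) (B - O))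
    (hA : 2 ≤ dist A O) (hB : 2 ≤ dist B O) (hAB : dist A B ≤ 4.32) : dist A O ≤ 2.68 := by
  have h1 := sq_add_le_of_angle_gt h
  have h2 : dist A B ^ 2 ≤ 4.32 ^ 2 := by gcongr
  by_contra! hlt
  nlinarith

lemma lt_dist_of_angle_gt {O A B : Plane} (h : 3 * π / 4 < angle (A - O) (B - O))
    (hA : 2 ≤ dist A O) (hB : 2 ≤ dist B O) : 3.69 < dist A B := by
  have h1 := sq_add_le_of_angle_gt h
  have h2 : 4 ≤ dist A O * dist B O := by nlinarith
  refine lt_of_pow_lt_pow_left₀ 2 dist_nonneg ?_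
  nlinarith

/-- In a triangle of perimeter less than `10`, two points at distance at least `2` from each other
and from the vertices do not see different sides at angles greater than `3π / 4`. -/
lemma false_of_angle_gt_of_angle_gt {A B C D E : Plane} (hD : InTri D A B C) (hE : InTri E A B C)
    (hAD : 2 ≤ dist A D) (hBD : 2 ≤ dist B D) (hAE : 2 ≤ dist A E)
    (hCE : 2 ≤ dist C E) (hDE : 2 ≤ dist D E)
    (hBC : 2 ≤ dist B C) (hp : dist A B + dist B C + dist C A < 10)
    (h1 : 3 * π / 4 < angle (A - D) (B - D)) (h2 : 3 * π / 4 < angle (A - E) (C - E)) : False := by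
  have hc := lt_dist_of_angle_gt h1 hAD hBD
  have hb := lt_dist_of_angle_gt h2 hAE hCE
  rw [dist_comm C A] at hp
  have hx := dist_lt_of_angle_gt h1 hAD hBD (by linarith)
  have hy := dist_lt_of_angle_gt h2 hAE hCE (by linarith)
  -- Both `A B` and `A C` exceed `3.69`, so `B C` is below `2.62` and the angle at `A` is small. The
  -- directions from `A` to `D` and `E` lie within it.
  have hcos : 0.74 * (dist A B * dist A C) ≤ ⟪B - A, C - A⟫ := by
    have e : dist B C ^ 2 = dist A B ^ 2 + dist A C ^ 2 - 2 * ⟪B - A, C - A⟫ := by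
      rw [dist_eq_norm, show B - C = (B - A) - (C - A) by abel, norm_sub_sq_real, dist_comm A B,
        dist_comm A C, dist_eq_norm, dist_eq_norm]
      ring
    have h3 : dist B C ≤ 2.62 := by linarith
    have h4 : dist B C ^ 2 ≤ 2.62 ^ 2 := by gcongr
    have h5 : 3.69 * 3.69 ≤ dist A B * dist A C := by gcongr
    nlinarith [sq_nonneg (dist A B - dist A C)]
  obtain ⟨α, β, γ, hα, hβ, hγ, hs, hD⟩ := hD
  obtain ⟨α', β', γ', hα', hβ', hγ', hs', hE⟩ := hE
  have hD' : D - A = β • (B - A) + γ • (C - A) := by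
    rw [hD, show α = 1 - β - γ by linarith]; module
  have hE' : E - A = β' • (B - A) + γ' • (C - A) := by
    rw [hE, show α' = 1 - β' - γ' by linarith]; module
  have n1 : dist A D ≤ β * dist A B + γ * dist A C := by
    rw [dist_comm, dist_eq_norm, hD']
    refine (norm_add_le _ _).trans (le_of_eq ?_)
    rw [norm_smul, norm_smul, Real.norm_of_nonneg hβ, Real.norm_of_nonneg hγ, dist_comm A B,
      dist_comm A C, dist_eq_norm, dist_eq_norm]
  have n2 : dist A E ≤ β' * dist A B + γ' * dist A C := by
    rw [dist_comm, dist_eq_norm, hE']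
    refine (norm_add_le _ _).trans (le_of_eq ?_)
    rw [norm_smul, norm_smul, Real.norm_of_nonneg hβ', Real.norm_of_nonneg hγ', dist_comm A B,
      dist_comm A C, dist_eq_norm, dist_eq_norm]
  have hin : 0.74 * (dist A D * dist A E) ≤ ⟪D - A, E - A⟫ := by
    have e : ⟪D - A, E - A⟫ = β * β' * dist A B ^ 2 + γ * γ' * dist A C ^ 2 +
        (β * γ' + β' * γ) * ⟪B - A, C - A⟫ := by
      rw [hD', hE', dist_comm A B, dist_comm A C, dist_eq_norm, dist_eq_norm]
      simp only [inner_add_left, inner_add_right, inner_smul_left, inner_smul_right, conj_trivial,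
        real_inner_self_eq_norm_sq]
      rw [real_inner_comm (B - A) (C - A)]
      ring
    have m : dist A D * dist A E ≤ (β * dist A B + γ * dist A C) * (β' * dist A B + γ' * dist A C) := by
      gcongr
    have m2 : (β * γ' + β' * γ) * (0.74 * (dist A B * dist A C)) ≤
        (β * γ' + β' * γ) * ⟪B - A, C - A⟫ := mul_le_mul_of_nonneg_left hcos (by positivity)
    have m3 : 0 ≤ β * β' * dist A B ^ 2 := by positivity
    have m4 : 0 ≤ γ * γ' * dist A C ^ 2 := by positivity
    rw [e]
    nlinarith
  have e : dist D E ^ 2 = dist A D ^ 2 + dist A E ^ 2 - 2 * ⟪D - A, E - A⟫ := by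
    rw [dist_eq_norm, show D - E = (D - A) - (E - A) by abel, norm_sub_sq_real, dist_comm A D,
      dist_comm A E, dist_eq_norm, dist_eq_norm]
    ring
  -- For distances `p, q` in `[2, 2.68]` from `A`, the quantity `p² + q² - 1.48 p q` stays below
  -- `4`, against `dist D E ≥ 2`.
  nlinarith [mul_nonneg (sub_nonneg.2 hAD) (sub_nonneg.2 hx), mul_nonneg (sub_nonneg.2 hAE)
    (sub_nonneg.2 hy), mul_nonneg (sub_nonneg.2 hAD) (sub_nonneg.2 hAE),
    mul_nonneg (sub_nonneg.2 hx) (sub_nonneg.2 hy)]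

/-- Here `t` and `h` are the coordinates of a point along and across a segment of length `L`, and
`p, q` its distances to the ends. With `d = t (L - t) - h²`, minus the inner product at the point,
the cosine bound reads `p q ≤ 1.4145 d`. The cross product satisfies `(L h)² = (p q)² - d²`, so `L
|h| ≤ 1.0005 d`, and `d ≤ L² / 4 - h²` makes `h` small. Then `p, q ≥ 2` keep `t` away from both
ends. -/
lemma bounds_of_law_of_cosines {L t h p q : ℝ} (hL3 : 3.69 < L) (hc5 : L < 5) (hA : 2 ≤ p)
    (hB : 2 ≤ q) (e1 : p ^ 2 = t ^ 2 + h ^ 2) (e2 : q ^ 2 = (L - t) ^ 2 + h ^ 2)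
    (hc : p ^ 2 + q ^ 2 + 1.414 * (p * q) ≤ L ^ 2) : 1.7 ≤ t ∧ t ≤ L - 1.7 ∧ |h| ≤ 1.04 := by
  have hA2 : 2 ^ 2 ≤ p ^ 2 := by gcongr
  have hB2 : 2 ^ 2 ≤ q ^ 2 := by gcongr
  set d := t * (L - t) - h ^ 2 with hd_def
  have hp0 : 0 ≤ p * q := by positivity
  have hq : p * q ≤ 1.4145 * d := by
    have : 1.414 * (p * q) ≤ 2 * d := by rw [e1, e2] at hc; rw [hd_def]; linarith
    linarith
  have hd : 0 ≤ d := by linarith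
  have hpq : (L * |h|) ^ 2 = (p * q) ^ 2 - d ^ 2 := by
    rw [mul_pow p q, e1, e2, mul_pow, sq_abs, hd_def]; ring
  have hh : L * |h| ≤ 1.0005 * d := by
    have h3 : (p * q) ^ 2 ≤ (1.4145 * d) ^ 2 := pow_le_pow_left₀ hp0 hq 2
    have h4 := sq_nonneg d
    refine (sq_le_sq₀ (by positivity) (by linarith)).1 ?_
    rw [hpq]
    linarith
  have hL5 : L * L ≤ 5 * L := mul_le_mul_of_nonneg_right hc5.le (by linarith)
  have htL : t * (L - t) ≤ L * L / 4 := by linarith [sq_nonneg (t - L / 2)]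
  have hhb : |h| ≤ 1.04 := by
    by_contra! hlt
    have hs : |h| ^ 2 = h ^ 2 := sq_abs h
    have h3 : 1.04 ^ 2 < |h| ^ 2 := pow_lt_pow_left₀ hlt (by norm_num) two_ne_zero
    have h4 : L * 1.04 < L * |h| := mul_lt_mul_of_pos_left hlt (by linarith)
    rw [hd_def] at hh
    linarith
  have hh2 : h ^ 2 ≤ 1.04 ^ 2 := by
    rw [← sq_abs]; gcongr
  have htp : 0 ≤ t * (L - t) := by linarith [sq_nonneg h]
  have ht0 : 0 ≤ t := by
    by_contra! hlt
    linarith [mul_neg_of_neg_of_pos hlt (show 0 < L - t by linarith)]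
  have ht1 : 0 ≤ L - t := by
    by_contra! hlt
    linarith [mul_neg_of_pos_of_neg (show 0 < t by linarith) hlt]
  refine ⟨?_, ?_, hhb⟩
  · by_contra! hlt
    have := pow_le_pow_left₀ ht0 hlt.le 2
    linarith
  · by_contra! hlt
    have := pow_le_pow_left₀ ht1 (show L - t ≤ 1.7 by linarith) 2
    linarith

/-- In a triangle of perimeter less than `10`, two points at distance at least `2` from each other
and from the vertices do not see the same side at angles greater than `3π / 4`. -/
lemma false_of_angle_gt_of_angle_gt' {A B C D E : Plane} (hD : InTri D A B C) (hE : InTri E A B C)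
    (hAD : 2 ≤ dist A D) (hBD : 2 ≤ dist B D) (hAE : 2 ≤ dist A E) (hBE : 2 ≤ dist B E)
    (hDE : 2 ≤ dist D E) (hp : dist A B + dist B C + dist C A < 10)
    (h1 : 3 * π / 4 < angle (A - D) (B - D)) (h2 : 3 * π / 4 < angle (A - E) (B - E)) : False := by
  have hc0 := lt_dist_of_angle_gt h1 hAD hBD
  have hc5 : dist A B < 5 := by linarith [dist_triangle_right A B C, dist_comm B C, dist_comm A C]
  set L := dist A B with hL
  -- coordinates along and across the side
  set T : Plane → ℝ := fun P => ((P 0 - A 0) * (B 0 - A 0) + (P 1 - A 1) * (B 1 - A 1)) / L with hT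
  set H : Plane → ℝ := fun P => orient A B P / L with hH
  have hLsq : L ^ 2 = (B 0 - A 0) ^ 2 + (B 1 - A 1) ^ 2 := by rw [hL, plane_dist_sq]; ring
  have hL0 : L ≠ 0 := by linarith
  have hdist : ∀ P Q, dist P Q ^ 2 = (T P - T Q) ^ 2 + (H P - H Q) ^ 2 := by
    intro P Q
    rw [plane_dist_sq]
    have : (T P - T Q) ^ 2 + (H P - H Q) ^ 2 =
        ((P 0 - Q 0) ^ 2 + (P 1 - Q 1) ^ 2) * ((B 0 - A 0) ^ 2 + (B 1 - A 1) ^ 2) / L ^ 2 := by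
      simp only [hT, hH, orient]; field_simp; ring
    rw [this, ← hLsq]; field_simp
  have hTA : T A = 0 := by simp [hT]
  have hHA : H A = 0 := by simp [hH, orient]
  have hTB : T B = L := by
    simp only [hT]; rw [div_eq_iff hL0, ← sq, ← sq, ← sq, hLsq]
  have hHB : H B = 0 := by simp only [hH, orient]; rw [div_eq_zero_iff]; left; ring
  have key : ∀ P, 2 ≤ dist A P → 2 ≤ dist B P → 3 * π / 4 < angle (A - P) (B - P) →
      1.7 ≤ T P ∧ T P ≤ L - 1.7 ∧ |H P| ≤ 1.04 := by
    intro P hA hB hang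
    have e1 := hdist A P
    have e2 := hdist B P
    rw [hTA, hHA] at e1
    rw [hTB, hHB] at e2
    exact bounds_of_law_of_cosines hc0 hc5 hA hB (by rw [e1]; ring) (by rw [e2]; ring)
      (sq_add_le_of_angle_gt hang)
  obtain ⟨d1, d2, d3⟩ := key D hAD hBD h1
  obtain ⟨f1, f2, f3⟩ := key E hAE hBE h2
  -- Both points are on the side of `A B` where the triangle lies, so their heights differ by at
  -- most `1.04`. Along `A B` they differ by at most `5 - 2 · 1.7 = 1.6`, and together this is less
  -- than `2`.
  have hside : (0 ≤ H D ∧ 0 ≤ H E) ∨ (H D ≤ 0 ∧ H E ≤ 0) := by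
    obtain ⟨α, β, γ, hα, hβ, hγ, hs, hD⟩ := hD
    obtain ⟨α', β', γ', hα', hβ', hγ', hs', hE⟩ := hE
    have e1 : orient A B D = γ * orient A B C := by
      simp only [orient, hD, PiLp.add_apply, PiLp.smul_apply, smul_eq_mul]
      rw [show α = 1 - β - γ by linarith]; ring
    have e2 : orient A B E = γ' * orient A B C := by
      simp only [orient, hE, PiLp.add_apply, PiLp.smul_apply, smul_eq_mul]
      rw [show α' = 1 - β' - γ' by linarith]; ring
    simp only [hH, e1, e2, mul_div_assoc]
    rcases le_total 0 (orient A B C / L) with h | h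
    · exact Or.inl ⟨mul_nonneg hγ h, mul_nonneg hγ' h⟩
    · exact Or.inr ⟨mul_nonpos_of_nonneg_of_nonpos hγ h, mul_nonpos_of_nonneg_of_nonpos hγ' h⟩
  have hHd : (H D - H E) ^ 2 ≤ 1.04 ^ 2 := by
    rw [abs_le] at d3 f3
    rcases hside with ⟨h, h'⟩ | ⟨h, h'⟩ <;> exact sq_le_sq' (by linarith) (by linarith)
  have hTd : (T D - T E) ^ 2 ≤ 1.6 ^ 2 := sq_le_sq' (by linarith) (by linarith)
  have h3 := hdist D E
  have h4 := pow_le_pow_left₀ (by norm_num) hDE 2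
  linarith

/-- A triangle that contains two more points, all distances being at least `2`, has perimeter at
least `10`. -/
lemma ten_le_of_two_inTri {A B C D E : Plane} (hD : InTri D A B C) (hE : InTri E A B C)
    (hAB : 2 ≤ dist A B) (hBC : 2 ≤ dist B C) (hCA : 2 ≤ dist C A)
    (hAD : 2 ≤ dist A D) (hBD : 2 ≤ dist B D) (hCD : 2 ≤ dist C D) (hAE : 2 ≤ dist A E)
    (hBE : 2 ≤ dist B E) (hCE : 2 ≤ dist C E) (hDE : 2 ≤ dist D E) :
    10 ≤ dist A B + dist B C + dist C A := by
  by_contra! hp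
  have hED : 2 ≤ dist E D := by rwa [dist_comm]
  have hAC : 2 ≤ dist A C := by rwa [dist_comm]
  have hp2 : dist B C + dist C A + dist A B < 10 := by linarith
  have hp3 : dist C A + dist A B + dist B C < 10 := by linarith
  have r1 : dist B A + dist A C + dist C B < 10 := by
    rw [dist_comm B A, dist_comm A C, dist_comm C B]; linarith
  rcases exists_angle_gt hD hAD hBD hCD hp with h | h | h <;>
  rcases exists_angle_gt hE hAE hBE hCE hp with h' | h' | h'
  · exact false_of_angle_gt_of_angle_gt' hD hE hAD hBD hAE hBE hDE hp h h'
  · rw [angle_comm] at h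
    exact false_of_angle_gt_of_angle_gt hD.swap hE.swap hBD hAD hBE hCE hDE hAC r1 h h'
  · rw [angle_comm] at h'
    exact false_of_angle_gt_of_angle_gt hD hE hAD hBD hAE hCE hDE hBC hp h h'
  · rw [angle_comm] at h'
    exact false_of_angle_gt_of_angle_gt hE.swap hD.swap hBE hAE hBD hCD hED hAC r1 h' h
  · exact false_of_angle_gt_of_angle_gt' hD.rotate hE.rotate hBD hCD hBE hCE hDE hp2 h h'
  · rw [angle_comm] at h
    exact false_of_angle_gt_of_angle_gt hE.rotate.rotate hD.rotate.rotate hCE hAE hCD hBD hED hAB hp3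
      h' h
  · rw [angle_comm] at h
    exact false_of_angle_gt_of_angle_gt hE hD hAE hBE hAD hCD hED hBC hp h' h
  · rw [angle_comm] at h'
    exact false_of_angle_gt_of_angle_gt hD.rotate.rotate hE.rotate.rotate hCD hAD hCE hBE hDE hAB hp3
      h h'
  · exact false_of_angle_gt_of_angle_gt' hD.rotate.rotate hE.rotate.rotate hCD hAD hCE hAE hDE hp3 h h'

end Triangle

/-! ### Positions of four and five points -/

section Position

/-- The segments `A B` and `C D` meet. -/
def Cross (A B C D : Plane) : Prop :=
  ∃ α β γ δ : ℝ, 0 ≤ α ∧ 0 ≤ β ∧ 0 ≤ γ ∧ 0 ≤ δ ∧ α + β = 1 ∧ γ + δ = 1 ∧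
    α • A + β • B = γ • C + δ • D

lemma inTri_of_relation {A B C D : Plane} {a b c d : ℝ} (hb : b ≤ 0) (hc : c ≤ 0) (hd : d ≤ 0)
    (hs : a + b + c + d = 0) (hpos : 0 < a ^ 2 + b ^ 2 + c ^ 2 + d ^ 2)
    (h0 : a * A 0 + b * B 0 + c * C 0 + d * D 0 = 0)
    (h1 : a * A 1 + b * B 1 + c * C 1 + d * D 1 = 0) : InTri A B C D := by
  have ha : 0 < a := by
    by_contra! hle
    obtain rfl : b = 0 := by linarith
    obtain rfl : c = 0 := by linarith
    obtain rfl : d = 0 := by linarith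
    obtain rfl : a = 0 := by linarith
    norm_num at hpos
  refine ⟨-b / a, -c / a, -d / a, div_nonneg (by linarith) ha.le, div_nonneg (by linarith) ha.le,
    div_nonneg (by linarith) ha.le, by field_simp; linarith, ?_⟩
  apply plane_ext <;> simp only [PiLp.add_apply, PiLp.smul_apply, smul_eq_mul] <;> field_simp <;>
    linarith

lemma cross_of_relation {A B C D : Plane} {a b c d : ℝ} (ha : 0 ≤ a) (hb : 0 ≤ b) (hc : c ≤ 0)
    (hd : d ≤ 0) (hs : a + b + c + d = 0) (hpos : 0 < a ^ 2 + b ^ 2 + c ^ 2 + d ^ 2)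
    (h0 : a * A 0 + b * B 0 + c * C 0 + d * D 0 = 0)
    (h1 : a * A 1 + b * B 1 + c * C 1 + d * D 1 = 0) : Cross A B C D := by
  have hab : 0 < a + b := by
    by_contra! hle
    obtain rfl : a = 0 := by linarith
    obtain rfl : b = 0 := by linarith
    obtain rfl : c = 0 := by linarith
    obtain rfl : d = 0 := by linarith
    norm_num at hpos
  refine ⟨a / (a + b), b / (a + b), -c / (a + b), -d / (a + b), by positivity, by positivity,
    div_nonneg (by linarith) hab.le, div_nonneg (by linarith) hab.le, by field_simp,
    by field_simp; linarith, ?_⟩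
  apply plane_ext <;> simp only [PiLp.add_apply, PiLp.smul_apply, smul_eq_mul] <;> field_simp <;>
    linarith

/-- Radon's theorem for four points of the plane. -/
lemma inTri_or_cross (A B C D : Plane) : InTri A B C D ∨ InTri B A C D ∨ InTri C A B D ∨
    InTri D A B C ∨ Cross A B C D ∨ Cross A C B D ∨ Cross A D B C := by
  -- The four vectors `(1, P)` in three-dimensional space are dependent. The sign pattern of such an
  -- affine relation tells whether one point lies in the triangle of the others or two segments
  -- cross.
  obtain ⟨g, hg, i, hi⟩ : ∃ g : Fin 4 → ℝ, ∑ i, g i • ![![1, A 0, A 1], ![1, B 0, B 1],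
      ![1, C 0, C 1], ![1, D 0, D 1]] i = 0 ∧ ∃ i, g i ≠ 0 := by
    refine Fintype.not_linearIndependent_iff.1 fun h => ?_
    have := h.fintype_card_le_finrank
    simp at this
  have hpos : 0 < g 0 ^ 2 + g 1 ^ 2 + g 2 ^ 2 + g 3 ^ 2 := by
    fin_cases i <;> simp only [Fin.zero_eta, Fin.mk_one, Fin.reduceFinMk] at hi <;> positivity
  have e0 := congrFun hg 0
  have e1 := congrFun hg 1
  have e2 := congrFun hg 2
  simp [Fin.sum_univ_four] at e0 e1 e2
  generalize g 0 = a at *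
  generalize g 1 = b at *
  generalize g 2 = c at *
  generalize g 3 = d at *
  rcases le_total 0 a with ha | ha <;> rcases le_total 0 b with hb | hb <;>
    rcases le_total 0 c with hc | hc <;> rcases le_total 0 d with hd | hd
  · left; exact inTri_of_relation (a := -a) (b := -b) (c := -c) (d := -d) (by linarith)
      (by linarith) (by linarith) (by linarith) (by linarith) (by linarith) (by linarith)
  · right; right; right; left
    exact inTri_of_relation (a := -d) (b := -a) (c := -b) (d := -c) (by linarith)
      (by linarith) (by linarith) (by linarith) (by linarith) (by linarith) (by linarith)
  · right; right; left
    exact inTri_of_relation (a := -c) (b := -a) (c := -b) (d := -d) (by linarith)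
      (by linarith) (by linarith) (by linarith) (by linarith) (by linarith) (by linarith)
  · right; right; right; right; left
    exact cross_of_relation ha hb hc hd e0 hpos e1 e2
  · right; left
    exact inTri_of_relation (a := -b) (b := -a) (c := -c) (d := -d) (by linarith)
      (by linarith) (by linarith) (by linarith) (by linarith) (by linarith) (by linarith)
  · right; right; right; right; right; left
    exact cross_of_relation ha hc hb hd (by linarith) (by linarith) (by linarith) (by linarith)
  · right; right; right; right; right; right
    exact cross_of_relation ha hd hb hc (by linarith) (by linarith) (by linarith) (by linarith)
  · left; exact inTri_of_relation hb hc hd e0 hpos e1 e2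
  · left; exact inTri_of_relation (a := -a) (b := -b) (c := -c) (d := -d) (by linarith)
      (by linarith) (by linarith) (by linarith) (by linarith) (by linarith) (by linarith)
  · right; right; right; right; right; right
    exact cross_of_relation (a := -a) (b := -d) (c := -b) (d := -c) (by linarith) (by linarith)
      (by linarith) (by linarith) (by linarith) (by linarith) (by linarith) (by linarith)
  · right; right; right; right; right; left
    exact cross_of_relation (a := -a) (b := -c) (c := -b) (d := -d) (by linarith) (by linarith)
      (by linarith) (by linarith) (by linarith) (by linarith) (by linarith) (by linarith)
  · right; left
    exact inTri_of_relation (a := b) ha hc hd (by linarith) (by linarith) (by linarith) (by linarith)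
  · right; right; right; right; left
    exact cross_of_relation (a := -a) (b := -b) (c := -c) (d := -d) (by linarith) (by linarith)
      (by linarith) (by linarith) (by linarith) (by linarith) (by linarith) (by linarith)
  · right; right; left
    exact inTri_of_relation (a := c) ha hb hd (by linarith) (by linarith) (by linarith) (by linarith)
  · right; right; right; left
    exact inTri_of_relation (a := d) ha hb hc (by linarith) (by linarith) (by linarith) (by linarith)
  · left; exact inTri_of_relation hb hc hd e0 hpos e1 e2

variable {ι : Type*} [Finite ι] [Nonempty ι] {c : ι → Plane}

/-- A point in a triangle makes its perimeter at least `9`. -/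
lemma nine_le_of_inTri (hc : Pairwise fun i j => 2 ≤ dist (c i) (c j)) {a b d p : ι} (hab : a ≠ b)
    (had : a ≠ d) (hbd : b ≠ d) (hpa : a ≠ p) (hpb : b ≠ p) (hpd : d ≠ p)
    (h : InTri (c p) (c a) (c b) (c d)) : 9 ≤ hullPerim c := by
  have hne : ∀ {i}, i ≠ p → c p ≠ c i := fun hi he => by
    have : 2 ≤ dist (c _) (c p) := hc hi; rw [he, dist_self] at this; linarith
  have h1 := h.two_pi_le (hne hpa) (hne hpb) (hne hpd)
  have h2 := one_add_angle_le_dist (hc hpa) (hc hpb) (hc hab)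
  have h3 := one_add_angle_le_dist (hc hpb) (hc hpd) (hc hbd)
  have h4 := one_add_angle_le_dist (hc hpd) (hc hpa) (hc had.symm)
  have h5 := triangle_le_hullPerim c a b d
  -- Three sides contribute `3`, and the angles around the inner point contribute at least `(3 / π)
  -- · 2π = 6`.
  have h6 := mul_le_mul_of_nonneg_left h1 (show 0 ≤ 3 / π by positivity)
  rw [show 3 / π * (2 * π) = 6 by field_simp; norm_num] at h6
  linarith

/-- The point `e` lies beyond the side from `b` to `d`, so this side can be replaced by two sides
through `e`, which are seen from `p` under at least the same angle. The four sides of the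
quadrilateral then have total length at least `4 + 6`. -/
lemma ten_le_of_inTri_of_cross (hc : Pairwise fun i j => 2 ≤ dist (c i) (c j)) {a b d p e : ι}
    (hab : a ≠ b) (had : a ≠ d) (hpa : a ≠ p) (hpb : b ≠ p) (hpd : d ≠ p)
    (heb : e ≠ b) (hed : e ≠ d) (hep : e ≠ p)
    (h : InTri (c p) (c a) (c b) (c d)) (hx : Cross (c a) (c e) (c b) (c d)) : 10 ≤ hullPerim c := by
  have hne : ∀ {i}, i ≠ p → c p ≠ c i := fun hi he => by
    have : 2 ≤ dist (c _) (c p) := hc hi; rw [he, dist_self] at this; linarith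
  have h1 := h.two_pi_le (hne hpa) (hne hpb) (hne hpd)
  have h2 := one_add_angle_le_dist (hc hpa) (hc hpb) (hc hab)
  have h3 := one_add_angle_le_dist (hc hpb) (hc hep) (hc heb.symm)
  have h4 := one_add_angle_le_dist (hc hep) (hc hpd) (hc hed)
  have h5 := one_add_angle_le_dist (hc hpd) (hc hpa) (hc had.symm)
  have h6 := angle_le_angle_add_angle (c b - c p) (c e - c p) (c d - c p)
  have h7 := quadrilateral_le_hullPerim c a b e d fun θ => by
    obtain ⟨α, β, γ, δ, hα, hβ, hγ, hδ, hs, hs', hX⟩ := hx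
    refine interlocked_of_eq hα hγ hβ hδ (by linarith) (by linarith) ?_
    have := congrArg (fun w => ⟪w, uvec θ⟫) hX
    simpa only [inner_add_left, inner_smul_left, conj_trivial] using this
  have h8 := mul_le_mul_of_nonneg_left (h1.trans (add_le_add_left (add_le_add_right h6 _) _))
    (show 0 ≤ 3 / π by positivity)
  rw [show 3 / π * (2 * π) = 6 by field_simp; norm_num] at h8
  linarith

/-- Five points one of which lies in a triangle of others have a hull of perimeter at least `10`. -/
lemma ten_le_of_inTri (hc : Pairwise fun i j => 2 ≤ dist (c i) (c j)) {a b d p e : ι} (hab : a ≠ b)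
    (had : a ≠ d) (hbd : b ≠ d) (hpa : a ≠ p) (hpb : b ≠ p) (hpd : d ≠ p) (hea : e ≠ a)
    (heb : e ≠ b) (hed : e ≠ d) (hep : e ≠ p) (h : InTri (c p) (c a) (c b) (c d)) :
    10 ≤ hullPerim c := by
  -- The four points `a, b, d, e` either have one of them inside the triangle of the others, which
  -- then contains `p` as well, or form a convex quadrilateral whose diagonals tell which side of
  -- the triangle is to be replaced by two sides through `e`.
  rcases inTri_or_cross (c a) (c b) (c d) (c e) with hx | hx | hx | hx | hx | hx | hx
  · have hx' := hx.rotate.rotate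
    exact (ten_le_of_two_inTri (h.trans hx') hx' (hc heb) (hc hbd) (hc hed.symm) (hc hep) (hc hpb)
      (hc hpd) (hc hea) (hc hab.symm) (hc had.symm) (hc hpa.symm)).trans
      (triangle_le_hullPerim c e b d)
  · have hx' := hx.rotate.rotate
    exact (ten_le_of_two_inTri (h.swap.trans hx') hx' (hc hea) (hc had) (hc hed.symm) (hc hep)
      (hc hpa) (hc hpd) (hc heb) (hc hab) (hc hbd.symm) (hc hpb.symm)).trans
      (triangle_le_hullPerim c e a d)
  · have hx' := hx.rotate.rotate
    exact (ten_le_of_two_inTri (h.rotate.rotate.trans hx') hx' (hc hea) (hc hab) (hc heb.symm)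
      (hc hep) (hc hpa) (hc hpb) (hc hed) (hc had) (hc hbd) (hc hpd.symm)).trans
      (triangle_le_hullPerim c e a b)
  · exact (ten_le_of_two_inTri h hx (hc hab) (hc hbd) (hc had.symm) (hc hpa) (hc hpb) (hc hpd)
      (hc hea.symm) (hc heb.symm) (hc hed.symm) (hc hep.symm)).trans (triangle_le_hullPerim c a b d)
  · refine ten_le_of_inTri_of_cross hc had.symm hbd.symm hpd hpa hpb hea heb hep h.rotate.rotate ?_
    obtain ⟨α, β, γ, δ, hα, hβ, hγ, hδ, hs, hs', hX⟩ := hx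
    exact ⟨γ, δ, α, β, hγ, hδ, hα, hβ, hs', hs, hX.symm⟩
  · refine ten_le_of_inTri_of_cross hc hab.symm hbd hpb hpa hpd hea hed hep h.swap ?_
    obtain ⟨α, β, γ, δ, hα, hβ, hγ, hδ, hs, hs', hX⟩ := hx
    exact ⟨γ, δ, α, β, hγ, hδ, hα, hβ, hs', hs, hX.symm⟩
  · exact ten_le_of_inTri_of_cross hc hab had hpa hpb hpd heb hed hep h hx

/-- The points other than a suitable first one can be sorted by their direction from it. -/
lemma exists_perm_orient_nonneg {n : ℕ} {c : Fin (n + 1) → Plane} (hc : Function.Injective c) :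
    ∃ e : Equiv.Perm (Fin (n + 1)), ∀ i j, 0 < i → i < j →
      0 ≤ orient (c (e 0)) (c (e i)) (c (e j)) := by
  classical
  -- The point farthest from the origin is extreme, and all others lie in an open half-plane at it.
  -- There directions can be compared by the slopes `b i / a i`.
  obtain ⟨p, hp⟩ := Finite.exists_max fun i => ‖c i‖
  set P := c p
  set a : Fin (n + 1) → ℝ := fun i => -((c i 0 - P 0) * P 0 + (c i 1 - P 1) * P 1)
  set b : Fin (n + 1) → ℝ := fun i => (c i 0 - P 0) * P 1 - (c i 1 - P 1) * P 0
  have ha : ∀ i, i ≠ p → 0 < a i := by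
    intro i hi
    have h1 : 0 < ‖c i - P‖ ^ 2 := by
      have := norm_pos_iff.2 (sub_ne_zero.2 (hc.ne hi)); positivity
    have h2 : ‖c i‖ ^ 2 ≤ ‖P‖ ^ 2 := by gcongr; exact hp i
    rw [plane_norm_sq] at h1 h2
    rw [plane_norm_sq] at h2
    simp only [PiLp.sub_apply] at h1
    simp only [a]
    linarith
  -- The value `⊥` sorts `p` itself to the front.
  set f : Fin (n + 1) → WithBot ℝ := fun i => if i = p then ⊥ else ((b i / a i : ℝ) : WithBot ℝ)
  have hmono := Tuple.monotone_sort f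
  have h0 : Tuple.sort f 0 = p := by
    have h1 := hmono (Fin.zero_le ((Tuple.sort f).symm p))
    simp only [Function.comp, Equiv.apply_symm_apply] at h1
    have h2 : f p = ⊥ := if_pos rfl
    rw [h2, le_bot_iff] at h1
    by_contra hne
    simp [f, hne] at h1
  refine ⟨Tuple.sort f, fun i j hi hij => ?_⟩
  have hne : ∀ k, 0 < k → Tuple.sort f k ≠ p := fun k hk h =>
    hk.ne' ((Tuple.sort f).injective (h.trans h0.symm))
  have h1 := hmono hij.le
  simp only [Function.comp, f, if_neg (hne i hi), if_neg (hne j (hi.trans hij))] at h1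
  rw [WithBot.coe_le_coe] at h1
  rw [h0]
  set q := Tuple.sort f i
  set r := Tuple.sort f j
  have hq := ha q (hne i hi)
  have hr := ha r (hne j (hi.trans hij))
  rw [div_le_div_iff₀ hq hr] at h1
  have e : (P 0 ^ 2 + P 1 ^ 2) * orient P (c q) (c r) = a q * b r - b q * a r := by
    simp only [a, b, orient]; ring
  have hP : 0 < P 0 ^ 2 + P 1 ^ 2 := by
    by_contra! hle
    have p0 : P 0 = 0 := by nlinarith [sq_nonneg (P 0), sq_nonneg (P 1)]
    have p1 : P 1 = 0 := by nlinarith [sq_nonneg (P 0), sq_nonneg (P 1)]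
    simp only [a, p0, p1] at hq
    linarith
  refine nonneg_of_mul_nonneg_right (a := P 0 ^ 2 + P 1 ^ 2) ?_ hP
  linarith

lemma exists_combination_of_orient_eq_zero {P Q R : Plane} (hQ : Q ≠ P) (h : orient P Q R = 0) :
    ∃ s : ℝ, R = P + s • (Q - P) := by
  have h1 : 0 < (Q 0 - P 0) ^ 2 + (Q 1 - P 1) ^ 2 := by
    have h2 := norm_pos_iff.2 (sub_ne_zero.2 hQ)
    have := plane_norm_sq (Q - P)
    simp only [PiLp.sub_apply] at this
    rw [← this]; positivity
  refine ⟨((R 0 - P 0) * (Q 0 - P 0) + (R 1 - P 1) * (Q 1 - P 1)) /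
    ((Q 0 - P 0) ^ 2 + (Q 1 - P 1) ^ 2), ?_⟩
  simp only [orient] at h
  apply plane_ext <;> simp only [PiLp.add_apply, PiLp.smul_apply, PiLp.sub_apply, smul_eq_mul] <;>
    field_simp
  · linear_combination -(Q 1 - P 1) * h
  · linear_combination (Q 0 - P 0) * h

/-- Points that are not in convex position contain a point in a triangle of others. -/
lemma exists_inTri {n : ℕ} (hn : ∀ p q r : Fin (n + 1), ∃ x, x ≠ p ∧ x ≠ q ∧ x ≠ r)
    {c : Fin (n + 1) → Plane} (hc : Function.Injective c)
    (hs : ∀ i j, 0 < i → i < j → 0 ≤ orient (c 0) (c i) (c j))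
    (h : ¬ ∀ i j k, i < j → j < k → 0 < orient (c i) (c j) (c k)) :
    ∃ a b d p, a ≠ b ∧ a ≠ d ∧ b ≠ d ∧ a ≠ p ∧ b ≠ p ∧ d ≠ p ∧ InTri (c p) (c a) (c b) (c d) := by
  -- Of three collinear points one lies between the others, hence in a degenerate sense in their
  -- triangle with any fourth point `x`.
  have hcol : ∀ p q r, p ≠ q → p ≠ r → q ≠ r → orient (c p) (c q) (c r) = 0 →
      ∃ a b d p, a ≠ b ∧ a ≠ d ∧ b ≠ d ∧ a ≠ p ∧ b ≠ p ∧ d ≠ p ∧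
        InTri (c p) (c a) (c b) (c d) := by
    intro p q r hpq hpr hqr h0
    obtain ⟨x, hxp, hxq, hxr⟩ := hn p q r
    obtain ⟨s, hs⟩ := exists_combination_of_orient_eq_zero (hc.ne hpq.symm) h0
    rcases le_total s 0 with h1 | h1
    · refine ⟨q, r, x, p, hqr, hxq.symm, hxr.symm, hpq.symm, hpr.symm, hxp, -s / (1 - s),
        1 / (1 - s), 0, div_nonneg (by linarith) (by linarith), div_nonneg (by linarith)
        (by linarith), le_rfl, ?_, ?_⟩
      · have : 1 - s ≠ 0 := by linarith
        field_simp; ring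
      · have : 1 - s ≠ 0 := by linarith
        rw [hs, zero_smul, add_zero]
        have : (1 : ℝ) - s ≠ 0 := by linarith
        apply plane_ext <;>
          simp only [PiLp.add_apply, PiLp.smul_apply, PiLp.sub_apply, smul_eq_mul] <;>
          field_simp <;> ring
    · rcases le_total s 1 with h2 | h2
      · refine ⟨p, q, x, r, hpq, hxp.symm, hxq.symm, hpr, hqr, hxr, 1 - s, s, 0, by linarith, h1,
          le_rfl, by ring, ?_⟩
        rw [hs]; module
      · refine ⟨p, r, x, q, hpr, hxp.symm, hxr.symm, hpq, hqr.symm, hxq, 1 - 1 / s, 1 / s, 0, ?_,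
          by positivity, le_rfl, by ring, ?_⟩
        · rw [sub_nonneg]; exact div_le_one_of_le₀ h2 h1
        · have : s ≠ 0 := by linarith
          rw [hs, zero_smul, add_zero]
          apply plane_ext <;>
            simp only [PiLp.add_apply, PiLp.smul_apply, PiLp.sub_apply, smul_eq_mul] <;>
            field_simp <;> ring
  push Not at h
  obtain ⟨i, j, k, hij, hjk, hle⟩ := h
  rcases (Fin.zero_le i).eq_or_lt with rfl | hi
  · exact hcol 0 j k hij.ne (hij.trans hjk).ne hjk.ne (le_antisymm hle (hs j k hij hjk))
  · rcases (hs i k hi (hij.trans hjk)).eq_or_lt with h0 | hT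
    · exact hcol 0 i k hi.ne (hi.trans (hij.trans hjk)).ne (hij.trans hjk).ne h0.symm
    -- The points are sorted by direction from the point `0`, so a reflex corner at `j` means that
    -- `j` lies in the triangle of `0, i, k`. The quotients of signed areas are its barycentric
    -- coordinates.
    · refine ⟨0, i, k, j, hi.ne, (hi.trans (hij.trans hjk)).ne, (hij.trans hjk).ne,
        (hi.trans hij).ne, hij.ne, hjk.ne', ?_⟩
      have h1 := hs i j hi hij
      have h2 := hs j k (hi.trans hij) hjk
      refine ⟨-orient (c i) (c j) (c k) / orient (c 0) (c i) (c k),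
        orient (c 0) (c j) (c k) / orient (c 0) (c i) (c k),
        orient (c 0) (c i) (c j) / orient (c 0) (c i) (c k), div_nonneg (by linarith) hT.le,
        div_nonneg h2 hT.le, div_nonneg h1 hT.le, ?_, ?_⟩
      · rw [← add_div, ← add_div, div_eq_one_iff_eq hT.ne']
        simp only [orient]; ring
      · have hT' := hT.ne'
        apply plane_ext <;> simp only [PiLp.add_apply, PiLp.smul_apply, smul_eq_mul] <;>
          field_simp <;> simp only [orient] <;> ring

lemma injective_of_two_le_dist {κ : Type*} {c : κ → Plane}
    (hc : Pairwise fun i j => 2 ≤ dist (c i) (c j)) : Function.Injective c := fun i j h => by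
  by_contra hne
  have : 2 ≤ dist (c i) (c j) := hc hne
  rw [h, dist_self] at this
  linarith

lemma four_le_hullPerim (c : Fin 2 → Plane) (hc : Pairwise fun i j => 2 ≤ dist (c i) (c j)) :
    4 ≤ hullPerim c := by
  have h1 := two_mul_dist_le_hullPerim c 0 1
  have h2 := hc (show (0 : Fin 2) ≠ 1 by decide)
  linarith

lemma six_le_hullPerim (c : Fin 3 → Plane) (hc : Pairwise fun i j => 2 ≤ dist (c i) (c j)) :
    6 ≤ hullPerim c := by
  have h1 := triangle_le_hullPerim c 0 1 2
  have h2 := hc (show (0 : Fin 3) ≠ 1 by decide)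
  have h3 := hc (show (1 : Fin 3) ≠ 2 by decide)
  have h4 := hc (show (2 : Fin 3) ≠ 0 by decide)
  linarith

lemma eight_le_hullPerim (c : Fin 4 → Plane) (hc : Pairwise fun i j => 2 ≤ dist (c i) (c j)) :
    8 ≤ hullPerim c := by
  have hinj := injective_of_two_le_dist hc
  obtain ⟨e, he⟩ := exists_perm_orient_nonneg hinj
  have hc' : Pairwise fun i j => 2 ≤ dist (c (e i)) (c (e j)) := fun i j hij =>
    hc (e.injective.ne hij)
  refine le_trans ?_ (hullPerim_comp_le c e)
  by_cases h : ∀ i j k, i < j → j < k → 0 < orient (c (e i)) (c (e j)) (c (e k))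
  · have h1 := quadrilateral_le_hullPerim (fun i => c (e i)) 0 1 2 3 fun θ =>
      interlocked_of_orient (h 1 2 3 (by decide) (by decide)) (h 0 1 3 (by decide) (by decide))
        (h 0 2 3 (by decide) (by decide)) (h 0 1 2 (by decide) (by decide)) θ
    have h2 := hc' (show (0 : Fin 4) ≠ 1 by decide)
    have h3 := hc' (show (1 : Fin 4) ≠ 2 by decide)
    have h4 := hc' (show (2 : Fin 4) ≠ 3 by decide)
    have h5 := hc' (show (3 : Fin 4) ≠ 0 by decide)
    linarith
  · obtain ⟨a, b, d, p, h1, h2, h3, h4, h5, h6, h7⟩ := exists_inTri (by decide)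
      (c := fun i => c (e i)) (hinj.comp e.injective) he h
    have := nine_le_of_inTri hc' h1 h2 h3 h4 h5 h6 h7
    linarith

lemma ten_le_hullPerim (c : Fin 5 → Plane) (hc : Pairwise fun i j => 2 ≤ dist (c i) (c j)) :
    10 ≤ hullPerim c := by
  have hinj := injective_of_two_le_dist hc
  obtain ⟨e, he⟩ := exists_perm_orient_nonneg hinj
  have hc' : Pairwise fun i j => 2 ≤ dist (c (e i)) (c (e j)) := fun i j hij =>
    hc (e.injective.ne hij)
  refine le_trans ?_ (hullPerim_comp_le c e)
  by_cases h : ∀ i j k, i < j → j < k → 0 < orient (c (e i)) (c (e j)) (c (e k))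
  · have h1 := pentagon_le_hullPerim (fun i => c (e i)) h
    have h2 := hc' (show (0 : Fin 5) ≠ 1 by decide)
    have h3 := hc' (show (1 : Fin 5) ≠ 2 by decide)
    have h4 := hc' (show (2 : Fin 5) ≠ 3 by decide)
    have h5 := hc' (show (3 : Fin 5) ≠ 4 by decide)
    have h6 := hc' (show (4 : Fin 5) ≠ 0 by decide)
    linarith
  · obtain ⟨a, b, d, p, h1, h2, h3, h4, h5, h6, h7⟩ := exists_inTri (by decide)
      (c := fun i => c (e i)) (hinj.comp e.injective) he h
    have hex : ∀ a b d p : Fin 5, ∃ x, x ≠ a ∧ x ≠ b ∧ x ≠ d ∧ x ≠ p := by decide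
    obtain ⟨x, x1, x2, x3, x4⟩ := hex a b d p
    have := ten_le_of_inTri hc' h1 h2 h3 h4 h5 h6 x1 x2 x3 x4 h7
    linarith

/-- The hull of `n ≤ 5` points at mutual distances at least `2` has perimeter at least `2n`. -/
lemma two_mul_le_hullPerim {n : ℕ} [NeZero n] (hn : n ≤ 5) (hn2 : 2 ≤ n) (c : Fin n → Plane)
    (hc : Pairwise fun i j => 2 ≤ dist (c i) (c j)) : 2 * n ≤ hullPerim c := by
  interval_cases n <;> norm_num
  exacts [four_le_hullPerim c hc, six_le_hullPerim c hc, eight_le_hullPerim c hc,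
    ten_le_hullPerim c hc]

/-- `P_n ≥ 2π + 2n` for `2 ≤ n ≤ 5`. -/
lemma ofReal_le_peri {n : ℕ} (hn : n ≤ 5) (hn2 : 2 ≤ n) :
    ENNReal.ofReal (2 * π + 2 * n) ≤ peri n := by
  have : NeZero n := ⟨by omega⟩
  exact le_peri fun c hc => two_mul_le_hullPerim hn hn2 c hc

lemma ofReal_le_peri_one : ENNReal.ofReal (2 * π) ≤ peri 1 := by
  simpa using le_peri (n := 1) (r := 0) fun c _ => hullPerim_nonneg c

end Position

/-! ### Linking from winding numbers -/

/-- A loop on which a function `F` has non-zero winding number is linked to the zero set of `F`. -/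
lemma topologicallyLinked_of_exp_eq {A B : Set Space} {γ : ℝ → Space}
    (hγ : ContinuousOn γ (Icc 0 1)) (hA : ∀ t ∈ Icc (0 : ℝ) 1, γ t ∈ A) (h01 : γ 0 = γ 1)
    {F : Space → ℂ} (hF : Continuous F) (hB : ∀ x, F x = 0 → x ∈ B) {L : ℝ → ℂ}
    (hL : ContinuousOn L (Icc 0 1)) (hexp : ∀ t ∈ Icc (0 : ℝ) 1, Complex.exp (L t) = F (γ t))
    (hne : L 0 ≠ L 1) : TopologicallyLinked A B := by
  rintro ⟨h, h1, h2⟩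
  have hm0 : (0 : ℝ) ∈ Icc (0 : ℝ) 1 := by simp
  have hm1 : (1 : ℝ) ∈ Icc (0 : ℝ) 1 := by simp
  have hball : ∀ t ∈ Icc (0 : ℝ) 1, h (γ t) ∈ ball (0 : Space) 1 := fun t ht =>
    h1 ⟨_, hA t ht, rfl⟩
  have hcv : Convex ℝ (ball (0 : Space) 1) := convex_ball 0 1
  have : ContractibleSpace (ball (0 : Space) 1) := hcv.contractibleSpace ⟨_, hball 0 hm0⟩
  have : LocallyPathConnectedSpace (ball (0 : Space) 1) := isOpen_ball.locallyPathConnectedSpace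
  -- If the sets were separated, `F` would be nonvanishing on the ball that contains the loop. The
  -- ball is contractible, so `F` has a continuous logarithm there. It agrees along the loop with
  -- `L` by uniqueness of lifts, so `L` would return to its initial value.
  let f : C(ball (0 : Space) 1, ℂ) := ⟨fun x => F (h.symm x), by fun_prop⟩
  have hf0 : ∀ x, f x ∈ ({0}ᶜ : Set ℂ) := fun x hx => by
    have := hB _ hx
    exact disjoint_left.1 h2 ⟨_, this, h.apply_symm_apply _⟩ (ball_subset_closedBall x.2)
  obtain ⟨ℓ, ⟨hℓ0, hℓ⟩, -⟩ := Complex.isCoveringMapOn_exp.existsUnique_continuousMap_lifts f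
    (a₀ := ⟨h (γ 0), hball 0 hm0⟩) (e₀ := L 0)
    (by rw [hexp 0 hm0]; simp [f]) hf0
  have hm : ∀ t : Icc (0 : ℝ) 1, Complex.exp (L t) = f ⟨h (γ t), hball t t.2⟩ := fun t => by
    rw [hexp t t.2]; simp [f]
  have hcov := Complex.isCoveringMap_exp
  have key := hcov.isSeparatedMap.eq_of_comp_eq hcov.isLocalHomeomorph.isLocallyInjective
    (A := Icc (0 : ℝ) 1) (g₁ := fun t => L t) (g₂ := fun t => ℓ ⟨h (γ t), hball t t.2⟩)
    hL.domRestrict (ℓ.continuous.comp (Continuous.subtype_mk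
      (h.continuous.comp hγ.domRestrict) _))
    (by
      funext t
      apply Subtype.ext
      have := congrFun hℓ ⟨h (γ t), hball t t.2⟩
      simp only [Function.comp_apply] at this ⊢
      rw [hm t, this])
    ⟨0, hm0⟩ hℓ0.symm
  have e1 := congrFun key ⟨1, hm1⟩
  have e0 := congrFun key ⟨0, hm0⟩
  simp only [← h01] at e1
  exact hne (e0.trans e1.symm)

lemma TopologicallyLinked.mono {A B A' B' : Set Space} (h : TopologicallyLinked A B) (hA : A ⊆ A')
    (hB : B ⊆ B') : TopologicallyLinked A' B' := fun hs =>
  h (hs.of_image (Homeomorph.refl _) (by simpa using hA) (by simpa using hB))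

/-! ### Space as plane times height -/

/-- The point of space over `x` at height `z`. -/
def lift3 (x : Plane) (z : ℝ) : Space := !₂[x 0, x 1, z]

/-- The orthogonal projection of space onto the horizontal plane. -/
def proj (x : Space) : Plane := !₂[x 0, x 1]

@[simp] lemma lift3_zero (x : Plane) (z : ℝ) : lift3 x z 0 = x 0 := rfl
@[simp] lemma lift3_one (x : Plane) (z : ℝ) : lift3 x z 1 = x 1 := rfl
@[simp] lemma lift3_two (x : Plane) (z : ℝ) : lift3 x z 2 = z := rfl
@[simp] lemma proj_zero (x : Space) : proj x 0 = x 0 := rfl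
@[simp] lemma proj_one (x : Space) : proj x 1 = x 1 := rfl

@[simp] lemma proj_lift3 (x : Plane) (z : ℝ) : proj (lift3 x z) = x := plane_ext rfl rfl

@[simp] lemma lift3_proj (x : Space) : lift3 (proj x) (x 2) = x := by
  ext i; fin_cases i <;> rfl

@[fun_prop] lemma continuous_lift3 : Continuous fun p : Plane × ℝ => lift3 p.1 p.2 := by
  unfold lift3
  refine (PiLp.continuous_toLp 2 _).comp (continuous_pi fun i => ?_)
  fin_cases i <;> simp <;> fun_prop

@[fun_prop] lemma continuous_proj : Continuous proj := by
  unfold proj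
  refine (PiLp.continuous_toLp 2 _).comp (continuous_pi fun i => ?_)
  fin_cases i <;> simp <;> fun_prop

@[fun_prop] lemma Continuous.lift3 {X : Type*} [TopologicalSpace X] {f : X → Plane} {g : X → ℝ}
    (hf : Continuous f) (hg : Continuous g) : Continuous fun x => lift3 (f x) (g x) :=
  continuous_lift3.comp (hf.prodMk hg)

lemma lift3_sub (x y : Plane) (z w : ℝ) : lift3 x z - lift3 y w = lift3 (x - y) (z - w) := by
  ext i; fin_cases i <;> simp [lift3]

lemma inner_lift3 (x y : Plane) (z w : ℝ) : ⟪lift3 x z, lift3 y w⟫ = ⟪x, y⟫ + z * w := by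
  simp [PiLp.inner_apply, Fin.sum_univ_succ, lift3]
  ring

lemma norm_lift3_sq (x : Plane) (z : ℝ) : ‖lift3 x z‖ ^ 2 = ‖x‖ ^ 2 + z ^ 2 := by
  rw [← real_inner_self_eq_norm_sq, inner_lift3, real_inner_self_eq_norm_sq]; ring

lemma dist_lift3_sq (x y : Plane) (z w : ℝ) :
    dist (lift3 x z) (lift3 y w) ^ 2 = dist x y ^ 2 + (z - w) ^ 2 := by
  rw [dist_eq_norm, lift3_sub, norm_lift3_sq, dist_eq_norm]

lemma dist_lift3_same (x y : Plane) (z : ℝ) : dist (lift3 x z) (lift3 y z) = dist x y := by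
  rw [← sq_eq_sq₀ dist_nonneg dist_nonneg, dist_lift3_sq]; ring

lemma lift3_injective {x y : Plane} {z w : ℝ} (h : lift3 x z = lift3 y w) : x = y ∧ z = w :=
  ⟨by simpa using congrArg proj h, by simpa using congrArg (fun p : Space => p 2) h⟩

/-! ### Thickness of plane curves and of separated unions -/

/-- Twice the signed area of a triangle. -/
def area2 (x y z : Plane) : ℝ := (y 0 - x 0) * (z 1 - x 1) - (y 1 - x 1) * (z 0 - x 0)

lemma gram_eq_area2_sq (x y z : Plane) :
    ‖y - x‖ ^ 2 * ‖z - x‖ ^ 2 - ⟪y - x, z - x⟫ ^ 2 = area2 x y z ^ 2 := by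
  simp only [plane_norm_sq, plane_inner, area2, PiLp.sub_apply]; ring

/-- The hypotheses place `y` and `z` between the line through `x` normal to `u` and the circle of
radius `2` tangent to it at `x`: the normal components are at most a quarter of the squared
distances. Expanding the area in this frame bounds it by the mean of the two sides at `x`, which is
no more than the third side. -/
lemma two_mul_abs_area2_le {x y z u : Plane} (hu : ‖u‖ = 1) (hy : 0 ≤ -⟪y - x, u⟫)
    (hy' : 4 * -⟪y - x, u⟫ ≤ ‖y - x‖ ^ 2) (hz : 0 ≤ -⟪z - x, u⟫)
    (hz' : 4 * -⟪z - x, u⟫ ≤ ‖z - x‖ ^ 2) (h1 : ‖y - x‖ ≤ ‖y - z‖) (h2 : ‖z - x‖ ≤ ‖y - z‖) :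
    2 * |area2 x y z| ≤ ‖y - x‖ * ‖z - x‖ * ‖y - z‖ := by
  obtain ⟨α, rfl⟩ := exists_uvec_eq hu
  have e : area2 x y z = ⟪y - x, uvec α⟫ * ⟪z - x, uperp α⟫ - ⟪y - x, uperp α⟫ * ⟪z - x, uvec α⟫ := by
    have := sin_sq_add_cos_sq α
    simp only [plane_inner, area2, PiLp.sub_apply, uvec_zero', uvec_one', uperp_zero', uperp_one']
    linear_combination (-((y 0 - x 0) * (z 1 - x 1) - (y 1 - x 1) * (z 0 - x 0))) * this
  have b1 : |⟪y - x, uperp α⟫| ≤ ‖y - x‖ := by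
    simpa [norm_uperp] using abs_real_inner_le_norm (y - x) (uperp α)
  have b2 : |⟪z - x, uperp α⟫| ≤ ‖z - x‖ := by
    simpa [norm_uperp] using abs_real_inner_le_norm (z - x) (uperp α)
  have a1 : |⟪y - x, uvec α⟫| ≤ ‖y - x‖ ^ 2 / 4 := by rw [abs_of_nonpos (by linarith)]; linarith
  have a2 : |⟪z - x, uvec α⟫| ≤ ‖z - x‖ ^ 2 / 4 := by rw [abs_of_nonpos (by linarith)]; linarith
  have n1 := norm_nonneg (y - x)
  have n2 := norm_nonneg (z - x)
  calc 2 * |area2 x y z|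
      ≤ 2 * (|⟪y - x, uvec α⟫| * |⟪z - x, uperp α⟫| + |⟪y - x, uperp α⟫| * |⟪z - x, uvec α⟫|) := by
        rw [e, ← abs_mul, ← abs_mul]; linarith [abs_sub (⟪y - x, uvec α⟫ * ⟪z - x, uperp α⟫)
          (⟪y - x, uperp α⟫ * ⟪z - x, uvec α⟫)]
    _ ≤ 2 * (‖y - x‖ ^ 2 / 4 * ‖z - x‖ + ‖y - x‖ * (‖z - x‖ ^ 2 / 4)) := by gcongr
    _ = ‖y - x‖ * ‖z - x‖ * ((‖y - x‖ + ‖z - x‖) / 2) := by ring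
    _ ≤ _ := by gcongr; linarith

/-- A plane set which is everywhere enclosed by a disk of radius `2` on one side and a line on the
other, is thick in every plane of space. -/
lemma thick_image_of_supported {A : Set Plane} {f : Plane → Space}
    (hf : ∀ x y z, ⟪f y - f x, f z - f x⟫ = ⟪y - x, z - x⟫)
    (h : ∀ x ∈ A, ∃ u : Plane, ‖u‖ = 1 ∧ ∀ y ∈ A, 0 ≤ -⟪y - x, u⟫ ∧ 4 * -⟪y - x, u⟫ ≤ ‖y - x‖ ^ 2) :
    Thick 1 (f '' A) := by
  have hn : ∀ x y, ‖f y - f x‖ = ‖y - x‖ := fun x y => by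
    rw [← sq_eq_sq₀ (norm_nonneg _) (norm_nonneg _), ← real_inner_self_eq_norm_sq, hf,
      real_inner_self_eq_norm_sq]
  rintro _ ⟨x, hx, rfl⟩ _ ⟨y, hy, rfl⟩ _ ⟨z, hz, rfl⟩ - - -
  rw [hf, hn, hn, hn, gram_eq_area2_sq]
  have key : 2 * |area2 x y z| ≤ ‖y - x‖ * ‖z - x‖ * ‖y - z‖ := by
    -- The inequality is symmetric in the three points, so the estimate may be made at the vertex
    -- opposite a longest side.
    have cyc : ∀ x ∈ A, ∀ y ∈ A, ∀ z ∈ A, ‖y - x‖ ≤ ‖y - z‖ → ‖z - x‖ ≤ ‖y - z‖ →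
        2 * |area2 x y z| ≤ ‖y - x‖ * ‖z - x‖ * ‖y - z‖ := fun x hx y hy z hz h1 h2 => by
      obtain ⟨u, hu, hu'⟩ := h x hx
      exact two_mul_abs_area2_le hu (hu' y hy).1 (hu' y hy).2 (hu' z hz).1 (hu' z hz).2 h1 h2
    have r1 : area2 y z x = area2 x y z := by simp only [area2]; ring
    have r2 : area2 z x y = area2 x y z := by simp only [area2]; ring
    have c1 := cyc x hx y hy z hz
    have c2 := cyc y hy z hz x hx
    have c3 := cyc z hz x hx y hy
    rw [r1] at c2
    rw [r2] at c3
    have s1 := norm_sub_rev x y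
    have s2 := norm_sub_rev z y
    have s3 := norm_sub_rev x z
    rw [s2, s1] at c2
    rw [s3, s1] at c3
    rcases le_total ‖y - x‖ ‖y - z‖ with h1 | h1 <;> rcases le_total ‖z - x‖ ‖y - z‖ with h2 | h2 <;>
      rcases le_total ‖z - x‖ ‖y - x‖ with h3 | h3
    all_goals first
      | exact c1 h1 h2
      | exact (c2 (by assumption) (by assumption)).trans (le_of_eq (by ring))
      | exact (c3 (by assumption) (by assumption)).trans (le_of_eq (by ring))
      | exact (c2 (by linarith) (by linarith)).trans (le_of_eq (by ring))
  have := mul_self_le_mul_self (by positivity) key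
  have e := abs_mul_abs_self (area2 x y z)
  nlinarith [this, e]

/-- A circle through two points at distance at least `2` has radius at least `1`, so only triples
within one of the sets need the hypothesis on the sets. -/
lemma thick_iUnion {ι : Type*} {A : ι → Set Space} (h : ∀ i, Thick 1 (A i))
    (hd : ∀ i j, i ≠ j → ∀ x ∈ A i, ∀ y ∈ A j, 2 ≤ dist x y) : Thick 1 (⋃ i, A i) := by
  intro x hx y hy z hz h1 h2 h3
  obtain ⟨i, hi⟩ := mem_iUnion.1 hx
  obtain ⟨j, hj⟩ := mem_iUnion.1 hy
  obtain ⟨k, hk⟩ := mem_iUnion.1 hz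
  have sq : ∀ {a b : Space}, 2 ≤ dist a b → 4 ≤ ‖a - b‖ ^ 2 := fun {a b} hab => by
    rw [dist_eq_norm] at hab; nlinarith
  have e : ‖y - z‖ ^ 2 = ‖y - x‖ ^ 2 + ‖z - x‖ ^ 2 - 2 * ⟪y - x, z - x⟫ := by
    rw [← sub_sub_sub_cancel_right y z x, norm_sub_sq_real]; ring
  have pa := sq_nonneg ‖y - x‖
  have pb := sq_nonneg ‖z - x‖
  have pc := sq_nonneg ‖y - z‖
  by_cases hij : i = j
  · by_cases hik : i = k
    · subst hij hik; exact h i x hi y hj z hk h1 h2 h3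
    · have := sq (hd k i (Ne.symm hik) z hk x hi)
      have p1 := mul_nonneg (mul_nonneg pa pc) (sub_nonneg.2 this)
      rw [e] at p1 ⊢
      nlinarith [sq_nonneg (‖y - x‖ ^ 2 - ⟪y - x, z - x⟫)]
  · have := sq (hd j i (Ne.symm hij) y hj x hi)
    have p1 := mul_nonneg (mul_nonneg pb pc) (sub_nonneg.2 this)
    rw [e] at p1 ⊢
    nlinarith [sq_nonneg (‖z - x‖ ^ 2 - ⟪y - x, z - x⟫)]

lemma infDist_add_smul {C : Set Plane} {q u : Plane} (hq : q ∈ C) (hu : ‖u‖ = 1)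
    (h : ∀ x ∈ C, ⟪x - q, u⟫ ≤ 0) {s : ℝ} (hs : 0 ≤ s) : infDist (q + s • u) C = s := by
  apply le_antisymm
  · refine (infDist_le_dist_of_mem hq).trans (le_of_eq ?_)
    rw [dist_eq_norm, add_sub_cancel_left, norm_smul, hu, mul_one, Real.norm_of_nonneg hs]
  · refine (le_infDist ⟨q, hq⟩).2 fun x hx => ?_
    have h1 := real_inner_le_norm (q + s • u - x) u
    have h2 : ⟪q + s • u - x, u⟫ = s - ⟪x - q, u⟫ := by
      rw [show q + s • u - x = s • u - (x - q) by abel, inner_sub_left, inner_smul_left,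
        real_inner_self_eq_norm_sq, hu]
      simp
    rw [h2, hu, mul_one] at h1
    rw [dist_eq_norm]
    linarith [h x hx]

lemma inner_sub_le_of_convexHull {S : Set Plane} {q u : Plane} {a : ℝ}
    (h : ∀ x ∈ S, ⟪x - q, u⟫ ≤ a) : ∀ x ∈ convexHull ℝ S, ⟪x - q, u⟫ ≤ a := by
  have hc : Convex ℝ {x : Plane | ⟪x - q, u⟫ ≤ a} := by
    have : {x : Plane | ⟪x - q, u⟫ ≤ a} = {x : Plane | ⟪u, x⟫ ≤ a + ⟪u, q⟫} := by
      ext x; simp only [mem_ofPred_eq, inner_sub_left, real_inner_comm x u, real_inner_comm q u]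
      constructor <;> intro h <;> linarith
    rw [this]
    exact convex_halfSpace_le (innerₗ Plane u).isLinear _
  exact convexHull_min h hc

/-- A boundary point of a parallel body of a convex set is determined by its direction. -/
lemma eq_of_infDist_eq {C : Set Plane} (hC : Convex ℝ C) (hCc : IsCompact C) {c p w : Plane}
    (hc : c ∈ C) {r lam : ℝ} (hr : 0 < r) (hlam : 0 < lam) (hp : infDist (c + p) C = r)
    (hw : infDist (c + w) C = r) (h : w = lam • p) : w = p := by
  -- Shrinking towards a point `c` of the convex set, by a factor below `1`, strictly decreases a
  -- positive distance to the set.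
  have key : ∀ (p w : Plane) (lam : ℝ), 0 < lam → lam < 1 → infDist (c + p) C = r → w = lam • p →
      infDist (c + w) C < r := by
    intro p w lam h0 h1 hp hw
    obtain ⟨q, hq, hqd⟩ := hCc.exists_infDist_eq_dist ⟨c, hc⟩ (c + p)
    have hm : c + lam • (q - c) ∈ C := hC.add_smul_sub_mem hc hq ⟨h0.le, h1.le⟩
    refine (infDist_le_dist_of_mem hm).trans_lt ?_
    have : c + w - (c + lam • (q - c)) = lam • (c + p - q) := by rw [hw]; module
    rw [dist_eq_norm, this, norm_smul, Real.norm_of_nonneg h0.le, ← dist_eq_norm, ← hqd, hp]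
    nlinarith
  rcases lt_trichotomy lam 1 with h1 | rfl | h1
  · exact absurd hw (key p w lam hlam h1 hp h).ne
  · rw [h, one_smul]
  · refine absurd hp (key w p lam⁻¹ (by positivity) (inv_lt_one_of_one_lt₀ h1) hw ?_).ne
    rw [h, smul_smul, inv_mul_cancel₀ hlam.ne', one_smul]

/-! ### Rims around convex polygons and their rings -/

/-- The combinatorial data of a planar curve at distance `2` from a convex polygon, with vertices
at distance at least `2` from each other: its points are the `foot t + 2 • uvec (angle t)`, where
`foot t` belongs to the polygon and `uvec (angle t)` is an outer normal at it. -/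
structure Rim (n : ℕ) where
  center : Fin n → Plane
  dir : Fin n → ℝ
  foot : ℝ → Plane
  angle : ℝ → ℝ
  continuous_foot : Continuous foot
  continuous_angle : Continuous angle
  foot_one : foot 1 = foot 0
  angle_one : angle 1 = angle 0 + 2 * π
  foot_mem : ∀ t ∈ Icc (0 : ℝ) 1, foot t ∈ convexHull ℝ (range center)
  center_le : ∀ t ∈ Icc (0 : ℝ) 1, ∀ j, ⟪center j - foot t, uvec (angle t)⟫ ≤ 0
  dir_le : ∀ i j, ⟪center j - center i, uvec (dir i)⟫ ≤ 0
  sep : ∀ i j, i ≠ j → 2 ≤ dist (center i) (center j)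
  inj : ∀ s ∈ Ico (0 : ℝ) 1, ∀ t ∈ Ico (0 : ℝ) 1, foot s = foot t →
    uvec (angle s) = uvec (angle t) → s = t
  -- Here the rim is at distance exactly `2` from a ring, which makes the thickness of the link
  -- exactly `1`.
  touch : ∃ t ∈ Icc (0 : ℝ) 1, ∃ i, foot t = center i
  -- An upper bound for the arc length of the rim. By `clock_le` its total is at most `2π + P_n`.
  clock : ℝ → ℝ
  dist_le_clock : ∀ s ∈ Icc (0 : ℝ) 1, ∀ t ∈ Icc (0 : ℝ) 1, s ≤ t →
    dist (foot s) (foot t) + 2 * |angle s - angle t| ≤ clock t - clock s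
  clock_le : ENNReal.ofReal (clock 1 - clock 0 - 2 * π) ≤ peri n

namespace Rim

variable {n : ℕ} (R : Rim n)

/-- The convex polygon of a rim. -/
def hull : Set Plane := convexHull ℝ (range R.center)

lemma convex_hull : Convex ℝ R.hull := convex_convexHull ℝ _

lemma isCompact_hull : IsCompact R.hull := (finite_range R.center).isCompact_convexHull (𝕜 := ℝ)

lemma center_mem (i : Fin n) : R.center i ∈ R.hull := subset_convexHull ℝ _ (mem_range_self i)

lemma hull_le {t : ℝ} (ht : t ∈ Icc (0 : ℝ) 1) {x : Plane} (hx : x ∈ R.hull) :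
    ⟪x - R.foot t, uvec (R.angle t)⟫ ≤ 0 :=
  inner_sub_le_of_convexHull (by rintro _ ⟨j, rfl⟩; exact R.center_le t ht j) x hx

lemma hull_dir_le (i : Fin n) {x : Plane} (hx : x ∈ R.hull) :
    ⟪x - R.center i, uvec (R.dir i)⟫ ≤ 0 :=
  inner_sub_le_of_convexHull (by rintro _ ⟨j, rfl⟩; exact R.dir_le i j) x hx

/-- The point of the rim with parameter `t`. -/
def point (t : ℝ) : Plane := R.foot t + (2 : ℝ) • uvec (R.angle t)

lemma continuous_point : Continuous R.point := by
  have := R.continuous_foot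
  have := R.continuous_angle
  unfold point
  fun_prop

lemma point_one : R.point 1 = R.point 0 := by
  rw [point, point, R.foot_one, R.angle_one, uvec_add_two_pi]

lemma infDist_point {t : ℝ} (ht : t ∈ Icc (0 : ℝ) 1) : infDist (R.point t) R.hull = 2 :=
  infDist_add_smul (R.foot_mem t ht) (norm_uvec _) (fun _ hx => R.hull_le ht hx) zero_le_two

/-- The second inequality says that the rim stays outside the disk of radius `2` around `foot s`.
Expanded, both follow from the normal inequalities at the two feet and `cos ≤ 1`. -/
lemma supported {s t : ℝ} (hs : s ∈ Icc (0 : ℝ) 1) (ht : t ∈ Icc (0 : ℝ) 1) :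
    0 ≤ -⟪R.point t - R.point s, uvec (R.angle s)⟫ ∧
      4 * -⟪R.point t - R.point s, uvec (R.angle s)⟫ ≤ ‖R.point t - R.point s‖ ^ 2 := by
  have h1 := R.hull_le hs (R.foot_mem t ht)
  have h2 := R.hull_le ht (R.foot_mem s hs)
  have e : R.point t - R.point s =
      (R.foot t - R.foot s) + (2 : ℝ) • (uvec (R.angle t) - uvec (R.angle s)) := by
    simp only [point]; module
  have h2' : 0 ≤ ⟪R.foot t - R.foot s, uvec (R.angle t)⟫ := by
    rw [← neg_sub, inner_neg_left] at h2; linarith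
  have e1 : ⟪R.point t - R.point s, uvec (R.angle s)⟫ = ⟪R.foot t - R.foot s, uvec (R.angle s)⟫ +
      2 * (cos (R.angle t - R.angle s) - 1) := by
    rw [e, inner_add_left, inner_smul_left, inner_sub_left (uvec _), inner_uvec_uvec,
      inner_uvec_uvec]
    simp
  have e2 : ‖R.point t - R.point s‖ ^ 2 = ‖R.foot t - R.foot s‖ ^ 2 +
      4 * (⟪R.foot t - R.foot s, uvec (R.angle t)⟫ - ⟪R.foot t - R.foot s, uvec (R.angle s)⟫) +
      8 * (1 - cos (R.angle t - R.angle s)) := by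
    rw [e, norm_add_sq_real, inner_smul_right, inner_sub_right, norm_smul, mul_pow,
      norm_sub_sq_real (uvec (R.angle t)), inner_uvec_uvec, norm_uvec, norm_uvec]
    norm_num; ring
  have h3 := cos_le_one (R.angle t - R.angle s)
  rw [e1, e2]
  constructor
  · linarith
  · nlinarith [sq_nonneg ‖R.foot t - R.foot s‖]

/-- A point has only one nearest point in a convex set; here this comes from adding the normal
inequalities at the two feet. -/
lemma foot_eq_and_uvec_eq {s t : ℝ} (hs : s ∈ Icc (0 : ℝ) 1) (ht : t ∈ Icc (0 : ℝ) 1)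
    (h : R.point s = R.point t) : R.foot s = R.foot t ∧ uvec (R.angle s) = uvec (R.angle t) := by
  have h1 := R.hull_le hs (R.foot_mem t ht)
  have h2 := R.hull_le ht (R.foot_mem s hs)
  have e : R.foot t - R.foot s = (2 : ℝ) • (uvec (R.angle s) - uvec (R.angle t)) := by
    simp only [point] at h
    rw [smul_sub, sub_eq_sub_iff_add_eq_add, ← h, add_comm]
  have h0 : ‖R.foot t - R.foot s‖ ^ 2 ≤ 0 := by
    rw [← real_inner_self_eq_norm_sq]
    nth_rw 2 [e]
    rw [inner_smul_right, inner_sub_right]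
    rw [← neg_sub, inner_neg_left] at h2
    linarith
  have h3 : R.foot t - R.foot s = 0 := by
    rw [← norm_eq_zero]; exact pow_eq_zero_iff two_ne_zero |>.1 (le_antisymm h0 (sq_nonneg _))
  rw [h3] at e
  have e4 := (smul_eq_zero.1 e.symm).resolve_left two_ne_zero
  exact ⟨(sub_eq_zero.1 h3).symm, sub_eq_zero.1 e4⟩

lemma point_injOn : InjOn R.point (Ico 0 1) := fun s hs t ht h =>
  have h' := R.foot_eq_and_uvec_eq (Ico_subset_Icc_self hs) (Ico_subset_Icc_self ht) h
  R.inj s hs t ht h'.1 h'.2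

/-- The rim as a curve in space. -/
def rimCurve : C(UnitAddCircle, Space) :=
  closedCurve (fun t => lift3 (R.point t) 0) (by
    have := R.continuous_point
    exact Continuous.continuousOn (by fun_prop)) (by simp only [R.point_one])

/-- The `i`-th ring in vertical position. -/
def ringPoint (i : Fin n) (t : ℝ) : Space :=
  lift3 (R.center i + (2 * (1 - cos (2 * π * t))) • uvec (R.dir i)) (2 * sin (2 * π * t))

lemma continuous_ringPoint (i : Fin n) : Continuous (R.ringPoint i) := by
  unfold ringPoint; fun_prop

/-- The circle of radius `2` through the `i`-th center. -/
def ringCurve (i : Fin n) : C(UnitAddCircle, Space) :=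
  closedCurve (R.ringPoint i) (R.continuous_ringPoint i).continuousOn (by simp [ringPoint])

lemma range_rimCurve : range R.rimCurve = (fun t => lift3 (R.point t) 0) '' Icc 0 1 :=
  range_closedCurve

lemma range_ringCurve (i : Fin n) : range (R.ringCurve i) = R.ringPoint i '' Icc 0 1 :=
  range_closedCurve

lemma rimCurve_injective : Function.Injective R.rimCurve :=
  closedCurve_injective fun _ hs _ ht h => R.point_injOn hs ht (lift3_injective h).1

lemma ringCurve_injective (i : Fin n) : Function.Injective (R.ringCurve i) := by
  refine closedCurve_injective fun s hs t ht h => ?_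
  obtain ⟨h1, h2⟩ := lift3_injective h
  have h3 : (2 * (cos (2 * π * t) - cos (2 * π * s))) • uvec (R.dir i) = 0 := by
    rw [add_right_inj, ← sub_eq_zero, ← sub_smul] at h1
    rw [← h1]; ring_nf
  have h4 : cos (2 * π * s) = cos (2 * π * t) := by
    rcases smul_eq_zero.1 h3 with h | h
    · linarith
    · have := norm_uvec (R.dir i); rw [h] at this; simp at this
  have h5 : cos (2 * π * s - 2 * π * t) = 1 := by
    have hs : sin (2 * π * s) = sin (2 * π * t) := by linarith
    rw [cos_sub, h4, hs]; nlinarith [sin_sq_add_cos_sq (2 * π * t)]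
  rw [Real.cos_eq_one_iff_of_lt_of_lt] at h5
  · have := pi_pos
    have : 2 * π * (s - t) = 0 := by linarith
    rcases mul_eq_zero.1 this with h | h
    · linarith
    · linarith
  · nlinarith [pi_pos, hs.1, hs.2, ht.1, ht.2]
  · nlinarith [pi_pos, hs.1, hs.2, ht.1, ht.2]

/-- With `d = 1 - cos (2πt)` the squared distance is `4 + 8 d (1 - cos (angle - dir))` plus a square
and two terms that are nonnegative by the normal inequalities. -/
lemma two_le_dist_rim_ring (i : Fin n) {s : ℝ} (hs : s ∈ Icc (0 : ℝ) 1) (t : ℝ) :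
    2 ≤ dist (lift3 (R.point s) 0) (R.ringPoint i t) := by
  have h1 := R.center_le s hs i
  have h2 := R.hull_dir_le i (R.foot_mem s hs)
  have h3 := cos_le_one (R.angle s - R.dir i)
  have h4 := cos_le_one (2 * π * t)
  rw [← sq_le_sq₀ zero_le_two dist_nonneg, ringPoint, dist_lift3_sq]
  set d := 1 - cos (2 * π * t) with hd
  have e : R.point s - (R.center i + (2 * d) • uvec (R.dir i)) =
      (R.foot s - R.center i) + (2 : ℝ) • (uvec (R.angle s) - d • uvec (R.dir i)) := by
    simp only [point]; module
  have e2 : dist (R.point s) (R.center i + (2 * d) • uvec (R.dir i)) ^ 2 =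
      ‖R.foot s - R.center i‖ ^ 2 + 4 * (⟪R.foot s - R.center i, uvec (R.angle s)⟫ -
        d * ⟪R.foot s - R.center i, uvec (R.dir i)⟫) +
      4 * (1 - 2 * d * cos (R.angle s - R.dir i) + d ^ 2) := by
    rw [dist_eq_norm, e, norm_add_sq_real, inner_smul_right, inner_sub_right, inner_smul_right,
      norm_smul, mul_pow, norm_sub_sq_real (uvec (R.angle s)), inner_smul_right, inner_uvec_uvec,
      norm_smul, norm_uvec, norm_uvec, mul_one, Real.norm_eq_abs, sq_abs]
    norm_num; ring
  have h1' : 0 ≤ ⟪R.foot s - R.center i, uvec (R.angle s)⟫ := by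
    rw [← neg_sub, inner_neg_left] at h1; linarith
  have e3 : sin (2 * π * t) ^ 2 = 2 * d - d ^ 2 := by
    rw [hd, sin_sq]; ring
  have h0 : 0 ≤ d := by linarith
  have p1 := mul_nonneg h0 (sub_nonneg.2 h3)
  have p2 := mul_nonneg h0 (neg_nonneg.2 h2)
  rw [e2]
  nlinarith [sq_nonneg ‖R.foot s - R.center i‖]

/-- The centers are already at distance `2`, and the rings leave the polygon along outer normals, so
the projections of their points to the plane do not come closer than the centers. -/
lemma two_le_dist_ring_ring {i j : Fin n} (hij : i ≠ j) (s t : ℝ) :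
    2 ≤ dist (R.ringPoint i s) (R.ringPoint j t) := by
  refine (R.sep i j hij).trans ?_
  rw [← sq_le_sq₀ dist_nonneg dist_nonneg, ringPoint, ringPoint, dist_lift3_sq]
  have h1 := R.dir_le i j
  have h2 := R.dir_le j i
  set a := 2 * (1 - cos (2 * π * s))
  set b := 2 * (1 - cos (2 * π * t))
  have ha : 0 ≤ a := by have := cos_le_one (2 * π * s); simp only [a]; linarith
  have hb : 0 ≤ b := by have := cos_le_one (2 * π * t); simp only [b]; linarith
  have e : R.center i + a • uvec (R.dir i) - (R.center j + b • uvec (R.dir j)) =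
    (R.center i - R.center j) + (a • uvec (R.dir i) - b • uvec (R.dir j)) := by abel
  rw [dist_eq_norm, dist_eq_norm, e, norm_add_sq_real, inner_sub_right, inner_smul_right,
    inner_smul_right]
  rw [← neg_sub, inner_neg_left] at h1
  have p1 := mul_nonneg ha (neg_nonpos.1 h1)
  have p2 := mul_nonneg hb (neg_nonneg.2 h2)
  nlinarith [sq_nonneg ‖a • uvec (R.dir i) - b • uvec (R.dir j)‖,
    sq_nonneg (2 * sin (2 * π * s) - 2 * sin (2 * π * t))]

lemma thick_rim : Thick 1 (range R.rimCurve) := by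
  rw [range_rimCurve, show (fun t => lift3 (R.point t) 0) '' Icc (0 : ℝ) 1 =
    (fun x => lift3 x 0) '' (R.point '' Icc 0 1) by rw [image_image]]
  refine thick_image_of_supported (fun x y z => ?_) ?_
  · rw [lift3_sub, lift3_sub, inner_lift3]; ring
  · rintro _ ⟨s, hs, rfl⟩
    refine ⟨uvec (R.angle s), norm_uvec _, ?_⟩
    rintro _ ⟨t, ht, rfl⟩
    exact R.supported hs ht

end Rim

lemma thick_circle (f : Plane → Space) (hf : ∀ x y z, ⟪f y - f x, f z - f x⟫ = ⟪y - x, z - x⟫) :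
    Thick 1 (f '' range fun θ => (2 : ℝ) • uvec θ) := by
  refine thick_image_of_supported hf ?_
  rintro _ ⟨θ, rfl⟩
  refine ⟨uvec θ, norm_uvec θ, ?_⟩
  rintro _ ⟨φ, rfl⟩
  have e1 : ⟪(2 : ℝ) • uvec φ - (2 : ℝ) • uvec θ, uvec θ⟫ = 2 * (cos (φ - θ) - 1) := by
    rw [← smul_sub, inner_smul_left, inner_sub_left, inner_uvec_uvec, inner_uvec_uvec]; simp
  have e2 : ‖(2 : ℝ) • uvec φ - (2 : ℝ) • uvec θ‖ ^ 2 = 8 * (1 - cos (φ - θ)) := by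
    rw [← smul_sub, norm_smul, mul_pow, norm_sub_sq_real, inner_uvec_uvec, norm_uvec, norm_uvec]
    norm_num; ring
  have := cos_le_one (φ - θ)
  simp only [e1, e2]
  constructor <;> linarith

namespace Rim

variable {n : ℕ} (R : Rim n)

lemma thick_ring (i : Fin n) : Thick 1 (range (R.ringCurve i)) := by
  let f : Plane → Space := fun x => lift3 (R.center i + (2 + x 0) • uvec (R.dir i)) (x 1)
  have hf : ∀ x y z, ⟪f y - f x, f z - f x⟫ = ⟪y - x, z - x⟫ := fun x y z => by
    simp only [f, lift3_sub, inner_lift3, add_sub_add_left_eq_sub, ← sub_smul, inner_smul_left,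
      inner_smul_right, real_inner_self_eq_norm_sq, norm_uvec]
    simp [plane_inner]
    ring
  have h := thick_circle f hf
  intro x hx y hy z hz
  have hsub : range (R.ringCurve i) ⊆ f '' range fun θ => (2 : ℝ) • uvec θ := by
    rw [range_ringCurve]
    rintro _ ⟨t, -, rfl⟩
    refine ⟨_, ⟨π - 2 * π * t, rfl⟩, ?_⟩
    simp [f, ringPoint, cos_pi_sub, sin_pi_sub]
    congr 3
    ring
  exact h x (hsub hx) y (hsub hy) z (hsub hz)

/-- The link formed by a rim and the rings around it. -/
def link : Link (n + 1) where
  curve := Fin.cons R.rimCurve R.ringCurve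
  simple i := by
    refine Fin.cases ?_ (fun i => ?_) i
    · exact R.rimCurve_injective
    · exact R.ringCurve_injective i
  disjoint := by
    have aux : ∀ {A B : Set Space}, (∀ x ∈ A, ∀ y ∈ B, 2 ≤ dist x y) → Disjoint A B :=
      fun h => disjoint_left.2 fun x hx hy => by
        have := h x hx x hy; rw [dist_self] at this; linarith
    have h0 : ∀ j, ∀ x ∈ range R.rimCurve, ∀ y ∈ range (R.ringCurve j), 2 ≤ dist x y := by
      intro j x hx y hy
      rw [range_rimCurve] at hx
      rw [range_ringCurve] at hy
      obtain ⟨s, hs, rfl⟩ := hx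
      obtain ⟨t, -, rfl⟩ := hy
      exact R.two_le_dist_rim_ring j hs t
    intro i j
    refine Fin.cases ?_ (fun i => ?_) i <;> refine Fin.cases ?_ (fun j => ?_) j
    · exact fun h => absurd rfl h
    · exact fun _ => aux (h0 j)
    · exact fun _ => (aux (h0 i)).symm
    · intro h
      refine aux fun x hx y hy => ?_
      simp only [Fin.cons_succ, range_ringCurve] at hx hy
      obtain ⟨s, -, rfl⟩ := hx
      obtain ⟨t, -, rfl⟩ := hy
      exact R.two_le_dist_ring_ring (fun e => h (by rw [e])) s t

lemma component_zero : R.link.component 0 = (fun t => lift3 (R.point t) 0) '' Icc 0 1 :=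
  R.range_rimCurve

lemma component_succ (i : Fin n) : R.link.component i.succ = R.ringPoint i '' Icc 0 1 :=
  R.range_ringCurve i

lemma thick_link : Thick 1 R.link.carrier := by
  refine thick_iUnion (fun i => ?_) fun i j hij x hx y hy => ?_
  · refine Fin.cases ?_ (fun i => ?_) i
    · exact R.thick_rim
    · exact R.thick_ring i
  · revert hij hx hy
    refine Fin.cases ?_ (fun i => ?_) i <;> refine Fin.cases ?_ (fun j => ?_) j
    · exact fun h => absurd rfl h
    · rw [component_zero, component_succ]
      rintro - ⟨s, hs, rfl⟩ ⟨t, -, rfl⟩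
      exact R.two_le_dist_rim_ring j hs t
    · rw [component_zero, component_succ]
      rintro - ⟨s, -, rfl⟩ ⟨t, ht, rfl⟩
      rw [dist_comm]
      exact R.two_le_dist_rim_ring i ht s
    · rw [component_succ, component_succ]
      rintro h ⟨s, -, rfl⟩ ⟨t, -, rfl⟩
      exact R.two_le_dist_ring_ring (fun e => h (by rw [e])) s t

/-- The bound from below is `thick_link`. A thickness `r > 1` would keep the rim at distance `2 * r`
from the rings, while the point over a center is at distance `2` from the ring through it. -/
lemma thickness_link : R.link.thickness = 1 := by
  have h1 := (R.link.thick_iff zero_le_one).2 R.thick_link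
  rw [ENNReal.ofReal_one] at h1
  refine le_antisymm (le_of_not_gt fun h => ?_) h1
  obtain ⟨r, hr, hr'⟩ := ENNReal.lt_iff_exists_nnreal_btwn.1 h
  have hr1 : (1 : ℝ) < r := by exact_mod_cast hr
  have hT : Thick r R.link.carrier := (R.link.thick_iff r.2).1 (by simpa using hr'.le)
  obtain ⟨t, ht, i, hi⟩ := R.touch
  have hx : lift3 (R.center i) 0 ∈ R.link.component i.succ := by
    rw [component_succ]; exact ⟨0, by simp, by simp [ringPoint]⟩
  have hy : lift3 (R.point t) 0 ∈ R.link.component 0 := by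
    rw [component_zero]; exact ⟨t, ht, rfl⟩
  have hy' : lift3 (R.point t) 0 ∉ range (R.link.curve i.succ) := fun h' =>
    (Fin.succ_ne_zero i) (R.link.eq_of_mem_component h' hy)
  obtain ⟨s, hs⟩ := hx
  have := hT.two_mul_le_dist r.2 (R.link.simple i.succ) (R.link.component_subset_carrier i.succ)
    (R.link.component_subset_carrier 0 hy) hy' s
  rw [hs, dist_lift3_same, point, hi, dist_self_add_right, norm_smul, norm_uvec] at this
  norm_num at this
  linarith

lemma length_zero_le : R.link.length 0 ≤ ENNReal.ofReal (R.clock 1 - R.clock 0) := by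
  change curveLength R.rimCurve ≤ _
  rw [rimCurve, curveLength_closedCurve]
  refine eVariationOn_le_of_dist_le zero_le_one fun s hs t ht hst => ?_
  refine le_trans ?_ (R.dist_le_clock s hs t ht hst)
  rw [dist_lift3_same, point, point]
  refine (dist_add_add_le _ _ _ _).trans ?_
  rw [dist_smul₀]
  have := dist_uvec_le (R.angle s) (R.angle t)
  simp only [norm_ofNat]
  linarith

lemma length_succ_le (i : Fin n) : R.link.length i.succ ≤ ENNReal.ofReal (4 * π) := by
  change curveLength (R.ringCurve i) ≤ _
  rw [ringCurve, curveLength_closedCurve]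
  have h := eVariationOn_le_of_dist_le (f := R.ringPoint i) (g := fun t => 4 * π * t)
    (zero_le_one (α := ℝ)) (fun s _ t _ hst => ?_)
  · simpa using h
  have h0 : (0 : ℝ) ≤ 4 * π * t - 4 * π * s := by nlinarith [pi_pos]
  rw [← sq_le_sq₀ dist_nonneg h0, ringPoint, ringPoint, dist_lift3_sq, dist_add_left, dist_eq_norm,
    ← sub_smul, norm_smul, norm_uvec, mul_one, Real.norm_eq_abs, sq_abs]
  have h1 := Real.one_sub_sq_div_two_le_cos (x := 2 * π * t - 2 * π * s)
  rw [cos_sub] at h1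
  nlinarith [sin_sq_add_cos_sq (2 * π * t), sin_sq_add_cos_sq (2 * π * s)]

end Rim

/-! ### Linking of the rim with its rings, and tightness -/

/-- The complex coordinate of a vector in the orthonormal basis `uvec α`, `uperp α`. -/
def coord (α : ℝ) (x : Plane) : ℂ := ⟨⟪x, uvec α⟫, ⟪x, uperp α⟫⟩

@[fun_prop] lemma Continuous.coord {X : Type*} [TopologicalSpace X] {f : X → ℝ} {g : X → Plane}
    (hf : Continuous f) (hg : Continuous g) : Continuous fun x => coord (f x) (g x) := by
  have : (fun x => Ropelength.coord (f x) (g x)) = fun x =>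
      (⟪g x, uvec (f x)⟫ : ℂ) + (⟪g x, uperp (f x)⟫ : ℂ) * Complex.I := by
    funext x; apply Complex.ext <;> simp [Ropelength.coord]
  rw [this]
  fun_prop

lemma coord_eq_exp_mul (α β : ℝ) (x : Plane) :
    coord α x = Complex.exp ((β - α : ℝ) * Complex.I) * coord β x := by
  have h := sin_sq_add_cos_sq β
  apply Complex.ext
  · simp only [Complex.mul_re, Complex.exp_ofReal_mul_I_re, Complex.exp_ofReal_mul_I_im, cos_sub,
      sin_sub, coord, plane_inner, uvec_zero', uvec_one', uperp_zero', uperp_one']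
    linear_combination (-x 0 * cos α - x 1 * sin α) * h
  · simp only [Complex.mul_im, Complex.exp_ofReal_mul_I_re, Complex.exp_ofReal_mul_I_im, cos_sub,
      sin_sub, coord, plane_inner, uvec_zero', uvec_one', uperp_zero', uperp_one']
    linear_combination (x 0 * sin α - x 1 * cos α) * h

lemma norm_coord (α : ℝ) (x : Plane) : ‖coord α x‖ = ‖x‖ := by
  rw [← sq_eq_sq₀ (norm_nonneg _) (norm_nonneg _), Complex.sq_norm, Complex.normSq_apply,
    plane_norm_sq]
  have h := sin_sq_add_cos_sq α
  simp [coord, plane_inner]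
  linear_combination (x 0 ^ 2 + x 1 ^ 2) * h

lemma eq_smul_uvec_arg (α : ℝ) (x : Plane) :
    x = ‖x‖ • uvec (α + Complex.arg (coord α x)) := by
  have h := sin_sq_add_cos_sq α
  have h1 := Complex.norm_mul_cos_arg (coord α x)
  have h2 := Complex.norm_mul_sin_arg (coord α x)
  rw [norm_coord] at h1 h2
  generalize Complex.arg (coord α x) = φ at *
  apply plane_ext
  · simp [cos_add]
    simp [coord, plane_inner] at h1 h2
    linear_combination (-x 0) * h - cos α * h1 + sin α * h2
  · simp [sin_add]
    simp [coord, plane_inner] at h1 h2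
    linear_combination (-x 1) * h - sin α * h1 - cos α * h2

namespace Rim

variable {n : ℕ} (R : Rim n)

/-- Seen from a center, a point of the rim deviates from its normal direction by less than a right
angle. So the deviation is given by the principal argument, and the winding number of the rim around
the center is that of `angle`, namely one. -/
lemma two_le_inner_point_sub {t : ℝ} (ht : t ∈ Icc (0 : ℝ) 1) (i : Fin n) :
    2 ≤ ⟪R.point t - R.center i, uvec (R.angle t)⟫ := by
  have h := R.center_le t ht i
  have e : R.point t - R.center i = (2 : ℝ) • uvec (R.angle t) - (R.center i - R.foot t) := by
    simp only [point]; abel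
  rw [e, inner_sub_left, inner_smul_left, real_inner_self_eq_norm_sq, norm_uvec]
  simp
  linarith

lemma coord_mem_slitPlane {t : ℝ} (ht : t ∈ Icc (0 : ℝ) 1) (i : Fin n) :
    coord (R.angle t) (R.point t - R.center i) ∈ Complex.slitPlane :=
  Or.inl (by have := R.two_le_inner_point_sub ht i; simp only [coord]; linarith)

lemma continuous_coord (i : Fin n) :
    Continuous fun t => coord (R.angle t) (R.point t - R.center i) := by
  have := R.continuous_point
  have := R.continuous_angle
  fun_prop

lemma coord_one (i : Fin n) : coord (R.angle 1) (R.point 1 - R.center i) =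
    coord (R.angle 0) (R.point 0 - R.center i) := by
  rw [R.point_one, R.angle_one]
  simp [coord, uvec, uperp]

/-- A point in the horizontal plane at distance `2` from the polygon belongs to the rim. -/
lemma mem_component_zero_iff [NeZero n] (x : Space) :
    x ∈ R.link.component 0 ↔ x 2 = 0 ∧ infDist (proj x) R.hull = 2 := by
  rw [component_zero]
  constructor
  · rintro ⟨t, ht, rfl⟩
    exact ⟨rfl, by rw [proj_lift3]; exact R.infDist_point ht⟩
  · rintro ⟨hz, hx⟩
    let c := R.center 0
    have hc : c ∈ R.hull := R.center_mem 0
    -- A continuous polar angle of the rim around `c`. It grows by `2π` in total, so the rim has a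
    -- point in every direction, and `eq_of_infDist_eq` leaves only one candidate there.
    let Θ : ℝ → ℝ := fun t => R.angle t + Complex.arg (coord (R.angle t) (R.point t - c))
    have hΘ : ContinuousOn Θ (Icc 0 1) := R.continuous_angle.continuousOn.add fun t ht =>
      ((Complex.continuousAt_arg (R.coord_mem_slitPlane ht 0)).comp
        (f := fun t => coord (R.angle t) (R.point t - c)) (R.continuous_coord 0).continuousAt).continuousWithinAt
    have hΘ1 : Θ 1 = Θ 0 + 2 * π := by
      simp only [Θ, c]
      rw [R.coord_one, R.angle_one]
      ring
    have h2π : (0 : ℝ) < 2 * π := by positivity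
    obtain ⟨β, hβ⟩ := exists_eq_smul_uvec (proj x - c)
    have hm := toIcoMod_mem_Ico h2π (Θ 0) β
    rw [← hΘ1] at hm
    obtain ⟨t, ht, hΘt⟩ := intermediate_value_Icc zero_le_one hΘ (Ico_subset_Icc_self hm)
    have hu : uvec (Θ t) = uvec β := by
      have e : Θ t = β - toIcoDiv h2π (Θ 0) β * (2 * π) := by rw [hΘt, toIcoMod, zsmul_eq_mul]
      apply plane_ext <;> simp only [uvec_zero', uvec_one', e, cos_sub_int_mul_two_pi,
        sin_sub_int_mul_two_pi]
    have hp := eq_smul_uvec_arg (R.angle t) (R.point t - c)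
    change _ = _ • uvec (Θ t) at hp
    rw [hu] at hp
    have hpt : infDist (c + (R.point t - c)) R.hull = 2 := by
      rw [add_sub_cancel]; exact R.infDist_point ht
    have hxc : infDist (c + (proj x - c)) R.hull = 2 := by rw [add_sub_cancel]; exact hx
    have hne : ∀ w : Plane, infDist (c + w) R.hull = 2 → 0 < ‖w‖ := fun w hw => by
      refine norm_pos_iff.2 fun h => ?_
      rw [h, add_zero, infDist_zero_of_mem hc] at hw
      norm_num at hw
    have e := eq_of_infDist_eq R.convex_hull R.isCompact_hull hc two_pos
      (div_pos (hne _ hxc) (hne _ hpt)) hpt hxc (by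
        have hp' := hne _ hpt
        generalize ‖R.point t - c‖ = lam at *
        rw [hp, smul_smul, div_mul_cancel₀ _ hp'.ne', ← hβ])
    refine ⟨t, ht, ?_⟩
    rw [sub_left_inj] at e
    simp only [← e]
    nth_rw 2 [← lift3_proj x]
    rw [hz]

lemma ringPoint_mem (i : Fin n) (t : ℝ) : R.ringPoint i t ∈ R.link.component i.succ := by
  rw [component_succ]
  refine ⟨Int.fract t, ⟨Int.fract_nonneg t, (Int.fract_lt_one t).le⟩, ?_⟩
  have e : 2 * π * Int.fract t = 2 * π * t - ⌊t⌋ * (2 * π) := by rw [Int.fract]; ring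
  rw [ringPoint, ringPoint, e, cos_sub_int_mul_two_pi, sin_sub_int_mul_two_pi]

/-- The function `F` vanishes only on the ring: its imaginary part is the distance from the vertical
plane of the ring, its real part compares the distance from the center of the circle with the radius
`2`. On the rim the component along `dir i` is at most `2`, so `F` reduces to the complex coordinate
relative to the polygon vertex, which winds once around `0`. -/
lemma linked_rim_ring (i : Fin n) :
    TopologicallyLinked (R.link.component 0) (R.link.component i.succ) := by
  have hcp := R.continuous_point
  have hca := R.continuous_angle
  let F : Space → ℂ := fun x =>
    ((2 - √((⟪proj x - R.center i, uvec (R.dir i)⟫ - 2) ^ 2 + x 2 ^ 2) : ℝ) : ℂ) +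
      (⟪proj x - R.center i, uperp (R.dir i)⟫ : ℂ) * Complex.I
  refine topologicallyLinked_of_exp_eq (γ := fun t => lift3 (R.point t) 0) (F := F)
    (L := fun t => ((R.angle t - R.dir i : ℝ) : ℂ) * Complex.I +
      Complex.log (coord (R.angle t) (R.point t - R.center i)))
    (Continuous.continuousOn (by fun_prop)) (fun t ht => ?_) (by simp only [R.point_one]) ?_
    (fun x hx => ?_) ?_ (fun t ht => ?_) ?_
  · rw [component_zero]; exact ⟨t, ht, rfl⟩
  · simp only [F]; fun_prop
  · have h1 := congrArg Complex.re hx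
    have h2 := congrArg Complex.im hx
    simp [F] at h1 h2
    set ξ := ⟪proj x - R.center i, uvec (R.dir i)⟫ with hξ
    have h3 : (ξ - 2) ^ 2 + x 2 ^ 2 = 4 := by
      rw [← Real.sq_sqrt (by positivity : 0 ≤ (ξ - 2) ^ 2 + x 2 ^ 2),
        show √((ξ - 2) ^ 2 + x 2 ^ 2) = 2 by linarith]
      norm_num
    obtain ⟨α, hα⟩ := exists_uvec_eq (w := !₂[(2 - ξ) / 2, x 2 / 2]) (by
      rw [← sq_eq_sq₀ (norm_nonneg _) zero_le_one, plane_norm_sq]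
      simp
      linarith)
    have hc : cos α = (2 - ξ) / 2 := by simpa using congrArg (fun p : Plane => p 0) hα
    have hs : sin α = x 2 / 2 := by simpa using congrArg (fun p : Plane => p 1) hα
    have hmem := R.ringPoint_mem i (α / (2 * π))
    convert hmem using 1
    rw [ringPoint, mul_div_cancel₀ _ (by positivity), hc, hs]
    nth_rw 1 [← lift3_proj x]
    congr 1
    · have h4 : proj x - R.center i = ξ • uvec (R.dir i) := by
        have h := sin_sq_add_cos_sq (R.dir i)
        rw [plane_inner] at h2 hξ
        simp at h2 hξ
        apply plane_ext <;> rw [hξ] <;> simp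
        · linear_combination (-(x 0 - R.center i 0)) * h - sin (R.dir i) * h2
        · linear_combination (-(x 1 - R.center i 1)) * h + cos (R.dir i) * h2
      rw [← sub_eq_iff_eq_add', h4]
      congr 1
      ring
    · ring
  · refine ContinuousOn.add (Continuous.continuousOn (by fun_prop)) ?_
    exact (R.continuous_coord i).continuousOn.clog fun t ht => R.coord_mem_slitPlane ht i
  · have h1 := R.hull_dir_le i (R.foot_mem t ht)
    rw [Complex.exp_add, Complex.exp_log (Complex.slitPlane_ne_zero (R.coord_mem_slitPlane ht i)),
      ← coord_eq_exp_mul]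
    have hle : ⟪R.point t - R.center i, uvec (R.dir i)⟫ ≤ 2 := by
      have e : R.point t - R.center i =
        (R.foot t - R.center i) + (2 : ℝ) • uvec (R.angle t) := by simp only [point]; abel
      rw [e, inner_add_left, inner_smul_left, inner_uvec_uvec]
      have := cos_le_one (R.angle t - R.dir i)
      simp
      linarith
    apply Complex.ext
    · simp only [coord, F, proj_lift3, lift3_two]
      rw [zero_pow two_ne_zero, add_zero, Real.sqrt_sq_eq_abs, abs_of_nonpos (by linarith)]
      simp
    · simp [coord, F]
  · intro h
    rw [R.coord_one, R.angle_one, add_left_inj] at h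
    have := congrArg Complex.im h
    simp at this

/-- The rim is the zero set of `F x = (infDist (proj x) hull - 2) + i x₂`. Along the ring the
distance to the polygon is `2 (1 - cos)`, so `F` runs once around the circle of radius `2`. -/
lemma linked_ring_rim (i : Fin n) :
    TopologicallyLinked (R.link.component i.succ) (R.link.component 0) := by
  have : NeZero n := ⟨fun h => by subst h; exact i.elim0⟩
  let F : Space → ℂ := fun x => ((infDist (proj x) R.hull - 2 : ℝ) : ℂ) + ((x 2 : ℝ) : ℂ) * Complex.I
  refine topologicallyLinked_of_exp_eq (γ := R.ringPoint i) (F := F)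
    (L := fun t => (Real.log 2 : ℂ) + ((π - 2 * π * t : ℝ) : ℂ) * Complex.I)
    (R.continuous_ringPoint i).continuousOn (fun t _ => R.ringPoint_mem i t) (by simp [ringPoint])
    ?_ (fun x hx => ?_) (Continuous.continuousOn (by fun_prop)) (fun t ht => ?_) ?_
  · have : Continuous fun x : Space => infDist (proj x) R.hull :=
      (continuous_infDist_pt _).comp continuous_proj
    simp only [F]; fun_prop
  · have h1 := congrArg Complex.re hx
    have h2 := congrArg Complex.im hx
    simp [F] at h1 h2
    rw [mem_component_zero_iff]
    exact ⟨h2, by linarith⟩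
  · have hd : infDist (proj (R.ringPoint i t)) R.hull = 2 * (1 - cos (2 * π * t)) := by
      rw [ringPoint, proj_lift3]
      refine infDist_add_smul (R.center_mem i) (norm_uvec _) (fun _ hx => R.hull_dir_le i hx) ?_
      have := cos_le_one (2 * π * t)
      linarith
    simp only [F]
    rw [hd, Complex.exp_add, ← Complex.ofReal_exp, Real.exp_log two_pos, Complex.exp_mul_I,
      ← Complex.ofReal_cos, ← Complex.ofReal_sin, cos_pi_sub, sin_pi_sub, ringPoint, lift3_two]
    push_cast
    ring
  · intro h
    have := congrArg Complex.im h
    simp at this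
    linarith [pi_pos]

lemma linkedToSublinks_zero : R.link.LinkedToSublinks 0 n := by
  refine ⟨fun i => i.1.pred i.2, fun j => (R.linked_rim_ring j).mono subset_rfl ?_⟩
  exact subset_iUnion₂_of_subset ⟨j.succ, Fin.succ_ne_zero j⟩ (Fin.pred_succ j) subset_rfl

/-- All other components together form one sublink, linked to the ring because it contains the rim.
The bound for the ring is therefore the one with `n = 1`, namely `2π + P_1 = 4π`. -/
lemma linkedToSublinks_succ (i : Fin n) : R.link.LinkedToSublinks i.succ 1 := by
  refine ⟨fun _ => 0, fun j => (R.linked_ring_rim i).mono subset_rfl ?_⟩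
  exact subset_iUnion₂_of_subset ⟨0, (Fin.succ_ne_zero i).symm⟩ (Subsingleton.elim _ _) subset_rfl

lemma length_zero : R.link.length 0 = ENNReal.ofReal (2 * π) + peri n := by
  refine le_antisymm ?_ (Link.le_length R.thick_link R.linkedToSublinks_zero)
  refine R.length_zero_le.trans ?_
  have h : R.clock 1 - R.clock 0 = 2 * π + (R.clock 1 - R.clock 0 - 2 * π) := by ring
  rw [h]
  exact ENNReal.ofReal_add_le.trans (add_le_add_right R.clock_le _)

lemma length_succ (i : Fin n) : R.link.length i.succ = ENNReal.ofReal (2 * π) + peri 1 := by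
  refine le_antisymm ?_ (Link.le_length R.thick_link (R.linkedToSublinks_succ i))
  refine (R.length_succ_le i).trans ?_
  rw [show 4 * π = 2 * π + 2 * π by ring, ENNReal.ofReal_add (by positivity) (by positivity)]
  exact add_le_add_right ofReal_le_peri_one _

lemma isTight_link : R.link.IsTight := by
  refine Link.isTight_of_length_eq R.thickness_link.ge fun k => ?_
  refine Fin.cases ?_ (fun i => ?_) k
  · exact ⟨n, R.linkedToSublinks_zero, R.length_zero⟩
  · exact ⟨1, R.linkedToSublinks_succ i, R.length_succ i⟩

end Rim

/-! ### Rims of equilateral polygons -/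

lemma polyPath_sub {E : Type*} [NormedAddCommGroup E] [NormedSpace ℝ E] (v : ℕ → E) (N : ℕ)
    (x y : ℝ) : polyPath v N y - polyPath v N x =
      ∑ k ∈ Finset.range N, (ramp (y - k) - ramp (x - k)) • (v (k + 1) - v k) := by
  simp only [polyPath, add_sub_add_left_eq_sub, ← Finset.sum_sub_distrib, ← sub_smul]

lemma dist_polyPath_add_le (v : ℕ → Plane) (a g : ℕ → ℝ) (N : ℕ)
    (h : ∀ k < N, dist (v k) (v (k + 1)) + 2 * |a (k + 1) - a k| ≤ g (k + 1) - g k) {x y : ℝ}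
    (hxy : x ≤ y) : dist (polyPath v N x) (polyPath v N y) +
      2 * |polyPath a N x - polyPath a N y| ≤ polyPath g N y - polyPath g N x := by
  rw [dist_comm, dist_eq_norm, abs_sub_comm, polyPath_sub, polyPath_sub, polyPath_sub]
  refine (add_le_add (norm_sum_le _ _)
    (mul_le_mul_of_nonneg_left (Finset.abs_sum_le_sum_abs _ _) zero_le_two)).trans ?_
  rw [Finset.mul_sum, ← Finset.sum_add_distrib]
  refine Finset.sum_le_sum fun k hk => ?_
  have h0 : 0 ≤ ramp (y - k) - ramp (x - k) := sub_nonneg.2 (ramp_mono (by linarith))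
  have h1 := h k (Finset.mem_range.1 hk)
  rw [dist_comm, dist_eq_norm] at h1
  rw [norm_smul, smul_eq_mul, smul_eq_mul, abs_mul, Real.norm_eq_abs, abs_of_nonneg h0]
  nlinarith

lemma polyPath_mono {a : ℕ → ℝ} (ha : Monotone a) (N : ℕ) : Monotone (polyPath a N) := fun x y h => by
  rw [← sub_nonneg, polyPath_sub]
  exact Finset.sum_nonneg fun k _ => smul_nonneg (sub_nonneg.2 (ramp_mono (by linarith)))
    (sub_nonneg.2 (ha k.le_succ))

/-- A convex polygon with `n` sides of length `2`; the outer normal of the side from `vertex k` to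
`vertex (k + 1)` has direction `normal k`. -/
structure RimPolygon (n : ℕ) where
  vertex : ℕ → Plane
  normal : ℕ → ℝ
  two_le : 2 ≤ n
  le_five : n ≤ 5
  normal_lt : ∀ k, normal k < normal (k + 1)
  normal_add : ∀ k, normal (k + n) = normal k + 2 * π
  vertex_succ : ∀ k, vertex (k + 1) = vertex k + (2 : ℝ) • uperp (normal k)
  vertex_add : ∀ k, vertex (k + n) = vertex k
  -- Exterior angles of at most `2π / 3` keep vertices with one vertex between them at distance at
  -- least `2`.
  gap : 4 ≤ n → ∀ k, normal (k + 1) - normal k ≤ 2 * π / 3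

namespace RimPolygon

variable {n : ℕ} (S : RimPolygon n)

lemma normal_mono : Monotone S.normal := monotone_nat_of_le_succ fun k => (S.normal_lt k).le

lemma inner_vertex_succ (k : ℕ) (θ : ℝ) : ⟪S.vertex (k + 1), uvec θ⟫ =
    ⟪S.vertex k, uvec θ⟫ + 2 * sin (θ - S.normal k) := by
  rw [S.vertex_succ, inner_add_left, inner_smul_left, inner_uperp_uvec]; simp

/-- The vertex between two sides whose normals enclose the direction `θ` is the highest one in this
direction. From there the heights fall as long as the normals are within `π` of `θ`, and afterwards
they rise until the polygon returns to the same vertex. -/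
lemma vertex_sub_le {k : ℕ} {θ : ℝ} (h1 : S.normal k ≤ θ) (h2 : θ ≤ S.normal (k + 1)) {m : ℕ}
    (hm : m ≤ n) : ⟪S.vertex (k + 1 + m), uvec θ⟫ ≤ ⟪S.vertex (k + 1), uvec θ⟫ := by
  by_cases h : ∀ i < m, S.normal (k + 1 + i) - θ ≤ π
  · clear hm
    induction m with
    | zero => simp
    | succ m ih =>
      refine le_trans ?_ (ih fun i hi => h i (by omega))
      rw [← add_assoc, S.inner_vertex_succ]
      have h3 := h m (by omega)
      have h4 := S.normal_mono (by omega : k + 1 ≤ k + 1 + m)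
      have := sin_nonpos_of_nonpos_of_neg_pi_le (x := θ - S.normal (k + 1 + m)) (by linarith)
        (by linarith)
      linarith
  · push Not at h
    obtain ⟨i, hi, hi'⟩ := h
    have key : ∀ d, m + d ≤ n → ⟪S.vertex (k + 1 + m), uvec θ⟫ ≤ ⟪S.vertex (k + 1 + (m + d)), uvec θ⟫ := by
      intro d
      induction d with
      | zero => simp
      | succ d ih =>
        intro hd
        refine (ih (by omega)).trans ?_
        rw [show k + 1 + (m + (d + 1)) = (k + 1 + (m + d)) + 1 by ring, S.inner_vertex_succ]
        have h3 := S.normal_mono (by omega : k + 1 + i ≤ k + 1 + (m + d))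
        have h4 := S.normal_mono (by omega : k + 1 + (m + d) ≤ k + n)
        rw [S.normal_add] at h4
        have := sin_nonneg_of_nonneg_of_le_pi
          (x := θ - S.normal (k + 1 + (m + d)) + 2 * π) (by linarith) (by linarith)
        rw [sin_add_two_pi] at this
        linarith
    have := key (n - m) (by omega)
    rwa [Nat.add_sub_cancel' hm, S.vertex_add] at this

lemma inner_vertex_sub_le {k : ℕ} (hk : k < n) {θ : ℝ} (h1 : S.normal k ≤ θ)
    (h2 : θ ≤ S.normal (k + 1)) (i : Fin n) :
    ⟪S.vertex (i + 1) - S.vertex (k + 1), uvec θ⟫ ≤ 0 := by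
  rw [inner_sub_left, sub_nonpos]
  have hi := i.2
  rcases le_or_gt k i with h | h
  · have := S.vertex_sub_le h1 h2 (m := i - k) (by omega)
    rwa [show k + 1 + (i - k) = (i : ℕ) + 1 by omega] at this
  · have := S.vertex_sub_le h1 h2 (m := i + n - k) (by omega)
    rwa [show k + 1 + (i + n - k) = (i : ℕ) + 1 + n by omega, S.vertex_add] at this

lemma dist_vertex_succ (k : ℕ) : dist (S.vertex k) (S.vertex (k + 1)) = 2 := by
  rw [S.vertex_succ, dist_self_add_right, norm_smul, norm_uperp]; norm_num

lemma two_le_dist_vertex_add_two (h : 4 ≤ n) (k : ℕ) :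
    2 ≤ dist (S.vertex k) (S.vertex (k + 2)) := by
  have e : S.vertex (k + 2) = S.vertex k + (2 : ℝ) • (uperp (S.normal k) + uperp (S.normal (k + 1))) := by
    rw [show k + 2 = k + 1 + 1 from rfl, S.vertex_succ, S.vertex_succ]; module
  have h1 := S.gap h k
  have h2 := S.normal_lt k
  have h3 : -(1 / 2) ≤ cos (S.normal (k + 1) - S.normal k) := by
    have h4 : cos (2 * π / 3) = -(1 / 2) := by
      rw [show 2 * π / 3 = π - π / 3 by ring, cos_pi_sub, cos_pi_div_three]
    rw [← h4]
    exact cos_le_cos_of_nonneg_of_le_pi (by linarith) (by linarith [pi_pos]) h1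
  rw [cos_sub] at h3
  rw [e, dist_self_add_right, ← sq_le_sq₀ zero_le_two (norm_nonneg _), norm_smul, mul_pow,
    plane_norm_sq]
  simp
  nlinarith [sin_sq_add_cos_sq (S.normal k), sin_sq_add_cos_sq (S.normal (k + 1))]

/-- With at most five vertices, any two are joined by a side or have one vertex between them on some
way around. -/
lemma two_le_dist_of_lt {i j : ℕ} (hij : i < j) (hj : j < i + n) :
    2 ≤ dist (S.vertex i) (S.vertex j) := by
  have h5 := S.le_five
  have h2 := S.two_le
  obtain ⟨d, rfl⟩ := Nat.exists_eq_add_of_lt hij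
  have hd : d = 0 ∨ d + 2 = n ∨ (4 ≤ n ∧ (d = 1 ∨ d + 3 = n)) := by omega
  rcases hd with rfl | rfl | ⟨h4, rfl | rfl⟩
  · exact (S.dist_vertex_succ i).ge
  · rw [← S.vertex_add i, dist_comm]
    exact (S.dist_vertex_succ (i + d + 1)).ge
  · exact S.two_le_dist_vertex_add_two h4 i
  · rw [← S.vertex_add i, dist_comm]
    exact S.two_le_dist_vertex_add_two h4 (i + d + 1)

/-- The direction of the normal, along `n` arcs alternating with `n` sides. -/
def turn (x : ℝ) : ℝ := polyPath (fun i => S.normal ((i + 1) / 2)) (2 * n) x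

/-- The position on the polygon, along `n` arcs alternating with `n` sides. -/
def walk (x : ℝ) : Plane := polyPath (fun i => S.vertex (i / 2 + 1)) (2 * n) x

lemma continuous_turn : Continuous S.turn :=
  continuous_polyPath (fun i => S.normal ((i + 1) / 2)) (2 * n)
lemma continuous_walk : Continuous S.walk :=
  continuous_polyPath (fun i => S.vertex (i / 2 + 1)) (2 * n)

/-- On `[2k, 2k + 1]` the foot rests at the vertex `k + 1` and the normal turns from `normal k` to
`normal (k + 1)`; on `[2k + 1, 2k + 2]` the normal rests and the foot walks from the vertex `k + 1`
to the vertex `k + 2`. -/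
lemma turn_arc {k : ℕ} (hk : k < n) {x : ℝ} (h1 : 2 * k ≤ x) (h2 : x ≤ 2 * k + 1) :
    S.turn x = S.normal k + (x - 2 * k) * (S.normal (k + 1) - S.normal k) := by
  rw [turn, polyPath_eq _ (k := 2 * k) (by omega) ⟨by push_cast; exact h1, by push_cast; exact h2⟩,
    show (2 * k + 1) / 2 = k by omega, show (2 * k + 1 + 1) / 2 = k + 1 by omega]
  push_cast; rfl

lemma walk_arc {k : ℕ} (hk : k < n) {x : ℝ} (h1 : 2 * k ≤ x) (h2 : x ≤ 2 * k + 1) :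
    S.walk x = S.vertex (k + 1) := by
  rw [walk, polyPath_eq _ (k := 2 * k) (by omega) ⟨by push_cast; exact h1, by push_cast; exact h2⟩,
    show (2 * k) / 2 = k by omega, show (2 * k + 1) / 2 = k by omega, sub_self, smul_zero, add_zero]

lemma turn_side {k : ℕ} (hk : k < n) {x : ℝ} (h1 : 2 * k + 1 ≤ x) (h2 : x ≤ 2 * k + 2) :
    S.turn x = S.normal (k + 1) := by
  rw [turn, polyPath_eq _ (k := 2 * k + 1) (by omega)
    ⟨by push_cast; exact h1, by push_cast; linarith⟩,
    show (2 * k + 1 + 1) / 2 = k + 1 by omega, show (2 * k + 1 + 1 + 1) / 2 = k + 1 by omega,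
    sub_self, smul_zero, add_zero]

lemma walk_side {k : ℕ} (hk : k < n) {x : ℝ} (h1 : 2 * k + 1 ≤ x) (h2 : x ≤ 2 * k + 2) :
    S.walk x = S.vertex (k + 1) + (x - (2 * k + 1)) • (S.vertex (k + 2) - S.vertex (k + 1)) := by
  rw [walk, polyPath_eq _ (k := 2 * k + 1) (by omega)
    ⟨by push_cast; exact h1, by push_cast; linarith⟩,
    show (2 * k + 1) / 2 = k by omega, show (2 * k + 1 + 1) / 2 = k + 1 by omega]
  push_cast; rfl

lemma turn_mono : Monotone S.turn :=
  polyPath_mono (fun i j h => S.normal_mono (by omega : (i + 1) / 2 ≤ (j + 1) / 2)) _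

lemma exists_arc_or_side (S : RimPolygon n) {x : ℝ} (h0 : 0 ≤ x) (h1 : x ≤ 2 * n) : ∃ k < n,
    (2 * k ≤ x ∧ x ≤ 2 * k + 1) ∨ (2 * k + 1 ≤ x ∧ x ≤ 2 * k + 2) := by
  have h2 := S.two_le
  obtain ⟨j, hj, hx⟩ := exists_nat_mem_Icc (N := 2 * n) (by omega) (x := x)
    ⟨h0, by push_cast; exact h1⟩
  rcases j.even_or_odd' with ⟨k, rfl | rfl⟩
  · exact ⟨k, by omega, Or.inl (by exact_mod_cast hx)⟩
  · refine ⟨k, by omega, Or.inr ?_⟩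
    have := hx.1
    have := hx.2
    push_cast at *
    constructor <;> linarith

lemma turn_zero : S.turn 0 = S.normal 0 := by
  rw [S.turn_arc (k := 0) (by linarith [S.two_le]) (by simp) (by simp)]; simp

lemma walk_zero : S.walk 0 = S.vertex 1 :=
  S.walk_arc (k := 0) (by linarith [S.two_le]) (by simp) (by simp)

lemma exists_succ (S : RimPolygon n) : ∃ m, n = m + 1 := ⟨n - 1, by have := S.two_le; omega⟩

lemma turn_two_mul : S.turn (2 * n) = S.normal 0 + 2 * π := by
  obtain ⟨m, hm⟩ := S.exists_succ
  have hm' : (n : ℝ) = m + 1 := by exact_mod_cast hm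
  have h := S.normal_add 0
  rw [zero_add] at h
  rw [S.turn_side (k := m) (by omega) (by linarith) (by linarith), ← hm, h]

lemma walk_two_mul : S.walk (2 * n) = S.vertex 1 := by
  obtain ⟨m, hm⟩ := S.exists_succ
  have hm' : (n : ℝ) = m + 1 := by exact_mod_cast hm
  rw [S.walk_side (k := m) (by omega) (by linarith) (by linarith), hm',
    show 2 * ((m : ℝ) + 1) - (2 * m + 1) = 1 by ring, one_smul, add_sub_cancel,
    show m + 2 = 1 + n by omega, S.vertex_add]

lemma turn_lt_of_arc {k : ℕ} (hk : k < n) {x y : ℝ} (hxy : x < y) (h1 : x < 2 * k + 1)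
    (h2 : 2 * k < y) : S.turn x < S.turn y := by
  have a1 : 2 * (k : ℝ) ≤ max x (2 * k) := le_max_right _ _
  have a2 : min y (2 * k + 1) ≤ 2 * k + 1 := min_le_right _ _
  have a3 : max x (2 * k) < min y (2 * k + 1) :=
    max_lt (lt_min hxy h1) (lt_min h2 (by linarith))
  refine (S.turn_mono (le_max_left x (2 * (k : ℝ)))).trans_lt
    (lt_of_lt_of_le ?_ (S.turn_mono (min_le_left y (2 * (k : ℝ) + 1))))
  rw [S.turn_arc hk a1 (by linarith), S.turn_arc hk (by linarith) a2]
  have := S.normal_lt k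
  gcongr

/-- The normal direction turns monotonically, by `2π` in total, so equal normals mean equal angles
or a full turn. Equal angles put both parameters on one side, where the foot moves injectively. A
full turn forces `x = 0` and `y` on the last side, and the foot returns to its start only at the
excluded end. -/
lemma eq_of_walk_eq {x y : ℝ} (hx : 0 ≤ x) (hy : y < 2 * n) (hw : S.walk x = S.walk y)
    (hu : uvec (S.turn x) = uvec (S.turn y)) : ¬ x < y := by
  intro hxy
  have m1 := S.turn_mono hx
  have m2 := S.turn_mono hxy.le
  have m3 := S.turn_mono hy.le
  rw [S.turn_zero] at m1
  rw [S.turn_two_mul] at m3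
  have hne : ∀ k, S.vertex (k + 2) - S.vertex (k + 1) ≠ 0 := fun k h => by
    have := S.dist_vertex_succ (k + 1)
    rw [dist_comm, dist_eq_norm, h, norm_zero] at this
    norm_num at this
  have hcos : cos (S.turn y - S.turn x) = 1 := by
    rw [← inner_uvec_uvec, hu, real_inner_self_eq_norm_sq, norm_uvec, one_pow]
  obtain ⟨z, hz⟩ := (Real.cos_eq_one_iff _).1 hcos
  have hz0 : 0 ≤ z := by
    by_contra h
    have : (z : ℝ) ≤ -1 := by exact_mod_cast (by omega : z ≤ -1)
    nlinarith [pi_pos]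
  have hz1 : z ≤ 1 := by
    by_contra h
    have : (2 : ℝ) ≤ z := by exact_mod_cast (by omega : 2 ≤ z)
    nlinarith [pi_pos]
  have hz2 : z = 0 ∨ z = 1 := by omega
  rcases hz2 with rfl | rfl
  · have he : S.turn x = S.turn y := by simp at hz; linarith
    obtain ⟨k, hk, ⟨h1, h2⟩ | ⟨h1, h2⟩⟩ := S.exists_arc_or_side hx (hxy.trans hy).le
    · rcases h2.lt_or_eq with h2 | h2
      · exact (S.turn_lt_of_arc hk hxy h2 (by linarith)).ne he
      · rcases le_or_gt y (2 * k + 2) with h3 | h3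
        · rw [S.walk_side hk (by linarith) (by linarith), S.walk_side hk (by linarith) h3,
            add_right_inj] at hw
          have := smul_left_injective ℝ (hne k) hw
          linarith
        · have hk' : k + 1 < n := by
            have : ((k + 1 : ℕ) : ℝ) < n := by push_cast; linarith
            exact_mod_cast this
          exact (S.turn_lt_of_arc hk' hxy (by push_cast; linarith) (by push_cast; linarith)).ne he
    · rcases le_or_gt y (2 * k + 2) with h3 | h3
      · rw [S.walk_side hk h1 h2, S.walk_side hk (by linarith) h3, add_right_inj] at hw
        have := smul_left_injective ℝ (hne k) hw
        linarith
      · have hk' : k + 1 < n := by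
          have : ((k + 1 : ℕ) : ℝ) < n := by push_cast; linarith
          exact_mod_cast this
        exact (S.turn_lt_of_arc hk' hxy (by push_cast; linarith) (by push_cast; linarith)).ne he
  · have he : S.turn y = S.turn x + 2 * π := by simp at hz; linarith
    have hn := S.two_le
    have hx0 : x = 0 := by
      by_contra h
      have := S.turn_lt_of_arc (k := 0) (by omega) (lt_of_le_of_ne hx (Ne.symm h)) (by simp)
        (by simpa using lt_of_le_of_ne hx (Ne.symm h))
      rw [S.turn_zero] at this
      linarith
    obtain ⟨m, hm⟩ := S.exists_succ
    have hm' : (n : ℝ) = m + 1 := by exact_mod_cast hm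
    have hy1 : 2 * m + 1 ≤ y := by
      by_contra h
      have := S.turn_lt_of_arc (k := m) (by omega) hy (by linarith) (by linarith)
      rw [S.turn_two_mul] at this
      linarith
    rw [hx0, S.walk_zero, S.walk_side (k := m) (by omega) hy1 (by linarith)] at hw
    have h1 := S.vertex_add 1
    rw [show 1 + n = m + 2 by omega] at h1
    have h2 : (1 - (y - (2 * m + 1))) • (S.vertex (m + 2) - S.vertex (m + 1)) = 0 := by
      rw [← h1, ← sub_eq_iff_eq_add'] at hw
      rw [sub_smul, one_smul, sub_eq_zero]
      exact hw
    rcases smul_eq_zero.1 h2 with h | h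
    · linarith
    · exact hne m h

/-- The rim at distance `2` from a polygon. -/
def toRim : Rim n where
  -- The index is shifted because the arc with index `i` turns around the vertex `i + 1`. The ring
  -- there points along the bisector of the two adjacent normals.
  center i := S.vertex (i + 1)
  dir i := (S.normal i + S.normal (i + 1)) / 2
  foot t := S.walk (2 * n * t)
  angle t := S.turn (2 * n * t)
  continuous_foot := S.continuous_walk.comp (by fun_prop)
  continuous_angle := S.continuous_turn.comp (by fun_prop)
  foot_one := by rw [mul_one, mul_zero, S.walk_two_mul, S.walk_zero]
  angle_one := by rw [mul_one, mul_zero, S.turn_two_mul, S.turn_zero]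
  foot_mem t ht := by
    have hv : ∀ k, S.vertex (k + 1) ∈ convexHull ℝ (range fun i : Fin n => S.vertex (i + 1)) := by
      intro k
      have hper : Function.Periodic S.vertex n := S.vertex_add
      have h2 := S.two_le
      rw [← hper.map_mod_nat (k + 1)]
      obtain ⟨m, hm⟩ := S.exists_succ
      have hlt := Nat.mod_lt (k + 1) (show 0 < n by omega)
      apply subset_convexHull ℝ _
      rcases Nat.eq_zero_or_pos ((k + 1) % n) with h | h
      · exact ⟨⟨n - 1, by omega⟩, by
          rw [h, ← S.vertex_add 0]; simp only; congr 1; omega⟩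
      · exact ⟨⟨(k + 1) % n - 1, by omega⟩, by simp; congr 1; omega⟩
    have hn : (0 : ℝ) ≤ n := n.cast_nonneg
    obtain ⟨k, hk, ⟨h1, h2⟩ | ⟨h1, h2⟩⟩ := S.exists_arc_or_side
      (x := 2 * n * t) (by have := ht.1; positivity) (by nlinarith [ht.2])
    · rw [S.walk_arc hk h1 h2]; exact hv k
    · rw [S.walk_side hk h1 h2]
      exact (convex_convexHull ℝ _).add_smul_sub_mem (hv k) (hv (k + 1))
        ⟨by linarith, by linarith⟩
  center_le t ht j := by
    have hn : (0 : ℝ) ≤ n := n.cast_nonneg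
    obtain ⟨k, hk, ⟨h1, h2⟩ | ⟨h1, h2⟩⟩ := S.exists_arc_or_side
      (x := 2 * n * t) (by have := ht.1; positivity) (by nlinarith [ht.2])
    · rw [S.walk_arc hk h1 h2, S.turn_arc hk h1 h2]
      have := S.normal_lt k
      exact S.inner_vertex_sub_le hk (by nlinarith) (by nlinarith) j
    · rw [S.walk_side hk h1 h2, S.turn_side hk h1 h2, ← sub_sub, inner_sub_left, inner_smul_left,
        S.vertex_succ (k + 1), add_sub_cancel_left, inner_smul_left, inner_uperp_uvec]
      have := S.inner_vertex_sub_le hk (S.normal_lt k).le le_rfl j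
      simpa using this
  dir_le i j := by
    have := S.normal_lt i
    exact S.inner_vertex_sub_le i.2 (by linarith) (by linarith) j
  sep i j hij := by
    rcases lt_or_gt_of_ne (Fin.val_ne_of_ne hij) with h | h
    · exact S.two_le_dist_of_lt (by omega) (by omega)
    · rw [dist_comm]; exact S.two_le_dist_of_lt (by omega) (by omega)
  inj s hs t ht hw hu := by
    have h2 : (2 : ℝ) ≤ n := by exact_mod_cast S.two_le
    have aux : ∀ s ∈ Ico (0 : ℝ) 1, ∀ t ∈ Ico (0 : ℝ) 1, S.walk (2 * n * s) = S.walk (2 * n * t) →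
        uvec (S.turn (2 * n * s)) = uvec (S.turn (2 * n * t)) → ¬ s < t := by
      intro s hs t ht hw hu hst
      refine S.eq_of_walk_eq ?_ ?_ hw hu ?_
      · nlinarith [hs.1]
      · nlinarith [ht.2]
      · nlinarith
    exact le_antisymm (not_lt.1 (aux t ht s hs hw.symm hu.symm)) (not_lt.1 (aux s hs t ht hw hu))
  touch := ⟨0, by simp, ⟨0, by linarith [S.two_le]⟩, by rw [mul_zero, S.walk_zero]⟩
  -- Each side counts `2` and each arc twice its angle, in total `2n + 4π`.
  clock t := polyPath (fun i => (2 * (i / 2 : ℕ) + 2 * S.normal ((i + 1) / 2) : ℝ)) (2 * n)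
    (2 * n * t)
  dist_le_clock s _ t _ hst := by
    refine dist_polyPath_add_le _ _ _ _ (fun k _ => ?_) (by gcongr)
    rcases k.even_or_odd' with ⟨k, rfl | rfl⟩
    · rw [show (2 * k) / 2 = k by omega, show (2 * k + 1) / 2 = k by omega, dist_self,
        show (2 * k + 1 + 1) / 2 = k + 1 by omega, abs_of_pos (sub_pos.2 (S.normal_lt k))]
      linarith
    · rw [show (2 * k + 1) / 2 = k by omega, show (2 * k + 1 + 1) / 2 = k + 1 by omega,
        show (2 * k + 1 + 1 + 1) / 2 = k + 1 by omega, S.dist_vertex_succ]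
      push_cast
      simp
      linarith
  clock_le := by
    obtain ⟨m, hm⟩ := S.exists_succ
    have hm' : (n : ℝ) = m + 1 := by exact_mod_cast hm
    have h := S.normal_add 0
    have h2 := S.two_le
    rw [zero_add] at h
    rw [polyPath_eq _ (k := 2 * n - 1) (by omega) (by
        rw [Nat.cast_sub (by omega)]; push_cast; constructor <;> linarith),
      polyPath_eq _ (k := 0) (by omega) (by simp)]
    rw [show 2 * n - 1 = 2 * m + 1 by omega, show (2 * m + 1) / 2 = m by omega,
      show (2 * m + 1 + 1) / 2 = n by omega, show (2 * m + 1 + 1 + 1) / 2 = n by omega, h]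
    refine le_trans (le_of_eq ?_) (ofReal_le_peri S.le_five S.two_le)
    congr 1
    push_cast
    simp
    rw [hm']
    ring

end RimPolygon

/-! ### Regular polygons, rhombi and the single ring -/

lemma uvec_sub_uvec (μ d : ℝ) :
    uvec (μ + d) - uvec (μ - d) = (2 * sin d) • uperp μ := by
  apply plane_ext <;> simp [cos_add, cos_sub, sin_add, sin_sub] <;> ring

/-- The regular polygon with `n` sides of length `2`. -/
def regularPolygon (n : ℕ) (h2 : 2 ≤ n) (h5 : n ≤ 5) : RimPolygon n where
  -- Sides of length `2` need the circumradius `1 / sin (π / n)`; the rotation by `-π / n` gives the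
  -- side after the vertex `k` the normal `2πk / n`. For `n = 2` this is a segment run forth and
  -- back.
  vertex k := (sin (π / n))⁻¹ • uvec (2 * π / n * k - π / n)
  normal k := 2 * π / n * k
  two_le := h2
  le_five := h5
  normal_lt k := by
    have : (0 : ℝ) < n := by exact_mod_cast (by omega : 0 < n)
    push_cast
    gcongr
    linarith
  normal_add k := by
    have : (n : ℝ) ≠ 0 := by exact_mod_cast (by omega : n ≠ 0)
    push_cast
    field_simp
  vertex_succ k := by
    have hn : (2 : ℝ) ≤ n := by exact_mod_cast h2
    have hs : 0 < sin (π / n) := sin_pos_of_pos_of_lt_pi (by positivity)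
      (div_lt_self pi_pos (by linarith))
    rw [← sub_eq_iff_eq_add', ← smul_sub,
      show 2 * π / n * (k + 1 : ℕ) - π / n = 2 * π / n * k + π / n by push_cast; ring, uvec_sub_uvec,
      smul_smul, mul_comm, mul_assoc, mul_inv_cancel₀ hs.ne', mul_one]
  vertex_add k := by
    have : (n : ℝ) ≠ 0 := by exact_mod_cast (by omega : n ≠ 0)
    rw [show 2 * π / n * (k + n : ℕ) - π / n = 2 * π / n * k - π / n + 2 * π by
      push_cast; field_simp; ring, uvec_add_two_pi]
  gap h4 k := by
    have : (4 : ℝ) ≤ n := by exact_mod_cast h4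
    push_cast
    rw [show 2 * π / n * (k + 1) - 2 * π / n * k = 2 * π / n by ring]
    gcongr
    linarith

lemma parity_aux (k : ℕ) : (2 * k) % 2 = 0 ∧ (2 * k) / 2 = k ∧ ¬ (2 * k + 1) % 2 = 0 ∧
    (2 * k + 1) / 2 = k ∧ (2 * k + 1 + 1) % 2 = 0 ∧ (2 * k + 1 + 1) / 2 = k + 1 := by omega

/-- The rhombus with sides of length `2` whose first side has a normal of direction `p`. -/
def rhombus (p : ℝ) (h1 : π / 4 ≤ p) (h2 : p ≤ π / 3) : RimPolygon 4 where
  -- The vertices with odd index lie on the horizontal axis at distance `2 sin p`, those with even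
  -- index on the vertical axis at distance `2 cos p`. The exterior angles are `2 p` and `π - 2 p`;
  -- the bound `p ≤ π / 3` keeps the short diagonal at least `2`, and `p ≥ π / 4` makes the
  -- horizontal diagonal the longer one.
  vertex k := if k % 2 = 0 then ((-1) ^ (k / 2) * (2 * cos p)) • uvec (-(π / 2))
    else ((-1) ^ (k / 2) * (2 * sin p)) • uvec 0
  normal k := if k % 2 = 0 then (k / 2 : ℕ) * π - p else (k / 2 : ℕ) * π + p
  two_le := by norm_num
  le_five := by norm_num
  normal_lt k := by
    have := pi_pos
    rcases k.even_or_odd' with ⟨k, rfl | rfl⟩ <;> obtain ⟨e0, e1, e2, e3, e4, e5⟩ := parity_aux k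
    · rw [if_pos e0, if_neg e2, e1, e3]
      linarith
    · rw [if_neg e2, if_pos e4, e3, e5]
      push_cast
      linarith
  normal_add k := by
    rw [show (k + 4) / 2 = k / 2 + 2 by omega, show (k + 4) % 2 = k % 2 by omega]
    push_cast
    split_ifs <;> ring
  vertex_succ k := by
    rcases k.even_or_odd' with ⟨k, rfl | rfl⟩ <;> obtain ⟨e0, e1, e2, e3, e4, e5⟩ := parity_aux k
    · rw [if_neg e2, if_pos e0, if_pos e0, e1, e3]
      apply plane_ext <;> simp [cos_nat_mul_pi_sub, sin_nat_mul_pi_sub] <;> ring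
    · rw [if_pos e4, if_neg e2, if_neg e2, e3, e5]
      apply plane_ext <;> simp [add_comm ((k : ℝ) * π) p, cos_add_nat_mul_pi, sin_add_nat_mul_pi] <;>
        ring
  vertex_add k := by
    rw [show (k + 4) / 2 = k / 2 + 2 by omega, show (k + 4) % 2 = k % 2 by omega, pow_add]
    norm_num
  gap _ k := by
    rcases k.even_or_odd' with ⟨k, rfl | rfl⟩ <;> obtain ⟨e0, e1, e2, e3, e4, e5⟩ := parity_aux k
    · rw [if_pos e0, if_neg e2, e1, e3]
      linarith
    · rw [if_neg e2, if_pos e4, e3, e5]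
      push_cast
      linarith

/-- The rim around a single ring: a circle of radius `2`. -/
def singleRim : Rim 1 where
  center _ := 0
  dir _ := 0
  foot _ := 0
  angle t := 2 * π * t
  continuous_foot := continuous_const
  continuous_angle := by fun_prop
  foot_one := rfl
  angle_one := by ring
  foot_mem _ _ := subset_convexHull ℝ _ ⟨0, rfl⟩
  center_le _ _ _ := by simp
  dir_le _ _ := by simp
  sep i j h := absurd (Subsingleton.elim i j) h
  inj s hs t ht _ h := by
    have h5 : cos (2 * π * s - 2 * π * t) = 1 := by
      rw [← inner_uvec_uvec, h, real_inner_self_eq_norm_sq, norm_uvec, one_pow]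
    have := pi_pos
    rw [Real.cos_eq_one_iff_of_lt_of_lt (by nlinarith [hs.1, hs.2, ht.1, ht.2])
      (by nlinarith [hs.1, hs.2, ht.1, ht.2])] at h5
    have : 2 * π * (s - t) = 0 := by linarith
    rcases mul_eq_zero.1 this with h | h <;> linarith
  touch := ⟨0, by simp, 0, rfl⟩
  clock t := 4 * π * t
  dist_le_clock s _ t _ hst := by
    rw [dist_self, abs_sub_comm, abs_of_nonneg (by have := pi_pos; nlinarith)]
    linarith
  clock_le := by
    refine le_trans (le_of_eq ?_) ofReal_le_peri_one
    congr 1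
    ring

/-! ### The round circle, the case without rings -/

/-- A round circle of radius `1`. -/
def roundCurve : C(UnitAddCircle, Space) :=
  closedCurve (fun t => lift3 (uvec (2 * π * t)) 0)
    (Continuous.continuousOn (by fun_prop)) (by
      rw [mul_zero, mul_one]; congr 1; simpa using (uvec_add_two_pi 0).symm)

/-- The round circle of radius `1` as a link. -/
def roundLink : Link 1 where
  curve _ := roundCurve
  simple _ := closedCurve_injective fun s hs t ht h =>
    singleRim.inj s hs t ht rfl (lift3_injective h).1
  disjoint i j h := absurd (Subsingleton.elim i j) h

lemma roundLink_carrier : roundLink.carrier = (fun t => lift3 (uvec (2 * π * t)) 0) '' Icc 0 1 := by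
  have : roundLink.carrier = roundLink.component 0 := by
    ext x; simp [Link.carrier]
  rw [this]
  exact range_closedCurve

/-- All circles through three points of the unit circle have radius `1`, so the inequality is an
equality. It is verified with the radial and tangential coordinates `p, q` and `r, s` of the other
two points relative to the first one; the relation `p² + q² + 2p = 0` says that a point is on the
circle. -/
lemma thick_roundLink : Thick 1 roundLink.carrier := by
  rw [roundLink_carrier]
  rintro _ ⟨s, -, rfl⟩ _ ⟨t, -, rfl⟩ _ ⟨w, -, rfl⟩ - - -
  dsimp only
  generalize 2 * π * s = α
  generalize 2 * π * t = β
  generalize 2 * π * w = φ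
  refine le_of_eq ?_
  simp only [lift3_sub, norm_lift3_sq, inner_lift3, sub_self, mul_zero, add_zero, plane_inner,
    plane_norm_sq, PiLp.sub_apply, uvec_zero', uvec_one']
  have h1 := sin_sq_add_cos_sq α
  have h2 := sin_sq_add_cos_sq β
  have h3 := sin_sq_add_cos_sq φ
  obtain ⟨p, hp⟩ : ∃ p, p = (cos β - cos α) * cos α + (sin β - sin α) * sin α := ⟨_, rfl⟩
  obtain ⟨q, hq⟩ : ∃ q, q = (sin β - sin α) * cos α - (cos β - cos α) * sin α := ⟨_, rfl⟩
  obtain ⟨r, hr⟩ : ∃ r, r = (cos φ - cos α) * cos α + (sin φ - sin α) * sin α := ⟨_, rfl⟩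
  obtain ⟨s, hs⟩ : ∃ s, s = (sin φ - sin α) * cos α - (cos φ - cos α) * sin α := ⟨_, rfl⟩
  have b0 : cos β = (1 + p) * cos α - q * sin α := by
    rw [hp, hq]; linear_combination (cos α - cos β) * h1
  have b1 : sin β = (1 + p) * sin α + q * cos α := by
    rw [hp, hq]; linear_combination (sin α - sin β) * h1
  have c0 : cos φ = (1 + r) * cos α - s * sin α := by
    rw [hr, hs]; linear_combination (cos α - cos φ) * h1
  have c1 : sin φ = (1 + r) * sin α + s * cos α := by
    rw [hr, hs]; linear_combination (sin α - sin φ) * h1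
  have e1 : p ^ 2 + q ^ 2 + 2 * p = 0 := by
    rw [b0, b1] at h2; linear_combination h2 - ((1 + p) ^ 2 + q ^ 2) * h1
  have e2 : r ^ 2 + s ^ 2 + 2 * r = 0 := by
    rw [c0, c1] at h3; linear_combination h3 - ((1 + r) ^ 2 + s ^ 2) * h1
  have n1 : (cos β - cos α) ^ 2 + (sin β - sin α) ^ 2 = p ^ 2 + q ^ 2 := by
    rw [b0, b1]; linear_combination (p ^ 2 + q ^ 2) * h1
  have n2 : (cos φ - cos α) ^ 2 + (sin φ - sin α) ^ 2 = r ^ 2 + s ^ 2 := by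
    rw [c0, c1]; linear_combination (r ^ 2 + s ^ 2) * h1
  have n3 : (cos β - cos φ) ^ 2 + (sin β - sin φ) ^ 2 = (p - r) ^ 2 + (q - s) ^ 2 := by
    rw [b0, b1, c0, c1]; linear_combination ((p - r) ^ 2 + (q - s) ^ 2) * h1
  have n4 : (cos β - cos α) * (cos φ - cos α) + (sin β - sin α) * (sin φ - sin α) =
      p * r + q * s := by
    rw [b0, b1, c0, c1]; linear_combination (p * r + q * s) * h1
  have z : (0 : ℝ) ^ 2 = 0 := by norm_num
  rw [z, add_zero, add_zero, add_zero, n1, n2, n3, n4]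
  linear_combination 4 * p ^ 2 * e2 + 4 * r ^ 2 * e1 -
    e1 * (r ^ 2 + s ^ 2) * (p ^ 2 + q ^ 2 + r ^ 2 + s ^ 2 - 2 * p * r - 2 * q * s) +
    2 * p * e2 * (p ^ 2 + q ^ 2 + r ^ 2 + s ^ 2 - 2 * p * r - 2 * q * s) - 4 * p * r * (e1 + e2)

lemma thickness_roundLink : roundLink.thickness = 1 := by
  have h1 := (roundLink.thick_iff zero_le_one).2 thick_roundLink
  rw [ENNReal.ofReal_one] at h1
  refine le_antisymm (le_of_not_gt fun h => ?_) h1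
  obtain ⟨r, hr, hr'⟩ := ENNReal.lt_iff_exists_nnreal_btwn.1 h
  have hr1 : (1 : ℝ) < r := by exact_mod_cast hr
  have hT : Thick r roundLink.carrier := (roundLink.thick_iff r.2).1 (by simpa using hr'.le)
  have hm : ∀ t ∈ Icc (0 : ℝ) 1, lift3 (uvec (2 * π * t)) 0 ∈ roundLink.carrier := fun t ht => by
    rw [roundLink_carrier]; exact ⟨t, ht, rfl⟩
  have m0 := hm 0 (by norm_num)
  have m1 := hm (1 / 4) (by norm_num)
  have m2 := hm (1 / 2) (by norm_num)
  rw [show 2 * π * (0 : ℝ) = 0 by ring] at m0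
  rw [show 2 * π * (1 / 4 : ℝ) = π / 2 by ring] at m1
  rw [show 2 * π * (1 / 2 : ℝ) = π by ring] at m2
  have hne : ∀ {α β : ℝ}, cos α ≠ cos β → lift3 (uvec α) 0 ≠ lift3 (uvec β) 0 := fun h e =>
    h (by simpa using congrArg (fun p : Space => p 0) e)
  have := hT _ m0 _ m1 _ m2 (hne (by simp)) (hne (by simp)) (hne (by norm_num))
  simp only [lift3_sub, norm_lift3_sq, inner_lift3, sub_self, mul_zero, add_zero, plane_inner,
    plane_norm_sq, PiLp.sub_apply, uvec_zero', uvec_one'] at this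
  norm_num at this
  nlinarith

lemma linkedToSublinks_roundLink : roundLink.LinkedToSublinks 0 0 :=
  ⟨fun i => absurd (Subsingleton.elim _ _) i.2, fun j => j.elim0⟩

lemma length_roundLink : roundLink.length 0 = ENNReal.ofReal (2 * π) + peri 0 := by
  refine le_antisymm ?_ (Link.le_length thick_roundLink linkedToSublinks_roundLink)
  rw [peri_zero, add_zero]
  change curveLength roundCurve ≤ _
  rw [roundCurve, curveLength_closedCurve]
  have h := eVariationOn_le_of_dist_le (f := fun t => lift3 (uvec (2 * π * t)) 0)
    (g := fun t => 2 * π * t) (zero_le_one (α := ℝ)) (fun s _ t _ hst => ?_)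
  · simpa using h
  · rw [dist_lift3_same]
    refine (dist_uvec_le _ _).trans (le_of_eq ?_)
    rw [abs_sub_comm, abs_of_nonneg (by nlinarith [pi_pos])]

lemma isTight_roundLink : roundLink.IsTight :=
  Link.isTight_of_length_eq thickness_roundLink.ge fun k => by
    rw [Subsingleton.elim k 0]
    exact ⟨0, linkedToSublinks_roundLink, length_roundLink⟩

/-! ### Failure of twice differentiability -/

/-- Outside a neighborhood of `t₀` in one period the curve stays away from `γ t₀`, by compactness.
So points of the curve near `γ t₀` have parameters near `t₀`, modulo the period. -/
lemma exists_param_near {γ : ℝ → Space} (hper : Function.Periodic γ 1) (hinj : InjOn γ (Ico 0 1))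
    (hc : Continuous γ) (t₀ : ℝ) {P : Space → Prop}
    (hP : ∀ ε > 0, ∃ x ∈ range γ, x ≠ γ t₀ ∧ dist x (γ t₀) < ε ∧ P x) :
    ∃ᶠ t in 𝓝[≠] t₀, P (γ t) := by
  have hinj' : ∀ t ∈ Ico (t₀ - 1 / 2) (t₀ + 1 / 2), γ t = γ t₀ → t = t₀ := by
    intro t ht h
    have e : γ (Int.fract t) = γ (Int.fract t₀) := by
      rw [Int.fract, Int.fract, ← mul_one (⌊t⌋ : ℝ), ← mul_one (⌊t₀⌋ : ℝ), hper.sub_int_mul_eq,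
        hper.sub_int_mul_eq, h]
    have := hinj ⟨Int.fract_nonneg _, Int.fract_lt_one _⟩ ⟨Int.fract_nonneg _, Int.fract_lt_one _⟩ e
    obtain ⟨z, hz⟩ := Int.fract_eq_fract.1 this
    have h1 : (z : ℝ) < 1 := by rw [← hz]; linarith [ht.2]
    have h2 : (-1 : ℝ) < z := by rw [← hz]; linarith [ht.1]
    have h3 : z = 0 := by
      have : z < 1 := by exact_mod_cast h1
      have : -1 < z := by exact_mod_cast h2
      omega
    rw [h3] at hz
    simpa [sub_eq_zero] using hz
  rw [(Metric.nhdsWithin_basis_ball (x := t₀) (s := {t₀}ᶜ)).frequently_iff]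
  intro ε hε
  let C := Icc (t₀ - 1 / 2) (t₀ + 1 / 2) \ ball t₀ ε
  have hC : IsCompact C := isCompact_Icc.diff isOpen_ball
  have hper2 : γ (t₀ + 1 / 2) = γ (t₀ - 1 / 2) := by
    rw [← hper (t₀ - 1 / 2)]; congr 1; ring
  have hne : γ t₀ ∉ γ '' C := by
    rintro ⟨t, ht, hte⟩
    rcases ht.1.2.lt_or_eq with h | h
    · rw [hinj' t ⟨ht.1.1, h⟩ hte] at ht
      exact ht.2 (mem_ball_self hε)
    · rw [h, hper2] at hte
      have := hinj' _ ⟨le_rfl, by linarith⟩ hte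
      linarith
  obtain ⟨δ, hδ, hδ'⟩ := Metric.isOpen_iff.1 (hC.image hc).isClosed.isOpen_compl _ hne
  obtain ⟨_, ⟨s, rfl⟩, hs1, hs2, hs3⟩ := hP δ hδ
  obtain ⟨t, ht, hst⟩ := hper.exists_mem_Ico one_pos s (t₀ - 1 / 2)
  rw [hst] at hs1 hs2 hs3
  refine ⟨t, ⟨?_, fun h => hs1 (by rw [mem_singleton_iff.1 h])⟩, hs3⟩
  by_contra hb
  exact hδ' (mem_ball.2 hs2) ⟨t, ⟨⟨ht.1, by linarith [ht.2]⟩, hb⟩, rfl⟩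

/-- A curve that contains points arbitrarily close to `x₀`, both on a line and on a circle tangent
to it at `x₀`, is not of class `C²`. -/
lemma not_isC2Curve {K : Set Space} {x₀ u : Space} (hx₀ : x₀ ∈ K)
    (hline : ∀ ε > 0, ∃ x ∈ K, x ≠ x₀ ∧ dist x x₀ < ε ∧ ⟪x - x₀, u⟫ = 0)
    (hcirc : ∀ ε > 0, ∃ x ∈ K, x ≠ x₀ ∧ dist x x₀ < ε ∧ ⟪x - x₀, u⟫ = -‖x - x₀‖ ^ 2 / 4) :
    ¬ IsC2Curve K := by
  rintro ⟨γ, v, hper, hinj, rfl, hspeed, hC2⟩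
  obtain ⟨t₀, rfl⟩ := hx₀
  have hc := hC2.continuous
  have f1 := exists_param_near hper hinj hc t₀ (P := fun x => ⟪x - γ t₀, u⟫ = 0) hline
  have f2 := exists_param_near hper hinj hc t₀
    (P := fun x => ⟪x - γ t₀, u⟫ = -‖x - γ t₀‖ ^ 2 / 4) hcirc
  let g : ℝ → ℝ := fun t => ⟪γ t - γ t₀, u⟫
  have hg : ContDiff ℝ 2 g := (hC2.sub contDiff_const).inner ℝ contDiff_const
  have hg0 : g t₀ = 0 := by simp [g]
  have hd : HasDerivAt γ (deriv γ t₀) t₀ := (hC2.differentiable (by norm_num) t₀).hasDerivAt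
  have hgd : HasDerivAt g ⟪deriv γ t₀, u⟫ t₀ := by
    simpa using (hd.sub_const (γ t₀)).inner ℝ (hasDerivAt_const t₀ u)
  -- The function `g` vanishes at parameters accumulating at `t₀`, namely at the points on the line.
  have hA : ⟪deriv γ t₀, u⟫ = 0 := by
    have := hasDerivAt_iff_tendsto_slope.1 hgd
    refine (isClosed_singleton (x := (0 : ℝ))).mem_of_frequently_of_tendsto
      (f1.mono fun t ht => ?_) this
    rw [mem_singleton_iff, slope_def_field, hg0, show g t = 0 from ht]; simp
  -- Taylor's theorem gives the quotient of `g` by the squared increment a single limit `B`. The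
  -- points on the line show `B = 0`; the points on the circle show `B = -‖γ'(t₀)‖² / 4`. Hence the
  -- derivative vanishes at `t₀`.
  obtain ⟨B, hB⟩ : ∃ B, Tendsto (fun t => g t / (t - t₀) ^ 2) (𝓝[≠] t₀) (𝓝 B) := by
    have h := Real.taylor_tendsto (n := 2) convex_univ (mem_univ t₀) hg.contDiffOn
    rw [nhdsWithin_univ] at h
    have h' := (h.mono_left (nhdsWithin_le_nhds (s := {t₀}ᶜ))).add_const
      (iteratedDerivWithin 2 g univ t₀ / 2)
    refine ⟨_, h'.congr' ?_⟩
    filter_upwards [self_mem_nhdsWithin] with t ht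
    have ht' : t - t₀ ≠ 0 := sub_ne_zero.2 ht
    have h1 : deriv g t₀ = 0 := by rw [hgd.deriv, hA]
    rw [taylor_within_apply]
    simp [Finset.sum_range_succ, h1, hg0]
    field_simp
    ring
  have hB0 : B = 0 := (isClosed_singleton (x := (0 : ℝ))).mem_of_frequently_of_tendsto
    (f1.mono fun t ht => by rw [mem_singleton_iff, show g t = 0 from ht, zero_div]) hB
  have hslope := (hasDerivAt_iff_tendsto_slope.1 hd).norm.pow 2
  have hsum := hB.add (hslope.div_const 4)
  have h0 := (isClosed_singleton (x := (0 : ℝ))).mem_of_frequently_of_tendsto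
    ((f2.and_eventually self_mem_nhdsWithin).mono fun t ht => by
      have ht' : t - t₀ ≠ 0 := sub_ne_zero.2 ht.2
      rw [mem_singleton_iff, slope_def_module, norm_smul, norm_inv, mul_pow,
        show g t = -‖γ t - γ t₀‖ ^ 2 / 4 from ht.1, inv_pow, Real.norm_eq_abs, sq_abs]
      field_simp
      ring) hsum
  rw [mem_singleton_iff, hB0, zero_add] at h0
  have hd0 : deriv γ t₀ = 0 := by
    rw [← norm_eq_zero]; exact pow_eq_zero_iff two_ne_zero |>.1 (by linarith)
  -- The speed is constant, so a vanishing derivative at one point makes it zero and the curve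
  -- constant, against injectivity.
  have hv : v = 0 := by
    by_contra hv
    have hv' : 0 < v := pos_iff_ne_zero.2 hv
    have hcd : Continuous (deriv γ) := hC2.continuous_deriv (by norm_num)
    have : ∀ᶠ t in 𝓝 t₀, ‖deriv γ t‖ < v / 2 := by
      have := hcd.norm.tendsto t₀
      rw [hd0, norm_zero] at this
      exact this.eventually_lt_const (by positivity)
    obtain ⟨η, hη, hball⟩ := Metric.eventually_nhds_iff_ball.1 this
    have hsub : Icc t₀ (t₀ + η / 2) ⊆ ball t₀ η := fun t ht => by
      rw [mem_ball, Real.dist_eq, abs_lt]; constructor <;> linarith [ht.1, ht.2]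
    have h1 := hspeed (mem_univ t₀) (mem_univ (t₀ + η / 2))
    rw [univ_inter] at h1
    have h2 := eVariationOn_le_of_dist_le (f := γ) (g := fun t => v / 2 * t) (a := t₀)
      (b := t₀ + η / 2) (by linarith) (fun s hs t ht hst => by
        have := (convex_Icc t₀ (t₀ + η / 2)).norm_image_sub_le_of_norm_deriv_le
          (fun x _ => hC2.differentiable (by norm_num) x) (fun x hx => (hball x (hsub hx)).le) hs ht
        rw [dist_comm, dist_eq_norm, ← mul_sub]
        rwa [Real.norm_eq_abs, abs_of_nonneg (sub_nonneg.2 hst)] at this)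
    rw [h1, ENNReal.ofReal_le_ofReal_iff (by
      have : (0 : ℝ) ≤ v := v.2
      nlinarith)] at h2
    have : (0 : ℝ) < v := hv'
    nlinarith
  have h1 := hspeed (mem_univ 0) (mem_univ (1 / 2))
  rw [univ_inter, hv] at h1
  have h2 := eVariationOn.edist_le γ (s := Icc (0 : ℝ) (1 / 2)) (x := 0) (y := 1 / 2) (by norm_num)
    (by norm_num)
  rw [h1] at h2
  simp at h2
  have := hinj (by norm_num) (by norm_num) h2
  norm_num at this

/-- At the parameter `1 / (2n)` an arc of radius `2` around the vertex `1` ends and a segment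
begins. Points after it are on the common tangent, points before it satisfy the chord relation of
the circle. -/
lemma RimPolygon.not_isC2Curve {n : ℕ} (S : RimPolygon n) :
    ¬ IsC2Curve (S.toRim.link.component 0) := by
  have hn : (2 : ℝ) ≤ n := by exact_mod_cast S.two_le
  have hn0 : 0 < n := by have := S.two_le; omega
  have hpt : ∀ x : ℝ, S.toRim.point (x / (2 * n)) = S.walk x + (2 : ℝ) • uvec (S.turn x) := by
    intro x
    have : 2 * (n : ℝ) * (x / (2 * n)) = x := by field_simp
    simp only [Rim.point, toRim, this]
  have hmem : ∀ x ∈ Icc (0 : ℝ) 2,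
      lift3 (S.toRim.point (x / (2 * n))) 0 ∈ S.toRim.link.component 0 := fun x hx => by
    rw [Rim.component_zero]
    refine ⟨_, ⟨by have := hx.1; positivity, ?_⟩, rfl⟩
    rw [div_le_one (by positivity)]
    linarith [hx.2]
  have hp1 : S.toRim.point (1 / (2 * n)) = S.vertex 1 + (2 : ℝ) • uvec (S.normal 1) := by
    rw [hpt, S.walk_arc hn0 (by simp) (by simp), S.turn_side hn0 (by simp) (by norm_num)]
  have hcont : Continuous fun x : ℝ => lift3 (S.toRim.point (x / (2 * n))) 0 := by
    have := S.toRim.continuous_point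
    fun_prop
  have hne : ∀ x ∈ Icc (0 : ℝ) 2, x ≠ 1 →
      lift3 (S.toRim.point (x / (2 * n))) 0 ≠ lift3 (S.toRim.point (1 / (2 * n))) 0 := by
    intro x hx hx1 h
    have hI : ∀ x ∈ Icc (0 : ℝ) 2, x / (2 * n) ∈ Ico (0 : ℝ) 1 := fun x hx =>
      ⟨by have := hx.1; positivity, by rw [div_lt_one (by positivity)]; linarith [hx.2]⟩
    have := S.toRim.point_injOn (hI x hx) (hI 1 (by norm_num)) (lift3_injective h).1
    rw [div_left_inj' (by positivity)] at this
    exact hx1 this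
  have hnear : ∀ ε > 0, ∃ δ ∈ Ioo (0 : ℝ) 1, ∀ x, |x - 1| < δ →
      dist (lift3 (S.toRim.point (x / (2 * n))) 0) (lift3 (S.toRim.point (1 / (2 * n))) 0) < ε := by
    intro ε hε
    obtain ⟨δ, hδ, h⟩ := Metric.continuous_iff.1 hcont 1 ε hε
    exact ⟨min δ (1 / 2), ⟨by positivity, by linarith [min_le_right δ (1 / 2)]⟩,
      fun x hx => h x (hx.trans_le (min_le_left _ _))⟩
  refine Ropelength.not_isC2Curve (u := lift3 (uvec (S.normal 1)) 0) (hmem 1 (by norm_num))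
    (fun ε hε => ?_) (fun ε hε => ?_)
  · obtain ⟨δ, hδ, h⟩ := hnear ε hε
    have hx : 1 + δ / 2 ∈ Icc (0 : ℝ) 2 := ⟨by linarith [hδ.1], by linarith [hδ.2]⟩
    refine ⟨_, hmem _ hx, hne _ hx (by linarith [hδ.1]), h _ ?_, ?_⟩
    · rw [add_sub_cancel_left, abs_of_pos (by linarith [hδ.1])]; linarith [hδ.1]
    · rw [lift3_sub, inner_lift3, hp1, hpt, S.walk_side hn0 (by simp; linarith [hδ.1])
        (by simp; linarith [hδ.2]), S.turn_side hn0 (by simp; linarith [hδ.1])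
        (by simp; linarith [hδ.2])]
      simp only [zero_add]
      rw [add_sub_add_right_eq_sub, add_sub_cancel_left, S.vertex_succ 1, add_sub_cancel_left,
        inner_smul_left, inner_smul_left, inner_uperp_uvec]
      simp
  · obtain ⟨δ, hδ, h⟩ := hnear ε hε
    have hx : 1 - δ / 2 ∈ Icc (0 : ℝ) 2 := ⟨by linarith [hδ.2], by linarith [hδ.1]⟩
    refine ⟨_, hmem _ hx, hne _ hx (by linarith [hδ.1]), h _ ?_, ?_⟩
    · rw [abs_sub_comm, sub_sub_cancel, abs_of_pos (by linarith [hδ.1])]; linarith [hδ.1]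
    · rw [lift3_sub, inner_lift3, norm_lift3_sq, hp1, hpt, S.walk_arc hn0 (by simp; linarith [hδ.2])
        (by simp; linarith [hδ.1]), zero_add, add_sub_add_left_eq_sub, ← smul_sub, inner_smul_left,
        inner_sub_left, norm_smul, mul_pow, norm_sub_sq_real, inner_uvec_uvec, inner_uvec_uvec,
        norm_uvec, norm_uvec]
      norm_num
      ring

/-! ### Radial deformation between parallel bodies -/

/-- The gauge of the parallel body at distance `2` of a set. -/
def parallelGauge (C : Set Plane) : Plane → ℝ := gauge (cthickening 2 C)

section ParallelGauge

variable {C C' : Set Plane}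

lemma mem_cthickening_two_iff (h0 : (0 : Plane) ∈ C) (x : Plane) :
    x ∈ cthickening 2 C ↔ infDist x C ≤ 2 := by
  rw [mem_cthickening_iff, infDist, ENNReal.le_ofReal_iff_toReal_le (infEDist_ne_top ⟨0, h0⟩)
    zero_le_two]

lemma cthickening_two_mem_nhds (h0 : (0 : Plane) ∈ C) : cthickening 2 C ∈ 𝓝 (0 : Plane) :=
  mem_of_superset (ball_mem_nhds 0 two_pos) fun x hx =>
    (mem_cthickening_two_iff h0 x).2 ((infDist_le_dist_of_mem h0).trans (mem_ball.1 hx).le)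

lemma continuous_parallelGauge (hC : Convex ℝ C) (h0 : (0 : Plane) ∈ C) :
    Continuous (parallelGauge C) :=
  continuous_gauge (hC.cthickening 2) (cthickening_two_mem_nhds h0)

lemma parallelGauge_smul {r : ℝ} (hr : 0 ≤ r) (x : Plane) :
    parallelGauge C (r • x) = r * parallelGauge C x := gauge_smul_of_nonneg hr x

lemma parallelGauge_pos (hCc : IsCompact C) (h0 : (0 : Plane) ∈ C) {x : Plane} (hx : x ≠ 0) :
    0 < parallelGauge C x :=
  (gauge_pos (absorbent_nhds_zero (cthickening_two_mem_nhds h0))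
    (NormedSpace.isVonNBounded_iff ℝ |>.2 hCc.isBounded.cthickening)).2 hx

lemma infDist_smul_le (hCc : IsCompact C) (h0 : (0 : Plane) ∈ C) {r : ℝ}
    (hr : 0 ≤ r) (hC' : ∀ x ∈ C, r • x ∈ C') (y : Plane) :
    infDist (r • y) C' ≤ r * infDist y C := by
  obtain ⟨q, hq, hqd⟩ := hCc.exists_infDist_eq_dist ⟨0, h0⟩ y
  refine (infDist_le_dist_of_mem (hC' q hq)).trans (le_of_eq ?_)
  rw [dist_smul₀, Real.norm_of_nonneg hr, hqd]

lemma parallelGauge_eq_one_iff (hC : Convex ℝ C) (hCc : IsCompact C) (h0 : (0 : Plane) ∈ C)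
    (x : Plane) : parallelGauge C x = 1 ↔ infDist x C = 2 := by
  constructor
  · intro h
    rw [parallelGauge, gauge_eq_one_iff_mem_frontier (hC.cthickening 2)
      (cthickening_two_mem_nhds h0)] at h
    refine le_antisymm ((mem_cthickening_two_iff h0 x).1
      (isClosed_cthickening.closure_subset h.1)) (le_of_not_gt fun hlt => h.2 ?_)
    rw [mem_interior_iff_mem_nhds]
    filter_upwards [(continuous_infDist_pt C).continuousAt.eventually_lt_const hlt] with y hy
    exact (mem_cthickening_two_iff h0 y).2 hy.le
  · intro h
    refine le_antisymm (gauge_le_one_of_mem ((mem_cthickening_two_iff h0 x).2 h.le))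
      (le_of_not_gt fun hlt => ?_)
    obtain ⟨b, hb0, hb1, y, hy, rfl⟩ := exists_lt_of_gauge_lt
      (absorbent_nhds_zero (cthickening_two_mem_nhds h0)) hlt
    dsimp only at h
    have h1 := infDist_smul_le hCc h0 hb0.le
      (fun x hx => by simpa using hC.add_smul_sub_mem h0 hx ⟨hb0.le, hb1.le⟩) y
    have h2 := (mem_cthickening_two_iff h0 y).1 hy
    nlinarith

/-- If `r • C` lies in `C'` and `r ≤ 1`, then `r` times the parallel body of `C` lies in that of
`C'`, because the distance `2` shrinks as well. -/
lemma parallelGauge_le (hCc : IsCompact C) (h0 : (0 : Plane) ∈ C)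
    (h0' : (0 : Plane) ∈ C') {r : ℝ} (hr : 0 < r) (hr1 : r ≤ 1) (h : ∀ x ∈ C, r • x ∈ C')
    (x : Plane) : parallelGauge C' x ≤ parallelGauge C x / r := by
  refine le_of_forall_gt fun a ha => ?_
  rw [div_lt_iff₀ hr] at ha
  obtain ⟨b, hb0, hba, y, hy, rfl⟩ := exists_lt_of_gauge_lt
    (absorbent_nhds_zero (cthickening_two_mem_nhds h0)) ha
  have h1 := infDist_smul_le hCc h0 hr.le h y
  have h2 := (mem_cthickening_two_iff h0 y).1 hy
  refine lt_of_le_of_lt (gauge_le_of_mem (by positivity : 0 ≤ b / r) ?_)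
    ((div_lt_iff₀ hr).2 hba)
  refine ⟨r • y, (mem_cthickening_two_iff h0' _).2 (by nlinarith [infDist_nonneg (x := y) (s := C)]),
    ?_⟩
  simp only [smul_smul, div_mul_cancel₀ _ hr.ne']

end ParallelGauge

/-- The radial stretching factor from the parallel body of `C` to that of `C'`. -/
def stretch (C C' : Set Plane) (x : Plane) : ℝ :=
  ((parallelGauge C' x)⁻¹ - (parallelGauge C x)⁻¹) * min 1 (3 * parallelGauge C x)

/-- The radial deformation from the parallel body of `C` to that of `C'`. -/
def deform (C C' : Set Plane) (τ : ℝ) (x : Plane) : Plane := (1 + τ * stretch C C' x) • x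

section Deform

variable {C C' : Set Plane} (hC : Convex ℝ C) (hCc : IsCompact C) (h0 : (0 : Plane) ∈ C)
  (hC' : Convex ℝ C') (hCc' : IsCompact C') (h0' : (0 : Plane) ∈ C')
  (h : ∀ x ∈ C, (7 / 10 : ℝ) • x ∈ C') (h' : ∀ x ∈ C', (7 / 10 : ℝ) • x ∈ C)
include hC hCc h0 hC' hCc' h0' h h'

/-- The product is `g / g' - 1` for the two gauges, and the comparison of the sets with the factor
`7 / 10` puts `g / g'` between `7 / 10` and `10 / 7`. -/
lemma stretch_aux {x : Plane} (hx : x ≠ 0) :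
    -(3 / 10) ≤ ((parallelGauge C' x)⁻¹ - (parallelGauge C x)⁻¹) * parallelGauge C x ∧
      ((parallelGauge C' x)⁻¹ - (parallelGauge C x)⁻¹) * parallelGauge C x ≤ 1 := by
  have p := parallelGauge_pos hCc h0 hx
  have p' := parallelGauge_pos hCc' h0' hx
  have l := parallelGauge_le hCc h0 h0' (by norm_num) (by norm_num) h x
  have l' := parallelGauge_le hCc' h0' h0 (by norm_num) (by norm_num) h' x
  rw [sub_mul, inv_mul_cancel₀ p.ne', ← div_eq_inv_mul, le_sub_iff_add_le, sub_le_iff_le_add,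
    le_div_iff₀ p', div_le_iff₀ p']
  constructor <;> linarith

/-- The vector `(1 / g' - 1 / g) • x` depends only on the direction of `x`: it is the difference of
the boundary points of the two bodies. The cutoff `min 1 (3 g)` tapers it inside a third of the
body. Three times `3 / 10` is below `1`, so the deformation does not turn rays around. -/
lemma stretch_bounds {x : Plane} (hx : x ≠ 0) :
    -(9 / 10) ≤ stretch C C' x ∧ stretch C C' x ≤ 3 := by
  have p := parallelGauge_pos hCc h0 hx
  obtain ⟨l, u⟩ := stretch_aux hC hCc h0 hC' hCc' h0' h h' hx
  have m0 : 0 ≤ min 1 (3 * parallelGauge C x) := le_min zero_le_one (by positivity)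
  have m1 : min 1 (3 * parallelGauge C x) ≤ 3 * parallelGauge C x := min_le_right _ _
  rw [stretch]
  generalize min 1 (3 * parallelGauge C x) = m at *
  generalize (parallelGauge C' x)⁻¹ - (parallelGauge C x)⁻¹ = d at *
  rcases le_or_gt 0 d with hd | hd <;> constructor <;> nlinarith

lemma continuous_deform : Continuous fun p : I × Plane => deform C C' p.1 p.2 := by
  have cg := continuous_parallelGauge hC h0
  have cg' := continuous_parallelGauge hC' h0'
  refine continuous_iff_continuousAt.2 fun ⟨τ, x⟩ => ?_
  rcases eq_or_ne x 0 with rfl | hx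
  · have hb : ∀ p : I × Plane, ‖deform C C' p.1 p.2‖ ≤ 4 * ‖p.2‖ := fun ⟨τ, x⟩ => by
      rcases eq_or_ne x 0 with rfl | hx
      · simp [deform]
      · obtain ⟨l, u⟩ := stretch_bounds hC hCc h0 hC' hCc' h0' h h' hx
        rw [deform, norm_smul]
        gcongr
        have t0 := τ.2.1
        have t1 := τ.2.2
        rw [Real.norm_eq_abs, abs_le]
        constructor <;> nlinarith
    have e : deform C C' τ 0 = 0 := by simp [deform]
    rw [ContinuousAt, e]
    refine squeeze_zero_norm hb ?_
    have : Continuous fun p : I × Plane => 4 * ‖p.2‖ := by fun_prop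
    simpa using this.tendsto (τ, (0 : Plane))
  · have p : parallelGauge C x ≠ 0 := (parallelGauge_pos hCc h0 hx).ne'
    have p' : parallelGauge C' x ≠ 0 := (parallelGauge_pos hCc' h0' hx).ne'
    unfold deform stretch
    have a1 : ContinuousAt (fun p : I × Plane => (parallelGauge C' p.2)⁻¹) (τ, x) :=
      ContinuousAt.inv₀ (by fun_prop) p'
    have a2 : ContinuousAt (fun p : I × Plane => (parallelGauge C p.2)⁻¹) (τ, x) :=
      ContinuousAt.inv₀ (by fun_prop) p
    fun_prop

lemma exists_homeomorph_deform (τ : I) : ∃ g : Plane ≃ₜ Plane, ⇑g = deform C C' τ := by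
  have t0 := τ.2.1
  have t1 := τ.2.2
  have hb : ∀ x : Plane, x ≠ 0 → 1 / 10 ≤ 1 + τ * stretch C C' x := fun x hx => by
    obtain ⟨l, -⟩ := stretch_bounds hC hCc h0 hC' hCc' h0' h h' hx
    nlinarith
  have hN : ∀ x : Plane, ‖deform C C' τ x‖ = (1 + τ * stretch C C' x) * ‖x‖ := fun x => by
    rcases eq_or_ne x 0 with rfl | hx
    · simp [deform]
    · rw [deform, norm_smul, Real.norm_of_nonneg (by linarith [hb x hx])]
  obtain ⟨g, hg⟩ := exists_homeomorph_radialMap (N := fun x => ‖deform C C' τ x‖)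
    (by have := (continuous_deform hC hCc h0 hC' hCc' h0' h h').comp (Continuous.prodMk_right τ)
        exact this.norm) (show (0 : ℝ) < 1 / 10 by norm_num) (by simp [deform]) (fun x => by
      rw [hN]
      rcases eq_or_ne x 0 with rfl | hx
      · simp
      · have := hb x hx
        gcongr) (fun x hx t ht => by
      have hxn : 0 < ‖x‖ := norm_pos_iff.2 hx
      rw [hN, hN, norm_smul, Real.norm_of_nonneg ht.1]
      rcases ht.1.eq_or_lt with rfl | ht0
      · rw [zero_mul, mul_zero]
        exact mul_pos (by linarith [hb x hx]) hxn
      · obtain ⟨l, -⟩ := stretch_aux hC hCc h0 hC' hCc' h0' h h' hx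
        have p := parallelGauge_pos hCc h0 hx
        -- Growth along rays: between `t • x` and `x` the identity gains `1 - t`, and the cutoff, of
        -- slope at most `3`, takes away at most `9 / 10` of this.
        have key : t * (1 + τ * stretch C C' (t • x)) < 1 + τ * stretch C C' x := by
          simp only [stretch, parallelGauge_smul ht.1]
          have e : ((t * parallelGauge C' x)⁻¹ - (t * parallelGauge C x)⁻¹) =
              t⁻¹ * ((parallelGauge C' x)⁻¹ - (parallelGauge C x)⁻¹) := by
            rw [mul_inv, mul_inv]; ring
          rw [e]
          have hmin : min 1 (3 * parallelGauge C x) - min 1 (3 * (t * parallelGauge C x)) ≤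
              3 * (1 - t) * parallelGauge C x := by
            rcases le_total 1 (3 * (t * parallelGauge C x)) with h1 | h1
            · rw [min_eq_left h1]
              have := min_le_left 1 (3 * parallelGauge C x)
              have := mul_nonneg (mul_nonneg (by norm_num : (0 : ℝ) ≤ 3) (sub_nonneg.2 ht.2.le)) p.le
              linarith
            · rw [min_eq_right h1]
              have := min_le_right 1 (3 * parallelGauge C x)
              linarith
          have hmin0 : 0 ≤ min 1 (3 * parallelGauge C x) - min 1 (3 * (t * parallelGauge C x)) :=
            sub_nonneg.2 (min_le_min_left _ (by nlinarith [ht.2]))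
          generalize min 1 (3 * parallelGauge C x) = m1 at *
          generalize min 1 (3 * (t * parallelGauge C x)) = m2 at *
          generalize (parallelGauge C' x)⁻¹ - (parallelGauge C x)⁻¹ = d at *
          have e2 : t * (1 + τ * (t⁻¹ * d * m2)) = t + τ * d * m2 := by field_simp
          rw [e2]
          have h3 : -(9 / 10) * (1 - t) ≤ d * (m1 - m2) := by
            rcases le_or_gt 0 d with hd | hd
            · have := mul_nonneg hd hmin0
              nlinarith [ht.2]
            · have h4 := mul_le_mul_of_nonpos_left hmin hd.le
              have h5 := mul_le_mul_of_nonneg_left l (sub_nonneg.2 ht.2.le)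
              linarith
          have h6 := mul_le_mul_of_nonneg_left h3 t0
          have h7 := mul_nonneg (sub_nonneg.2 t1) (sub_nonneg.2 ht.2.le)
          nlinarith [ht.2]
        nlinarith)
  refine ⟨g, hg.trans (funext fun x => ?_)⟩
  rw [radialMap, hN]
  rcases eq_or_ne x 0 with rfl | hx
  · simp [deform]
  · rw [mul_div_cancel_right₀ _ (norm_ne_zero_iff.2 hx), deform]

end Deform

/-- A homeomorphism of the plane acts on space, preserving heights. -/
def liftHomeomorph (g : Plane ≃ₜ Plane) : Space ≃ₜ Space where
  toFun x := lift3 (g (proj x)) (x 2)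
  invFun x := lift3 (g.symm (proj x)) (x 2)
  left_inv x := by simp
  right_inv x := by simp
  continuous_toFun := by fun_prop
  continuous_invFun := by fun_prop

lemma image_deform_gauge_eq_one {C C' : Set Plane} (hCc : IsCompact C) (h0 : (0 : Plane) ∈ C)
    (hCc' : IsCompact C') (h0' : (0 : Plane) ∈ C') :
    deform C C' 1 '' {x | parallelGauge C x = 1} = {x | parallelGauge C' x = 1} := by
  have hne : ∀ {C : Set Plane} {x : Plane}, parallelGauge C x = 1 → x ≠ 0 := fun {C x} h e => by
    rw [e, parallelGauge, gauge_zero] at h; norm_num at h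
  have hd : ∀ {x}, parallelGauge C x = 1 → deform C C' 1 x = (parallelGauge C' x)⁻¹ • x :=
    fun {x} h => by rw [deform, stretch, h]; norm_num
  apply Subset.antisymm
  · rintro _ ⟨x, hx, rfl⟩
    have p := parallelGauge_pos hCc' h0' (hne hx)
    rw [mem_ofPred_eq, hd hx, parallelGauge_smul (by positivity), inv_mul_cancel₀ p.ne']
  · intro y hy
    have p := parallelGauge_pos hCc h0 (hne hy)
    have hx : parallelGauge C ((parallelGauge C y)⁻¹ • y) = 1 := by
      rw [parallelGauge_smul (by positivity), inv_mul_cancel₀ p.ne']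
    refine ⟨_, hx, ?_⟩
    rw [hd hx, parallelGauge_smul (by positivity), show parallelGauge C' y = 1 from hy, mul_one,
      inv_inv, smul_smul, mul_inv_cancel₀ p.ne', one_smul]

/-- On a ray that meets the two boundaries at `2 + l` and `2 + l'`, the deformation at time `1` is
translation by `l' - l` where the cutoff equals `1`. That is the part from `(2 + l) / 3` on, which
contains everything beyond `l` because `l ≥ 1`. So the rings are translated as a whole. -/
lemma deform_of_smul {C C' : Set Plane} {v : Plane} {l l' : ℝ} (hl : 1 ≤ l)
    (hl' : 0 ≤ l') (hv : parallelGauge C ((2 + l) • v) = 1)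
    (hv' : parallelGauge C' ((2 + l') • v) = 1) {s : ℝ} (hs : 0 ≤ s) :
    deform C C' 1 ((l + s) • v) = (l' + s) • v := by
  rw [parallelGauge_smul (by linarith)] at hv hv'
  have e : parallelGauge C v = (2 + l)⁻¹ := eq_inv_of_mul_eq_one_right hv
  have e' : parallelGauge C' v = (2 + l')⁻¹ := eq_inv_of_mul_eq_one_right hv'
  have p1 : 0 < l + s := by linarith
  have p2 : 0 < 2 + l := by linarith
  have p3 : 0 < 2 + l' := by linarith
  rw [deform, stretch, parallelGauge_smul (by linarith), parallelGauge_smul (by linarith), e, e',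
    min_eq_left (by rw [← div_eq_mul_inv, ← mul_div_assoc, le_div_iff₀ p2]; linarith), smul_smul]
  congr 1
  field_simp
  ring

/-! ### The family of links around rhombi -/

/-- The angle of the rhombus with parameter `t`. -/
def rhombusAngle (t : I) : ℝ := π / 4 + t * (π / 12)

lemma le_rhombusAngle (t : I) : π / 4 ≤ rhombusAngle t := by
  have := mul_nonneg t.2.1 pi_pos.le
  unfold rhombusAngle; linarith

lemma rhombusAngle_le (t : I) : rhombusAngle t ≤ π / 3 := by
  have := mul_le_mul_of_nonneg_right t.2.2 pi_pos.le
  unfold rhombusAngle; linarith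

lemma rhombusAngle_lt {s t : I} (h : s < t) : rhombusAngle s < rhombusAngle t := by
  have := pi_pos
  have : (s : ℝ) < t := h
  unfold rhombusAngle; gcongr

/-- The rim of the rhombus with parameter `t`. -/
def rhombusRim (t : I) : Rim 4 := (rhombus _ (le_rhombusAngle t) (rhombusAngle_le t)).toRim

/-- The distance of the vertices of the rhombus to the origin. -/
def halfDiag (t : I) (i : Fin 4) : ℝ :=
  if (i : ℕ) % 2 = 0 then 2 * sin (rhombusAngle t) else 2 * cos (rhombusAngle t)

lemma rhombusRim_dir (t : I) (i : Fin 4) : (rhombusRim t).dir i = i * (π / 2) := by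
  fin_cases i <;> simp [rhombusRim, RimPolygon.toRim, rhombus] <;> ring

lemma rhombusRim_center (t : I) (i : Fin 4) :
    (rhombusRim t).center i = halfDiag t i • uvec (i * (π / 2)) := by
  have h3 : (3 : ℝ) * (π / 2) = π / 2 + π := by ring
  fin_cases i <;> apply plane_ext <;>
    simp [rhombusRim, RimPolygon.toRim, rhombus, halfDiag, h3, mul_div_cancel₀]

lemma sin_rhombusAngle_pos (t : I) : 0 < sin (rhombusAngle t) :=
  sin_pos_of_pos_of_lt_pi (by linarith [pi_pos, le_rhombusAngle t])
    (by linarith [pi_pos, rhombusAngle_le t])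

lemma one_le_two_mul_cos (t : I) : 1 ≤ 2 * cos (rhombusAngle t) := by
  have := cos_le_cos_of_nonneg_of_le_pi (by linarith [pi_pos, le_rhombusAngle t])
    (by linarith [pi_pos]) (rhombusAngle_le t)
  rw [cos_pi_div_three] at this
  linarith

lemma cos_rhombusAngle_le (t : I) : cos (rhombusAngle t) ≤ √2 / 2 := by
  have := cos_le_cos_of_nonneg_of_le_pi (by linarith [pi_pos])
    (by linarith [pi_pos, rhombusAngle_le t]) (le_rhombusAngle t)
  rwa [cos_pi_div_four] at this

lemma le_sin_rhombusAngle (t : I) : √2 / 2 ≤ sin (rhombusAngle t) := by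
  have := sin_le_sin_of_le_of_le_pi_div_two (by linarith [pi_pos])
    (by linarith [pi_pos, rhombusAngle_le t]) (le_rhombusAngle t)
  rwa [sin_pi_div_four] at this

lemma sin_rhombusAngle_le (t : I) : sin (rhombusAngle t) ≤ √3 / 2 := by
  have := sin_le_sin_of_le_of_le_pi_div_two (by linarith [pi_pos, le_rhombusAngle t])
    (by linarith [pi_pos]) (rhombusAngle_le t)
  rwa [sin_pi_div_three] at this

lemma one_le_halfDiag (t : I) (i : Fin 4) : 1 ≤ halfDiag t i := by
  unfold halfDiag
  split_ifs
  · have := one_le_two_mul_cos t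
    linarith [cos_rhombusAngle_le t, le_sin_rhombusAngle t]
  · exact one_le_two_mul_cos t

lemma halfDiag_le (t : I) (i : Fin 4) : halfDiag t i ≤ 2 * sin (rhombusAngle t) := by
  unfold halfDiag
  split_ifs
  · rfl
  · linarith [cos_rhombusAngle_le t, le_sin_rhombusAngle t]

lemma le_halfDiag (t : I) (i : Fin 4) : 2 * cos (rhombusAngle t) ≤ halfDiag t i := by
  unfold halfDiag
  split_ifs
  · linarith [cos_rhombusAngle_le t, le_sin_rhombusAngle t]
  · rfl

/-- The half diagonals range in `[√2, √3]` and in `[1, √2]`, so any two corresponding ones have a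
ratio of at least `1 / √2`, above `7 / 10`. -/
lemma halfDiag_compare (s t : I) (i : Fin 4) : 7 / 10 * halfDiag s i ≤ halfDiag t i := by
  have h2 : 7 / 5 ≤ √2 := Real.le_sqrt_of_sq_le (by norm_num)
  have h2' : √2 ≤ 10 / 7 := Real.sqrt_le_iff.2 (by norm_num)
  have h3 : √3 ≤ 2 := Real.sqrt_le_iff.2 (by norm_num)
  unfold halfDiag
  split_ifs
  · linarith [sin_rhombusAngle_le s, le_sin_rhombusAngle t]
  · linarith [one_le_two_mul_cos t, cos_rhombusAngle_le s]

lemma zero_mem_hull (t : I) : (0 : Plane) ∈ (rhombusRim t).hull := by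
  have h := (rhombusRim t).convex_hull.add_smul_sub_mem ((rhombusRim t).center_mem 0)
    ((rhombusRim t).center_mem 2) (show (1 / 2 : ℝ) ∈ Icc (0 : ℝ) 1 by norm_num)
  convert h using 1
  rw [rhombusRim_center, rhombusRim_center]
  have e : uvec (((2 : Fin 4) : ℕ) * (π / 2)) = -uvec (((0 : Fin 4) : ℕ) * (π / 2)) := by
    rw [← uvec_add_pi]; congr 1; simp; ring
  rw [e]
  have e2 : halfDiag t 2 = halfDiag t 0 := rfl
  rw [e2]
  module

lemma smul_mem_hull (s t : I) {x : Plane} (hx : x ∈ (rhombusRim s).hull) :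
    (7 / 10 : ℝ) • x ∈ (rhombusRim t).hull := by
  have hc : Convex ℝ {x : Plane | (7 / 10 : ℝ) • x ∈ (rhombusRim t).hull} :=
    (rhombusRim t).convex_hull.smul_preimage (7 / 10)
  refine convexHull_min ?_ hc hx
  rintro _ ⟨i, rfl⟩
  have h1 := one_le_halfDiag t i
  have h2 := halfDiag_compare s t i
  have h := (rhombusRim t).convex_hull.add_smul_sub_mem (zero_mem_hull t)
    ((rhombusRim t).center_mem i)
    (show 7 / 10 * halfDiag s i / halfDiag t i ∈ Icc (0 : ℝ) 1 from
      ⟨by have := one_le_halfDiag s i; positivity, div_le_one_of_le₀ h2 (by linarith)⟩)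
  rw [mem_ofPred_eq]
  convert h using 1
  rw [rhombusRim_center, rhombusRim_center, zero_add, sub_zero, smul_smul, smul_smul,
    div_mul_cancel₀ _ (by linarith)]

lemma parallelGauge_vertex (t : I) (i : Fin 4) :
    parallelGauge (rhombusRim t).hull ((2 + halfDiag t i) • uvec (i * (π / 2))) = 1 := by
  rw [parallelGauge_eq_one_iff (rhombusRim t).convex_hull (rhombusRim t).isCompact_hull
    (zero_mem_hull t), add_comm, add_smul, ← rhombusRim_center, ← rhombusRim_dir t]
  exact infDist_add_smul ((rhombusRim t).center_mem i) (norm_uvec _)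
    (fun _ hx => (rhombusRim t).hull_dir_le i hx) zero_le_two

/-- The link around the rhombus with parameter `t`. -/
def rhombusLink (t : I) : Link 5 := (rhombusRim t).link

lemma rhombusLink_component_zero (t : I) : (rhombusLink t).component 0 =
    (fun x => lift3 x 0) '' {x | parallelGauge (rhombusRim t).hull x = 1} := by
  ext x
  rw [rhombusLink, Rim.mem_component_zero_iff]
  constructor
  · rintro ⟨h1, h2⟩
    refine ⟨proj x, (parallelGauge_eq_one_iff (rhombusRim t).convex_hull
      (rhombusRim t).isCompact_hull (zero_mem_hull t) _).2 h2, ?_⟩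
    dsimp only
    rw [← h1, lift3_proj]
  · rintro ⟨y, hy, rfl⟩
    exact ⟨rfl, by rw [proj_lift3]; exact (parallelGauge_eq_one_iff (rhombusRim t).convex_hull
      (rhombusRim t).isCompact_hull (zero_mem_hull t) _).1 hy⟩

lemma rhombusRim_ringPoint (t : I) (i : Fin 4) (x : ℝ) : (rhombusRim t).ringPoint i x =
    lift3 ((halfDiag t i + 2 * (1 - cos (2 * π * x))) • uvec (i * (π / 2))) (2 * sin (2 * π * x)) := by
  rw [Rim.ringPoint, rhombusRim_center, rhombusRim_dir, ← add_smul]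

/-- The radial deformation of the plane is applied at every height. It carries one rim to the other
as level sets of gauges. Each ring lies over a ray through a vertex, in the part where the
deformation is a translation. -/
lemma ambientIsotopic_rhombusLink (s t : I) :
    AmbientIsotopic (rhombusLink s).carrier (rhombusLink t).carrier := by
  have hC := (rhombusRim s).convex_hull
  have hCc := (rhombusRim s).isCompact_hull
  have h0 := zero_mem_hull s
  have hC' := (rhombusRim t).convex_hull
  have hCc' := (rhombusRim t).isCompact_hull
  have h0' := zero_mem_hull t
  have h := fun x (hx : x ∈ (rhombusRim s).hull) => smul_mem_hull s t hx
  have h' := fun x (hx : x ∈ (rhombusRim t).hull) => smul_mem_hull t s hx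
  choose g hg using exists_homeomorph_deform hC hCc h0 hC' hCc' h0' h h'
  have hH : ∀ τ x, liftHomeomorph (g τ) x =
      lift3 (deform (rhombusRim s).hull (rhombusRim t).hull τ (proj x)) (x 2) := fun τ x => by
    rw [← hg]; rfl
  refine ⟨fun τ => liftHomeomorph (g τ), ?_, fun x => ?_, ?_⟩
  · simp only [hH]
    have := continuous_deform hC hCc h0 hC' hCc' h0' h h'
    have h2 : Continuous fun p : I × Space =>
        deform (rhombusRim s).hull (rhombusRim t).hull p.1 (proj p.2) :=
      this.comp (continuous_fst.prodMk (continuous_proj.comp continuous_snd))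
    fun_prop
  · rw [hH]
    simp [deform]
  · rw [Link.carrier, Link.carrier, image_iUnion]
    refine iUnion_congr fun i => ?_
    refine Fin.cases ?_ (fun i => ?_) i
    · rw [rhombusLink_component_zero, rhombusLink_component_zero,
        ← image_deform_gauge_eq_one hCc h0 hCc' h0', image_image, image_image]
      refine image_congr fun x _ => ?_
      rw [hH]
      simp
    · simp only [rhombusLink, Rim.component_succ, image_image]
      refine image_congr fun x _ => ?_
      have hc := cos_le_one (2 * π * x)
      rw [hH, rhombusRim_ringPoint, rhombusRim_ringPoint, proj_lift3, lift3_two]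
      congr 1
      exact deform_of_smul (one_le_halfDiag s i) (by linarith [one_le_halfDiag t i])
        (parallelGauge_vertex s i) (parallelGauge_vertex t i) (by linarith)

@[fun_prop] lemma continuous_rhombusAngle : Continuous rhombusAngle := by
  unfold rhombusAngle; fun_prop

lemma continuous_polyPath_param {X E : Type*} [TopologicalSpace X] [NormedAddCommGroup E]
    [NormedSpace ℝ E] {v : X → ℕ → E} (hv : ∀ k, Continuous fun x => v x k) (N : ℕ) {f : X → ℝ}
    (hf : Continuous f) : Continuous fun x => polyPath (v x) N (f x) := by
  unfold polyPath
  fun_prop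

lemma continuous_rhombusRim_point : Continuous fun p : I × ℝ => (rhombusRim p.1).point p.2 := by
  have hn : ∀ k, Continuous fun p : I × ℝ =>
      (rhombus _ (le_rhombusAngle p.1) (rhombusAngle_le p.1)).normal k := fun k => by
    simp only [rhombus]; split_ifs <;> fun_prop
  have hv : ∀ k, Continuous fun p : I × ℝ =>
      (rhombus _ (le_rhombusAngle p.1) (rhombusAngle_le p.1)).vertex k := fun k => by
    simp only [rhombus]; split_ifs <;> fun_prop
  have hx : Continuous fun p : I × ℝ => 2 * ((4 : ℕ) : ℝ) * p.2 := by fun_prop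
  have h1 := continuous_polyPath_param (v := fun (p : I × ℝ) i =>
    (rhombus _ (le_rhombusAngle p.1) (rhombusAngle_le p.1)).vertex (i / 2 + 1)) (fun k => hv _)
    (2 * 4) hx
  have h2 := continuous_polyPath_param (v := fun (p : I × ℝ) i =>
    (rhombus _ (le_rhombusAngle p.1) (rhombusAngle_le p.1)).normal ((i + 1) / 2)) (fun k => hn _)
    (2 * 4) hx
  change Continuous fun p : I × ℝ => (rhombusRim p.1).foot p.2 at h1
  change Continuous fun p : I × ℝ => (rhombusRim p.1).angle p.2 at h2
  unfold Rim.point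
  fun_prop

/-- Joint continuity can be checked after composition with the quotient map from the product with
the line, which is open, so its product with the identity is again a quotient map. -/
lemma continuous_closedCurve_param {F : I → ℝ → Space} (hF : Continuous fun p : I × ℝ => F p.1 p.2)
    (h01 : ∀ t, F t 0 = F t 1) {γ : I → C(UnitAddCircle, Space)}
    (hγ : ∀ t (x : ℝ), γ t (x : UnitAddCircle) = F t (Int.fract x)) :
    Continuous fun p : I × UnitAddCircle => γ p.1 p.2 := by
  have hq : IsOpenQuotientMap (fun p : I × ℝ => (p.1, (p.2 : UnitAddCircle))) :=
    IsOpenQuotientMap.id.prodMap QuotientAddGroup.isOpenQuotientMap_mk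
  rw [← hq.continuous_comp_iff]
  have := ContinuousOn.comp_fract (s := fun p : I × ℝ => p.2) (f := fun p x => F p.1 x)
    (Continuous.continuousOn (by
      exact hF.comp ((continuous_fst.comp continuous_fst).prodMk continuous_snd)))
    continuous_snd (fun p => h01 p.1)
  refine this.congr fun p => ?_
  simp only [Function.comp_apply, hγ]

lemma continuous_halfDiag (i : Fin 4) : Continuous fun t => halfDiag t i := by
  unfold halfDiag; split_ifs <;> fun_prop

lemma continuous_rhombusLink (i : Fin 5) :
    Continuous fun p : I × UnitAddCircle => (rhombusLink p.1).curve i p.2 := by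
  refine Fin.cases ?_ (fun i => ?_) i
  · refine continuous_closedCurve_param (F := fun t x => lift3 ((rhombusRim t).point x) 0)
      (γ := fun t => (rhombusRim t).rimCurve) ?_
      (fun t => by rw [(rhombusRim t).point_one]) (fun t x => rfl)
    have := continuous_rhombusRim_point
    fun_prop
  · refine continuous_closedCurve_param (F := fun t x => (rhombusRim t).ringPoint i x)
      (γ := fun t => (rhombusRim t).ringCurve i) ?_
      (fun t => by simp [Rim.ringPoint]) (fun t x => rfl)
    simp only [rhombusRim_ringPoint]
    have h : Continuous fun p : I × ℝ => halfDiag p.1 i := (continuous_halfDiag i).comp continuous_fst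
    fun_prop

/-! ### Invariants of shape -/

/-- The ratio of the largest and the smallest distance to the origin is an invariant of the shape
of sets that have a diameter centered at the origin. -/
lemma SameShape.mul_eq_mul {A B : Set Space} (h : SameShape A B) {P Q x₀ y₀ : Space} (hP : P ∈ A)
    (hP' : -P ∈ A) (hPmax : ∀ x ∈ A, ‖x‖ ≤ ‖P‖) (hx₀ : x₀ ∈ A) (hmin : ∀ x ∈ A, ‖x₀‖ ≤ ‖x‖)
    (hQ : Q ∈ B) (hQ' : -Q ∈ B) (hQmax : ∀ x ∈ B, ‖x‖ ≤ ‖Q‖) (hy₀ : y₀ ∈ B)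
    (hmin' : ∀ x ∈ B, ‖y₀‖ ≤ ‖x‖) : ‖P‖ * ‖y₀‖ = ‖Q‖ * ‖x₀‖ := by
  obtain ⟨f, rfl⟩ := h
  obtain ⟨r, hrf⟩ : ∃ r : ℝ, r = (Dilation.ratio f : ℝ≥0) := ⟨_, rfl⟩
  have hr : 0 < r := by rw [hrf]; exact_mod_cast Dilation.ratio_pos f
  have hd : ∀ x y, ‖f x - f y‖ = r * ‖x - y‖ := fun x y => by
    rw [← dist_eq_norm, ← dist_eq_norm, hrf]; exact Dilation.dist_eq f x y
  have two : ∀ v : Space, ‖v - -v‖ = 2 * ‖v‖ := fun v => by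
    rw [sub_neg_eq_add, ← two_smul ℝ v, norm_smul]; norm_num
  -- The sets have diameters `2 ‖P‖` and `2 ‖Q‖`, and the similarity multiplies the diameter by `r`.
  have e1 : r * ‖P‖ ≤ ‖Q‖ := by
    have h1 := hd P (-P)
    rw [two] at h1
    have h2 := norm_sub_le (f P) (f (-P))
    have h3 := hQmax _ ⟨P, hP, rfl⟩
    have h4 := hQmax _ ⟨-P, hP', rfl⟩
    linarith
  have e2 : ‖Q‖ ≤ r * ‖P‖ := by
    obtain ⟨x, hx, hxQ⟩ := hQ
    obtain ⟨y, hy, hyQ⟩ := hQ'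
    have h1 := hd x y
    rw [hyQ, hxQ, two] at h1
    have h2 := norm_sub_le x y
    have h3 := hPmax x hx
    have h4 := hPmax y hy
    nlinarith
  have e : r * ‖P‖ = ‖Q‖ := le_antisymm e1 e2
  -- Two points of the ball of radius `‖Q‖` at distance `2 ‖Q‖` are opposite. So the similarity
  -- fixes the origin, the midpoint of such a pair, and multiplies all norms by `r`.
  have hsum : f P + f (-P) = 0 := by
    have h1 := hd P (-P)
    rw [two] at h1
    have h2 := parallelogram_law_with_norm ℝ (f P) (f (-P))
    have h3 := hQmax _ ⟨P, hP, rfl⟩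
    have h4 := hQmax _ ⟨-P, hP', rfl⟩
    rw [h1, show r * (2 * ‖P‖) = 2 * ‖Q‖ by linarith] at h2
    have h5 := mul_self_le_mul_self (norm_nonneg _) h3
    have h6 := mul_self_le_mul_self (norm_nonneg _) h4
    rw [← norm_eq_zero]
    nlinarith [norm_nonneg (f P + f (-P))]
  have hf0 : f 0 = 0 := by
    have h1 := hd 0 P
    have h2 := hd 0 (-P)
    rw [zero_sub, norm_neg, e] at h1
    rw [eq_neg_of_add_eq_zero_right hsum, zero_sub, neg_neg, e] at h2
    have h4 := parallelogram_law_with_norm ℝ (f 0) (f P)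
    have h5 := hd P (-P)
    rw [eq_neg_of_add_eq_zero_right hsum, two, two] at h5
    rw [sub_neg_eq_add] at h2
    rw [h1, h2] at h4
    have h6 : ‖f P‖ = ‖Q‖ := by linarith
    rw [h6] at h4
    rw [← norm_eq_zero]
    nlinarith [norm_nonneg (f 0)]
  have hn : ∀ x, ‖f x‖ = r * ‖x‖ := fun x => by simpa [hf0] using hd x 0
  obtain ⟨z, hz, rfl⟩ := hy₀
  have m1 := hmin' _ ⟨x₀, hx₀, rfl⟩
  have m2 := hmin z hz
  rw [hn, hn] at m1
  have m3 : ‖z‖ = ‖x₀‖ := le_antisymm (le_of_mul_le_mul_left m1 hr) m2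
  rw [hn, m3, ← e]
  ring

lemma lift3_neg (x : Plane) : lift3 (-x) 0 = -lift3 x 0 := by
  ext i; fin_cases i <;> simp [lift3]

lemma norm_lift3_same (x : Plane) : ‖lift3 x 0‖ = ‖x‖ := by
  rw [← sq_eq_sq₀ (norm_nonneg _) (norm_nonneg _), norm_lift3_sq]; ring

lemma uvec_two_half_pi : uvec (((2 : Fin 4) : ℕ) * (π / 2)) = -uvec 0 := by
  rw [← uvec_add_pi]; congr 1; simp; ring

lemma uvec_zero_half_pi : uvec (((0 : Fin 4) : ℕ) * (π / 2)) = uvec 0 := by simp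

lemma vertex_mem_component (t : I) (i : Fin 4) :
    lift3 ((2 + halfDiag t i) • uvec (i * (π / 2))) 0 ∈ (rhombusLink t).component 0 := by
  rw [rhombusLink_component_zero]
  exact ⟨_, parallelGauge_vertex t i, rfl⟩

lemma norm_smul_uvec {r : ℝ} (hr : 0 ≤ r) (α : ℝ) : ‖r • uvec α‖ = r := by
  rw [norm_smul, norm_uvec, mul_one, Real.norm_of_nonneg hr]

lemma norm_le_of_mem_component_zero (t : I) {x : Space} (hx : x ∈ (rhombusLink t).component 0) :
    ‖x‖ ≤ 2 + 2 * sin (rhombusAngle t) := by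
  rw [rhombusLink, Rim.component_zero] at hx
  obtain ⟨s, hs, rfl⟩ := hx
  rw [norm_lift3_same, Rim.point]
  refine (norm_add_le _ _).trans ?_
  rw [norm_smul_uvec zero_le_two, add_comm]
  have hsub : (rhombusRim t).hull ⊆ closedBall 0 (2 * sin (rhombusAngle t)) := by
    refine convexHull_min ?_ (convex_closedBall _ _)
    rintro _ ⟨i, rfl⟩
    rw [mem_closedBall_zero_iff, rhombusRim_center,
      norm_smul_uvec (by linarith [one_le_halfDiag t i])]
    exact halfDiag_le t i
  gcongr
  exact mem_closedBall_zero_iff.1 (hsub ((rhombusRim t).foot_mem s hs))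

/-- The norm is at least the component along the normal, which is `2` plus the support function `h`
of the rhombus. With half diagonals `2a`, `2b` and `a² + b² = 1`, the bounds `h ≥ 2a |cos Ψ|` and `h
≥ 2b |sin Ψ|` combine to `h ≥ 2ab`, the radius of the inscribed circle. -/
lemma le_norm_of_mem_component_zero (t : I) {x : Space} (hx : x ∈ (rhombusLink t).component 0) :
    2 + sin (2 * rhombusAngle t) ≤ ‖x‖ := by
  rw [rhombusLink, Rim.component_zero] at hx
  obtain ⟨s, hs, rfl⟩ := hx
  rw [norm_lift3_same]
  set Ψ := (rhombusRim t).angle s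
  set h := ⟪(rhombusRim t).foot s, uvec Ψ⟫
  have h1 : 2 + h ≤ ‖(rhombusRim t).point s‖ := by
    have := real_inner_le_norm ((rhombusRim t).point s) (uvec Ψ)
    rw [norm_uvec, mul_one, Rim.point, inner_add_left, inner_smul_left, real_inner_self_eq_norm_sq,
      norm_uvec] at this
    simp at this
    rw [Rim.point]
    linarith
  have hc : ∀ i : Fin 4, halfDiag t i * cos (i * (π / 2) - Ψ) ≤ h := fun i => by
    have := (rhombusRim t).center_le s hs i
    rw [inner_sub_left, sub_nonpos, rhombusRim_center, inner_smul_left, inner_uvec_uvec] at this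
    simpa using this
  have a0 := hc 0
  have a1 := hc 1
  have a2 := hc 2
  have a3 := hc 3
  have r2 : ((2 : Fin 4) : ℕ) * (π / 2) - Ψ = π - Ψ := by simp; ring
  have r3 : ((3 : Fin 4) : ℕ) * (π / 2) - Ψ = π / 2 - Ψ + π := by simp; ring
  rw [r2, cos_pi_sub] at a2
  rw [r3, cos_add_pi, cos_pi_div_two_sub] at a3
  simp [halfDiag, cos_pi_div_two_sub] at a0 a1 a2 a3
  refine le_trans ?_ h1
  gcongr
  rw [sin_two_mul]
  have ps := sin_rhombusAngle_pos t
  have pc := one_le_two_mul_cos t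
  have q := sin_sq_add_cos_sq (rhombusAngle t)
  have q' := sin_sq_add_cos_sq Ψ
  generalize sin (rhombusAngle t) = a at *
  generalize cos (rhombusAngle t) = b at *
  have hh : 0 ≤ h := by
    by_contra hneg
    push Not at hneg
    have : 2 * a * cos Ψ ≤ h := a0
    linarith
  have s1 : (2 * a * cos Ψ) ^ 2 ≤ h ^ 2 := sq_le_sq' (by linarith) a0
  have s2 : (2 * b * sin Ψ) ^ 2 ≤ h ^ 2 := sq_le_sq' (by linarith) a1
  refine (sq_le_sq₀ (by nlinarith) hh).1 ?_
  have k1 := mul_le_mul_of_nonneg_left s1 (sq_nonneg b)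
  have k2 := mul_le_mul_of_nonneg_left s2 (sq_nonneg a)
  have k3 : (2 * a * b) ^ 2 = b ^ 2 * (2 * a * cos Ψ) ^ 2 + a ^ 2 * (2 * b * sin Ψ) ^ 2 := by
    linear_combination (-(2 * a * b) ^ 2) * q'
  have k4 : b ^ 2 * h ^ 2 + a ^ 2 * h ^ 2 = h ^ 2 := by linear_combination h ^ 2 * q
  linarith

/-- The point lies over the foot of the perpendicular from the center to a side, which divides this
side in the ratio of `sin²` to `cos²`. It attains the least norm on the rim. -/
lemma midpoint_mem_component (t : I) :
    lift3 ((2 + sin (2 * rhombusAngle t)) • uvec (rhombusAngle t)) 0 ∈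
      (rhombusLink t).component 0 := by
  have ps := sin_rhombusAngle_pos t
  have pc := one_le_two_mul_cos t
  rw [rhombusLink, Rim.mem_component_zero_iff]
  refine ⟨rfl, ?_⟩
  rw [proj_lift3, add_comm, add_smul]
  have q := sin_sq_add_cos_sq (rhombusAngle t)
  refine infDist_add_smul ?_ (norm_uvec _) ?_ zero_le_two
  · have h := (rhombusRim t).convex_hull.add_smul_sub_mem ((rhombusRim t).center_mem 0)
      ((rhombusRim t).center_mem 1) (show sin (rhombusAngle t) ^ 2 ∈ Icc (0 : ℝ) 1 from
        ⟨sq_nonneg _, sin_sq_le_one _⟩)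
    convert h using 1
    rw [rhombusRim_center, rhombusRim_center, sin_two_mul]
    apply plane_ext <;> simp [halfDiag]
    · linear_combination (2 * sin (rhombusAngle t)) * q
    · ring
  · refine inner_sub_le_of_convexHull ?_
    rintro _ ⟨i, rfl⟩
    have r2 : (2 : ℝ) * (π / 2) = π := by ring
    have r3 : (3 : ℝ) * (π / 2) = π / 2 + π := by ring
    have hp : 0 ≤ sin (rhombusAngle t) * cos (rhombusAngle t) := by nlinarith
    rw [inner_sub_left, rhombusRim_center, inner_smul_left, inner_smul_left, inner_uvec_uvec,
      inner_uvec_uvec, sub_self, cos_zero, sin_two_mul]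
    fin_cases i <;> simp [halfDiag, cos_pi_div_two_sub, cos_pi_sub, r2, r3,
      add_sub_right_comm, cos_add_pi] <;> linarith

lemma norm_ringPoint_sq (t : I) (i : Fin 4) (x : ℝ) : ‖(rhombusRim t).ringPoint i x‖ ^ 2 =
    halfDiag t i ^ 2 + 4 * (halfDiag t i + 2) * (1 - cos (2 * π * x)) := by
  have h := sin_sq_add_cos_sq (2 * π * x)
  rw [rhombusRim_ringPoint, norm_lift3_sq, norm_smul, norm_uvec, mul_one, Real.norm_eq_abs, sq_abs]
  linear_combination 4 * h

lemma norm_le_of_mem_carrier (t : I) {x : Space} (hx : x ∈ (rhombusLink t).carrier) :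
    ‖x‖ ≤ 4 + 2 * sin (rhombusAngle t) := by
  obtain ⟨i, hi⟩ := mem_iUnion.1 hx
  revert hi
  refine Fin.cases (fun hi => ?_) (fun i hi => ?_) i
  · exact (norm_le_of_mem_component_zero t hi).trans (by linarith)
  · rw [rhombusLink, Rim.component_succ] at hi
    obtain ⟨s, -, rfl⟩ := hi
    have h1 := neg_one_le_cos (2 * π * s)
    have h2 := one_le_halfDiag t i
    have h3 := halfDiag_le t i
    refine le_trans ?_ (show 4 + halfDiag t i ≤ _ by linarith)
    refine (sq_le_sq₀ (norm_nonneg _) (by linarith)).1 ?_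
    rw [norm_ringPoint_sq]
    nlinarith

lemma le_norm_of_mem_carrier (t : I) {x : Space} (hx : x ∈ (rhombusLink t).carrier) :
    2 * cos (rhombusAngle t) ≤ ‖x‖ := by
  obtain ⟨i, hi⟩ := mem_iUnion.1 hx
  revert hi
  refine Fin.cases (fun hi => ?_) (fun i hi => ?_) i
  · have h1 := le_norm_of_mem_component_zero t hi
    rw [sin_two_mul] at h1
    nlinarith [sin_rhombusAngle_pos t, one_le_two_mul_cos t, cos_le_one (rhombusAngle t)]
  · rw [rhombusLink, Rim.component_succ] at hi
    obtain ⟨s, -, rfl⟩ := hi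
    have h1 := cos_le_one (2 * π * s)
    have h2 := one_le_halfDiag t i
    refine (le_halfDiag t i).trans ?_
    refine (sq_le_sq₀ (by linarith) (norm_nonneg _)).1 ?_
    rw [norm_ringPoint_sq]
    nlinarith

/-- The invariant is `(2 + 2 sin p) / (2 + sin 2p)`, and it increases strictly for `p` in `[π / 4, π
/ 3]`. -/
lemma not_sameShape_component {s t : I} (hst : s ≠ t) :
    ¬ SameShape ((rhombusLink s).component 0) ((rhombusLink t).component 0) := by
  intro h
  have hM : ∀ t, ‖lift3 ((2 + halfDiag t 0) • uvec (((0 : Fin 4) : ℕ) * (π / 2))) 0‖ =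
      2 + 2 * sin (rhombusAngle t) := fun t => by
    rw [norm_lift3_same, norm_smul_uvec (by linarith [one_le_halfDiag t 0])]; rfl
  have hneg : ∀ t, -lift3 ((2 + halfDiag t 0) • uvec (((0 : Fin 4) : ℕ) * (π / 2))) 0 ∈
      (rhombusLink t).component 0 := fun t => by
    have := vertex_mem_component t 2
    rw [uvec_two_half_pi, smul_neg, lift3_neg] at this
    rw [uvec_zero_half_pi]
    exact this
  have hsin : ∀ t, 0 ≤ sin (2 * rhombusAngle t) := fun t => by
    rw [sin_two_mul]; nlinarith [sin_rhombusAngle_pos t, one_le_two_mul_cos t]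
  have hm : ∀ t, ‖lift3 ((2 + sin (2 * rhombusAngle t)) • uvec (rhombusAngle t)) 0‖ =
      2 + sin (2 * rhombusAngle t) := fun t => by
    rw [norm_lift3_same, norm_smul_uvec (by linarith [hsin t])]
  have key := h.mul_eq_mul (vertex_mem_component s 0) (hneg s)
    (fun x hx => by rw [hM]; exact norm_le_of_mem_component_zero s hx)
    (midpoint_mem_component s) (fun x hx => by rw [hm]; exact le_norm_of_mem_component_zero s hx)
    (vertex_mem_component t 0) (hneg t)
    (fun x hx => by rw [hM]; exact norm_le_of_mem_component_zero t hx)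
    (midpoint_mem_component t) (fun x hx => by rw [hm]; exact le_norm_of_mem_component_zero t hx)
  rw [hM, hM, hm, hm] at key
  have aux : ∀ s t : I, s < t → (2 + 2 * sin (rhombusAngle s)) * (2 + sin (2 * rhombusAngle t)) <
      (2 + 2 * sin (rhombusAngle t)) * (2 + sin (2 * rhombusAngle s)) := by
    intro s t hst
    have hlt := rhombusAngle_lt hst
    have h1 := le_rhombusAngle s
    have h2 := rhombusAngle_le t
    have h3 : sin (rhombusAngle s) < sin (rhombusAngle t) :=
      sin_lt_sin_of_lt_of_le_pi_div_two (by linarith [pi_pos]) (by linarith [pi_pos]) hlt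
    have h4 : sin (2 * rhombusAngle t) ≤ sin (2 * rhombusAngle s) := by
      rw [← sin_pi_sub (2 * rhombusAngle t), ← sin_pi_sub (2 * rhombusAngle s)]
      exact sin_le_sin_of_le_of_le_pi_div_two (by linarith [pi_pos]) (by linarith [pi_pos])
        (by linarith)
    have := hsin t
    have := sin_rhombusAngle_pos s
    exact mul_lt_mul (by linarith) (by linarith) (by linarith) (by linarith)
  rcases lt_or_gt_of_ne hst with h | h
  · exact (aux s t h).ne key
  · exact (aux t s h).ne' key

/-- The farthest points of the link are the outermost points of the rings at the long diagonal, the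
nearest ones the vertices of the short diagonal. The invariant `(4 + 2 sin p) / (2 cos p)` increases
strictly. -/
lemma not_sameShape_carrier {s t : I} (hst : s ≠ t) :
    ¬ SameShape (rhombusLink s).carrier (rhombusLink t).carrier := by
  intro h
  have hmem : ∀ t (i : Fin 4) x, (rhombusRim t).ringPoint i x ∈ (rhombusLink t).carrier :=
    fun t i x => (rhombusLink t).component_subset_carrier _ ((rhombusRim t).ringPoint_mem i x)
  have hM : ∀ t, ‖(rhombusRim t).ringPoint 0 (1 / 2)‖ = 4 + 2 * sin (rhombusAngle t) := fun t => by
    have h0 : halfDiag t 0 = 2 * sin (rhombusAngle t) := rfl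
    rw [← sq_eq_sq₀ (norm_nonneg _) (by linarith [sin_rhombusAngle_pos t]), norm_ringPoint_sq, h0,
      show 2 * π * (1 / 2 : ℝ) = π by ring, cos_pi]
    ring
  have hneg : ∀ t, -(rhombusRim t).ringPoint 0 (1 / 2) ∈ (rhombusLink t).carrier := fun t => by
    have := hmem t 2 (1 / 2)
    rw [rhombusRim_ringPoint, show 2 * π * (1 / 2 : ℝ) = π by ring, sin_pi, mul_zero,
      uvec_two_half_pi, smul_neg, lift3_neg] at this
    rw [rhombusRim_ringPoint, show 2 * π * (1 / 2 : ℝ) = π by ring, sin_pi, mul_zero,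
      uvec_zero_half_pi]
    exact this
  have hm : ∀ t, ‖(rhombusRim t).ringPoint 1 0‖ = 2 * cos (rhombusAngle t) := fun t => by
    have h1 : halfDiag t 1 = 2 * cos (rhombusAngle t) := rfl
    rw [← sq_eq_sq₀ (norm_nonneg _) (by linarith [one_le_two_mul_cos t]), norm_ringPoint_sq, h1,
      mul_zero, cos_zero]
    ring
  have key := h.mul_eq_mul (hmem s 0 (1 / 2)) (hneg s)
    (fun x hx => by rw [hM]; exact norm_le_of_mem_carrier s hx)
    (hmem s 1 0) (fun x hx => by rw [hm]; exact le_norm_of_mem_carrier s hx)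
    (hmem t 0 (1 / 2)) (hneg t)
    (fun x hx => by rw [hM]; exact norm_le_of_mem_carrier t hx)
    (hmem t 1 0) (fun x hx => by rw [hm]; exact le_norm_of_mem_carrier t hx)
  rw [hM, hM, hm, hm] at key
  have aux : ∀ s t : I, s < t → (4 + 2 * sin (rhombusAngle s)) * (2 * cos (rhombusAngle t)) <
      (4 + 2 * sin (rhombusAngle t)) * (2 * cos (rhombusAngle s)) := by
    intro s t hst
    have hlt := rhombusAngle_lt hst
    have h1 := le_rhombusAngle s
    have h2 := rhombusAngle_le t
    have h3 : sin (rhombusAngle s) < sin (rhombusAngle t) :=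
      sin_lt_sin_of_lt_of_le_pi_div_two (by linarith [pi_pos]) (by linarith [pi_pos]) hlt
    have h4 : cos (rhombusAngle t) ≤ cos (rhombusAngle s) :=
      cos_le_cos_of_nonneg_of_le_pi (by linarith [pi_pos]) (by linarith [pi_pos]) hlt.le
    have := one_le_two_mul_cos t
    have := sin_rhombusAngle_pos s
    exact mul_lt_mul (by linarith) (by linarith) (by linarith) (by linarith)
  rcases lt_or_gt_of_ne hst with h | h
  · exact (aux s t h).ne key
  · exact (aux t s h).ne' key

/-! ### Tight links for at most five rings -/

lemma Rim.linked_of_ne_zero {n : ℕ} (R : Rim n) (i : Fin (n + 1)) (hi : i ≠ 0) :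
    TopologicallyLinked (R.link.component 0) (R.link.component i) := by
  obtain ⟨j, rfl⟩ := Fin.exists_succ_eq.2 hi
  exact R.linked_rim_ring j

lemma exists_tight_link {n : ℕ} (hn : n ≤ 5) : ∃ L : Link (n + 1), L.thickness = 1 ∧
    (∀ i, i ≠ 0 → TopologicallyLinked (L.component 0) (L.component i)) ∧
    L.length 0 = ENNReal.ofReal (2 * π) + peri n ∧ L.IsTight ∧
    (2 ≤ n → ¬ IsC2Curve (L.component 0)) := by
  rcases lt_or_ge n 2 with h | h
  · have h01 : n = 0 ∨ n = 1 := by omega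
    rcases h01 with rfl | rfl
    · exact ⟨roundLink, thickness_roundLink, fun i hi => absurd (Fin.fin_one_eq_zero i) hi,
        length_roundLink, isTight_roundLink, fun h => absurd h (by norm_num)⟩
    · exact ⟨singleRim.link, singleRim.thickness_link, singleRim.linked_of_ne_zero,
        singleRim.length_zero, singleRim.isTight_link, fun h => absurd h (by norm_num)⟩
  · let R := (regularPolygon n h hn).toRim
    exact ⟨R.link, R.thickness_link, R.linked_of_ne_zero, R.length_zero, R.isTight_link,
      fun _ => (regularPolygon n h hn).not_isC2Curve⟩

end Ropelength

end

theorem mainTheorem3 :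
    -- `P_n` is a minimum
    (∀ n : ℕ, Ropelength.peri n ∈ Ropelength.enclosingLengths n) ∧
    -- the length bound
    (∀ (m n : ℕ) (L : Ropelength.Link m) (k : Fin m), 1 ≤ L.thickness →
      L.LinkedToSublinks k n →
      ENNReal.ofReal (2 * Real.pi) + Ropelength.peri n ≤ L.length k) ∧
    -- a link all of whose components attain their bounds is tight
    (∀ (m : ℕ) (L : Ropelength.Link m), 1 ≤ L.thickness →
      (∀ k : Fin m, ∃ n : ℕ, L.LinkedToSublinks k n ∧
        L.length k = ENNReal.ofReal (2 * Real.pi) + Ropelength.peri n) →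
      L.IsTight) ∧
    -- sharpness for `n ≤ 5`, by tight links that are not `C²` as soon as `2 ≤ n`
    (∀ n : ℕ, n ≤ 5 → ∃ L : Ropelength.Link (n + 1),
      L.thickness = 1 ∧
      (∀ i, i ≠ 0 → Ropelength.TopologicallyLinked (L.component 0) (L.component i)) ∧
      L.length 0 = ENNReal.ofReal (2 * Real.pi) + Ropelength.peri n ∧
      L.IsTight ∧
      (2 ≤ n → ¬ Ropelength.IsC2Curve (L.component 0))) ∧
    -- non-uniqueness: a one-parameter family of tight five-component links of one link type
    (∃ L : unitInterval → Ropelength.Link 5,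
      (∀ i, Continuous (fun p : unitInterval × UnitAddCircle => (L p.1).curve i p.2)) ∧
      (∀ t, (L t).thickness = 1 ∧
        (∀ i, i ≠ 0 →
          Ropelength.TopologicallyLinked ((L t).component 0) ((L t).component i)) ∧
        (L t).length 0 = ENNReal.ofReal (2 * Real.pi) + Ropelength.peri 4 ∧
        (L t).IsTight) ∧
      (∀ s t, Ropelength.AmbientIsotopic (L s).carrier (L t).carrier) ∧
      (∀ s t, s ≠ t →
        ¬ Ropelength.SameShape (L s).carrier (L t).carrier ∧
        ¬ Ropelength.SameShape ((L s).component 0) ((L t).component 0))) := by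
  refine ⟨Ropelength.peri_mem_enclosingLengths, fun m n L k hL h => ?_,
    fun m L hL h => Ropelength.Link.isTight_of_length_eq hL h,
    fun n hn => Ropelength.exists_tight_link hn, Ropelength.rhombusLink,
    Ropelength.continuous_rhombusLink, fun t => ⟨(Ropelength.rhombusRim t).thickness_link,
      (Ropelength.rhombusRim t).linked_of_ne_zero, (Ropelength.rhombusRim t).length_zero,
      (Ropelength.rhombusRim t).isTight_link⟩, Ropelength.ambientIsotopic_rhombusLink,
    fun s t hst => ⟨Ropelength.not_sameShape_carrier hst, Ropelength.not_sameShape_component hst⟩⟩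
  exact Ropelength.Link.le_length ((L.thick_iff zero_le_one).1 (by simpa using hL)) h
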